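/- Let $k\ge 1$. A \emph{$k$-expression} $e$ of a finite simple graph $G$ builds $G$, together with a labeling of its vertices by $k$ labels, from the following operations: creation of a vertex $v$ with label $i$; disjoint union; join $\eta_{i\times j}$ of two distinct labels $i\neq j$ (every vertex of label $i$ becomes adjacent to every vertex of label $j$); renaming $\rho_{i\to j}$ (every vertex of label $i$ gets label $j$). Its \emph{size} $n$ is the number of operations (nodes of its tree). Consider the following weighted problems, for a graph $G$ with vertex weights $c\colon V(G)\to\mathbb{N}\cup\{+\infty\}$, a set $S$ (resp. $T$) of vertices, and a budget $p\in\mathbb{N}$. \begin{itemize} \item \textsc{Subset Feedback Vertex Set (SFVS)}: is there a set $X\subseteq V(G)$ with $\sum_{x\in X}c(x)\le p$ that hits every cycle of $G$ containing a vertex of $S$? \item \textsc{Node Multiway Cut}: is there a set $X\subseteq V(G)\setminus T$ with $\sum_{x\in X}c(x)\le p$ that hits every path of $G$ between two distinct vertices of $T$? \end{itemize} The unweighted problems are the case $c\equiv 1$. \textbf{Theorem.} Both problems can be solved in time $2^{\mathcal{O}(k\log k)}\cdot n$ when $G$ is given as a $k$-expression of size $n$. Precisely: there are a function $f$ with $f(k)=\mathcal{O}(k\log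 k)$, and, for each of the two problems, one word-RAM program and a constant $C$, such that on every instance given by $k$, $n$, $p$ and the sequence of the operations of a $k$-expression of $G$ of size $n$ (each vertex creation being accompanied by the weight of the vertex and its membership in $S$, resp. $T$), the program halts within $2^{f(k)}\cdot n$ steps with the correct answer, on every machine whose words have at least $f(k)+C\log_2 N$ bits, where $N$ is any bound on the number of input cells and on the numbers in them; each arithmetic operation, comparison or memory access on words takes one step. Moreover, \textsc{Node Multiway Cut} reduces to weighted \textsc{SFVS}: an instance $(G,T,c,p)$ of \textsc{Node Multiway Cut} has answer yes if and only if the \textsc{SFVS} instance $(G',\{s\},c',p)$ has answer yes, where $G'$ is $G$ with a new vertex $s$ adjacent to exactly the vertices of $T$, $c'(s)=+\infty$, $c'(t)=+\infty$ for $t\in T$, and $c'(v)=c(v)$ for $v\in V(G)\setminus T$. -/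

import Mathlib

open Asymptotics Filter

universe u

/-! ### A word RAM with a step count

The memory is an array of words, and there are finitely many registers (those that the fixed
program mentions).  With word length `w`, a word is a natural number below `2 ^ w`.  Every
elementary operation on words (a constant, an arithmetic operation, a comparison, a memory access,
an assignment, a test) takes one step.  An operation whose result is not a word aborts the
computation, so a completed run never leaves the range of the words.  Programs are in structured
form (sequence, conditional, loop). -/

namespace WordRAM

/-- Registers and memory of the machine. -/
structure Store where
  reg : ℕ → ℕ
  mem : ℕ → ℕ

/-- The operations on words. -/
inductive BinOp where
  | add | sub | mul | div | mod | lt | eq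

/-- Subtraction is truncated at `0`; comparisons return `1` for true and `0` for false. -/
def BinOp.apply : BinOp → ℕ → ℕ → ℕ
  | .add, x, y => x + y
  | .sub, x, y => x - y
  | .mul, x, y => x * y
  | .div, x, y => x / y
  | .mod, x, y => x % y
  | .lt, x, y => if x < y then 1 else 0
  | .eq, x, y => if x = y then 1 else 0

/-- Expressions: constants, contents of a register, contents of the memory cell at a computed
address, and operations. -/
inductive Term where
  | lit (x : ℕ)
  | reg (r : ℕ)
  | load (addr : Term)
  | op (o : BinOp) (a b : Term)

/-- A number that does not fit into a word is not representable. -/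
def toWord (w x : ℕ) : Option ℕ := if x < 2 ^ w then some x else none

/-- The value of an expression on the machine with word length `w`, if there is no overflow. -/
def Term.eval (w : ℕ) (s : Store) : Term → Option ℕ
  | .lit x => toWord w x
  | .reg r => toWord w (s.reg r)
  | .load a => (a.eval w s).bind fun x => toWord w (s.mem x)
  | .op o a b => (a.eval w s).bind fun x => (b.eval w s).bind fun y => toWord w (o.apply x y)

/-- The number of steps that the evaluation of an expression takes. -/
def Term.cost : Term → ℕ
  | .lit _ => 1
  | .reg _ => 1
  | .load a => a.cost + 1
  | .op _ a b => a.cost + b.cost + 1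

/-- Programs.  A test succeeds if its value is not `0`. -/
inductive Prog where
  | skip
  | assign (r : ℕ) (a : Term)
  | store (addr a : Term)
  | seq (P Q : Prog)
  | cond (a : Term) (P Q : Prog)
  | loop (a : Term) (P : Prog)

/-- `Exec w P s t s'`: on the machine with word length `w`, the program `P` started in `s` halts
after exactly `t` steps in `s'`. -/
inductive Exec (w : ℕ) : Prog → Store → ℕ → Store → Prop where
  | skip (s : Store) : Exec w .skip s 1 s
  | assign {s : Store} {r : ℕ} {a : Term} {x : ℕ} (hx : a.eval w s = some x) :
      Exec w (.assign r a) s (a.cost + 1) { s with reg := Function.update s.reg r x }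
  | store {s : Store} {b a : Term} {y x : ℕ} (hy : b.eval w s = some y) (hx : a.eval w s = some x) :
      Exec w (.store b a) s (b.cost + a.cost + 1) { s with mem := Function.update s.mem y x }
  | seq {P Q : Prog} {s s' s'' : Store} {t t' : ℕ} (hP : Exec w P s t s') (hQ : Exec w Q s' t' s'') :
      Exec w (.seq P Q) s (t + t') s''
  | condTrue {a : Term} {P Q : Prog} {s s' : Store} {x t : ℕ} (hx : a.eval w s = some x)
      (h : x ≠ 0) (hP : Exec w P s t s') : Exec w (.cond a P Q) s (a.cost + 1 + t) s'
  | condFalse {a : Term} {P Q : Prog} {s s' : Store} {t : ℕ} (hx : a.eval w s = some 0)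
      (hQ : Exec w Q s t s') : Exec w (.cond a P Q) s (a.cost + 1 + t) s'
  | loopTrue {a : Term} {P : Prog} {s s' s'' : Store} {x t t' : ℕ} (hx : a.eval w s = some x)
      (h : x ≠ 0) (hP : Exec w P s t s') (hL : Exec w (.loop a P) s' t' s'') :
      Exec w (.loop a P) s (a.cost + 1 + t + t') s''
  | loopFalse {a : Term} {P : Prog} {s : Store} (hx : a.eval w s = some 0) :
      Exec w (.loop a P) s (a.cost + 1) s

/-- The initial store: the input occupies the first memory cells, everything else is `0`. -/
def Store.init (input : List ℕ) : Store where
  reg := fun _ => 0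
  mem := fun x => input.getD x 0

/-- The machine is deterministic: the halting time and the final store are determined. -/
theorem Exec.unique {w : ℕ} {P : Prog} {s : Store} {t₁ : ℕ} {s₁ : Store}
    (h₁ : Exec w P s t₁ s₁) : ∀ {t₂ : ℕ} {s₂ : Store}, Exec w P s t₂ s₂ → t₁ = t₂ ∧ s₁ = s₂ := by
  induction h₁ with
  | skip s => intro _ _ h; cases h; exact ⟨rfl, rfl⟩
  | assign hx => intro _ _ h; cases h; simp_all
  | store hy hx => intro _ _ h; cases h; simp_all
  | seq _ _ ihP ihQ =>
    intro _ _ h; cases h with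
    | seq hP hQ =>
      obtain ⟨rfl, rfl⟩ := ihP hP
      obtain ⟨rfl, rfl⟩ := ihQ hQ
      exact ⟨rfl, rfl⟩
  | condTrue hx h0 _ ih =>
    intro _ _ h; cases h with
    | condTrue _ _ hP => obtain ⟨rfl, rfl⟩ := ih hP; exact ⟨rfl, rfl⟩
    | condFalse hx' _ => simp_all
  | condFalse hx _ ih =>
    intro _ _ h; cases h with
    | condTrue _ _ _ => simp_all
    | condFalse _ hQ => obtain ⟨rfl, rfl⟩ := ih hQ; exact ⟨rfl, rfl⟩
  | loopTrue hx h0 _ _ ihP ihL =>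
    intro _ _ h; cases h with
    | loopTrue _ _ hP hL =>
      obtain ⟨rfl, rfl⟩ := ihP hP
      obtain ⟨rfl, rfl⟩ := ihL hL
      exact ⟨rfl, rfl⟩
    | loopFalse _ => simp_all
  | loopFalse hx =>
    intro _ _ h; cases h with
    | loopTrue _ _ _ _ => simp_all
    | loopFalse _ => exact ⟨rfl, rfl⟩

end WordRAM

/-! ### Clique-width expressions -/

/-- Expressions over the four clique-width operations with `k` labels: vertex creation, disjoint
union, join of two distinct labels, renaming of label `i` to label `j`. -/
inductive KExpr (V : Type*) (k : ℕ) where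
  | vertex (i : Fin k) (v : V)
  | union (e₁ e₂ : KExpr V k)
  | join (i j : Fin k) (hij : i ≠ j) (e : KExpr V k)
  | rename (i j : Fin k) (e : KExpr V k)

namespace KExpr

variable {V : Type*} {k : ℕ}

/-- The size: the number of operations, i.e. of nodes of the associated tree. -/
def size : KExpr V k → ℕ
  | vertex _ _ => 1
  | union e₁ e₂ => e₁.size + e₂.size + 1
  | join _ _ _ e => e.size + 1
  | rename _ _ e => e.size + 1

/-- The vertices of the constructed graph. -/
def verts : KExpr V k → Set V
  | vertex _ v => {v}
  | union e₁ e₂ => e₁.verts ∪ e₂.verts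
  | join _ _ _ e => e.verts
  | rename _ _ e => e.verts

/-- All unions in the expression are unions of graphs without a common vertex. -/
def IsDisjoint : KExpr V k → Prop
  | vertex _ _ => True
  | union e₁ e₂ => e₁.IsDisjoint ∧ e₂.IsDisjoint ∧ Disjoint e₁.verts e₂.verts
  | join _ _ _ e => e.IsDisjoint
  | rename _ _ e => e.IsDisjoint

/-- `e.HasLabel v l`: in the constructed graph, `v` is a vertex with label `l`. -/
def HasLabel : KExpr V k → V → Fin k → Prop
  | vertex i v, u, l => u = v ∧ l = i
  | union e₁ e₂, u, l => e₁.HasLabel u l ∨ e₂.HasLabel u l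
  | join _ _ _ e, u, l => e.HasLabel u l
  | rename i j e, u, l => ∃ l', e.HasLabel u l' ∧ l = if l' = i then j else l'

/-- Adjacency in the constructed graph. -/
def Adj : KExpr V k → V → V → Prop
  | vertex _ _, _, _ => False
  | union e₁ e₂, u, v => e₁.Adj u v ∨ e₂.Adj u v
  | join i j _ e, u, v =>
      e.Adj u v ∨ (e.HasLabel u i ∧ e.HasLabel v j) ∨ (e.HasLabel u j ∧ e.HasLabel v i)
  | rename _ _ e, u, v => e.Adj u v

/-- `e` is a `k`-expression of the graph `G`. -/
def Describes (e : KExpr V k) (G : SimpleGraph V) : Prop :=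
  e.IsDisjoint ∧ e.verts = Set.univ ∧ ∀ u v, G.Adj u v ↔ e.Adj u v

end KExpr

/-! ### The two problems -/

section Problems

variable {V : Type*}

/-- Weighted Subset Feedback Vertex Set: is there a vertex set of weight at most `p` that hits
every cycle of `G` through a vertex of `S`? -/
def SubsetFVS (G : SimpleGraph V) (S : Set V) (c : V → ℕ∞) (p : ℕ) : Prop :=
  ∃ X : Finset V, ∑ v ∈ X, c v ≤ p ∧
    ∀ (u : V) (C : G.Walk u u), C.IsCycle → (∃ s ∈ C.support, s ∈ S) → ∃ x ∈ C.support, x ∈ X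

/-- Weighted Node Multiway Cut: is there a vertex set of weight at most `p` that contains no vertex
of `T` and hits every path between two distinct vertices of `T`? -/
def NodeMultiwayCut (G : SimpleGraph V) (T : Set V) (c : V → ℕ∞) (p : ℕ) : Prop :=
  ∃ X : Finset V, ∑ v ∈ X, c v ≤ p ∧ (∀ x ∈ X, x ∉ T) ∧
    ∀ a ∈ T, ∀ b ∈ T, a ≠ b → ∀ P : G.Walk a b, P.IsPath → ∃ x ∈ P.support, x ∈ X

/-- The graph obtained from `G` by adding a new vertex `none` adjacent to exactly the vertices
of `T`. -/
def addApex (G : SimpleGraph V) (T : Set V) : SimpleGraph (Option V) where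
  Adj
    | none, none => False
    | none, some v => v ∈ T
    | some u, none => u ∈ T
    | some u, some v => G.Adj u v
  symm := ⟨by
    rintro (_ | u) (_ | v) h
    · exact h
    · exact h
    · exact h
    · exact G.adj_symm h⟩
  loopless := ⟨by
    rintro (_ | u) h
    · exact h
    · exact G.loopless.irrefl u h⟩

open Classical in
/-- The weights in which the new vertex and the vertices of `T` get weight `+∞`. -/
noncomputable def apexWeight (T : Set V) (c : V → ℕ∞) : Option V → ℕ∞
  | none => ⊤
  | some v => if v ∈ T then ⊤ else c v

end Problems

/-! ### Instances given by expressions, and deciding them -/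

section Deciding

variable {V : Type u} {k : ℕ}

open Classical in
/-- A weight in one cell: `0` stands for `+∞`, and `x + 1` for the finite weight `x`. -/
noncomputable def weightCode (x : ℕ∞) : ℕ := if x = ⊤ then 0 else x.toNat + 1

open Classical in
/-- The expression as the sequence of its operations, in the order in which they are performed
(operands first), with four cells for each operation.  The creation of a vertex comes with a bit
that tells whether the vertex is in `S`, and with its weight. -/
noncomputable def KExpr.code (S : Set V) (c : V → ℕ∞) : KExpr V k → List ℕ
  | .vertex i v => [0, i.val, if v ∈ S then 1 else 0, weightCode (c v)]
  | .union e₁ e₂ => e₁.code S c ++ e₂.code S c ++ [1, 0, 0, 0]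
  | .join i j _ e => e.code S c ++ [2, i.val, j.val, 0]
  | .rename i j e => e.code S c ++ [3, i.val, j.val, 0]

/-- The input: the number of labels, the size of the expression, the budget, the expression. -/
noncomputable def inputCode (e : KExpr V k) (S : Set V) (c : V → ℕ∞) (p : ℕ) : List ℕ :=
  k :: e.size :: p :: e.code S c

/-- The program `P` decides the problem `Q` on instances `(G, S, c, p)` in which `G` is given by a
`k`-expression `e`: on every machine whose word length is at least `W k N`, where `N` bounds the
number of input cells and all numbers in them, it halts within `T k e.size` steps, and register
`0` finally holds `1` if and only if the answer is yes. -/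
def DecidesOnExpressions (P : WordRAM.Prog)
    (Q : ∀ {V : Type u}, SimpleGraph V → Set V → (V → ℕ∞) → ℕ → Prop)
    (T W : ℕ → ℕ → ℝ) : Prop :=
  ∀ (V : Type u) (k : ℕ) (e : KExpr V k) (G : SimpleGraph V) (S : Set V) (c : V → ℕ∞) (p : ℕ),
    e.Describes G →
    ∀ N w : ℕ, (inputCode e S c p).length ≤ N → (∀ x ∈ inputCode e S c p, x ≤ N) →
      W k N ≤ (w : ℝ) →
      ∃ (t : ℕ) (s : WordRAM.Store),
        WordRAM.Exec w P (WordRAM.Store.init (inputCode e S c p)) t s ∧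
        (t : ℝ) ≤ T k e.size ∧ (s.reg 0 = 1 ↔ Q G S c p)

end Deciding

/-!
Call an edge hard if it meets `S`, and soft otherwise.  A graph has no cycle through `S` if and only
if each of its hard edges is a bridge (`good_offLinks_iff`).  So a partial solution is recorded by
two nested partitions: the components, and the blobs, i.e. the components of the soft edges.  In a
graph all of whose hard edges are bridges, a new hard edge has to connect two components, and a new
soft edge two components or two vertices of one blob; nothing else about the graph matters
(`Links.CanAdd`).  `NodeMultiwayCut` is the case in which `S` consists of a new vertex adjacent to
`T`, and this vertex, `T` being undeletable.

The difficulty is that a join concerns arbitrarily many vertices.  If both labels have several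
vertices, then each of them is on a cycle of length `4`; so none is in `S`, and they all become part of
one blob.  Otherwise a single vertex becomes the common neighbour of the vertices of the other label.
Hence several vertices with the same label can be represented by the neighbour that they get later,
and whether they get one, and whether it is in `S`, is guessed when their labels are merged: from then
on they are treated as adjacent to a promised neighbour (`zlinks`).  The state of a partial solution
consists, for each label, of a status (empty, a single vertex inside or outside `S`, several vertices
without or with one of three kinds of promise) and of the blob and the component of the single vertex
or of the promised neighbour (`Represents`).  An array of `3 (2 k + 3)` numbers below `2 k + 10` is
sufficient for this, so there are `Q = 2 ^ O(k log k)` states; the code of an array is the number with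
these digits.  The transitions on arrays are shown to be right by maps between graphs that carry soft
edges into blobs and distinct hard edges to distinct hard edges (`Links.Lifts`); if they exist in both
directions, both graphs have the same partitions, and if the hard edges are bridges in one graph, then
also in the other.  Three facts make the transitions simple:

* Each join can be assumed to add only new edges, since the joins of labels that are joined again later
  may be omitted (`KExpr.thinAdj_false_iff`).  Then a join inserts a single edge, between the vertices or
  promised neighbours of its labels.
* A disjoint union is a union in which the labels of the second graph are shifted, followed by `k + 1`
  renamings.
* The vertex adjacent to `T` is never created.  It is the promised neighbour, of the kind inside `S`,
  of an additional label of the vertices of `T`, and this promise is never fulfilled.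

`KExpr.correct` states that the states computed with weight at most `p` are those of the partial
solutions of weight at most `p`; `subsetFVS_iff_achieves` and `nodeMultiwayCut_iff_achieves` follow.

The program makes two passes through the operations of the expression.  A backward pass, with a stack
of `k × k` matrices, marks the joins that are repeated later (`iterates_pruneP`).  A forward pass, with
a stack of tables that contain the minimal weight for each of the `Q` codes, evaluates the expression
(`iterates_evalP`); the time per operation is bounded by a power of `Q`.  Programs are verified by
triples with a time bound (`WordRAM.Ends`), and the combination is `WordRAM.ends_solveP`.
-/

open Function Sum Relation

/-! ### Graphs with soft and hard edges -/

/-- A graph whose edges are divided into soft and hard ones.  The relations need not be symmetric: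
an edge may be recorded in one direction only. -/
structure Links (Ω : Type*) where
  soft : Ω → Ω → Prop
  hard : Ω → Ω → Prop

namespace Links

variable {Ω Ω' : Type*}

/-- Connected by soft edges. -/
def blob (W : Links Ω) : Ω → Ω → Prop := EqvGen W.soft

/-- Connected by edges. -/
def comp (W : Links Ω) : Ω → Ω → Prop := EqvGen fun a b => W.soft a b ∨ W.hard a b

/-- Connected by edges other than the hard edge between `x` and `y`. -/
def compWithout (W : Links Ω) (x y : Ω) : Ω → Ω → Prop :=
  EqvGen fun a b => W.soft a b ∨ W.hard a b ∧ s(a, b) ≠ s(x, y)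

/-- Every hard edge is a bridge. -/
def Good (W : Links Ω) : Prop := ∀ x y, W.hard x y → ¬ W.compWithout x y x y

/-- The graph with an additional soft edge. -/
def addSoft (W : Links Ω) (x y : Ω) : Links Ω where
  soft a b := W.soft a b ∨ s(a, b) = s(x, y)
  hard := W.hard

/-- The graph with an additional hard edge. -/
def addHard (W : Links Ω) (x y : Ω) : Links Ω where
  soft := W.soft
  hard a b := W.hard a b ∨ s(a, b) = s(x, y)

theorem eqvGen_lift {r : Ω → Ω → Prop} {R : Ω' → Ω' → Prop} (f : Ω → Ω')
    (h : ∀ a b, r a b → EqvGen R (f a) (f b)) {a b : Ω} (hab : EqvGen r a b) :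
    EqvGen R (f a) (f b) := by
  induction hab with
  | rel a b hr => exact h a b hr
  | refl a => exact .refl _
  | symm a b _ ih => exact .symm _ _ ih
  | trans a b c _ _ ih1 ih2 => exact .trans _ _ _ ih1 ih2

theorem eqvGen_mono {r R : Ω → Ω → Prop}
    (h : ∀ a b, r a b → R a b) {a b : Ω} (hab : EqvGen r a b) : EqvGen R a b :=
  eqvGen_lift id (fun a b hr => .rel _ _ (h a b hr)) hab

/-- A property that is constant along the edges is constant along connections. -/
theorem eqvGen_invariant {r : Ω → Ω → Prop} (p : Ω → Prop)
    (h : ∀ a b, r a b → (p a ↔ p b)) {a b : Ω} (hab : EqvGen r a b) : p a ↔ p b := by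
  induction hab with
  | rel a b hr => exact h a b hr
  | refl a => exact Iff.rfl
  | symm a b _ ih => exact ih.symm
  | trans a b c _ _ ih1 ih2 => exact ih1.trans ih2

theorem eqvGen_isolated {r : Ω → Ω → Prop} {z : Ω} (h1 : ∀ a, ¬ r z a) (h2 : ∀ a, ¬ r a z)
    {a : Ω} : EqvGen r z a ↔ a = z := by
  refine ⟨fun h => ?_, fun h => h ▸ .refl _⟩; refine (eqvGen_invariant (fun c => c = z) ?_ h).1 rfl
  grind

theorem eqvGen_add_edge {r : Ω → Ω → Prop} {x y a b : Ω} :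
    EqvGen (fun a b => r a b ∨ s(a, b) = s(x, y)) a b ↔
      EqvGen r a b ∨ (EqvGen r a x ∧ EqvGen r y b) ∨ (EqvGen r a y ∧ EqvGen r x b) := by
  constructor
  · intro h
    induction h with
    | rel a b h =>
      rcases h with h | h
      · exact .inl (.rel _ _ h)
      · rcases Sym2.eq_iff.1 h with ⟨rfl, rfl⟩ | ⟨rfl, rfl⟩
        · exact .inr (.inl ⟨.refl _, .refl _⟩)
        · exact .inr (.inr ⟨.refl _, .refl _⟩)
    | refl a => exact .inl (.refl _)
    | symm a b _ ih =>
      rcases ih with h | ⟨h1, h2⟩ | ⟨h1, h2⟩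
      · exact .inl (h.symm)
      · exact .inr (.inr ⟨h2.symm, h1.symm⟩)
      · exact .inr (.inl ⟨h2.symm, h1.symm⟩)
    | trans a b c _ _ ih1 ih2 =>
      rcases ih1 with h | ⟨h1, h2⟩ | ⟨h1, h2⟩ <;> rcases ih2 with g | ⟨g1, g2⟩ | ⟨g1, g2⟩
      · exact .inl (h.trans _ _ _ g)
      · exact .inr (.inl ⟨h.trans _ _ _ g1, g2⟩)
      · exact .inr (.inr ⟨h.trans _ _ _ g1, g2⟩)
      · exact .inr (.inl ⟨h1, h2.trans _ _ _ g⟩)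
      · exact .inr (.inl ⟨h1, g2⟩)
      · exact .inl (h1.trans _ _ _ g2)
      · exact .inr (.inr ⟨h1, h2.trans _ _ _ g⟩)
      · exact .inl (h1.trans _ _ _ g2)
      · exact .inr (.inr ⟨h1, g2⟩)
  · have hm : ∀ {a b}, EqvGen r a b → EqvGen (fun a b => r a b ∨ s(a, b) = s(x, y)) a b :=
      fun h => eqvGen_mono (fun _ _ h => .inl h) h
    have e : EqvGen (fun a b => r a b ∨ s(a, b) = s(x, y)) x y := .rel _ _ (.inr rfl)
    rintro (h | ⟨h1, h2⟩ | ⟨h1, h2⟩)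
    · exact hm h
    · exact (hm h1).trans _ _ _ (e.trans _ _ _ (hm h2))
    · exact (hm h1).trans _ _ _ (e.symm.trans _ _ _ (hm h2))

variable {W W' : Links Ω}

theorem blob_compWithout {x y a b : Ω} (h : W.blob a b) : W.compWithout x y a b :=
  eqvGen_mono (fun _ _ h => .inl h) h

theorem compWithout_comp {x y a b : Ω} (h : W.compWithout x y a b) : W.comp a b :=
  eqvGen_mono (fun _ _ h => h.imp id And.left) h

theorem blob_comp {a b : Ω} (h : W.blob a b) : W.comp a b := eqvGen_mono (fun _ _ h => .inl h) h

theorem compWithout_comm {x y a b : Ω} : W.compWithout x y a b ↔ W.compWithout y x a b := by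
  simp only [compWithout, Sym2.eq_swap (a := x)]

theorem blob_addSoft {x y a b : Ω} : (W.addSoft x y).blob a b ↔
    W.blob a b ∨ (W.blob a x ∧ W.blob y b) ∨ (W.blob a y ∧ W.blob x b) :=
  eqvGen_add_edge

theorem comp_addSoft {x y a b : Ω} : (W.addSoft x y).comp a b ↔
    W.comp a b ∨ (W.comp a x ∧ W.comp y b) ∨ (W.comp a y ∧ W.comp x b) := by
  rw [comp, comp, ← eqvGen_add_edge]; simp only [addSoft, or_assoc, or_comm]

theorem comp_addHard {x y a b : Ω} : (W.addHard x y).comp a b ↔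
    W.comp a b ∨ (W.comp a x ∧ W.comp y b) ∨ (W.comp a y ∧ W.comp x b) := by
  rw [comp, comp, ← eqvGen_add_edge]; simp only [addHard, or_assoc]

theorem blob_addHard {x y a b : Ω} : (W.addHard x y).blob a b ↔ W.blob a b := Iff.rfl

theorem Good.mono (h : W'.Good) (hs : ∀ a b, W.soft a b → W'.soft a b)
    (hh : ∀ a b, W.hard a b → W'.hard a b) : W.Good := fun x y hxy hc =>
  h x y (hh _ _ hxy) (eqvGen_mono (fun a b => Or.imp (hs a b) (And.imp_left (hh a b))) hc)

theorem compWithout_addSoft {x y u v a b : Ω} : (W.addSoft x y).compWithout u v a b ↔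
    W.compWithout u v a b ∨ (W.compWithout u v a x ∧ W.compWithout u v y b) ∨
      (W.compWithout u v a y ∧ W.compWithout u v x b) := by
  rw [compWithout, compWithout, ← eqvGen_add_edge]; simp only [addSoft, or_assoc, or_comm]

theorem Good.addSoft {x y : Ω} (h : W.Good) (hxy : W.blob x y ∨ ¬ W.comp x y) :
    (W.addSoft x y).Good := by
  intro u v huv hc; rw [compWithout_addSoft] at hc; have huv' : W.comp u v := .rel _ _ (.inr huv)
  have key : ∀ {p q}, W.compWithout u v p q → W.comp p q := compWithout_comp
  rcases hxy with hxy | hxy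
  · have hxy' : W.compWithout u v x y := blob_compWithout hxy
    rcases hc with hc | ⟨h1, h2⟩ | ⟨h1, h2⟩
    · exact h u v huv hc
    · exact h u v huv (h1.trans _ _ _ (hxy'.trans _ _ _ h2))
    · exact h u v huv (h1.trans _ _ _ (hxy'.symm.trans _ _ _ h2))
  · rcases hc with hc | ⟨h1, h2⟩ | ⟨h1, h2⟩
    · exact h u v huv hc
    · exact hxy ((key h1).symm.trans _ _ _ (huv'.trans _ _ _ (key h2).symm))
    · exact hxy ((key h2).trans _ _ _ (huv'.symm.trans _ _ _ (key h1)))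

theorem Good.addHard {x y : Ω} (h : W.Good) (hxy : ¬ W.comp x y) : (W.addHard x y).Good := by
  intro u v huv hc; by_cases he : s(u, v) = s(x, y)
  · have : W.comp u v := by
      refine eqvGen_mono ?_ hc; rintro a b (h | ⟨h | h, hne⟩)
      · exact .inl h
      all_goals grind
    rcases Sym2.eq_iff.1 he with ⟨rfl, rfl⟩ | ⟨rfl, rfl⟩
    · exact hxy this
    · exact hxy this.symm
  · have huv' : W.hard u v := by
      rcases huv with h | h
      · exact h
      · exact absurd h he
    have hc' : (W.addSoft x y).compWithout u v u v := by
      refine eqvGen_mono ?_ hc; rintro a b (h | ⟨h | h, hne⟩)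
      · exact .inl (.inl h)
      · exact .inr ⟨h, hne⟩
      · exact .inl (.inr h)
    exact h.addSoft (.inr hxy) u v huv' hc'

theorem Good.not_comp_of_addHard {x y : Ω} (h : (W.addHard x y).Good) (h1 : ¬ W.hard x y)
    (h2 : ¬ W.hard y x) : ¬ W.comp x y := by
  intro hc; refine h x y (.inr rfl) (eqvGen_mono ?_ hc); rintro a b (hab | hab)
  · exact .inl hab
  · refine .inr ⟨.inl hab, fun he => ?_⟩; grind

theorem compWithout_of_hard {x y a b : Ω} (h : W.hard a b ∨ W.hard b a) (hne : s(a, b) ≠ s(x, y)) :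
    W.compWithout x y a b := by
  rcases h with h | h
  · exact .rel _ _ (.inr ⟨h, hne⟩)
  · exact .symm _ _ (.rel _ _ (.inr ⟨h, by rwa [Sym2.eq_swap]⟩))

/-- Two connected points are in the same blob, or some hard edge separates them along a simple
path. -/
theorem blob_or_separated {x y : Ω} (h : W.comp x y) : W.blob x y ∨
    ∃ u v, (W.hard u v ∨ W.hard v u) ∧ W.compWithout u v x u ∧ W.compWithout u v v y := by
  let G : SimpleGraph Ω := SimpleGraph.fromRel fun a b => W.soft a b ∨ W.hard a b
  have hr : G.Reachable x y := by
    induction h with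
    | rel a b hr =>
      by_cases hab : a = b
      · subst hab; exact .refl _
      · exact SimpleGraph.Adj.reachable ((SimpleGraph.fromRel_adj _ _ _).2 ⟨hab, .inl hr⟩)
    | refl a => exact .refl _
    | symm a b _ ih => exact ih.symm
    | trans a b c _ _ ih1 ih2 => exact ih1.trans ih2
  obtain ⟨p, hp⟩ := hr.exists_isPath
  suffices H : W.blob x y ∨ ∃ u v, u ∈ p.support ∧ v ∈ p.support ∧ (W.hard u v ∨ W.hard v u) ∧
      W.compWithout u v x u ∧ W.compWithout u v v y by grind
  clear h hr
  induction p with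
  | nil => exact .inl (.refl _)
  | @cons a b c hab q ih =>
    rw [SimpleGraph.Walk.cons_isPath_iff] at hp
    have hab' := ((SimpleGraph.fromRel_adj _ _ _).1 hab).2; by_cases hs : W.soft a b ∨ W.soft b a
    · have hb : W.blob a b := hs.elim (fun h => .rel _ _ h) fun h => .symm _ _ (.rel _ _ h)
      rcases ih hp.1 with H | ⟨u, v, hu, hv, H, h1, h2⟩
      · exact .inl (hb.trans _ _ _ H)
      · exact .inr ⟨u, v, by simp [hu], by simp [hv], H, (blob_compWithout hb).trans _ _ _ h1, h2⟩
    · have hh : W.hard a b ∨ W.hard b a := by tauto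
      rcases ih hp.1 with H | ⟨u, v, hu, hv, H, h1, h2⟩
      · exact .inr ⟨a, b, by simp, by simp, hh, .refl _, blob_compWithout H⟩
      · refine .inr ⟨u, v, by simp [hu], by simp [hv], H, ?_, h2⟩
        exact (compWithout_of_hard hh (by grind)).trans _ _ _ h1

theorem Good.of_addSoft {x y : Ω} (h : (W.addSoft x y).Good) : W.blob x y ∨ ¬ W.comp x y := by
  by_contra! hc; rcases blob_or_separated hc.2 with H | ⟨u, v, H, h1, h2⟩
  · exact hc.1 H
  · have huv : (W.addSoft x y).compWithout u v u v :=
      compWithout_addSoft.2 (.inr (.inl ⟨h1.symm, h2.symm⟩))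
    rcases H with H | H
    · exact h u v H huv
    · exact h v u H (compWithout_comm.1 huv.symm)

theorem blob_rel {a b : Ω} (h : W.soft a b) : W.blob a b := .rel _ _ h

theorem blob_symm {a b : Ω} (h : W.blob a b) : W.blob b a := h.symm

/-- A hard edge is a bridge if some map sends it to a hard bridge and sends no other edge across
that bridge. -/
theorem Good.not_compWithout {W : Links Ω} {W' : Links Ω'} (h : W'.Good) (f : Ω → Ω') {x y : Ω}
    {x' y' : Ω'} (hxy : W'.hard x' y' ∨ W'.hard y' x') (hx : W'.blob (f x) x')
    (hy : W'.blob (f y) y') (hs : ∀ a b, W.soft a b → W'.blob (f a) (f b))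
    (hh : ∀ a b, W.hard a b → s(a, b) ≠ s(x, y) → W'.compWithout x' y' (f a) (f b)) :
    ¬ W.compWithout x y x y := by
  intro hc
  have h1 : W'.compWithout x' y' (f x) (f y) := by
    refine eqvGen_lift f ?_ hc; rintro a b (hab | ⟨hab, hne⟩)
    · exact blob_compWithout (hs a b hab)
    · exact hh a b hab hne
  have h2 : W'.compWithout x' y' x' y' :=
    (blob_compWithout hx).symm.trans _ _ _ (h1.trans _ _ _ (blob_compWithout hy))
  rcases hxy with hxy | hxy
  · exact h _ _ hxy h2
  · exact h _ _ hxy (compWithout_comm.1 h2.symm)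

/-- A map that sends soft edges into blobs and hard edges, injectively, to hard edges between
blobs. -/
structure Lifts (W : Links Ω) (W' : Links Ω') (f : Ω → Ω') (φ : Ω → Ω → Ω' × Ω') : Prop where
  soft : ∀ a b, W.soft a b → W'.blob (f a) (f b)
  hard : ∀ a b, W.hard a b → (W'.hard (φ a b).1 (φ a b).2 ∨ W'.hard (φ a b).2 (φ a b).1) ∧
    W'.blob (f a) (φ a b).1 ∧ W'.blob (f b) (φ a b).2
  inj : ∀ a b c d, W.hard a b → W.hard c d →
    s((φ a b).1, (φ a b).2) = s((φ c d).1, (φ c d).2) → s(a, b) = s(c, d)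

/-- An edge that closes a cycle through a hard edge of `W` would do so in `W'`. -/
theorem Lifts.good {W : Links Ω} {W' : Links Ω'} {f : Ω → Ω'} {φ : Ω → Ω → Ω' × Ω'}
    (hf : Lifts W W' f φ) (h : W'.Good) : W.Good := by
  intro x y hxy; obtain ⟨h1, h2, h3⟩ := hf.hard x y hxy
  refine h.not_compWithout f h1 h2 h3 hf.soft fun a b hab hne => ?_
  obtain ⟨g1, g2, g3⟩ := hf.hard a b hab
  exact (blob_compWithout g2).trans _ _ _ ((compWithout_of_hard g1 fun he =>
    hne (hf.inj _ _ _ _ hab hxy he)).trans _ _ _ (blob_compWithout g3).symm)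

theorem Lifts.blob {W : Links Ω} {W' : Links Ω'} {f : Ω → Ω'} {φ : Ω → Ω → Ω' × Ω'}
    (hf : Lifts W W' f φ) {a b : Ω} (h : W.blob a b) : W'.blob (f a) (f b) :=
  eqvGen_lift f hf.soft h

theorem Lifts.comp {W : Links Ω} {W' : Links Ω'} {f : Ω → Ω'} {φ : Ω → Ω → Ω' × Ω'}
    (hf : Lifts W W' f φ) {a b : Ω} (h : W.comp a b) : W'.comp (f a) (f b) := by
  refine eqvGen_lift f ?_ h; rintro a b (h | h)
  · exact blob_comp (hf.soft a b h)
  · obtain ⟨g1, g2, g3⟩ := hf.hard a b h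
    refine (blob_comp g2).trans _ _ _ (EqvGen.trans _ _ _ ?_ (blob_comp g3).symm)
    rcases g1 with g1 | g1
    · exact .rel _ _ (.inr g1)
    · exact .symm _ _ (.rel _ _ (.inr g1))

/-- Maps in both directions that are inverse to each other at two points, up to blobs, preserve and
reflect the connections between these points. -/
theorem Lifts.conn_iff {W : Links Ω} {W' : Links Ω'} {f : Ω → Ω'} {φ : Ω → Ω → Ω' × Ω'}
    {f' : Ω' → Ω} {φ' : Ω' → Ω' → Ω × Ω} (hf : Lifts W W' f φ) (hf' : Lifts W' W f' φ') {x y : Ω'}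
    (hx : W'.blob (f (f' x)) x) (hy : W'.blob (f (f' y)) y) :
    (W'.blob x y ↔ W.blob (f' x) (f' y)) ∧ (W'.comp x y ↔ W.comp (f' x) (f' y)) := by
  refine ⟨⟨hf'.blob, fun h => ?_⟩, ⟨hf'.comp, fun h => ?_⟩⟩
  · exact hx.symm.trans _ _ _ ((hf.blob h).trans _ _ _ hy)
  · exact (blob_comp hx).symm.trans _ _ _ ((hf.comp h).trans _ _ _ (blob_comp hy))

/-- The graph with an additional edge, which is hard if `h` holds and soft otherwise. -/
def add (W : Links Ω) (h : Prop) (x y : Ω) : Links Ω where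
  soft a b := W.soft a b ∨ ¬ h ∧ s(a, b) = s(x, y)
  hard a b := W.hard a b ∨ h ∧ s(a, b) = s(x, y)

theorem add_of {h : Prop} (hh : h) (x y : Ω) : W.add h x y = W.addHard x y := by
  simp [add, addHard, hh]

theorem add_of_not {h : Prop} (hh : ¬ h) (x y : Ω) : W.add h x y = W.addSoft x y := by
  simp [add, addSoft, hh]

/-- The condition under which a new edge creates no cycle through a hard edge. -/
def CanAdd (W : Links Ω) (h : Prop) (x y : Ω) : Prop := ¬ h ∧ W.blob x y ∨ ¬ W.comp x y

theorem Good.add {h : Prop} {x y : Ω} (hW : W.Good) (hxy : W.CanAdd h x y) :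
    (W.add h x y).Good := by
  by_cases hh : h
  · rw [add_of hh]; exact hW.addHard (hxy.resolve_left fun h => h.1 hh)
  · rw [add_of_not hh]; exact hW.addSoft (hxy.imp_left And.right)

theorem Good.canAdd {h : Prop} {x y : Ω} (hW : (W.add h x y).Good)
    (h1 : h → ¬ W.hard x y ∧ ¬ W.hard y x) : W.CanAdd h x y := by
  by_cases hh : h
  · rw [add_of hh] at hW; exact .inr (hW.not_comp_of_addHard (h1 hh).1 (h1 hh).2)
  · rw [add_of_not hh] at hW; exact hW.of_addSoft.imp_left fun h => ⟨hh, h⟩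

theorem Good.of_add {h : Prop} {x y : Ω} (hW : (W.add h x y).Good) : W.Good :=
  hW.mono (fun _ _ => .inl) fun _ _ => .inl

theorem comp_add {h : Prop} {x y a b : Ω} : (W.add h x y).comp a b ↔
    W.comp a b ∨ (W.comp a x ∧ W.comp y b) ∨ (W.comp a y ∧ W.comp x b) := by
  by_cases hh : h
  · rw [add_of hh]; exact comp_addHard
  · rw [add_of_not hh]; exact comp_addSoft

/-- Four edges that form a cycle of length four, one of them hard. -/
theorem Good.not_square (hW : W.Good) {a b p q : Ω} (hab : a ≠ b) (hpq : p ≠ q) (haq : a ≠ q)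
    (h1 : W.hard a p ∨ W.hard p a)
    (h2 : W.soft a q ∨ W.hard a q ∨ W.hard q a) (h3 : W.soft b p ∨ W.hard b p ∨ W.hard p b)
    (h4 : W.soft b q ∨ W.hard b q ∨ W.hard q b) : False := by
  have key : ∀ u v, s(u, v) ≠ s(a, p) → (W.soft u v ∨ W.hard u v ∨ W.hard v u) →
      W.compWithout a p u v := by
    rintro u v hne (h | h)
    · exact .rel _ _ (.inl h)
    · exact compWithout_of_hard h hne
  have e : W.compWithout a p a p := by
    refine (key a q ?_ h2).trans _ _ _ ((key b q ?_ h4).symm.trans _ _ _ (key b p ?_ h3))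
    · grind [Sym2.eq_iff]
    all_goals grind
  rcases h1 with h1 | h1
  · exact hW _ _ h1 e
  · exact hW _ _ h1 (compWithout_comm.1 e.symm)

end Links

/-! ### The two problems in terms of bridges -/

section Problems

variable {V : Type*}

/-- Adjacency in the graph without the vertices of `X`. -/
def adjOff (G : SimpleGraph V) (X : Set V) (a b : V) : Prop := G.Adj a b ∧ a ∉ X ∧ b ∉ X

/-- The graph without the vertices of `X`, in which the edges at vertices of `S` are hard. -/
def offLinks (G : SimpleGraph V) (S X : Set V) : Links V where
  soft a b := adjOff G X a b ∧ a ∉ S ∧ b ∉ S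
  hard a b := adjOff G X a b ∧ (a ∈ S ∨ b ∈ S)

/-- `adjOff` as a simple graph. -/
def offGraph (G : SimpleGraph V) (X : Set V) : SimpleGraph V where
  Adj := adjOff G X
  symm := ⟨fun _ _ h => ⟨h.1.symm, h.2.2, h.2.1⟩⟩
  loopless := ⟨fun _ h => h.1.ne rfl⟩

theorem SimpleGraph.reachable_iff_eqvGen (G : SimpleGraph V) {a b : V} :
    G.Reachable a b ↔ EqvGen G.Adj a b := by
  constructor
  · rw [SimpleGraph.reachable_iff_reflTransGen]
    exact fun h => (EqvGen.reflTransGen_le_eqvGen _ : _ ≤ _) _ _ h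
  · intro h
    induction h with
    | rel a b h => exact h.reachable
    | refl a => exact .refl _
    | symm a b _ ih => exact ih.symm
    | trans a b c _ _ ih1 ih2 => exact ih1.trans ih2

theorem isBridge_offGraph_iff {G : SimpleGraph V} {S X : Set V} {x y : V} (hS : x ∈ S ∨ y ∈ S) :
    (offGraph G X).IsBridge s(x, y) ↔ ¬ (offLinks G S X).compWithout x y x y := by
  rw [SimpleGraph.isBridge_iff, SimpleGraph.reachable_iff_eqvGen, not_iff_not]; constructor
  · refine Links.eqvGen_mono fun a b h => ?_; rw [SimpleGraph.deleteEdges_adj] at h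
    by_cases hab : a ∈ S ∨ b ∈ S
    · exact .inr ⟨⟨h.1, hab⟩, h.2⟩
    · exact .inl ⟨h.1, by tauto⟩
  · refine Links.eqvGen_mono fun a b h => ?_; rw [SimpleGraph.deleteEdges_adj]
    rcases h with h | ⟨h, hne⟩
    · refine ⟨h.1, fun he => ?_⟩; have h1 := h.2.1; have h2 := h.2.2; grind
    · exact ⟨h.1, hne⟩

theorem good_offLinks_iff (G : SimpleGraph V) (S X : Set V) :
    (offLinks G S X).Good ↔ ∀ (u : V) (C : G.Walk u u), C.IsCycle → (∃ s ∈ C.support, s ∈ S) →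
      ∃ x ∈ C.support, x ∈ X := by
  classical
  have hle : offGraph G X ≤ G := fun a b h => h.1; constructor
  · rintro h u C hC ⟨s, hs, hsS⟩; by_contra! hX
    have hE : ∀ e ∈ C.edges, e ∈ (offGraph G X).edgeSet := by
      intro e he
      induction e with | _ a b =>
      exact ⟨C.adj_of_mem_edges he, hX a (C.fst_mem_support_of_mem_edges he),
        hX b (C.snd_mem_support_of_mem_edges he)⟩
    let D := (C.transfer _ hE).rotate s (by simpa using hs)
    have hD : D.IsCycle := (hC.transfer hE).rotate _
    have hadj : (offGraph G X).Adj s D.snd := D.adj_snd hD.not_nil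
    have hmem : s(s, D.snd) ∈ D.edges := D.mk_start_snd_mem_edges hD.not_nil
    exact ((isBridge_offGraph_iff (.inl hsS)).2 (h s D.snd ⟨hadj, .inl hsS⟩)).notMem_edges_of_isCycle
      hD hmem
  · intro h x y hxy; rw [← isBridge_offGraph_iff hxy.2]
    refine (SimpleGraph.isBridge_iff_forall_cycle_notMem hxy.1).2 fun u C hC he => ?_
    have hx := C.fst_mem_support_of_mem_edges he; have hy := C.snd_mem_support_of_mem_edges he
    obtain ⟨v, hv, hvX⟩ := h u (C.mapLe hle) (hC.mapLe hle) (by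
      rcases hxy.2 with h | h
      · exact ⟨x, by simpa using hx, h⟩
      · exact ⟨y, by simpa using hy, h⟩)
    have hv' : v ∈ C.support := by simpa using hv
    let D := C.rotate v hv'; have hD : D.IsCycle := hC.rotate _
    exact (D.adj_snd hD.not_nil).2.1 hvX

theorem subsetFVS_iff (G : SimpleGraph V) (S : Set V) (c : V → ℕ∞) (p : ℕ) :
    SubsetFVS G S c p ↔ ∃ X : Finset V, ∑ v ∈ X, c v ≤ p ∧ (offLinks G S X).Good := by
  simp only [good_offLinks_iff]; rfl

theorem nodeMultiwayCut_iff (G : SimpleGraph V) (T : Set V) (c : V → ℕ∞) (p : ℕ) :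
    NodeMultiwayCut G T c p ↔ ∃ X : Finset V, ∑ v ∈ X, c v ≤ p ∧ (∀ x ∈ X, x ∉ T) ∧
      ∀ a ∈ T, ∀ b ∈ T, a ≠ b → ¬ EqvGen (adjOff G X) a b := by
  classical
  refine exists_congr fun X => and_congr_right fun _ => and_congr_right fun hX => ?_
  have hle : offGraph G X ≤ G := fun a b h => h.1
  refine forall₂_congr fun a ha => forall₂_congr fun b hb => forall_congr' fun hab => ?_
  have : EqvGen (adjOff G X) a b ↔ (offGraph G X).Reachable a b :=
    ((offGraph G X).reachable_iff_eqvGen).symm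
  rw [this]; constructor
  · intro h hr; obtain ⟨P, hP⟩ := hr.exists_isPath
    obtain ⟨x, hx, hxX⟩ := h (P.mapLe hle) (hP.mapLe hle)
    have hx' : x ∈ P.support := by simpa using hx
    have hne : ∀ {a b : V} (P : (offGraph G X).Walk a b), a ∉ X → ∀ x ∈ P.support, x ∉ X := by
      intro a b P ha
      induction P with
      | nil => simpa using ha
      | cons h q ih =>
        intro x hx; rcases List.mem_cons.1 (by simpa using hx) with rfl | hx
        · exact ha
        · exact ih h.2.2 x hx
    exact hne P (fun h => hX a h ha) x hx' hxX
  · intro h P hP; by_contra! hno; refine h ⟨P.transfer _ fun e he => ?_⟩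
    induction e with | _ u v =>
    exact ⟨P.adj_of_mem_edges he, hno u (P.fst_mem_support_of_mem_edges he),
      hno v (P.snd_mem_support_of_mem_edges he)⟩

/-- A hard edge at the new vertex is on a cycle exactly if its end is connected with another vertex of `T`. -/
theorem good_addApex_iff (G : SimpleGraph V) (T : Set V) (X : Finset V) (hX : ∀ x ∈ X, x ∉ T) :
    (offLinks (addApex G T) {none} (X.map .some : Finset (Option V))).Good ↔
      ∀ a ∈ T, ∀ b ∈ T, a ≠ b → ¬ EqvGen (adjOff G X) a b := by
  constructor
  · intro h a ha b hb hab hr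
    have hmem : ∀ v ∈ T, adjOff (addApex G T) (X.map .some : Finset (Option V)) none (some v) := by
      intro v hv; refine ⟨hv, by simp, ?_⟩; simpa using fun h => hX v h hv
    refine h none (some a) ⟨hmem a ha, .inl rfl⟩ ?_
    refine EqvGen.trans _ (some b) _ (.rel _ _ (.inr ⟨⟨hmem b hb, .inl rfl⟩, ?_⟩)) ?_
    · simpa using hab.symm
    · refine Links.eqvGen_lift some (fun u v huv => .rel _ _ (.inl ⟨⟨huv.1, ?_, ?_⟩, ?_, ?_⟩)) hr.symm
      · simpa using huv.2.1
      · simpa using huv.2.2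
      all_goals simp
  · intro h
    have main : ∀ a, a ∈ T → ¬ (offLinks (addApex G T) {none}
        (X.map .some : Finset (Option V))).compWithout none (some a) none (some a) := by
      intro a ha hc
      let p : Option V → Prop := fun o => ∀ v, o = some v →
        ∃ b ∈ T, b ≠ a ∧ EqvGen (adjOff G X) v b
      have hp : p none ↔ p (some a) := by
        refine Links.eqvGen_invariant p ?_ hc; have hpn : p none := by simp [p]
        have hpb : ∀ b ∈ T, b ≠ a → p (some b) := by
          rintro b hb hba v ⟨⟩; exact ⟨b, hb, hba, .refl _⟩
        rintro (_ | u) (_ | v) huv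
        · exact Iff.rfl
        · rcases huv with huv | ⟨huv, hne⟩
          · simp [offLinks] at huv
          · exact iff_of_true hpn (hpb v huv.1.1 (by simpa using hne))
        · rcases huv with huv | ⟨huv, hne⟩
          · simp [offLinks] at huv
          · exact iff_of_true (hpb u huv.1.1 (by rintro rfl; exact hne Sym2.eq_swap)) hpn
        · rcases huv with huv | ⟨huv, hne⟩
          · have huv' : EqvGen (adjOff G X) u v :=
              .rel _ _ ⟨huv.1.1, by simpa using huv.1.2.1, by simpa using huv.1.2.2⟩
            constructor
            · rintro hu w ⟨⟩; obtain ⟨b, hb, hba, hub⟩ := hu u rfl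
              exact ⟨b, hb, hba, huv'.symm.trans _ _ _ hub⟩
            · rintro hu w ⟨⟩; obtain ⟨b, hb, hba, hub⟩ := hu v rfl
              exact ⟨b, hb, hba, huv'.trans _ _ _ hub⟩
          · simp [offLinks] at huv
      grind
    rintro (_ | u) (_ | v) huv
    · exact absurd huv.1.1 id
    · exact main v huv.1.1
    · intro hc; exact main u huv.1.1 (Links.compWithout_comm.1 hc.symm)
    · simp [offLinks] at huv

theorem nodeMultiwayCut_iff_subsetFVS (G : SimpleGraph V) (T : Set V) (c : V → ℕ∞) (p : ℕ) :
    NodeMultiwayCut G T c p ↔ SubsetFVS (addApex G T) {none} (apexWeight T c) p := by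
  classical
  rw [nodeMultiwayCut_iff, subsetFVS_iff]
  have hsum : ∀ X : Finset V, (∀ x ∈ X, x ∉ T) →
      ∑ v ∈ X.map .some, apexWeight T c v = ∑ v ∈ X, c v := by
    intro X hX; rw [Finset.sum_map]; refine Finset.sum_congr rfl fun v hv => ?_
    simp [apexWeight, hX v hv]
  constructor
  · rintro ⟨X, h1, h2, h3⟩
    exact ⟨X.map .some, by rwa [hsum X h2], (good_addApex_iff G T X h2).2 h3⟩
  · rintro ⟨X', h1, h2⟩
    have hfin : ∀ o ∈ X', apexWeight T c o ≠ ⊤ := by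
      intro o ho htop; have := (Finset.single_le_sum (fun _ _ => zero_le) ho).trans h1; simp_all
    have hX' : X' = (Finset.eraseNone X').map .some := by
      ext o; rcases o with _ | v
      · simpa using fun h => hfin _ h (by simp [apexWeight])
      · simp
    have hT : ∀ x ∈ Finset.eraseNone X', x ∉ T := by
      intro x hx hxT; exact hfin (some x) (by simpa using hx) (by simp [apexWeight, hxT])
    rw [hX'] at h1 h2; exact ⟨_, by rwa [hsum _ hT] at h1, hT, (good_addApex_iff G T _ hT).1 h2⟩

end Problems

/-! ### Two nested partitions kept in an array -/

/-- In the segment of length `K` that starts at `o`, the entries `v` are replaced by `u`. -/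
def relabel (o K v u : ℕ) (f : ℕ → ℕ) : ℕ → ℕ :=
  fun a => if o ≤ a ∧ a < o + K ∧ f a = v then u else f a

theorem relab_outside {o K v u : ℕ} {f : ℕ → ℕ} {a : ℕ} (h : a < o ∨ o + K ≤ a) :
    relabel o K v u f a = f a := by
  rw [relabel, if_neg (by omega)]

theorem relab_eq_iff {o K v u : ℕ} {f : ℕ → ℕ} {l m : ℕ} (hl : l < K) (hm : m < K) :
    relabel o K v u f (o + l) = relabel o K v u f (o + m) ↔
      f (o + l) = f (o + m) ∨ (f (o + l) = v ∧ u = f (o + m)) ∨ (f (o + l) = u ∧ v = f (o + m)) := by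
  have h1 : o + l < o + K := by omega
  have h2 : o + m < o + K := by omega
  simp only [relabel, h1, h2, Nat.le_add_right, true_and]; split_ifs <;> omega

/-- Insertion of an edge between the terminals of the slots `x` and `y`.  The entries `K + l` number
the blobs and the entries `2 * K + l` number the components.  The second component of the result
tells whether the insertion closes no cycle through a hard edge. -/
def addE (K : ℕ) (h : Bool) (x y : ℕ) (f : ℕ → ℕ) : (ℕ → ℕ) × Bool :=
  if h then
    if f (2 * K + x) = f (2 * K + y) then (f, false)
    else (relabel (2 * K) K (f (2 * K + x)) (f (2 * K + y)) f, true)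
  else if f (K + x) = f (K + y) then (f, true)
  else if f (2 * K + x) = f (2 * K + y) then (f, false)
  else (relabel K K (f (K + x)) (f (K + y)) (relabel (2 * K) K (f (2 * K + x)) (f (2 * K + y)) f), true)

/-- The array `f` describes the blobs and the components of the terminals in `W`; `τ l a` means that
`a` is the terminal in slot `l`. -/
def Ids {Ω : Type*} (K : ℕ) (W : Links Ω) (τ : ℕ → Ω → Prop) (f : ℕ → ℕ) : Prop :=
  ∀ l m a b, τ l a → τ m b →
    (f (K + l) = f (K + m) ↔ W.blob a b) ∧ (f (2 * K + l) = f (2 * K + m) ↔ W.comp a b)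

section

variable {Ω : Type*} {K : ℕ} {W : Links Ω} {τ : ℕ → Ω → Prop} {f : ℕ → ℕ}

theorem addE_low {h : Bool} {x y a : ℕ} (ha : a < K) : (addE K h x y f).1 a = f a := by
  unfold addE; split_ifs
  · rfl
  · exact relab_outside (.inl (by omega))
  · rfl
  · rfl
  · exact (relab_outside (.inl (by omega))).trans (relab_outside (.inl (by omega)))

theorem relab_lt {o v u D : ℕ} (hf : ∀ a, a < 3 * K → f a < D) (hu : u < D) :
    ∀ a, a < 3 * K → relabel o K v u f a < D := by
  intro a ha; unfold relabel; split_ifs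
  · exact hu
  · exact hf a ha

theorem addE_lt {h : Bool} {x y D : ℕ} (hy : y < K) (hf : ∀ a, a < 3 * K → f a < D) :
    ∀ a, a < 3 * K → (addE K h x y f).1 a < D := by
  unfold addE; have h1 := hf (K + y) (by omega); have h2 := hf (2 * K + y) (by omega); split_ifs
  · exact hf
  · exact relab_lt hf h2
  · exact hf
  · exact hf
  · exact relab_lt (relab_lt hf h2) h1

/-- On arrays, `addE` tests whether an edge may be added, and adds it. -/
theorem Ids.addE (hI : Ids K W τ f) (hτ : ∀ l a, τ l a → l < K) {h : Bool} {x y : ℕ} {a b : Ω}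
    (ha : τ x a) (hb : τ y b) :
    ((addE K h x y f).2 = true ↔ W.CanAdd h a b) ∧
      ((addE K h x y f).2 = true → Ids K (W.add h a b) τ (addE K h x y f).1) := by
  have hab := hI x y a b ha hb
  have hc : ∀ l m p q, τ l p → τ m q →
      (relabel (2 * K) K (f (2 * K + x)) (f (2 * K + y)) f (2 * K + l) =
        relabel (2 * K) K (f (2 * K + x)) (f (2 * K + y)) f (2 * K + m) ↔
          (W.add h a b).comp p q) := by
    intro l m p q hl hm
    rw [relab_eq_iff (hτ l p hl) (hτ m q hm), Links.comp_add, (hI l m p q hl hm).2,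
      (hI l x p a hl ha).2, (hI y m b q hb hm).2, (hI l y p b hl hb).2, (hI x m a q ha hm).2]
  cases h
  · have hB : ∀ p q, (W.add (false = true) a b).blob p q ↔
        W.blob p q ∨ (W.blob p a ∧ W.blob b q) ∨ (W.blob p b ∧ W.blob a q) := by
      intro p q; rw [Links.add_of_not (by simp)]; exact Links.blob_addSoft
    simp only [_root_.addE, Bool.false_eq_true, if_false, Links.CanAdd, not_false_eq_true, true_and]
    split_ifs with h1 h2
    · refine ⟨by simp [← hab.1, h1], fun _ l m p q hl hm => ⟨?_, ?_⟩⟩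
      · have hb' := hab.1.1 h1; rw [(hI l m p q hl hm).1]; have := hB p q
        simp only [Bool.false_eq_true] at this; rw [this]; refine ⟨.inl, ?_⟩
        rintro (h | ⟨h, g⟩ | ⟨h, g⟩)
        · exact h
        · exact h.trans _ _ _ (hb'.trans _ _ _ g)
        · exact h.trans _ _ _ (hb'.symm.trans _ _ _ g)
      · have hb' := Links.blob_comp (hab.1.1 h1); rw [(hI l m p q hl hm).2, Links.comp_add]
        refine ⟨.inl, ?_⟩; rintro (h | ⟨h, g⟩ | ⟨h, g⟩)
        · exact h
        · exact h.trans _ _ _ (hb'.trans _ _ _ g)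
        · exact h.trans _ _ _ (hb'.symm.trans _ _ _ g)
    · simp [← hab.1, ← hab.2, h1, h2]
    · refine ⟨by simp [← hab.1, ← hab.2, h1, h2], fun _ l m p q hl hm => ⟨?_, ?_⟩⟩
      · have hx := hτ x a ha; have hy := hτ y b hb; have hl' := hτ l p hl; have hm' := hτ m q hm
        simp only
        rw [relab_eq_iff hl' hm', relab_outside (.inl (by omega)), relab_outside (.inl (by omega)),
          (hI l m p q hl hm).1, (hI l x p a hl ha).1, (hI y m b q hb hm).1, (hI l y p b hl hb).1,
          (hI x m a q ha hm).1]
        grind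
      · have hl' := hτ l p hl; have hm' := hτ m q hm
        have e : ∀ l v u g, relabel K K v u g (2 * K + l) = g (2 * K + l) :=
          fun l v u g => relab_outside (.inr (by omega))
        simp only [e]; simpa using hc l m p q hl hm
  · simp only [_root_.addE, if_true, Links.CanAdd, not_true_eq_false, false_and, false_or]
    split_ifs with h1
    · simp [← hab.2, h1]
    · refine ⟨by simp [← hab.2, h1], fun _ l m p q hl hm => ⟨?_, ?_⟩⟩
      · have hl' := hτ l p hl; have hm' := hτ m q hm; simp only
        rw [relab_outside (.inl (by omega)), relab_outside (.inl (by omega)),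
          (hI l m p q hl hm).1, Links.add_of trivial]
        exact Links.blob_addHard.symm
      · simpa using hc l m p q hl hm

theorem Ids.congr {g : ℕ → ℕ} (hI : Ids K W τ f)
    (h1 : ∀ l m a b, τ l a → τ m b → (g (K + l) = g (K + m) ↔ f (K + l) = f (K + m)))
    (h2 : ∀ l m a b, τ l a → τ m b → (g (2 * K + l) = g (2 * K + m) ↔ f (2 * K + l) = f (2 * K + m))) :
    Ids K W τ g := fun l m a b ha hb =>
  ⟨(h1 l m a b ha hb).trans (hI l m a b ha hb).1, (h2 l m a b ha hb).trans (hI l m a b ha hb).2⟩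

end

/-- The first `n` steps of the renumbering of the segment at `o` by the numbers from `off` on. -/
def renum (o K off : ℕ) (f : ℕ → ℕ) : ℕ → ℕ → ℕ
  | 0 => f
  | l + 1 => relabel o K (renum o K off f l (o + l)) (off + l) (renum o K off f l)

theorem renum_outside {o K off : ℕ} {f : ℕ → ℕ} {a : ℕ} (h : a < o ∨ o + K ≤ a) (n : ℕ) :
    renum o K off f n a = f a := by
  induction n with
  | zero => rfl
  | succ n ih => rw [renum, relab_outside h, ih]

theorem renum_spec {o K off : ℕ} {f : ℕ → ℕ}
    (hf : ∀ l, l < K → f (o + l) < off ∨ off + K ≤ f (o + l)) (n : ℕ) (hn : n ≤ K) :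
    (∀ l m, l < K → m < K → (renum o K off f n (o + l) = renum o K off f n (o + m) ↔
      f (o + l) = f (o + m))) ∧
    (∀ l, l < K → (renum o K off f n (o + l) = f (o + l) ∨
      off ≤ renum o K off f n (o + l) ∧ renum o K off f n (o + l) < off + n)) ∧
    (∀ l, l < n → off ≤ renum o K off f n (o + l) ∧ renum o K off f n (o + l) < off + n) := by
  induction n with
  | zero => simp [renum]
  | succ n ih =>
    obtain ⟨h1, h2, h3⟩ := ih (by omega); set g := renum o K off f n with hg
    have e : renum o K off f (n + 1) = relabel o K (g (o + n)) (off + n) g := rfl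
    have hv : ∀ l, l < K → g (o + l) ≠ off + n := by grind
    have hval : ∀ l, l < K → relabel o K (g (o + n)) (off + n) g (o + l) =
        if g (o + l) = g (o + n) then off + n else g (o + l) := by
      intro l hl; simp only [relabel]; congr 1; simp [hl]
    rw [e]; grind

/-- Both partitions are renumbered by numbers below `K`, through numbers from `3 * B` on. -/
def normIds (K B : ℕ) (f : ℕ → ℕ) : ℕ → ℕ :=
  renum (2 * K) K 0 (renum (2 * K) K (3 * B) (renum K K 0 (renum K K (3 * B) f K) K) K) K

theorem renum_twice {o K B : ℕ} {f : ℕ → ℕ} (hK : K ≤ B) (hf : ∀ l, l < K → f (o + l) < 3 * B) :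
    (∀ l m, l < K → m < K → (renum o K 0 (renum o K (3 * B) f K) K (o + l) =
      renum o K 0 (renum o K (3 * B) f K) K (o + m) ↔ f (o + l) = f (o + m))) ∧
    (∀ l, l < K → renum o K 0 (renum o K (3 * B) f K) K (o + l) < K) := by
  obtain ⟨h1, -, h3⟩ := renum_spec (o := o) (K := K) (off := 3 * B) (f := f)
    (fun l hl => .inl (hf l hl)) K le_rfl
  obtain ⟨g1, -, g3⟩ := renum_spec (o := o) (K := K) (off := 0) (f := renum o K (3 * B) f K)
    (fun l hl => .inr (by have := h3 l hl; omega)) K le_rfl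
  grind

theorem normIds_spec {K B : ℕ} {f : ℕ → ℕ} (hK : K ≤ B) (hf : ∀ a, a < 3 * K → f a < 3 * B) :
    (∀ l, l < K → normIds K B f l = f l) ∧
    (∀ l m, l < K → m < K → (normIds K B f (K + l) = normIds K B f (K + m) ↔
      f (K + l) = f (K + m))) ∧
    (∀ l m, l < K → m < K → (normIds K B f (2 * K + l) = normIds K B f (2 * K + m) ↔
      f (2 * K + l) = f (2 * K + m))) ∧
    (∀ a, K ≤ a → a < 3 * K → normIds K B f a < K) := by
  obtain ⟨h1, h2⟩ := renum_twice (o := K) (f := f) hK (fun l hl => hf _ (by omega))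
  obtain ⟨g1, g2⟩ := renum_twice (o := 2 * K) (f := renum K K 0 (renum K K (3 * B) f K) K) hK
    (fun l hl => by
      rw [renum_outside (.inr (by omega)), renum_outside (.inr (by omega))]; exact hf _ (by omega))
  have e1 : ∀ l, l < 2 * K → normIds K B f l = renum K K 0 (renum K K (3 * B) f K) K l := by
    intro l hl; rw [normIds, renum_outside (.inl hl), renum_outside (.inl hl)]
  have e2 : ∀ l, renum K K 0 (renum K K (3 * B) f K) K (2 * K + l) = f (2 * K + l) := by
    intro l; rw [renum_outside (.inr (by omega)), renum_outside (.inr (by omega))]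
  refine ⟨fun l hl => ?_, fun l m hl hm => ?_, fun l m hl hm => ?_, fun a ha ha' => ?_⟩
  · rw [e1 l (by omega), renum_outside (.inl (by omega)), renum_outside (.inl (by omega))]
  · grind
  · rw [← e2 l, ← e2 m]; exact g1 l m hl hm
  · rcases lt_or_ge a (2 * K) with h | h
    · obtain ⟨l, rfl⟩ := Nat.exists_eq_add_of_le ha; rw [e1 _ h]; exact h2 l (by omega)
    · obtain ⟨l, rfl⟩ := Nat.exists_eq_add_of_le h; exact g2 l (by omega)

/-! ### Partial solutions with promised neighbours -/

/-- A graph in which vertices may carry labels. -/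
structure LGraph (V : Type*) where
  lab : V → ℕ → Prop
  adj : V → V → Prop

namespace LGraph

variable {V : Type*}

/-- The labels are below `n` and only vertices with a label have neighbours. -/
structure Proper (H : LGraph V) (n : ℕ) : Prop where
  symm : ∀ u v, H.adj u v → H.adj v u
  lab_lt : ∀ v l, H.lab v l → l < n
  alive : ∀ u v, H.adj u v → ∃ l, H.lab u l

/-- The join of the labels `i` and `j`. -/
def join (H : LGraph V) (i j : ℕ) : LGraph V where
  lab := H.lab
  adj u v := H.adj u v ∨ (H.lab u i ∧ H.lab v j) ∨ (H.lab u j ∧ H.lab v i)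

/-- The label `x` is renamed to `y`. -/
def rename (H : LGraph V) (x y : ℕ) : LGraph V where
  lab v l := ∃ l', H.lab v l' ∧ l = if l' = x then y else l'
  adj := H.adj

/-- The union, in which the labels of the second graph are shifted by `k`. -/
def union (k : ℕ) (H₁ H₂ : LGraph V) : LGraph V where
  lab v l := H₁.lab v l ∨ ∃ l', H₂.lab v l' ∧ l = k + l'
  adj u v := H₁.adj u v ∨ H₂.adj u v

theorem join_comm (H : LGraph V) (i j : ℕ) : H.join i j = H.join j i := by
  simp only [join, LGraph.mk.injEq, true_and]; grind

end LGraph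

section

variable {V : Type*} (S : V → Prop)

/-- At least two elements. -/
def Many (C : V → Prop) : Prop := ∃ a b, a ≠ b ∧ C a ∧ C b

/-- The status of a label with the vertices `C`: `0` if there are none; `1` and `2` for a single
vertex in `S` or outside `S`; `3` for several vertices that get no new neighbours; from `4` to `6`
for several vertices with a promised common neighbour, which is outside `S` for `4` (no vertex of `C`
is in `S`) and for `5` (some vertex of `C` is in `S`), and in `S` for `6`. -/
def Fits (C : V → Prop) : ℕ → Prop
  | 0 => ∀ v, ¬ C v
  | 1 => ∃ v, S v ∧ ∀ u, C u ↔ u = v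
  | 2 => ∃ v, ¬ S v ∧ ∀ u, C u ↔ u = v
  | 3 => Many C
  | 4 => Many C ∧ ∀ v, C v → ¬ S v
  | 5 => Many C ∧ ∃ v, C v ∧ S v
  | 6 => Many C
  | _ => False

/-- The graph together with the promised neighbours: `inr l` is the promised neighbour of the
vertices with label `l`. -/
def zlinks (H : LGraph V) (st : ℕ → ℕ) : Links (V ⊕ ℕ) where
  soft
    | .inl u, .inl v => H.adj u v ∧ ¬ S u ∧ ¬ S v
    | .inl u, .inr l => H.lab u l ∧ ¬ S u ∧ (st l = 4 ∨ st l = 5)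
    | _, _ => False
  hard
    | .inl u, .inl v => H.adj u v ∧ (S u ∨ S v)
    | .inl u, .inr l => H.lab u l ∧ (S u ∧ (st l = 4 ∨ st l = 5) ∨ st l = 6)
    | _, _ => False

/-- The terminal of a label below `n`: its single vertex or its promised neighbour. -/
def term (n : ℕ) (H : LGraph V) (st : ℕ → ℕ) (l : ℕ) : V ⊕ ℕ → Prop
  | .inl v => l < n ∧ (st l = 1 ∨ st l = 2) ∧ H.lab v l
  | .inr m => l < n ∧ 4 ≤ st l ∧ st l ≤ 6 ∧ m = l

variable {S} {H : LGraph V} {st st' : ℕ → ℕ}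

theorem zlinks_congr {n : ℕ} (hH : ∀ v l, H.lab v l → l < n) (h : ∀ l, l < n → st l = st' l) :
    zlinks S H st = zlinks S H st' := by
  have e : ∀ v l, H.lab v l → st l = st' l := fun v l hv => h l (hH v l hv)
  simp only [zlinks, Links.mk.injEq]; grind

theorem term_congr {n : ℕ} (h : ∀ l, l < n → st l = st' l) : term n H st = term n H st' := by
  funext l a; rcases a with u | m <;> simp only [term] <;>
  · grind

theorem Many.not_subsingleton {C : V → Prop} (h : Many C) {v : V} (hv : ∀ u, C u → u = v) :
    False := by
  obtain ⟨a, b, hab, ha, hb⟩ := h; exact hab ((hv a ha).trans (hv b hb).symm)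

theorem Fits.many {C : V → Prop} {s : ℕ} (h : Fits S C s) (hs : 3 ≤ s) : Many C := by
  match s, h with
  | 3, h => exact h
  | 4, h => exact h.1
  | 5, h => exact h.1
  | 6, h => exact h

theorem Fits.le {C : V → Prop} {s : ℕ} (h : Fits S C s) : s ≤ 6 := by
  by_contra! hs; obtain ⟨t, rfl⟩ := Nat.exists_eq_add_of_lt hs
  rw [show 6 + t + 1 = t + 7 from by omega] at h; exact h

theorem Fits.single {C : V → Prop} {s : ℕ} (h : Fits S C s) (h1 : s ≠ 0) (hs : s ≤ 2) :
    ∃ v, (∀ u, C u ↔ u = v) ∧ (s = 1 ∧ S v ∨ s = 2 ∧ ¬ S v) := by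
  match s, h with
  | 1, ⟨v, h⟩ => exact ⟨v, h.2, .inl ⟨rfl, h.1⟩⟩
  | 2, ⟨v, h⟩ => exact ⟨v, h.2, .inr ⟨rfl, h.1⟩⟩

theorem Fits.nonempty {C : V → Prop} {s : ℕ} (h : Fits S C s) (h1 : s ≠ 0) : ∃ v, C v := by
  by_cases hs : s ≤ 2
  · obtain ⟨v, hv, -⟩ := h.single h1 hs; exact ⟨v, (hv v).2 rfl⟩
  · obtain ⟨a, _, _, ha, _⟩ := h.many (by omega); exact ⟨a, ha⟩

theorem Fits.eq_zero {C : V → Prop} {s : ℕ} (h : Fits S C s) (h1 : ∀ v, ¬ C v) : s = 0 := by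
  by_contra h0; obtain ⟨v, hv⟩ := h.nonempty h0; exact h1 v hv

open Classical in
/-- A single vertex takes the place of the promised neighbour of a label that it is joined to. -/
theorem join_lifts_single {i j : ℕ} {v : V} (hi : ∀ u, H.lab u i ↔ u = v)
    (hne : ∀ u w, H.lab u i → H.lab w j → ¬ H.adj u w) (hsymm : ∀ u w, H.adj u w → H.adj w u)
    (hS : ¬ S v ∧ (st j = 4 ∨ st j = 5) ∨ S v ∧ st j = 6)
    (h4 : st j = 4 → ∀ w, H.lab w j → ¬ S w) (hoff : ∀ l, l ≠ j → st' l = st l)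
    (hj : st' j = 3 ∨ st' j = 4 ∧ st j = 4) :
    (∃ φ, Links.Lifts ((zlinks S H st).add False (inl v) (inr j)) (zlinks S (H.join i j) st')
      (fun a => if a = inr j then inl v else a) φ) ∧
    (∃ φ, Links.Lifts (zlinks S (H.join i j) st') ((zlinks S H st).add False (inl v) (inr j))
      id φ) := by
  set W1 := (zlinks S H st).add False (inl v) (inr j) with hW1
  have hvj : W1.blob (inl v) (inr j) := .rel _ _ (.inr ⟨id, rfl⟩)
  have hz : ∀ w, H.lab w j → ¬ S w → (st j = 4 ∨ st j = 5) → W1.blob (inr j) (inl w) := by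
    intro w hw hSw h45; exact .symm _ _ (.rel _ _ (.inl ⟨hw, hSw, h45⟩))
  constructor
  · have B := fun a b => Links.blob_rel (W := zlinks S (H.join i j) st') (a := a) (b := b)
    refine ⟨fun a b => (if a = inr j then inl v else a, if b = inr j then inl v else b),
      ⟨?_, ?_, ?_⟩⟩
    · rintro a b (hab | ⟨-, hab⟩)
      · rcases a with u | l <;> rcases b with w | m <;> try exact hab.elim
        · simpa using B (inl u) (inl w) ⟨.inl hab.1, hab.2⟩
        · by_cases hm : m = j
          · subst hm; obtain ⟨h1, h2, h3⟩ := hab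
            have hSv : ¬ S v := by rcases hS with h | h <;> [exact h.1; omega]
            simpa using B (inl u) (inl v) ⟨.inr (.inr ⟨h1, (hi v).2 rfl⟩), h2, hSv⟩
          · simpa [hm] using B (inl u) (inr m) ⟨hab.1, hab.2.1, by rw [hoff m hm]; exact hab.2.2⟩
      · rcases Sym2.eq_iff.1 hab with ⟨rfl, rfl⟩ | ⟨rfl, rfl⟩ <;> simpa using .refl _
    · rintro a b (hab | hab)
      · refine ⟨.inl ?_, .refl _, .refl _⟩
        rcases a with u | l <;> rcases b with w | m <;> try exact hab.elim
        · simpa using ⟨.inl hab.1, hab.2⟩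
        · by_cases hm : m = j
          · subst hm; obtain ⟨h1, h2⟩ := hab; simp only [reduceCtorEq, if_false, if_true]
            refine ⟨.inr (.inr ⟨h1, (hi v).2 rfl⟩), ?_⟩; grind
          · simp only [reduceCtorEq, if_false, inr.injEq, hm]
            exact ⟨hab.1, by rw [hoff m hm]; exact hab.2⟩
      · exact absurd hab.1 id
    · rintro a b c d (hab | hab) (hcd | hcd) he
      · have key : ∀ u w x, H.lab u j → H.adj w x → s(u, v) ≠ s(w, x) := by
          intro u w x hu hwx he; have hv := (hi v).2 rfl
          rcases Sym2.eq_iff.1 he with ⟨rfl, rfl⟩ | ⟨rfl, rfl⟩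
          all_goals grind
        rcases a with u | l <;> rcases b with w | m <;> rcases c with u' | l' <;>
          rcases d with w' | m' <;> first | exact hab.elim | exact hcd.elim | skip
        · simpa using he
        · by_cases hm : m' = j
          · subst hm; have he' : s(u', v) = s(u, w) := by simpa [eq_comm] using he
            exact absurd he' (key _ _ _ hcd.1 hab.1)
          · simp [hm] at he
        · by_cases hm : m = j
          · subst hm; have he' : s(u, v) = s(u', w') := by simpa [eq_comm] using he
            exact absurd he' (key _ _ _ hab.1 hcd.1)
          · simp [hm] at he
        · grind
      all_goals grind
  · refine ⟨fun a b => match a, b with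
      | inl u, inl w => if H.adj u w then (a, b) else
          if u = v then (inr j, inl w) else (inl u, inr j)
      | _, _ => (a, b), ⟨?_, ?_, ?_⟩⟩
    · intro a b hab; rcases a with u | l <;> rcases b with w | m <;> try exact hab.elim
      · obtain ⟨h | ⟨h1, h2⟩ | ⟨h1, h2⟩, hu, hw⟩ := hab
        · exact .rel _ _ (.inl ⟨h, hu, hw⟩)
        · obtain rfl := (hi u).1 h1
          exact hvj.trans _ _ _ (hz w h2 hw (by rcases hS with h | h <;> [exact h.2; tauto]))
        · obtain rfl := (hi w).1 h2
          exact ((hvj.trans _ _ _ (hz u h1 hu (by rcases hS with h | h <;> [exact h.2; tauto])))).symm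
      · obtain ⟨h1, h2, h3⟩ := hab; refine .rel _ _ (.inl ⟨h1, h2, ?_⟩); grind
    · intro a b hab; rcases a with u | l <;> rcases b with w | m <;> try exact hab.elim
      · obtain ⟨h, hu⟩ := hab; by_cases hadj : H.adj u w
        · simp only [hadj, if_true, id]; exact ⟨.inl (.inl ⟨hadj, hu⟩), .refl _, .refl _⟩
        · simp only [hadj, if_false, id]; by_cases huv : u = v
          · subst huv; simp only [if_true]; refine ⟨.inr (.inl ⟨?_, ?_⟩), hvj, .refl _⟩
            · rcases h with h | h | h; all_goals grind
            · grind
          · simp only [huv, if_false]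
            have h' : H.lab u j ∧ H.lab w i := by rcases h with h | h | h; all_goals grind
            obtain rfl := (hi w).1 h'.2; refine ⟨.inl (.inl ⟨h'.1, ?_⟩), .refl _, hvj⟩; grind
      · obtain ⟨h1, h2⟩ := hab; refine ⟨.inl (.inl ⟨h1, ?_⟩), .refl _, .refl _⟩; grind
    · have key : ∀ u, H.lab u j → (zlinks S (H.join i j) st').hard (inl u) (inr j) → False := by
        rintro u hu ⟨-, h⟩; grind
      have norm : ∀ u w, (zlinks S (H.join i j) st').hard (inl u) (inl w) → ∀ p : (V ⊕ ℕ) × (V ⊕ ℕ),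
          p = (if H.adj u w then (inl u, inl w) else
            if u = v then (inr j, inl w) else (inl u, inr j)) →
          s(p.1, p.2) = s(inl u, inl w) ∨ ∃ t, s(inl u, inl w) = s((inl t : V ⊕ ℕ), inl v) ∧
            s(p.1, p.2) = s(inl t, inr j) ∧ H.lab t j := by
        rintro u w ⟨h, -⟩ p rfl; by_cases hadj : H.adj u w
        · simp [hadj]
        · have h' := h.resolve_left hadj; grind
      intro a b c d hab hcd he
      rcases a with u | l <;> rcases b with w | m <;> rcases c with u' | l' <;>
        rcases d with w' | m' <;> first | exact hab.elim | exact hcd.elim | skip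
      · rcases norm u w hab _ rfl with h | ⟨t, h1, h2, h3⟩ <;>
          rcases norm u' w' hcd _ rfl with h' | ⟨t', h1', h2', h3'⟩
        · exact h.symm.trans (he.trans h')
        · simpa using h.symm.trans (he.trans h2')
        · simpa using h2.symm.trans (he.trans h')
        · have := h2.symm.trans (he.trans h2'); rw [h1, h1']; simp_all
      · rcases norm u w hab _ rfl with h | ⟨t, h1, h2, h3⟩
        · simpa using h.symm.trans he
        · simp_all
      · rcases norm u' w' hcd _ rfl with h | ⟨t, h1, h2, h3⟩
        · simpa using he.trans h
        · simp_all
      · exact he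

open Classical in
/-- Two labels with several vertices, all outside `S`, become part of one blob by a join. -/
theorem join_lifts_many {i j : ℕ} {p q : V} (hp : H.lab p i) (hq : H.lab q j)
    (hi : ∀ u, H.lab u i → ¬ S u) (hj : ∀ u, H.lab u j → ¬ S u) (hij : i ≠ j)
    (hsi : st i = 4) (hsj : st j = 4) (hoff : ∀ l, l ≠ i → l ≠ j → st' l = st l)
    (hsi' : st' i = 3 ∨ st' i = 4) (hsj' : st' j = 3 ∨ st' j = 4) :
    (∃ φ, Links.Lifts ((zlinks S H st).add False (inr i) (inr j)) (zlinks S (H.join i j) st')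
      (fun a => if a = inr i then inl q else if a = inr j then inl p else a) φ) ∧
    (∃ φ, Links.Lifts (zlinks S (H.join i j) st') ((zlinks S H st).add False (inr i) (inr j))
      id φ) := by
  set W1 := (zlinks S H st).add False (inr i) (inr j) with hW1
  have hz : W1.blob (inr i) (inr j) := .rel _ _ (.inr ⟨id, rfl⟩)
  have hzi : ∀ w, H.lab w i → W1.blob (inl w) (inr i) := fun w hw =>
    .rel _ _ (.inl ⟨hw, hi w hw, .inl hsi⟩)
  have hzj : ∀ w, H.lab w j → W1.blob (inl w) (inr j) := fun w hw =>
    .rel _ _ (.inl ⟨hw, hj w hw, .inl hsj⟩)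
  have hst : ∀ l, (st' l = 4 ∨ st' l = 5 → st l = 4 ∨ st l = 5) ∧ (st' l = 6 → st l = 6) := by grind
  constructor
  · have hhard : ∀ a b, (zlinks S H st).hard a b → (zlinks S (H.join i j) st').hard a b ∧
        a ≠ inr i ∧ a ≠ inr j ∧ b ≠ inr i ∧ b ≠ inr j := by
      intro a b hab; rcases a with u | l <;> rcases b with w | m <;> try exact hab.elim
      · exact ⟨⟨.inl hab.1, hab.2⟩, by simp, by simp, by simp, by simp⟩
      · have h1 : m ≠ i := by
          rintro rfl; rcases hab.2 with h | h
          · exact hi u hab.1 h.1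
          · omega
        have h2 : m ≠ j := by
          rintro rfl; rcases hab.2 with h | h
          · exact hj u hab.1 h.1
          · omega
        exact ⟨⟨hab.1, by rw [hoff m h1 h2]; exact hab.2⟩, by simp, by simp, by simp [h1],
          by simp [h2]⟩
    have B := fun a b => Links.blob_rel (W := zlinks S (H.join i j) st') (a := a) (b := b)
    refine ⟨fun a b => (a, b), ⟨?_, ?_, ?_⟩⟩
    · have hpq : (zlinks S (H.join i j) st').blob (inl q) (inl p) :=
        .rel _ _ ⟨.inr (.inr ⟨hq, hp⟩), hj q hq, hi p hp⟩
      rintro a b (hab | ⟨-, hab⟩)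
      · rcases a with u | l <;> rcases b with w | m <;> try exact hab.elim
        · simpa using B (inl u) (inl w) ⟨.inl hab.1, hab.2⟩
        · by_cases h1 : m = i
          · subst h1
            simpa using B (inl u) (inl q) ⟨.inr (.inl ⟨hab.1, hq⟩), hab.2.1, hj q hq⟩
          · by_cases h2 : m = j
            · subst h2
              simpa [h1] using B (inl u) (inl p) ⟨.inr (.inr ⟨hab.1, hp⟩), hab.2.1, hi p hp⟩
            · simpa [h1, h2] using B (inl u) (inr m)
                ⟨hab.1, hab.2.1, by rw [hoff m h1 h2]; exact hab.2.2⟩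
      · rcases Sym2.eq_iff.1 hab with ⟨rfl, rfl⟩ | ⟨rfl, rfl⟩
        · simpa [hij.symm] using hpq
        · simpa [hij.symm] using Links.blob_symm hpq
    · rintro a b (hab | hab)
      · obtain ⟨h, h1, h2, h3, h4⟩ := hhard a b hab; simp only [h1, h2, h3, h4, if_false]
        exact ⟨.inl h, .refl _, .refl _⟩
      · exact absurd hab.1 id
    · exact fun _ _ _ _ _ _ h => h
  · refine ⟨fun a b => (a, b), ⟨?_, ?_, fun _ _ _ _ _ _ h => h⟩⟩
    · intro a b hab; rcases a with u | l <;> rcases b with w | m <;> try exact hab.elim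
      · obtain ⟨h | ⟨h1, h2⟩ | ⟨h1, h2⟩, hu, hw⟩ := hab
        · exact .rel _ _ (.inl ⟨h, hu, hw⟩)
        · exact (hzi u h1).trans _ _ _ (hz.trans _ _ _ (hzj w h2).symm)
        · exact (hzj u h1).trans _ _ _ (hz.symm.trans _ _ _ (hzi w h2).symm)
      · exact .rel _ _ (.inl ⟨hab.1, hab.2.1, (hst m).1 hab.2.2⟩)
    · intro a b hab; refine ⟨.inl (.inl ?_), .refl _, .refl _⟩
      rcases a with u | l <;> rcases b with w | m <;> try exact hab.elim
      · obtain ⟨h | ⟨h1, h2⟩ | ⟨h1, h2⟩, hu⟩ := hab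
        · exact ⟨h, hu⟩
        all_goals grind
      · exact ⟨hab.1, hab.2.imp (And.imp_right (hst m).1) (hst m).2⟩

open Classical in
/-- The promised neighbours of two labels that are merged are identified; the single vertex of a
merged label is linked to the promised neighbour. -/
theorem rename_lifts {x y : ℕ} {W1 : Links (V ⊕ ℕ)} (hxy : x ≠ y)
    (hdis : ∀ u, H.lab u x → ¬ H.lab u y)
    (h45 : st x = 4 ∨ st x = 5 ∨ st y = 4 ∨ st y = 5 → st' y = 4 ∨ st' y = 5)
    (h6 : st x = 6 ∨ st y = 6 → st' y = 6)
    (hoff : ∀ l, l ≠ x → l ≠ y → st' l = st l)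
    (hs : ∀ a b, (zlinks S H st).soft a b → W1.soft a b)
    (hh : ∀ a b, (zlinks S H st).hard a b → W1.hard a b)
    (hs1 : ∀ u, H.lab u x ∨ H.lab u y → ¬ S u → st' y = 4 ∨ st' y = 5 → W1.blob (inl u) (inr y))
    (hh1 : ∀ u, H.lab u y → S u ∧ (st' y = 4 ∨ st' y = 5) ∨ st' y = 6 → W1.hard (inl u) (inr y))
    (hh2 : ∀ u, H.lab u x → S u ∧ (st' y = 4 ∨ st' y = 5) ∨ st' y = 6 →
      if st x ≤ 2 then W1.hard (inl u) (inr y) else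
        W1.hard (inl u) (inr x) ∧ W1.blob (inr x) (inr y))
    (hs2 : ∀ a b, W1.soft a b → (zlinks S H st).soft a b ∨
      (∃ u, (H.lab u x ∨ H.lab u y) ∧ ¬ S u ∧ (st' y = 4 ∨ st' y = 5) ∧
        s(a, b) = s(inl u, inr y)) ∨ s(a, b) = s(inr x, inr y))
    (hh3 : ∀ a b, W1.hard a b → (zlinks S H st).hard a b ∨
      (∃ u, (st x ≤ 2 ∧ H.lab u x ∨ st y ≤ 2 ∧ H.lab u y) ∧
        (S u ∧ (st' y = 4 ∨ st' y = 5) ∨ st' y = 6) ∧ s(a, b) = s(inl u, inr y))) :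
    (∃ φ, Links.Lifts W1 (zlinks S (H.rename x y) st')
      (fun a => if a = inr x then inr y else a) φ) ∧
    (∃ φ, Links.Lifts (zlinks S (H.rename x y) st') W1 id φ) := by
  have hlab : ∀ u, (H.rename x y).lab u y ↔ H.lab u x ∨ H.lab u y := by
    intro u; simp only [LGraph.rename]; constructor <;> grind
  have hlabx : ∀ u, ¬ (H.rename x y).lab u x := by rintro u ⟨l', h, he⟩; grind
  have hlab' : ∀ u l, l ≠ x → l ≠ y → ((H.rename x y).lab u l ↔ H.lab u l) := by
    intro u l h1 h2; simp only [LGraph.rename]; grind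
  constructor
  · have B := fun a b => Links.blob_rel (W := zlinks S (H.rename x y) st') (a := a) (b := b)
    refine ⟨fun a b => (if a = inr x then inr y else a, if b = inr x then inr y else b),
      ⟨?_, ?_, ?_⟩⟩
    · intro a b hab; rcases hs2 a b hab with hab | ⟨u, hu, hSu, h, he⟩ | he
      · rcases a with u | l <;> rcases b with w | m <;> try exact hab.elim
        · tauto
        · obtain ⟨g1, g2, g3⟩ := hab; by_cases h1 : m = x
          · subst h1
            simpa using B (inl u) (inr y) ⟨(hlab u).2 (.inl g1), g2, h45 (by tauto)⟩
          · by_cases h2 : m = y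
            · subst h2
              simpa [h1] using B (inl u) (inr m) ⟨(hlab u).2 (.inr g1), g2, h45 (by tauto)⟩
            · simpa [h1] using B (inl u) (inr m) ⟨(hlab' u m h1 h2).2 g1, g2, by rwa [hoff m h1 h2]⟩
      · have : (zlinks S (H.rename x y) st').blob (inl u) (inr y) :=
          .rel _ _ ⟨(hlab u).2 hu, hSu, h⟩
        rcases Sym2.eq_iff.1 he with ⟨rfl, rfl⟩ | ⟨rfl, rfl⟩
        · simpa [hxy.symm] using this
        · simpa [hxy.symm] using Links.blob_symm this
      · rcases Sym2.eq_iff.1 he with ⟨rfl, rfl⟩ | ⟨rfl, rfl⟩ <;> simpa [hxy.symm] using .refl _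
    · intro a b hab; refine ⟨?_, .refl _, .refl _⟩; rcases hh3 a b hab with hab | ⟨u, hu, h, he⟩
      · left; rcases a with u | l <;> rcases b with w | m <;> try exact hab.elim
        · simp only [reduceCtorEq, if_false]; exact hab
        · obtain ⟨g1, g2⟩ := hab; by_cases h1 : m = x
          · subst h1; simp only [reduceCtorEq, if_false, if_true]
            exact ⟨(hlab u).2 (.inl g1), by
              rcases g2 with g2 | g2
              · exact .inl ⟨g2.1, h45 (by tauto)⟩
              · exact .inr (h6 (.inl g2))⟩
          · simp only [reduceCtorEq, if_false, inr.injEq, h1]; by_cases h2 : m = y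
            · subst h2
              exact ⟨(hlab u).2 (.inr g1), by
                rcases g2 with g2 | g2
                · exact .inl ⟨g2.1, h45 (by tauto)⟩
                · exact .inr (h6 (.inr g2))⟩
            · exact ⟨(hlab' u m h1 h2).2 g1, by rwa [hoff m h1 h2]⟩
      · have : (zlinks S (H.rename x y) st').hard (inl u) (inr y) :=
          ⟨(hlab u).2 (hu.imp And.right And.right), h⟩
        grind
    · intro a b c d hab hcd he
      have norm : ∀ a b, W1.hard a b → (∃ u w, s(a, b) = s(inl u, inl w)) ∨
          (∃ u m, s(a, b) = s(inl u, inr m) ∧ m ≠ x ∧ m ≠ y) ∨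
          (∃ u, s(a, b) = s(inl u, inr y) ∧ (H.lab u x ∧ st x ≤ 2 ∨ H.lab u y)) ∨
          (∃ u, s(a, b) = s(inl u, inr x) ∧ H.lab u x ∧ ¬ st x ≤ 2) := by
        intro a b hab; rcases hh3 a b hab with hab | ⟨u, hu, h, he⟩
        · rcases a with u | l <;> rcases b with w | m <;> try exact hab.elim
          · exact .inl ⟨u, w, rfl⟩
          · by_cases h1 : m = x
            · subst h1; exact .inr (.inr (.inr ⟨u, rfl, hab.1, by have := hab.2; omega⟩))
            · by_cases h2 : m = y
              · subst h2; exact .inr (.inr (.inl ⟨u, rfl, .inr hab.1⟩))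
              · exact .inr (.inl ⟨u, m, rfl, h1, h2⟩)
        grind
      have hf : ∀ a b : V ⊕ ℕ, s((if a = inr x then inr y else a : V ⊕ ℕ),
          (if b = inr x then inr y else b : V ⊕ ℕ)) =
          Sym2.map (fun a : V ⊕ ℕ => if a = inr x then inr y else a) s(a, b) := fun a b => rfl
      rw [hf, hf] at he
      rcases norm a b hab with ⟨u, w, e⟩ | ⟨u, m, e, h1, h2⟩ | ⟨u, e, h1⟩ | ⟨u, e, h1⟩ <;>
        rcases norm c d hcd with ⟨u', w', e'⟩ | ⟨u', m', e', h1', h2'⟩ | ⟨u', e', h1'⟩ | ⟨u', e', h1'⟩ <;>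
        rw [e, e'] at he ⊢ <;> simp only [Sym2.map_mk, reduceCtorEq, if_false, inr.injEq,
          hxy.symm, if_true] at he <;> clear e e' hab hcd norm hs hh hs1 hh1 hh2 hs2 hh3 hlab hlab' hlabx
      all_goals grind [Sym2.eq_iff]
  · refine ⟨fun a b => match a, b with
      | inl u, inr m => if m = y ∧ H.lab u x ∧ ¬ st x ≤ 2 then (inl u, inr x) else (a, b)
      | _, _ => (a, b), ⟨?_, ?_, ?_⟩⟩
    · intro a b hab; rcases a with u | l <;> rcases b with w | m <;> try exact hab.elim
      · exact .rel _ _ (hs _ _ hab)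
      · obtain ⟨g1, g2, g3⟩ := hab; by_cases h1 : m = x
        · exact absurd (h1 ▸ g1) (hlabx u)
        · by_cases h2 : m = y
          · subst h2; exact hs1 u ((hlab u).1 g1) g2 g3
          · exact .rel _ _ (hs _ _ ⟨(hlab' u m h1 h2).1 g1, g2, by rwa [← hoff m h1 h2]⟩)
    · intro a b hab; rcases a with u | l <;> rcases b with w | m <;> try exact hab.elim
      · exact ⟨.inl (hh _ _ hab), .refl _, .refl _⟩
      · obtain ⟨g1, g2⟩ := hab; by_cases h1 : m = x
        · exact absurd (h1 ▸ g1) (hlabx u)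
        · by_cases h2 : m = y
          · subst h2; by_cases hu : H.lab u x
            · have := hh2 u hu g2; by_cases hx : st x ≤ 2
              · simp only [hx, if_true, not_true_eq_false, and_false, if_false] at this ⊢
                exact ⟨.inl this, .refl _, .refl _⟩
              · simp only [hx, if_false, hu, not_false_eq_true, and_self, if_true] at this ⊢
                exact ⟨.inl this.1, .refl _, this.2.symm⟩
            · simp only [hu, false_and, and_false, if_false]
              exact ⟨.inl (hh1 u (((hlab u).1 g1).resolve_left hu) g2), .refl _, .refl _⟩
          · simp only [h2, false_and, if_false]
            exact ⟨.inl (hh _ _ ⟨(hlab' u m h1 h2).1 g1, by rwa [← hoff m h1 h2]⟩), .refl _, .refl _⟩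
    · intro a b c d hab hcd he
      rcases a with u | l <;> rcases b with w | m <;> rcases c with u' | l' <;>
        rcases d with w' | m' <;> first | exact hab.elim | exact hcd.elim | skip
      · exact he
      · grind
      · grind
      · have g1 : m ≠ x := by rintro rfl; exact hlabx _ hab.1
        have g2 : m' ≠ x := by rintro rfl; exact hlabx _ hcd.1
        grind

/-! ### Renaming a label -/

/-- Is the edge between a single vertex of status `s` and a promised neighbour hard?  The promised
neighbour is outside `S` if `g = 1` and in `S` if `g = 2`. -/
def hardOf (g s : ℕ) : Bool := decide (s = 1 ∨ s = 2 ∧ g = 2)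

/-- Does the status `s` admit the promise `g`? -/
def Allowed (g s : ℕ) : Prop := s ≤ 2 ∨ (g = 1 ∧ (s = 4 ∨ s = 5)) ∨ (g = 2 ∧ s = 6)

instance (g s : ℕ) : Decidable (Allowed g s) := inferInstanceAs (Decidable (_ ∨ _))

/-- The single vertex in slot `y` moves to slot `K - 1`, and a new component is put into slot
`y`. -/
def freshen (K B y : ℕ) (f : ℕ → ℕ) : ℕ → ℕ :=
  update (update (update (update f (K + (K - 1)) (f (K + y)))
    (2 * K + (K - 1)) (f (2 * K + y))) (K + y) B) (2 * K + y) B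

/-- The labels `x` and `y` are merged, and the promised neighbour of the resulting label `y` is kept
in slot `y`. -/
def mergeLive (K B x y g : ℕ) (f : ℕ → ℕ) : (ℕ → ℕ) × Bool :=
  let r₁ := if f y ≤ 2 then addE K (hardOf g (f y)) (K - 1) y (freshen K B y f) else (f, true)
  let r₂ := addE K (hardOf g (f x)) x y r₁.1
  (update (update r₂.1 y (if g = 2 then 6 else
    if (f x = 2 ∨ f x = 4) ∧ (f y = 2 ∨ f y = 4) then 4 else 5)) x 0, r₁.2 && r₂.2)

/-- The effect on an array of renaming `x` to `y`, where `g` tells what is promised to the resulting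
label if it has several vertices, all of whose old labels are nonempty: `0` for nothing, `1` for a
neighbour outside `S`, `2` for a neighbour in `S`. -/
def mergeCore (K B x y g : ℕ) (f : ℕ → ℕ) : (ℕ → ℕ) × Bool :=
  if f x = 0 then (f, true)
  else if f y = 0 then (update (update (update (update f
    y (f x)) (K + y) (f (K + x))) (2 * K + y) (f (2 * K + x))) x 0, true)
  else if g = 0 then (update (update f y 3) x 0, decide (f x ≤ 3 ∧ f y ≤ 3))
  else if g ≤ 2 ∧ Allowed g (f x) ∧ Allowed g (f y) then mergeLive K B x y g f
  else (f, false)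

/-- `mergeCore` followed by a renumbering. -/
def mergeF (K B x y g : ℕ) (f : ℕ → ℕ) : (ℕ → ℕ) × Bool :=
  (normIds K B (mergeCore K B x y g f).1, (mergeCore K B x y g f).2)

section

variable {V : Type*} {S : V → Prop} {H : LGraph V} {st st' f : ℕ → ℕ} {n : ℕ}

/-- The array `f` describes a partial solution without cycles through hard edges. -/
def Represents (S : V → Prop) (n : ℕ) (H : LGraph V) (f : ℕ → ℕ) : Prop :=
  (∀ l, l < n → Fits S (H.lab · l) (f l)) ∧ (zlinks S H f).Good ∧
    Ids (n + 1) (zlinks S H f) (term n H f) f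

theorem term_lt {l : ℕ} {a : V ⊕ ℕ} (h : term n H st l a) : l < n := by
  rcases a with v | m <;> exact h.1

theorem term_of_inr {l m : ℕ} (h : term n H st l (.inr m)) : m = l := h.2.2.2

theorem exists_term {l : ℕ} (hl : l < n) (h : Fits S (H.lab · l) (st l)) (h0 : st l ≠ 0)
    (h3 : st l ≠ 3) : ∃ a, term n H st l a := by
  by_cases h2 : st l ≤ 2
  · obtain ⟨v, hv, -⟩ := h.single h0 h2; exact ⟨.inl v, hl, by omega, (hv v).2 rfl⟩
  · exact ⟨.inr l, hl, by omega, h.le, rfl⟩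

/-- Statuses and identifiers determine whether an array describes a partial solution. -/
theorem Represents.congr {g : ℕ → ℕ} (hH : ∀ v l, H.lab v l → l < n) (h : Represents S n H f)
    (h0 : ∀ l, l < n → f l = g l)
    (h1 : ∀ l m, l < n → m < n → (g (n + 1 + l) = g (n + 1 + m) ↔ f (n + 1 + l) = f (n + 1 + m)))
    (h2 : ∀ l m, l < n → m < n → (g (2 * (n + 1) + l) = g (2 * (n + 1) + m) ↔
      f (2 * (n + 1) + l) = f (2 * (n + 1) + m))) : Represents S n H g := by
  obtain ⟨g1, g2, g3⟩ := h
  refine ⟨fun l hl => by rw [← h0 l hl]; exact g1 l hl, by rwa [← zlinks_congr hH h0], ?_⟩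
  rw [← zlinks_congr hH h0, ← term_congr h0]
  exact g3.congr (fun l m a b ha hb => h1 l m (term_lt ha) (term_lt hb))
    (fun l m a b ha hb => h2 l m (term_lt ha) (term_lt hb))

theorem Represents.normIds {B : ℕ} (hH : ∀ v l, H.lab v l → l < n) (h : Represents S n H f)
    (hB : n + 1 ≤ B) (hf : ∀ a, a < 3 * (n + 1) → f a < 3 * B) :
    Represents S n H (normIds (n + 1) B f) := by
  obtain ⟨g1, g2, g3, -⟩ := normIds_spec hB hf
  exact h.congr hH (fun l hl => (g1 l (by omega)).symm)
    (fun l m hl hm => g2 l m (by omega) (by omega)) (fun l m hl hm => g3 l m (by omega) (by omega))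

theorem rename_lab {x y : ℕ} (hxy : x ≠ y) (u : V) (l : ℕ) : (H.rename x y).lab u l ↔
    l ≠ x ∧ (H.lab u l ∨ l = y ∧ H.lab u x) := by
  simp only [LGraph.rename]; constructor <;> grind

theorem rename_of_empty {x y : ℕ} (hxy : x ≠ y) (hx : ∀ v, ¬ H.lab v x) : H.rename x y = H := by
  have : (H.rename x y).lab = H.lab := by
    funext u l
    refine propext ((rename_lab hxy u l).trans ⟨fun h => h.2.resolve_right fun h => hx _ h.2,
      fun h => ⟨?_, .inl h⟩⟩)
    rintro rfl; exact hx _ h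
  cases H; exact congrArg (fun lab => LGraph.mk lab _) this

theorem hardOf_of_le {g s : ℕ} (h : 3 ≤ s) : hardOf g s = false := by
  simp only [hardOf, decide_eq_false_iff_not]; omega

theorem Links.isolated {Ω : Type*} (W : Links Ω) {z : Ω}
    (hz : ∀ a, ¬ W.soft z a ∧ ¬ W.soft a z ∧ ¬ W.hard z a ∧ ¬ W.hard a z) (a : Ω) :
    (W.comp z a ↔ a = z) ∧ (W.comp a z ↔ a = z) ∧ (W.blob z a ↔ a = z) ∧ (W.blob a z ↔ a = z) := by
  have hc : ∀ a, W.comp z a ↔ a = z := fun a => Links.eqvGen_isolated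
    (fun a => by have := hz a; tauto) (fun a => by have := hz a; tauto)
  have hb : ∀ a, W.blob z a ↔ a = z := fun a => Links.eqvGen_isolated
    (fun a => (hz a).1) (fun a => (hz a).2.1)
  exact ⟨hc a, ⟨fun h => (hc a).1 h.symm, fun h => ((hc a).2 h).symm⟩, hb a,
    ⟨fun h => (hb a).1 h.symm, fun h => ((hb a).2 h).symm⟩⟩

/-- An edge to a point without edges does not connect other points. -/
theorem Links.conn_add_isolated {Ω : Type*} {W : Links Ω} {h : Prop} {x z p q : Ω}
    (hz : ∀ a, ¬ W.soft z a ∧ ¬ W.soft a z ∧ ¬ W.hard z a ∧ ¬ W.hard a z) (hp : p ≠ z) (hq : q ≠ z) :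
    ((W.add h x z).comp p q ↔ W.comp p q) ∧ ((W.add h x z).blob p q ↔ W.blob p q) := by
  obtain ⟨-, h1, -, h2⟩ := W.isolated hz p; obtain ⟨h1', -, h2', -⟩ := W.isolated hz q; constructor
  · rw [Links.comp_add, h1, h1']; tauto
  · by_cases hh : h
    · rw [Links.add_of hh]; exact Links.blob_addHard
    · rw [Links.add_of_not hh, Links.blob_addSoft, h2, h2']; tauto

open Classical in
/-- The promised neighbour of a label is isolated if the label has no promised neighbour. -/
theorem zlinks_isolated {y : ℕ} (hy : st y ≤ 3) (a : V ⊕ ℕ) :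
    ¬ (zlinks S H st).soft (inr y) a ∧ ¬ (zlinks S H st).soft a (inr y) ∧
      ¬ (zlinks S H st).hard (inr y) a ∧ ¬ (zlinks S H st).hard a (inr y) := by
  rcases a with u | m
  · simp only [zlinks, not_false_eq_true, true_and]; omega
  · simp [zlinks]

open Classical in
/-- Merging of two nonempty labels with a promised neighbour. -/
theorem merge_lifts {x y g : ℕ} (hxy : x ≠ y) (hdis : ∀ u, H.lab u x → ¬ H.lab u y)
    (hfx : Fits S (H.lab · x) (st x)) (hfy : Fits S (H.lab · y) (st y))
    (hax : Allowed g (st x)) (hay : Allowed g (st y))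
    (hs' : g = 1 ∧ (st' y = 4 ∨ st' y = 5) ∨ g = 2 ∧ st' y = 6)
    (hoff : ∀ l, l ≠ x → l ≠ y → st' l = st l)
    {X Y : V ⊕ ℕ} (hX : term n H st x X) (hY : term n H st y Y) {W0 W1 : Links (V ⊕ ℕ)}
    (hW0 : W0 = if st y ≤ 2 then (zlinks S H st).add (hardOf g (st y)) Y (inr y)
      else zlinks S H st)
    (hW1 : W1 = W0.add (hardOf g (st x)) X (inr y)) :
    (∃ φ, Links.Lifts W1 (zlinks S (H.rename x y) st')
      (fun a => if a = inr x then inr y else a) φ) ∧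
    (∃ φ, Links.Lifts (zlinks S (H.rename x y) st') W1 id φ) := by
  have hsoft0 : ∀ a b, W0.soft a b ↔ (zlinks S H st).soft a b ∨
      (st y ≤ 2 ∧ ¬ hardOf g (st y) ∧ s(a, b) = s(Y, inr y)) := by
    intro a b; subst hW0; split_ifs with h <;> simp [Links.add, h]
  have hhard0 : ∀ a b, W0.hard a b ↔ (zlinks S H st).hard a b ∨
      (st y ≤ 2 ∧ hardOf g (st y) ∧ s(a, b) = s(Y, inr y)) := by
    intro a b; subst hW0; split_ifs with h <;> simp [Links.add, h]
  have hsoft1 : ∀ a b, W1.soft a b ↔ W0.soft a b ∨ (¬ hardOf g (st x) ∧ s(a, b) = s(X, inr y)) := by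
    intro a b; subst hW1; rfl
  have hhard1 : ∀ a b, W1.hard a b ↔ W0.hard a b ∨ (hardOf g (st x) ∧ s(a, b) = s(X, inr y)) := by
    intro a b; subst hW1; rfl
  have single : ∀ l p, term n H st l p → Fits S (H.lab · l) (st l) → st l ≤ 2 →
      ∃ v, p = inl v ∧ (∀ u, H.lab u l ↔ u = v) ∧ (st l = 1 ∧ S v ∨ st l = 2 ∧ ¬ S v) := by
    rintro (l) (p | m) hp hf h2
    · obtain ⟨v, hv, h⟩ := hf.single (by have := hp.2.1; omega) h2; obtain rfl := (hv p).1 hp.2.2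
      exact ⟨p, rfl, hv, h⟩
    · have := hp.2.1; omega
  have multi : ∀ l p, term n H st l p → ¬ st l ≤ 2 → p = inr l := by
    rintro l (p | m) hp h2
    · have := hp.2.1; omega
    · rw [hp.2.2.2]
  have hhard : ∀ s, hardOf g s = true ↔ s = 1 ∨ s = 2 ∧ g = 2 := by intro s; simp [hardOf]
  simp only [hhard] at hsoft0 hhard0 hsoft1 hhard1; unfold Allowed at hax hay
  have hSy : ∀ u, H.lab u y → st y ≤ 2 → s(Y, inr y) = s(inl u, inr y) ∧
      (st y = 1 ↔ S u) ∧ (st y = 2 ↔ ¬ S u) := by grind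
  have hSx : ∀ u, H.lab u x → st x ≤ 2 → X = inl u ∧
      (st x = 1 ↔ S u) ∧ (st x = 2 ↔ ¬ S u) := by grind
  have hx0 : st x ≠ 0 := by rcases X with v | m <;> have := hX.2.1 <;> omega
  have hy0 : st y ≠ 0 := by rcases Y with v | m <;> have := hY.2.1 <;> omega
  have hXm : ¬ st x ≤ 2 → W1.blob (inr x) (inr y) := by
    intro h2; refine .rel _ _ ((hsoft1 _ _).2 (.inr ⟨by omega, ?_⟩)); rw [multi x X hX h2]
  refine rename_lifts hxy hdis (by omega) (by omega) hoff
    (fun a b h => (hsoft1 _ _).2 (.inl ((hsoft0 _ _).2 (.inl h))))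
    (fun a b h => (hhard1 _ _).2 (.inl ((hhard0 _ _).2 (.inl h)))) ?_ ?_ ?_ ?_ ?_
  · rintro u (hu | hu) hSu h45
    · by_cases h2 : st x ≤ 2
      · obtain ⟨h1, h3, h4⟩ := hSx u hu h2; refine .rel _ _ ((hsoft1 _ _).2 (.inr ⟨?_, by rw [h1]⟩))
        have := h4.2 hSu; omega
      · refine EqvGen.trans _ (inr x) _ (.rel _ _ ((hsoft1 _ _).2 (.inl ((hsoft0 _ _).2 (.inl
          ⟨hu, hSu, ?_⟩))))) (hXm h2)
        omega
    · by_cases h2 : st y ≤ 2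
      · obtain ⟨h1, h3, h4⟩ := hSy u hu h2
        refine .rel _ _ ((hsoft1 _ _).2 (.inl ((hsoft0 _ _).2 (.inr ⟨h2, ?_, h1.symm⟩))))
        have := h4.2 hSu; omega
      · refine .rel _ _ ((hsoft1 _ _).2 (.inl ((hsoft0 _ _).2 (.inl ⟨hu, hSu, ?_⟩)))); omega
  · intro u hu h; by_cases h2 : st y ≤ 2
    · grind
    · refine (hhard1 _ _).2 (.inl ((hhard0 _ _).2 (.inl ⟨hu, ?_⟩))); grind
  · intro u hu h; split_ifs with h2
    · grind
    · refine ⟨(hhard1 _ _).2 (.inl ((hhard0 _ _).2 (.inl ⟨hu, ?_⟩))), hXm h2⟩; grind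
  · intro a b hab; rcases (hsoft1 _ _).1 hab with hab | ⟨h, he⟩
    all_goals grind
  · intro a b hab; rcases (hhard1 _ _).1 hab with hab | ⟨h, he⟩
    · grind
    · by_cases h2 : st x ≤ 2
      · obtain ⟨u, hu⟩ := hfx.nonempty hx0; grind
      · omega

end

section

variable {V : Type*} {S : V → Prop} {H : LGraph V} {st st' f : ℕ → ℕ} {n : ℕ}

/-- The promised neighbour of a label with a single vertex becomes a new component, to which the
vertex is linked.  Since slot `y` is needed for it, the vertex moves to the last slot. -/
theorem freshen_ids {B y g : ℕ} (hyn : y < n) (hR : Represents S n H f)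
    (hB : ∀ a, a < 3 * (n + 1) → f a < B) {Y : V ⊕ ℕ} (hY : term n H f y Y)
    {W0 : Links (V ⊕ ℕ)} {r : (ℕ → ℕ) × Bool}
    (hW0 : W0 = if f y ≤ 2 then (zlinks S H f).add (hardOf g (f y)) Y (inr y) else zlinks S H f)
    (hr : r = if f y ≤ 2 then addE (n + 1) (hardOf g (f y)) (n + 1 - 1) y (freshen (n + 1) B y f)
      else (f, true)) :
    ∃ τ : ℕ → V ⊕ ℕ → Prop, (∀ l a, τ l a → l < n + 1) ∧ τ y (inr y) ∧
      (∀ l a, l ≠ y → term n H f l a → τ l a) ∧ W0.Good ∧ Ids (n + 1) W0 τ r.1 ∧ r.2 = true := by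
  obtain ⟨h1, h2, h3⟩ := hR; by_cases hy : f y ≤ 2
  · rw [if_pos hy] at hW0 hr
    have hYy : Y ≠ inr y := by rintro rfl; have := hY.2.1; omega
    have hiso := fun a => zlinks_isolated (S := S) (H := H) (st := f) (y := y) (by omega) a
    have hd := (zlinks S H f).isolated hiso
    let τ : ℕ → V ⊕ ℕ → Prop := fun l a =>
      (l = n ∧ a = Y) ∨ (l = y ∧ a = inr y) ∨ (l ≠ y ∧ term n H f l a)
    have hτ : ∀ l a, τ l a → l < n + 1 := by
      rintro l a (⟨rfl, -⟩ | ⟨rfl, -⟩ | ⟨-, h⟩)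
      · omega
      · omega
      · have := term_lt h; omega
    -- the slot of the old array that holds the entry of slot `l`
    let σ : ℕ → ℕ := fun l => if l = n then y else l
    have hv : ∀ l, l < n + 1 → l ≠ y → freshen (n + 1) B y f (n + 1 + l) = f (n + 1 + σ l) ∧
        freshen (n + 1) B y f (2 * (n + 1) + l) = f (2 * (n + 1) + σ l) := by
      intro l hl hly; simp only [freshen, update_apply, σ]; by_cases hln : l = n
      all_goals grind
    have hvy : freshen (n + 1) B y f (n + 1 + y) = B ∧
        freshen (n + 1) B y f (2 * (n + 1) + y) = B := by
      simp only [freshen, update_apply]; grind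
    have hσ : ∀ l, l < n + 1 → σ l < n + 1 := by grind
    have hold : ∀ l a, l ≠ y → τ l a → term n H f (σ l) a ∧ a ≠ inr y := by
      rintro l a hly (⟨rfl, rfl⟩ | ⟨rfl, rfl⟩ | ⟨-, h⟩)
      · simpa [σ] using ⟨hY, hYy⟩
      · exact absurd rfl hly
      · have hl := term_lt h; simp only [σ, if_neg hl.ne]; refine ⟨h, ?_⟩; rintro rfl
        exact hly (term_of_inr h).symm
    have hyτ : ∀ a, τ y a → a = inr y := by grind
    have hI : Ids (n + 1) (zlinks S H f) τ (freshen (n + 1) B y f) := by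
      intro l m a b ha hb1; by_cases hl : l = y <;> by_cases hm : m = y
      · grind
      · grind
      · grind
      · rw [(hv l (hτ l a ha) hl).1, (hv l (hτ l a ha) hl).2, (hv m (hτ m b hb1) hm).1,
          (hv m (hτ m b hb1) hm).2]
        exact h3 _ _ a b (hold l a hl ha).1 (hold m b hm hb1).1
    have hcan : (zlinks S H f).CanAdd (hardOf g (f y)) Y (inr y) := .inr fun h => hYy ((hd Y).2.1.1 h)
    have hadd := hI.addE hτ (h := hardOf g (f y)) (x := n) (y := y) (a := Y) (b := inr y)
      (.inl ⟨rfl, rfl⟩) (.inr (.inl ⟨rfl, rfl⟩))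
    refine ⟨τ, hτ, .inr (.inl ⟨rfl, rfl⟩), fun l a hl h => .inr (.inr ⟨hl, h⟩), ?_, ?_, ?_⟩
    · rw [hW0]; exact h2.add hcan
    · rw [hW0, hr]; exact hadd.2 (hadd.1.2 hcan)
    · rw [hr]; exact hadd.1.2 hcan
  · rw [if_neg hy] at hW0 hr; subst hW0 hr
    have hYy : Y = inr y := by
      rcases Y with v | m
      · have := hY.2.1; omega
      · rw [hY.2.2.2]
    exact ⟨term n H f, fun l a h => by have := term_lt h; omega, hYy ▸ hY,
      fun l a _ h => h, h2, h3, rfl⟩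

theorem update_lt {D : ℕ} {f : ℕ → ℕ} {N a v : ℕ} (hf : ∀ a, a < N → f a < D) (hv : v < D) :
    ∀ b, b < N → update f a v b < D := by grind

theorem mergeCore_lt {K B x y g : ℕ} (hx : x < K) (hy : y < K) (hB : 7 ≤ B)
    (hf : ∀ a, a < 3 * K → f a < B) : ∀ a, a < 3 * K → (mergeCore K B x y g f).1 a < B + 1 := by
  have hf' : ∀ a, a < 3 * K → f a < B + 1 := fun a ha => (hf a ha).trans (by omega)
  have hfr : ∀ a, a < 3 * K → freshen K B y f a < B + 1 := by unfold freshen; grind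
  unfold mergeCore; split_ifs with h1 h2 h3 h4
  · exact hf'
  · grind
  · grind
  · unfold mergeLive; simp only; refine update_lt (update_lt (addE_lt hy ?_) ?_) (by omega)
    · split_ifs
      · exact addE_lt hy hfr
      · exact hf'
    · split_ifs <;> omega
  · exact hf'

theorem Allowed.ne_three {g s : ℕ} (h : Allowed g s) : s ≠ 3 := by unfold Allowed at h; omega

theorem fits_union {x y : ℕ} (hxy : x ≠ y) {s : ℕ} (hs3 : 3 ≤ s) (hs6 : s ≤ 6)
    (hdis : ∀ u, H.lab u x → ¬ H.lab u y) (hx : ∃ v, H.lab v x) (hy : ∃ v, H.lab v y)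
    (h4 : s = 4 → ∀ v, H.lab v x ∨ H.lab v y → ¬ S v)
    (h5 : s = 5 → ∃ v, (H.lab v x ∨ H.lab v y) ∧ S v) :
    Fits S ((H.rename x y).lab · y) s := by
  have hlab : ∀ u, (H.rename x y).lab u y ↔ H.lab u x ∨ H.lab u y := by
    intro u; rw [rename_lab hxy]; simp [hxy.symm, or_comm]
  have hM : Many ((H.rename x y).lab · y) := by
    obtain ⟨p, hp⟩ := hx; obtain ⟨q, hq⟩ := hy
    exact ⟨p, q, fun h => hdis p hp (h ▸ hq), (hlab p).2 (.inl hp), (hlab q).2 (.inr hq)⟩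
  obtain rfl | rfl | rfl | rfl : s = 3 ∨ s = 4 ∨ s = 5 ∨ s = 6 := by omega
  · exact hM
  · exact ⟨hM, fun v hv => h4 rfl v ((hlab v).1 hv)⟩
  · obtain ⟨v, hv, hS⟩ := h5 rfl; exact ⟨hM, v, (hlab v).2 hv, hS⟩
  · exact hM

/-- The statuses `2` and `4` belong to sets outside `S`, the statuses `1` and `5` do not. -/
theorem Fits.avoids_iff {C : V → Prop} {s : ℕ} (h : Fits S C s) (h0 : s ≠ 0) (h3 : s ≠ 3)
    (h6 : s ≠ 6) : (s = 2 ∨ s = 4) ↔ ∀ v, C v → ¬ S v := by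
  have := h.le; obtain rfl | rfl | rfl | rfl : s = 1 ∨ s = 2 ∨ s = 4 ∨ s = 5 := by omega
  · obtain ⟨v, hv, hC⟩ := h; simpa using ⟨v, (hC v).2 rfl, hv⟩
  · obtain ⟨v, hv, hC⟩ := h; simpa using fun u hu => ((hC u).1 hu) ▸ hv
  all_goals simpa using h.2

theorem fits_rename {x y l : ℕ} (hxy : x ≠ y) (hlx : l ≠ x) (hly : l ≠ y) :
    ((H.rename x y).lab · l) = (H.lab · l) := by
  funext u; rw [rename_lab hxy]; simp [hlx, hly]

theorem fits_rename_zero {x y : ℕ} (hxy : x ≠ y) : Fits S ((H.rename x y).lab · x) 0 := by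
  intro u; simp only [rename_lab hxy]; simp

open Classical in
/-- Merging of two labels one of which is empty or without promised neighbours. -/
theorem merge_quiet_lifts {x y : ℕ} {W1 : Links (V ⊕ ℕ)} (hxy : x ≠ y)
    (hdis : ∀ u, H.lab u x → ¬ H.lab u y) (hW1 : W1 = (zlinks S H st).add False (inr x) (inr y) ∨
      W1 = zlinks S H st)
    (h : W1 = (zlinks S H st).add False (inr x) (inr y) ∧ st' y = st x ∧ (∀ v, ¬ H.lab v y) ∧
      st y = 0 ∨ st x ≤ 3 ∧ st y ≤ 3 ∧ st' y ≤ 3)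
    (hoff : ∀ l, l ≠ x → l ≠ y → st' l = st l) :
    (∃ φ, Links.Lifts W1 (zlinks S (H.rename x y) st')
      (fun a => if a = inr x then inr y else a) φ) ∧
    (∃ φ, Links.Lifts (zlinks S (H.rename x y) st') W1 id φ) := by
  have hs : ∀ a b, W1.soft a b → (zlinks S H st).soft a b ∨ s(a, b) = s(inr x, inr y) := by
    rcases hW1 with rfl | rfl <;> grind [Links.add]
  have hs' : ∀ a b, (zlinks S H st).soft a b → W1.soft a b := by
    rcases hW1 with rfl | rfl <;> grind [Links.add]
  have hh : ∀ a b, W1.hard a b ↔ (zlinks S H st).hard a b := by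
    rcases hW1 with rfl | rfl <;> grind [Links.add]
  refine rename_lifts hxy hdis ?_ ?_ hoff hs' (fun a b h => (hh a b).2 h) ?_ ?_ ?_
    (fun a b h => (hs a b h).imp_right .inr) (fun a b h => .inl ((hh a b).1 h))
  · omega
  · omega
  · rintro u hu hSu h45; rcases h with ⟨hW, h1, h2, h3⟩ | h
    · have hu' := hu.resolve_right (h2 u)
      refine EqvGen.trans _ (inr x) _ (.rel _ _ (hs' _ _ ⟨hu', hSu, by omega⟩)) ?_; rw [hW]
      exact .rel _ _ (.inr ⟨id, rfl⟩)
    · omega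
  · grind
  · rintro u hu h45; rcases h with ⟨hW, h1, h2, h3⟩ | h
    · rw [if_neg (by omega)]; refine ⟨(hh _ _).2 ⟨hu, by rwa [← h1]⟩, ?_⟩; rw [hW]
      exact .rel _ _ (.inr ⟨id, rfl⟩)
    · omega

/-- The old terminal of a label that takes no part in a renaming. -/
theorem term_rename {f' : ℕ → ℕ} {x y l : ℕ} {a : V ⊕ ℕ} (hxy : x ≠ y) (hlx : l ≠ x) (hly : l ≠ y)
    (hoff : f' l = f l) (h : term n (H.rename x y) f' l a) : term n H f l a := by
  rcases a with u | m
  · obtain ⟨e1, e2, e3⟩ := h; refine ⟨e1, by rwa [← hoff], ?_⟩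
    have := ((rename_lab hxy _ _).1 e3).2; simpa [hly] using this
  · obtain ⟨e1, e2, e3, rfl⟩ := h; exact ⟨e1, by omega, by omega, rfl⟩

open Classical in
/-- The label `x` replaces the empty label `y`. -/
theorem Represents.move {f' : ℕ → ℕ} {x y : ℕ} (hR : Represents S n H f) (hxy : x ≠ y)
    (hxn : x < n) (hyn : y < n) (h0 : f y = 0) (hoff : ∀ l, l ≠ x → l ≠ y → l < n → f' l = f l)
    (hx : f' x = 0) (hy : f' y = f x)
    (h1 : ∀ l, l < n → f' (n + 1 + l) = f (n + 1 + if l = y then x else l))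
    (h2 : ∀ l, l < n → f' (2 * (n + 1) + l) = f (2 * (n + 1) + if l = y then x else l))
    (hH : ∀ v l, H.lab v l → l < n) : Represents S n (H.rename x y) f' := by
  obtain ⟨g1, g2, g3⟩ := hR; have hye : ∀ v, ¬ H.lab v y := by have := g1 y hyn; rwa [h0] at this
  have hH' : ∀ v l, (H.rename x y).lab v l → l < n := by
    intro v l h; obtain ⟨-, h | ⟨rfl, -⟩⟩ := (rename_lab hxy v l).1 h
    · exact hH v l h
    · exact hyn
  set st' : ℕ → ℕ := fun l => if l = x then 0 else if l = y then f x else f l with hst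
  have hst' : ∀ l, l < n → f' l = st' l := by grind
  have hl := merge_quiet_lifts (S := S) (H := H) (st := f) (st' := st')
    (W1 := (zlinks S H f).add False (inr x) (inr y)) hxy
    (fun u _ => hye u) (.inl rfl) (.inl ⟨rfl, by simp [hst, hxy.symm], hye, h0⟩)
    (fun l e1 e2 => by simp [hst, e1, e2])
  obtain ⟨⟨φ, hL⟩, ⟨φ', hL'⟩⟩ := hl
  have hiso := fun a => zlinks_isolated (S := S) (H := H) (st := f) (y := y) (by omega) a
  have hxy' : (inr x : V ⊕ ℕ) ≠ inr y := by simpa using hxy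
  refine ⟨fun l hl => ?_, ?_, ?_⟩
  · by_cases e1 : l = x
    · subst e1; rw [hx]; exact fits_rename_zero hxy
    · by_cases e2 : l = y
      · subst e2; rw [hy]
        have : ((H.rename x l).lab · l) = (H.lab · x) := by
          funext u; rw [rename_lab hxy]; simp [hxy.symm, hye]
        rw [this]; exact g1 x hxn
      · rw [hoff l e1 e2 hl, fits_rename hxy e1 e2]; exact g1 l hl
  · rw [zlinks_congr hH' hst']; exact hL'.good (g2.add (.inr fun h => hxy' (((zlinks S H f).isolated hiso _).2.1.1 h)))
  · rw [zlinks_congr hH' hst', term_congr hst']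
    have hterm : ∀ l a, term n (H.rename x y) st' l a → l ≠ x ∧ ∃ b,
        term n H f (if l = y then x else l) b ∧ b ≠ inr y ∧ a ≠ inr x ∧
        ((zlinks S H f).add False (inr x) (inr y)).blob a b := by
      intro l a h
      have hlx : l ≠ x := by
        rintro rfl; rcases a with u | m
        · exact ((rename_lab hxy _ _).1 h.2.2).1 rfl
        · have := h.2.1; simp [hst] at this
      refine ⟨hlx, ?_⟩; by_cases hly : l = y
      · subst hly; rcases a with u | m
        · refine ⟨inl u, ?_, by simp, by simp, .refl _⟩; obtain ⟨e1, e2, e3⟩ := h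
          simp only [if_true]; refine ⟨hxn, by simpa [hst, hxy.symm] using e2, ?_⟩
          have := ((rename_lab hxy _ _).1 e3).2; simpa [hye] using this
        · obtain ⟨e1, e2, e3, rfl⟩ := h
          refine ⟨inr x, ?_, by simpa using hxy, by simpa using hxy.symm, .rel _ _ (.inr ⟨id, Sym2.eq_swap⟩)⟩
          simp only [if_true]; simp only [hst, hxy.symm, if_false, if_true] at e2 e3
          exact ⟨hxn, e2, e3, rfl⟩
      · refine ⟨a, ?_, ?_, ?_, .refl _⟩
        · rw [if_neg hly]; exact term_rename hxy hlx hly (by simp [hst, hlx, hly]) h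
        · rintro rfl; exact hly (term_of_inr h).symm
        · rintro rfl; exact hlx (term_of_inr h).symm
    intro l m a b ha hb; obtain ⟨hl, p, hp, hpy, hax, hap⟩ := hterm l a ha
    obtain ⟨hm, q, hq, hqy, hbx, hbq⟩ := hterm m b hb
    have e := hL.conn_iff hL' (x := a) (y := b) (by simpa [hax] using .refl _)
      (by simpa [hbx] using .refl _)
    have c := Links.conn_add_isolated (W := zlinks S H f) (h := False) (x := inr x) (z := inr y)
      hiso hpy hqy
    rw [e.1, e.2, h1 l (term_lt ha), h1 m (term_lt hb), h2 l (term_lt ha), h2 m (term_lt hb),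
      (g3 _ _ p q hp hq).1, (g3 _ _ p q hp hq).2, ← c.1, ← c.2]
    have ap := Links.blob_comp hap; have bq := Links.blob_comp hbq
    exact ⟨⟨fun h => hap.trans _ _ _ (h.trans _ _ _ hbq.symm),
      fun h => hap.symm.trans _ _ _ (h.trans _ _ _ hbq)⟩,
      ⟨fun h => ap.trans _ _ _ (h.trans _ _ _ bq.symm),
      fun h => ap.symm.trans _ _ _ (h.trans _ _ _ bq)⟩⟩

/-- The side condition on the statuses under which `mergeCore` can succeed. -/
def MergeOk (x y g : ℕ) (f : ℕ → ℕ) : Prop := f x = 0 ∨ f y = 0 ∨ (g = 0 ∧ f x ≤ 3 ∧ f y ≤ 3) ∨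
    ((g = 1 ∨ g = 2) ∧ Allowed g (f x) ∧ Allowed g (f y))

theorem mergeOk_of_mergeCore {K B x y g : ℕ} (h : (mergeCore K B x y g f).2 = true) :
    MergeOk x y g f := by
  unfold mergeCore at h; unfold MergeOk; grind

theorem addE_freshen_low {K B y g l : ℕ} (hl : l < K) :
    (if f y ≤ 2 then addE K (hardOf g (f y)) (K - 1) y (freshen K B y f) else (f, true)).1 l = f l := by
  split_ifs
  · rw [addE_low hl]; simp only [freshen, update_apply]; grind
  · rfl

theorem mergeCore_status {K B x y g l : ℕ} (hy : y < K) (hxy : x ≠ y) (hl : l < K) :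
    (l ≠ x → l ≠ y → (mergeCore K B x y g f).1 l = f l) ∧
    (f x ≠ 0 → f y = 0 → (mergeCore K B x y g f).1 y = f x) ∧
    ((mergeCore K B x y g f).2 = true ∨ MergeOk x y g f → (mergeCore K B x y g f).1 x = 0) ∧
    (f x = 0 → (mergeCore K B x y g f).1 y = f y) ∧
    (f x ≠ 0 → f y ≠ 0 → g = 0 → (mergeCore K B x y g f).1 y = 3) ∧
    (f x ≠ 0 → f y ≠ 0 → g = 1 ∨ g = 2 → Allowed g (f x) → Allowed g (f y) →
      (mergeCore K B x y g f).1 y = if g = 2 then 6 else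
        if (f x = 2 ∨ f x = 4) ∧ (f y = 2 ∨ f y = 4) then 4 else 5) := by
  have hlow : ∀ r : (ℕ → ℕ) × Bool, ∀ h a b l, l < K → (addE K h a b r.1).1 l = r.1 l :=
    fun r h a b l hl => addE_low hl
  have hfr := fun l (hl : l < K) => addE_freshen_low (B := B) (g := g) (f := f) (y := y) hl
  refine ⟨fun h1 h2 => ?_, fun h1 h2 => ?_, fun h1 => ?_, fun h1 => ?_, fun h1 h2 h3 => ?_,
    fun h1 h2 h3 h4 h5 => ?_⟩
  · unfold mergeCore; split_ifs
    · rfl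
    · grind
    · grind
    · simp only [mergeLive, update_apply]; grind
    · rfl
  · unfold mergeCore; rw [if_neg h1, if_pos h2]; grind
  · have h1 : MergeOk x y g f := h1.elim mergeOk_of_mergeCore id; unfold mergeCore
    split_ifs with e1 e2 e3 e4
    · exact e1
    · simp
    · simp
    · simp [mergeLive]
    · rcases h1 with h | h | h | h; all_goals grind
  · unfold mergeCore; rw [if_pos h1]
  · unfold mergeCore; rw [if_neg h1, if_neg h2, if_pos h3]; simp [hxy.symm]
  · unfold mergeCore; rw [if_neg h1, if_neg h2, if_neg (by omega), if_pos ⟨by omega, h4, h5⟩]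
    simp [mergeLive, hxy.symm]

theorem Links.Lifts.ids {Ω : Type*} {K : ℕ} {W1 W' : Links Ω} {F φ φ'}
    (hL : Links.Lifts W1 W' F φ) (hL' : Links.Lifts W' W1 id φ') {τ τ' : ℕ → Ω → Prop}
    (hI : Ids K W1 τ f) (hτ : ∀ l a, τ' l a → τ l a ∧ W'.blob (F a) a) : Ids K W' τ' f := by
  intro l m a b ha hb; obtain ⟨ha', hax⟩ := hτ l a ha; obtain ⟨hb', hbx⟩ := hτ m b hb
  have e := hL.conn_iff hL' (x := a) (y := b) hax hbx; rw [e.1, e.2]; exact hI l m a b ha' hb'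

/-- Merging of two nonempty labels, nothing being promised to the result. -/
theorem Represents.dead {f' : ℕ → ℕ} {x y : ℕ} (hR : Represents S n H f) (hxy : x ≠ y)
    (hxn : x < n) (hyn : y < n) (hdis : ∀ u, H.lab u x → ¬ H.lab u y)
    (hx0 : f x ≠ 0) (hy0 : f y ≠ 0) (hx3 : f x ≤ 3) (hy3 : f y ≤ 3)
    (hoff : ∀ l, l ≠ x → l ≠ y → f' l = f l)
    (hx : f' x = 0) (hy : f' y = 3) : Represents S n (H.rename x y) f' := by
  obtain ⟨g1, g2, g3⟩ := hR
  obtain ⟨⟨φ, hL⟩, ⟨φ', hL'⟩⟩ := merge_quiet_lifts (S := S) (H := H) (st := f) (st' := f')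
    (W1 := zlinks S H f) hxy hdis (.inr rfl) (.inr ⟨hx3, hy3, hy.le⟩)
    (fun l e1 e2 => hoff l e1 e2)
  refine ⟨fun l hl => ?_, hL'.good g2, ?_⟩
  · by_cases e1 : l = x
    · subst e1; rw [hx]; exact fits_rename_zero hxy
    · by_cases e2 : l = y
      · subst e2; rw [hy]
        exact fits_union hxy le_rfl (by omega) hdis ((g1 _ hxn).nonempty hx0)
          ((g1 _ hyn).nonempty hy0) (by omega) (by omega)
      · rw [hoff l e1 e2, fits_rename hxy e1 e2]; exact g1 l hl
  · have hI := hL.ids hL' (τ' := term n (H.rename x y) f') g3 fun l a h => by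
      have hlx : l ≠ x := by
        rintro rfl; rcases a with u | m
        all_goals have := h.2.1; omega
      have hly : l ≠ y := by
        rintro rfl; rcases a with u | m
        · have := h.2.1; omega
        · obtain ⟨-, e1, e2, rfl⟩ := h; omega
      have hne : a ≠ inr x := by rintro rfl; exact hlx (term_of_inr h).symm
      exact ⟨term_rename hxy hlx hly (hoff l hlx hly) h, by simpa [hne] using .refl _⟩
    refine hI.congr (fun l m a b ha hb => ?_) (fun l m a b ha hb => ?_) <;>
    grind

/-- Merging of two nonempty labels with a promised neighbour. -/
theorem mergeLive_spec {B x y g : ℕ} (hHn : ∀ v l, H.lab v l → l < n) (hxy : x ≠ y)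
    (hxn : x < n) (hyn : y < n) (hdis : ∀ u, H.lab u x → ¬ H.lab u y)
    (hR : Represents S n H f) (hB : ∀ a, a < 3 * (n + 1) → f a < B) (hx0 : f x ≠ 0) (hy0 : f y ≠ 0)
    (hg : g = 1 ∨ g = 2) (hax : Allowed g (f x)) (hay : Allowed g (f y)) {r : (ℕ → ℕ) × Bool}
    (hr : r = mergeLive (n + 1) B x y g f) :
    (r.2 = true ↔ (zlinks S (H.rename x y) r.1).Good) ∧
      (r.2 = true → Represents S n (H.rename x y) r.1) := by
  obtain ⟨X, hX⟩ := exists_term hxn (hR.1 x hxn) hx0 hax.ne_three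
  obtain ⟨Y, hY⟩ := exists_term hyn (hR.1 y hyn) hy0 hay.ne_three
  obtain ⟨W0, hW0⟩ : ∃ W0, W0 = if f y ≤ 2 then (zlinks S H f).add (hardOf g (f y)) Y (inr y)
    else zlinks S H f := ⟨_, rfl⟩
  obtain ⟨W1, hW1⟩ : ∃ W1, W1 = W0.add (hardOf g (f x)) X (inr y) := ⟨_, rfl⟩
  obtain ⟨r1, hr1⟩ : ∃ r1, r1 = if f y ≤ 2 then
    addE (n + 1) (hardOf g (f y)) (n + 1 - 1) y (freshen (n + 1) B y f) else (f, true) := ⟨_, rfl⟩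
  obtain ⟨r2, hr2⟩ : ∃ r2, r2 = addE (n + 1) (hardOf g (f x)) x y r1.1 := ⟨_, rfl⟩
  obtain ⟨τ, hτ, hτy, hττ, hgood0, hI0, hok1⟩ := freshen_ids hyn hR hB hY hW0 hr1
  obtain ⟨hadd1, hadd2⟩ := hI0.addE hτ (h := hardOf g (f x)) (hττ x X hxy hX) hτy
  rw [← hr2] at hadd1 hadd2
  have hst := fun l (hl : l < n + 1) => mergeCore_status (f := f) (B := B) (g := g)
    (by omega : y < n + 1) hxy hl
  have hcore : mergeCore (n + 1) B x y g f = r := by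
    rw [mergeCore, if_neg hx0, if_neg hy0, if_neg (by omega), if_pos ⟨by omega, hax, hay⟩, hr]
  rw [hcore] at hst; have hry := (hst y (by omega)).2.2.2.2.2 hx0 hy0 hg hax hay
  have hrx := (hst x (by omega)).2.2.1 (.inr (.inr (.inr (.inr ⟨hg, hax, hay⟩))))
  have hr' : r = (update (update r2.1 y (if g = 2 then 6 else
      if (f x = 2 ∨ f x = 4) ∧ (f y = 2 ∨ f y = 4) then 4 else 5)) x 0, r1.2 && r2.2) := by
    rw [hr, mergeLive, hr2, hr1]
  have hr2' : r.2 = r2.2 := by rw [hr', hok1]; simp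
  have hH : ∀ l, l ≠ x → l ≠ y → l < n → r.1 l = f l := fun l e1 e2 hl => (hst l (by omega)).1 e1 e2
  set st' : ℕ → ℕ := fun l => if l = x ∨ l = y then r.1 l else f l with hst'
  have hste : ∀ l, l < n → r.1 l = st' l := by grind
  have hHr : ∀ v l, (H.rename x y).lab v l → l < n := by
    intro v l h; obtain ⟨-, h | ⟨rfl, -⟩⟩ := (rename_lab hxy v l).1 h
    · exact hHn v l h
    · exact hyn
  have hy' : st' y = r.1 y := by simp [hst']
  have hgy : g = 1 ∧ (st' y = 4 ∨ st' y = 5) ∨ g = 2 ∧ st' y = 6 := by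
    rw [hy', hry]; split_ifs <;> omega
  have hlifts := merge_lifts hxy hdis (hR.1 x hxn) (hR.1 y hyn) hax hay hgy
    (fun l e1 e2 => by simp [hst', e1, e2]) hX hY hW0 hW1
  obtain ⟨⟨φ, hL⟩, ⟨φ', hL'⟩⟩ := hlifts; rw [zlinks_congr hHr hste, hr2']
  have hXne : X ≠ inr y := by rintro rfl; exact hxy (term_of_inr hX).symm
  have hXY : X ≠ Y := by
    rintro rfl; rcases X with u | m
    · exact hdis u hX.2.2 hY.2.2
    · exact hxy ((term_of_inr hX).symm.trans (term_of_inr hY))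
  have hnothard : hardOf g (f x) = true → ¬ W0.hard X (inr y) ∧ ¬ W0.hard (inr y) X := by
    intro hh
    have hx2 : f x ≤ 2 := by by_contra hc; rw [hardOf_of_le (by omega)] at hh; simp at hh
    rcases X with u | m
    · have h1 : ¬ (zlinks S H f).hard (inl u) (inr y) := fun h => hdis u hX.2.2 h.1
      have h2 : ¬ (zlinks S H f).hard (inr y) (inl u) := id
      rw [hW0]; split_ifs with h
      · simp [Links.add, h1, h2, hXY]
      · exact ⟨h1, h2⟩
    · have := hX.2.1; omega
  have hgood : W1.Good ↔ r2.2 = true := by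
    rw [hadd1, hW1]; exact ⟨fun h => h.canAdd hnothard, hgood0.add⟩
  refine ⟨⟨fun h => hL'.good (hgood.2 h), fun h => hgood.1 (hL.good h)⟩, fun h => ⟨fun l hl => ?_, ?_, ?_⟩⟩
  · by_cases e1 : l = x
    · subst e1; rw [hrx]; exact fits_rename_zero hxy
    · by_cases e2 : l = y
      · subst e2; have havx := hR.1 x hxn; have havy := hR.1 _ hyn; rw [← hy']
        refine fits_union hxy (by omega) (by omega) hdis (havx.nonempty hx0)
          (havy.nonempty hy0) (fun h4 v hv => ?_) (fun h5 => ?_)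
        · have h4' : (f x = 2 ∨ f x = 4) ∧ (f l = 2 ∨ f l = 4) := by grind
          have n6 : f x ≠ 6 ∧ f l ≠ 6 := by omega
          rcases hv with hv | hv
          · exact (havx.avoids_iff hx0 hax.ne_three n6.1).1 h4'.1 v hv
          · exact (havy.avoids_iff hy0 hay.ne_three n6.2).1 h4'.2 v hv
        · have hg1 : g = 1 := by omega
          have h4' : ¬ ((f x = 2 ∨ f x = 4) ∧ (f l = 2 ∨ f l = 4)) := by grind
          have n6 : f x ≠ 6 ∧ f l ≠ 6 := by unfold Allowed at hax hay; omega
          rw [havx.avoids_iff hx0 hax.ne_three n6.1, havy.avoids_iff hy0 hay.ne_three n6.2] at h4'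
          grind
      · rw [hH l e1 e2 hl, fits_rename hxy e1 e2]; exact hR.1 l hl
  · rw [zlinks_congr hHr hste]; exact hL'.good (hgood.2 h)
  · rw [zlinks_congr hHr hste, term_congr hste]
    have hI := hL.ids hL' (τ' := term n (H.rename x y) st') (hW1 ▸ hadd2 h) fun l a h => by
      have hlx : l ≠ x := by
        rintro rfl; have : st' l = 0 := by rw [← hste l hxn, hrx]
        rcases a with u | m
        all_goals have := h.2.1; omega
      refine ⟨?_, ?_⟩
      · by_cases hly : l = y
        · subst hly; rcases a with u | m
          · have := h.2.1; omega
          · rw [term_of_inr h]; exact hτy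
        · exact hττ l a hly (term_rename hxy hlx hly (by simp [hst', hlx, hly]) h)
      · have hne : a ≠ inr x := by rintro rfl; exact hlx (term_of_inr h).symm
        simpa [hne] using .refl _
    refine hI.congr (fun l m a b ha hb => ?_) (fun l m a b ha hb => ?_) <;>
    · rw [hr']; simp only [update_apply]
      rw [if_neg (by omega), if_neg (by omega), if_neg (by omega), if_neg (by omega)]

/-- If the statuses admit the promise `g`, then `mergeCore` succeeds exactly if the renamed graph has
no cycle through a hard edge, and then it computes the state of this graph. -/
theorem mergeCore_spec {B x y g : ℕ} (hHn : ∀ v l, H.lab v l → l < n) (hxy : x ≠ y) (hxn : x < n)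
    (hyn : y < n) (hdis : ∀ u, H.lab u x → ¬ H.lab u y)
    (hR : Represents S n H f) (hB : ∀ a, a < 3 * (n + 1) → f a < B) (hok : MergeOk x y g f) :
    ((mergeCore (n + 1) B x y g f).2 = true ↔
      (zlinks S (H.rename x y) (mergeCore (n + 1) B x y g f).1).Good) ∧
      ((mergeCore (n + 1) B x y g f).2 = true →
        Represents S n (H.rename x y) (mergeCore (n + 1) B x y g f).1) := by
  have aux : ∀ r : (ℕ → ℕ) × Bool, r.2 = true → Represents S n (H.rename x y) r.1 →
      (r.2 = true ↔ (zlinks S (H.rename x y) r.1).Good) ∧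
      (r.2 = true → Represents S n (H.rename x y) r.1) :=
    fun r h1 h2 => ⟨iff_of_true h1 h2.2.1, fun _ => h2⟩
  by_cases h1 : f x = 0
  · rw [mergeCore, if_pos h1]; refine aux _ rfl ?_
    rw [rename_of_empty hxy (by have := hR.1 x hxn; rwa [h1] at this)]; exact hR
  · by_cases h2 : f y = 0
    · rw [mergeCore, if_neg h1, if_pos h2]
      refine aux _ rfl (hR.move hxy hxn hyn h2 (fun l e1 e2 hl => ?_) ?_ ?_ (fun l hl => ?_)
        (fun l hl => ?_) hHn) <;> simp only [update_apply]
      all_goals grind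
    · rcases hok with h | h | h | h
      · exact absurd h h1
      · exact absurd h h2
      · rw [mergeCore, if_neg h1, if_neg h2, if_pos h.1]
        refine aux _ (by simpa using h.2) (hR.dead hxy hxn hyn hdis h1 h2 h.2.1 h.2.2
          (fun l e1 e2 => ?_) ?_ ?_) <;> simp only [update_apply]
        all_goals grind
      · rw [mergeCore, if_neg h1, if_neg h2, if_neg (by omega), if_pos ⟨by omega, h.2⟩]
        exact mergeLive_spec hHn hxy hxn hyn hdis hR hB h1 h2 h.1 h.2.1 h.2.2 rfl

end

section

variable {V : Type*} {S : V → Prop} {H : LGraph V} {st st' f : ℕ → ℕ} {n : ℕ}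

/-- Every nonempty label has a status that admits a given promise. -/
theorem exists_fits (S : V → Prop) {C : V → Prop} (hC : ∃ v, C v) {g : ℕ} (hg : g ≤ 2) :
    ∃ s, Fits S C s ∧ s ≠ 0 ∧ (g = 0 → s ≤ 3) ∧ (g = 1 ∨ g = 2 → Allowed g s) := by
  obtain ⟨v, hv⟩ := hC; by_cases h1 : ∀ u, C u → u = v
  · have h1' : ∀ u, C u ↔ u = v := fun u => ⟨h1 u, fun h => h ▸ hv⟩
    by_cases hS : S v
    · exact ⟨1, ⟨v, hS, h1'⟩, by omega, by omega, fun _ => .inl (by omega)⟩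
    · exact ⟨2, ⟨v, hS, h1'⟩, by omega, by omega, fun _ => .inl (by omega)⟩
  · push Not at h1
    obtain ⟨u, hu, huv⟩ := h1; have hM : Many C := ⟨u, v, huv, hu, hv⟩
    obtain rfl | rfl | rfl : g = 0 ∨ g = 1 ∨ g = 2 := by omega
    · exact ⟨3, hM, by omega, by omega, by omega⟩
    · by_cases hS : ∀ w, C w → ¬ S w
      · exact ⟨4, ⟨hM, hS⟩, by omega, by omega, fun _ => by unfold Allowed; omega⟩
      · push Not at hS
        exact ⟨5, ⟨hM, hS⟩, by omega, by omega, fun _ => by unfold Allowed; omega⟩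
    · exact ⟨6, hM, by omega, by omega, fun _ => by unfold Allowed; omega⟩

/-- Every choice of promises after a renaming comes from some choice before it and some guess `g`. -/
theorem exists_premerge {x y : ℕ} (hxy : x ≠ y) (hxn : x < n)
    (hyn : y < n) (hdis : ∀ u, H.lab u x → ¬ H.lab u y)
    (hF : ∀ l, l < n → Fits S ((H.rename x y).lab · l) (st' l))
    (hG : (zlinks S (H.rename x y) st').Good) :
    ∃ st g, g < 4 ∧ (∀ l, l < n → Fits S (H.lab · l) (st l)) ∧ (zlinks S H st).Good ∧
      (∀ l, l ≠ x → l ≠ y → st l = st' l) ∧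
      (st' y = 6 → ∀ l, l = x ∨ l = y → st l ≤ 2 ∨ st l = 6) ∧
      ∀ f : ℕ → ℕ, (∀ l, l < n → f l = st l) → MergeOk x y g f ∧
        ∀ B l, l < n → (mergeCore (n + 1) B x y g f).1 l = st' l := by
  have hx' : st' x = 0 := (hF x hxn).eq_zero (fits_rename_zero (S := S) hxy)
  by_cases hx : ∃ v, H.lab v x
  · have hlab : ∀ u, (H.rename x y).lab u y ↔ H.lab u x ∨ H.lab u y := by
      intro u; rw [rename_lab hxy]; simp [hxy.symm, or_comm]
    by_cases hy : ∃ v, H.lab v y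
    · have hM : Many ((H.rename x y).lab · y) := by
        obtain ⟨p, hp⟩ := hx; obtain ⟨q, hq⟩ := hy
        exact ⟨p, q, fun h => hdis p hp (h ▸ hq), (hlab p).2 (.inl hp), (hlab q).2 (.inr hq)⟩
      have h3 : 3 ≤ st' y := by
        by_contra h
        have h0 : st' y ≠ 0 := by
          intro h0; obtain ⟨p, -, -, hp, -⟩ := hM; have := hF y hyn; rw [h0] at this
          exact this p hp
        obtain ⟨v, hv, -⟩ := (hF y hyn).single h0 (by omega); grind
      have h6 := (hF y hyn).le
      obtain ⟨g, hg⟩ : ∃ g, g = if st' y = 3 then 0 else if st' y = 6 then 2 else 1 := ⟨_, rfl⟩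
      have hg' : g = 0 ∧ st' y = 3 ∨ g = 1 ∧ (st' y = 4 ∨ st' y = 5) ∨ g = 2 ∧ st' y = 6 := by
        rw [hg]; split_ifs <;> omega
      clear hg; obtain ⟨s, hs1, hs2, hs3, hs4⟩ := exists_fits S hx (g := g) (by omega)
      obtain ⟨t, ht1, ht2, ht3, ht4⟩ := exists_fits S hy (g := g) (by omega)
      set st : ℕ → ℕ := fun l => if l = x then s else if l = y then t else st' l with hst
      have hsx : st x = s := by simp [hst]
      have hsy : st y = t := by simp [hst, hxy.symm]
      have hso : ∀ l, l ≠ x → l ≠ y → st l = st' l := fun l h1 h2 => by simp [hst, h1, h2]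
      have hfits : ∀ l, l < n → Fits S (H.lab · l) (st l) := by
        intro l hl; by_cases h1 : l = x
        · subst h1; rwa [hsx]
        · by_cases h2 : l = y
          · subst h2; rwa [hsy]
          · rw [hso l h1 h2, ← fits_rename hxy h1 h2]; exact hF l hl
      refine ⟨st, g, by omega, hfits, ?_, hso, ?_, fun f hf => ?_⟩
      · rcases Nat.eq_zero_or_pos g with h0 | h0
        · obtain ⟨⟨φ, hL⟩, -⟩ := merge_quiet_lifts (S := S) (H := H) (st := st) (st' := st')
            (W1 := zlinks S H st) hxy hdis (.inr rfl)
            (.inr ⟨by rw [hsx]; exact hs3 h0, by rw [hsy]; exact ht3 h0, by omega⟩)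
            (fun l e1 e2 => (hso l e1 e2).symm)
          exact hL.good hG
        · have hax := hs4 (by omega); have hay := ht4 (by omega); rw [← hsx] at hax hs2
          rw [← hsy] at hay ht2; obtain ⟨X, hX⟩ := exists_term hxn (hfits x hxn) hs2 hax.ne_three
          obtain ⟨Y, hY⟩ := exists_term hyn (hfits y hyn) ht2 hay.ne_three
          obtain ⟨⟨φ, hL⟩, -⟩ := merge_lifts hxy hdis (hfits x hxn) (hfits y hyn) hax hay
            (st' := st') (by omega) (fun l e1 e2 => (hso l e1 e2).symm) hX hY rfl rfl
          have h1 := (hL.good hG).of_add; split_ifs at h1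
          · exact h1.of_add
          · exact h1
      · rintro h l (rfl | rfl)
        · have := hs4 (by omega); unfold Allowed at this; omega
        · have := ht4 (by omega); unfold Allowed at this; omega
      · have hfx : f x = s := (hf x hxn).trans hsx; have hfy : f y = t := (hf y hyn).trans hsy
        have hok : MergeOk x y g f := by
          rcases Nat.eq_zero_or_pos g with h0 | h0
          · exact .inr (.inr (.inl ⟨h0, by rw [hfx]; exact hs3 h0, by rw [hfy]; exact ht3 h0⟩))
          · exact .inr (.inr (.inr ⟨by omega, by rw [hfx]; exact hs4 (by omega),
              by rw [hfy]; exact ht4 (by omega)⟩))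
        refine ⟨hok, fun B l hl => ?_⟩
        obtain ⟨c1, c2, c3, c4, c5, c6⟩ := mergeCore_status (f := f) (B := B) (g := g) (l := l)
          (by omega : y < n + 1) hxy (by omega)
        by_cases h1 : l = x
        · subst h1; rw [c3 (.inr hok), hx']
        · by_cases h2 : l = y
          · subst h2; rcases hg' with ⟨h0, h⟩ | ⟨h0, h⟩ | ⟨h0, h⟩
            · rw [c5 (by omega) (by omega) h0, h]
            · have hax := hs4 (by omega); have hay := ht4 (by omega)
              rw [c6 (by omega) (by omega) (by omega) (by rwa [hfx]) (by rwa [hfy]),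
                if_neg (by omega), hfx, hfy]
              have es := hs1.avoids_iff hs2 hax.ne_three (by unfold Allowed at hax; omega)
              have et := ht1.avoids_iff ht2 hay.ne_three (by unfold Allowed at hay; omega)
              have hl4 := (hF l hl).avoids_iff (by omega) (by omega) (by omega); grind
            · grind
          · rw [c1 h1 h2, hf l hl, hso l h1 h2]
    · push Not at hy
      set st : ℕ → ℕ := fun l => if l = x then st' y else if l = y then 0 else st' l with hst
      have hsx : st x = st' y := by simp [hst]
      have hsy : st y = 0 := by simp [hst, hxy.symm]
      have hso : ∀ l, l ≠ x → l ≠ y → st l = st' l := fun l h1 h2 => by simp [hst, h1, h2]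
      have hfits : ∀ l, l < n → Fits S (H.lab · l) (st l) := by
        intro l hl; by_cases h1 : l = x
        · grind
        · by_cases h2 : l = y
          · subst h2; rw [hsy]; exact hy
          · rw [hso l h1 h2, ← fits_rename hxy h1 h2]; exact hF l hl
      refine ⟨st, 0, by omega, hfits, ?_, hso, ?_, fun f hf => ?_⟩
      · obtain ⟨⟨φ, hL⟩, -⟩ := merge_quiet_lifts (S := S) (H := H) (st := st) (st' := st') hxy hdis
          (.inl rfl) (.inl ⟨rfl, hsx.symm, hy, hsy⟩)
          (fun l e1 e2 => (hso l e1 e2).symm)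
        exact (hL.good hG).of_add
      · rintro h l (rfl | rfl) <;> omega
      · have hfx : f x = st' y := (hf x hxn).trans hsx; have hfy : f y = 0 := (hf y hyn).trans hsy
        have hok : MergeOk x y 0 f := .inr (.inl hfy); refine ⟨hok, fun B l hl => ?_⟩
        obtain ⟨c1, c2, c3, c4, c5, c6⟩ := mergeCore_status (f := f) (B := B) (g := 0) (l := l)
          (by omega : y < n + 1) hxy (by omega)
        grind
  · push Not at hx
    have hr := rename_of_empty hxy hx; rw [hr] at hF hG
    refine ⟨st', 0, by omega, hF, hG, fun _ _ _ => rfl, ?_, fun f hf => ?_⟩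
    · rintro h l (rfl | rfl) <;> omega
    have h0 : f x = 0 := (hf x hxn).trans hx'; refine ⟨.inl h0, fun B l hl => ?_⟩
    rw [mergeCore, if_pos h0]; exact hf l hl

end

/-! ### Joining two labels -/

/-- Does `joinF` support a join of nonempty labels with the statuses `s` and `t`? -/
def Joinable (s t : ℕ) : Prop :=
  (s ≤ 2 ∧ t ≤ 2) ∨ (s = 2 ∧ (t = 4 ∨ t = 5)) ∨ (t = 2 ∧ (s = 4 ∨ s = 5)) ∨ (s = 4 ∧ t = 4) ∨
    (s = 1 ∧ t = 6) ∨ (s = 6 ∧ t = 1)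

instance (s t : ℕ) : Decidable (Joinable s t) := inferInstanceAs (Decidable (_ ∨ _))

/-- The status of a label after a join; the promise to a label of status `4` is kept if `b = 1`. -/
def joined (s b : ℕ) : ℕ := if s ≤ 3 then s else if s = 4 ∧ b = 1 then 4 else 3

/-- The effect on an array of the join of the labels `i` and `j`. -/
def joinF (K i j g : ℕ) (f : ℕ → ℕ) : (ℕ → ℕ) × Bool :=
  if f i = 0 ∨ f j = 0 then (f, true)
  else if Joinable (f i) (f j) then
    let r := addE K (decide (f i ≤ 2 ∧ f j ≤ 2 ∧ (f i = 1 ∨ f j = 1))) i j f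
    (update (update r.1 i (joined (f i) (g % 2))) j (joined (f j) (g / 2)), r.2)
  else (f, false)

theorem Links.add_swap {Ω : Type*} {W : Links Ω} {h : Prop} {x y : Ω} :
    W.add h x y = W.add h y x := by
  unfold Links.add; rw [Sym2.eq_swap]

section

variable {V : Type*} {S : V → Prop} {H : LGraph V} {st st' f : ℕ → ℕ} {n : ℕ}

theorem joinF_ok {K i j g : ℕ} (h : (joinF K i j g f).2 = true) :
    f i = 0 ∨ f j = 0 ∨ Joinable (f i) (f j) := by
  unfold joinF at h; split_ifs at h with h1 h2
  all_goals tauto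

theorem joinF_status {K i j g l : ℕ} (hl : l < K) (hij : i ≠ j)
    (h : f i ≠ 0 ∧ f j ≠ 0 → Joinable (f i) (f j)) :
    (joinF K i j g f).1 l = if f i = 0 ∨ f j = 0 then f l else if l = i then joined (f i) (g % 2)
      else if l = j then joined (f j) (g / 2) else f l := by
  unfold joinF; by_cases h1 : f i = 0 ∨ f j = 0
  · rw [if_pos h1, if_pos h1]
  · rw [if_neg h1, if_neg h1, if_pos (h (by tauto))]; simp only [update_apply, addE_low hl]; grind

theorem joinF_lt {K B i j g : ℕ} (hi : i < K) (hj : j < K) (hB : 7 ≤ B) (hf : ∀ a, a < 3 * K → f a < B) :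
    ∀ a, a < 3 * K → (joinF K i j g f).1 a < B := by
  have hs : ∀ a b, a < B → joined a b < B := by intro a b h; unfold joined; split_ifs <;> omega
  unfold joinF; split_ifs
  · exact hf
  · exact update_lt (update_lt (addE_lt hj hf) (hs _ _ (hf i (by omega)))) (hs _ _ (hf j (by omega)))
  · exact hf

theorem join_of_empty {i j : ℕ} (h : (∀ v, ¬ H.lab v i) ∨ ∀ v, ¬ H.lab v j) : H.join i j = H := by
  have : (H.join i j).adj = H.adj := by funext u v; simp only [LGraph.join]; grind
  cases H; exact congrArg (fun adj => LGraph.mk _ adj) this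

/-- The join of two single vertices adds one edge. -/
theorem zlinks_join_single {i j : ℕ} {u v : V} (hi : ∀ w, H.lab w i ↔ w = u)
    (hj : ∀ w, H.lab w j ↔ w = v) :
    zlinks S (H.join i j) st = (zlinks S H st).add (S u ∨ S v) (inl u) (inl v) := by
  simp only [zlinks, Links.add, LGraph.join, hi, hj, Links.mk.injEq]
  constructor <;> funext a b <;> rcases a with a | l <;> rcases b with b | m <;>
    simp only [Sym2.eq_iff, inl.injEq, reduceCtorEq, and_false, false_and, or_self, or_false,
      eq_iff_iff]
  all_goals grind

theorem term_join {i j l : ℕ} {a : V ⊕ ℕ} (h : st' l = st l ∨ st' l = 3)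
    (ha : term n (H.join i j) st' l a) : term n H st l a := by
  rcases a with u | m
  · obtain ⟨e1, e2, e3⟩ := ha; exact ⟨e1, by omega, e3⟩
  · obtain ⟨e1, e2, e3, rfl⟩ := ha; exact ⟨e1, by omega, by omega, rfl⟩

theorem exists_term_cases {l : ℕ} (hl : l < n) (h : Fits S (H.lab · l) (st l)) (h0 : st l ≠ 0) :
    (∃ v, (∀ u, H.lab u l ↔ u = v) ∧ term n H st l (.inl v) ∧ (st l = 1 ∧ S v ∨ st l = 2 ∧ ¬ S v)) ∨
      3 ≤ st l ∧ st l ≤ 6 ∧ (4 ≤ st l → term n H st l (.inr l)) := by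
  by_cases h2 : st l ≤ 2
  · obtain ⟨v, hv, hS⟩ := h.single h0 h2; exact .inl ⟨v, hv, ⟨hl, by omega, (hv v).2 rfl⟩, hS⟩
  · exact .inr ⟨by omega, h.le, fun h4 => ⟨hl, h4, h.le, rfl⟩⟩

/-- A label with one vertex is joined to a label with several vertices.  If the latter keeps a promise,
its promised neighbour stays in the blob of the single vertex, because no vertex involved is in `S`. -/
theorem join_lifts_mixed {i j : ℕ} {u : V} (hu : ∀ w, H.lab w i ↔ w = u)
    (hne : ∀ u w, H.lab u i → H.lab w j → ¬ H.adj u w) (hsymm : ∀ u w, H.adj u w → H.adj w u)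
    (hSu : st i = 1 ∧ S u ∨ st i = 2 ∧ ¬ S u) (hfj : Fits S (H.lab · j) (st j)) (hj4 : 4 ≤ st j)
    (hJ : Joinable (st i) (st j)) (hoff : ∀ l, l ≠ j → st' l = st l)
    (hj : st' j = 3 ∨ st' j = 4 ∧ st j = 4)
    (hterm : ∀ l a, term n (H.join i j) st' l a → term n H st l a) :
    ∃ F φ φ', Links.Lifts ((zlinks S H st).add False (inl u) (inr j)) (zlinks S (H.join i j) st') F φ ∧
      Links.Lifts (zlinks S (H.join i j) st') ((zlinks S H st).add False (inl u) (inr j)) id φ' ∧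
      ∀ l a, term n (H.join i j) st' l a → term n H st l a ∧
        (zlinks S (H.join i j) st').blob (F a) a := by
  unfold Joinable at hJ
  obtain ⟨⟨φ, hL⟩, ⟨φ', hL'⟩⟩ := join_lifts_single (S := S) (st := st) (st' := st') hu hne hsymm
    (by rcases hSu with h | h
        · exact .inr ⟨h.2, by omega⟩
        · exact .inl ⟨h.2, by omega⟩)
    (fun h4 => by rw [h4] at hfj; exact hfj.2) hoff hj
  refine ⟨_, φ, φ', hL, hL', fun l a h => ⟨hterm l a h, ?_⟩⟩; split_ifs with ha
  · subst ha; obtain rfl := term_of_inr h; have h4 := h.2.1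
    have h44 : st' j = 4 ∧ st j = 4 := by omega
    obtain ⟨w, hw⟩ := hfj.nonempty (by omega); rw [h44.2] at hfj; have hw' := hfj.2 w hw
    have hSu' : ¬ S u := by
      rcases hSu with h | h
      · omega
      · exact h.2
    exact EqvGen.trans _ (inl w) _ (.rel _ _ ⟨.inr (.inl ⟨(hu u).2 rfl, hw⟩), hSu', hw'⟩)
      (.rel _ _ ⟨hw, hw', .inl h44.1⟩)
  · exact .refl _

/-- The links after a join arise by the insertion of one edge between two terminals, up to
identification of points of the same blob. -/
theorem join_lifts {i j : ℕ} (hin : i < n) (hjn : j < n) (hij : i ≠ j)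
    (hne : ∀ u w, H.lab u i → H.lab w j → ¬ H.adj u w) (hsymm : ∀ u w, H.adj u w → H.adj w u)
    (hfi : Fits S (H.lab · i) (st i)) (hfj : Fits S (H.lab · j) (st j))
    (hi0 : st i ≠ 0) (hj0 : st j ≠ 0) (hJ : Joinable (st i) (st j))
    (hoff : ∀ l, l ≠ i → l ≠ j → st' l = st l)
    (hi : st i ≤ 2 ∧ st' i = st i ∨ 4 ≤ st i ∧ (st' i = 3 ∨ st' i = 4 ∧ st i = 4))
    (hj : st j ≤ 2 ∧ st' j = st j ∨ 4 ≤ st j ∧ (st' j = 3 ∨ st' j = 4 ∧ st j = 4)) :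
    ∃ X Y, term n H st i X ∧ term n H st j Y ∧ ((st i ≤ 2 ∧ st j ≤ 2 ∧ (st i = 1 ∨ st j = 1)) →
        ¬ (zlinks S H st).hard X Y ∧ ¬ (zlinks S H st).hard Y X) ∧
      ∃ F φ φ', Links.Lifts ((zlinks S H st).add
        (st i ≤ 2 ∧ st j ≤ 2 ∧ (st i = 1 ∨ st j = 1)) X Y) (zlinks S (H.join i j) st') F φ ∧
      Links.Lifts (zlinks S (H.join i j) st') ((zlinks S H st).add
        (st i ≤ 2 ∧ st j ≤ 2 ∧ (st i = 1 ∨ st j = 1)) X Y) id φ' ∧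
      ∀ l a, term n (H.join i j) st' l a → term n H st l a ∧
        (zlinks S (H.join i j) st').blob (F a) a := by
  have hterm : ∀ l a, term n (H.join i j) st' l a → term n H st l a := by
    refine fun l a => term_join ?_; grind
  rcases exists_term_cases hin hfi hi0 with ⟨u, hu, htu, hSu⟩ | ⟨hi3, hi6, htu⟩ <;>
    rcases exists_term_cases hjn hfj hj0 with ⟨v, hv, htv, hSv⟩ | ⟨hj3, hj6, htv⟩
  · refine ⟨_, _, htu, htv, fun _ => ⟨fun h => hne _ _ ((hu u).2 rfl) ((hv v).2 rfl) h.1,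
      fun h => hne _ _ ((hu u).2 rfl) ((hv v).2 rfl) (hsymm _ _ h.1)⟩, ?_⟩
    have e : st' = st := by grind
    have hS : (st i ≤ 2 ∧ st j ≤ 2 ∧ (st i = 1 ∨ st j = 1)) ↔ S u ∨ S v := by grind
    rw [e, zlinks_join_single hu hv, hS]
    refine ⟨id, fun a b => (a, b), fun a b => (a, b), ⟨fun a b h => .rel _ _ h,
      fun a b h => ⟨.inl h, .refl _, .refl _⟩, fun _ _ _ _ _ _ h => h⟩, ⟨fun a b h => .rel _ _ h,
      fun a b h => ⟨.inl h, .refl _, .refl _⟩, fun _ _ _ _ _ _ h => h⟩, fun l a h =>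
      ⟨hterm l a (e ▸ h), .refl _⟩⟩
  · have hj4 : 4 ≤ st j := by unfold Joinable at hJ; omega
    refine ⟨_, _, htu, htv hj4, fun h => by omega, ?_⟩
    have hF : ¬ (st i ≤ 2 ∧ st j ≤ 2 ∧ (st i = 1 ∨ st j = 1)) := by omega
    simp only [hF]; exact join_lifts_mixed hu hne hsymm hSu hfj hj4 hJ (by grind) (by omega) hterm
  · have hi4 : 4 ≤ st i := by unfold Joinable at hJ; omega
    refine ⟨_, _, htu hi4, htv, fun h => by omega, ?_⟩
    have hF : ¬ (st i ≤ 2 ∧ st j ≤ 2 ∧ (st i = 1 ∨ st j = 1)) := by omega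
    simp only [hF]; rw [LGraph.join_comm, Links.add_swap]; rw [LGraph.join_comm] at hterm
    exact join_lifts_mixed hv (fun u w h1 h2 h3 => hne w u h2 h1 (hsymm _ _ h3)) hsymm hSv hfi hi4
      (by unfold Joinable at hJ ⊢; omega) (by grind) (by omega) hterm
  · have h4 : st i = 4 ∧ st j = 4 := by unfold Joinable at hJ; omega
    refine ⟨_, _, htu h4.1.ge, htv h4.2.ge, fun h => by omega, ?_⟩
    have hF : ¬ (st i ≤ 2 ∧ st j ≤ 2 ∧ (st i = 1 ∨ st j = 1)) := by omega
    simp only [hF]; obtain ⟨p, hp⟩ := hfi.nonempty hi0; obtain ⟨q, hq⟩ := hfj.nonempty hj0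
    rw [h4.1] at hfi; rw [h4.2] at hfj
    obtain ⟨⟨φ, hL⟩, ⟨φ', hL'⟩⟩ := join_lifts_many (S := S) hp hq hfi.2 hfj.2 hij h4.1 h4.2 hoff
      (by omega) (by omega)
    refine ⟨_, φ, φ', hL, hL', fun l a h => ⟨hterm l a h, ?_⟩⟩; have hpS := hfi.2 p hp
    have hqS := hfj.2 q hq; split_ifs with ha ha'
    · subst ha; obtain rfl := term_of_inr h; have := h.2.1
      exact EqvGen.trans _ (inl p) _ (.rel _ _ ⟨.inr (.inr ⟨hq, hp⟩), hqS, hpS⟩)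
        (.rel _ _ ⟨hp, hpS, by omega⟩)
    · subst ha'; obtain rfl := term_of_inr h; have := h.2.1
      exact EqvGen.trans _ (inl q) _ (.rel _ _ ⟨.inr (.inl ⟨hp, hq⟩), hpS, hqS⟩)
        (.rel _ _ ⟨hq, hqS, by omega⟩)
    · exact .refl _

theorem joinF_spec {i j g : ℕ} (hHn : ∀ v l, H.lab v l → l < n) (hin : i < n) (hjn : j < n)
    (hij : i ≠ j) (hne : ∀ u w, H.lab u i → H.lab w j → ¬ H.adj u w)
    (hsymm : ∀ u w, H.adj u w → H.adj w u)
    (hR : Represents S n H f) (hok : f i = 0 ∨ f j = 0 ∨ Joinable (f i) (f j)) :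
    ((joinF (n + 1) i j g f).2 = true ↔ (zlinks S (H.join i j) (joinF (n + 1) i j g f).1).Good) ∧
      ((joinF (n + 1) i j g f).2 = true →
        Represents S n (H.join i j) (joinF (n + 1) i j g f).1) := by
  by_cases h0 : f i = 0 ∨ f j = 0
  · have he : H.join i j = H := join_of_empty (h0.imp
      (fun h => by have := hR.1 i hin; rwa [h] at this)
      (fun h => by have := hR.1 j hjn; rwa [h] at this))
    rw [joinF, if_pos h0, he]; exact ⟨iff_of_true rfl hR.2.1, fun _ => hR⟩
  · push Not at h0
    have hJ : Joinable (f i) (f j) := (hok.resolve_left h0.1).resolve_left h0.2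
    have hst := fun l hl => joinF_status (f := f) (g := g) (l := l) (K := n + 1) hl hij fun _ => hJ
    simp only [h0, false_or, if_false] at hst
    obtain ⟨r, hr⟩ : ∃ r, r = addE (n + 1) (decide (f i ≤ 2 ∧ f j ≤ 2 ∧ (f i = 1 ∨ f j = 1))) i j f :=
      ⟨_, rfl⟩
    have hF : joinF (n + 1) i j g f = (update (update r.1 i (joined (f i) (g % 2)))
        j (joined (f j) (g / 2)), r.2) := by
      rw [joinF, if_neg (by tauto), if_pos hJ, hr]
    have hHj : ∀ v l, (H.join i j).lab v l → l < n := hHn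
    obtain ⟨r', hr'⟩ : ∃ r', r' = joinF (n + 1) i j g f := ⟨_, rfl⟩
    rw [← hr'] at hst ⊢; rw [← hr'] at hF; have hri := hst i (by omega)
    have hrj := hst j (by omega); rw [if_pos rfl] at hri; rw [if_neg hij.symm, if_pos rfl] at hrj
    set st' : ℕ → ℕ := fun l => if l = i ∨ l = j then r'.1 l else f l with hst'
    have hste : ∀ l, l < n → r'.1 l = st' l := by grind
    have hsti : st' i = joined (f i) (g % 2) := by rw [← hste i hin, hri]
    have hstj : st' j = joined (f j) (g / 2) := by rw [← hste j hjn, hrj]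
    have hJ' := hJ; unfold Joinable at hJ'
    obtain ⟨X, Y, hX, hY, hhard, F, φ, φ', hL, hL', hterm⟩ := join_lifts (S := S) (st := f)
      (st' := st') hin hjn hij hne hsymm (hR.1 i hin) (hR.1 j hjn) h0.1 h0.2 hJ
      (fun l e1 e2 => by simp [hst', e1, e2])
      (by rw [hsti]; unfold joined; split_ifs <;> omega)
      (by rw [hstj]; unfold joined; split_ifs <;> omega)
    obtain ⟨hadd1, hadd2⟩ := hR.2.2.addE (fun l a h => (term_lt h).trans (Nat.lt_succ_self n))
      (h := decide (f i ≤ 2 ∧ f j ≤ 2 ∧ (f i = 1 ∨ f j = 1))) hX hY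
    rw [← hr] at hadd1 hadd2; simp only [decide_eq_true_eq] at hadd1 hadd2
    have hr2 : r'.2 = r.2 := by rw [hF]
    rw [hr2, zlinks_congr hHj hste]
    have hgood : ((zlinks S H f).add (f i ≤ 2 ∧ f j ≤ 2 ∧ (f i = 1 ∨ f j = 1)) X Y).Good ↔
        r.2 = true := by
      rw [hadd1]; exact ⟨fun h => h.canAdd hhard, hR.2.1.add⟩
    refine ⟨⟨fun h => hL'.good (hgood.2 h), fun h => hgood.1 (hL.good h)⟩, fun h => ⟨fun l hl => ?_, ?_, ?_⟩⟩
    · have hj : ∀ C s b, Fits S C s → Fits S C (joined s b) := by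
        intro C s b hs; unfold joined; split_ifs with h1 h2
        · exact hs
        · rwa [h2.1] at hs
        · exact hs.many (by omega)
      rw [hst l (by omega)]; split_ifs with h1 h2
      · subst h1; exact hj _ _ _ (hR.1 l hl)
      · subst h2; exact hj _ _ _ (hR.1 l hl)
      · exact hR.1 l hl
    · rw [zlinks_congr hHj hste]; exact hL'.good (hgood.2 h)
    · rw [zlinks_congr hHj hste, term_congr hste]; have hI := hL.ids hL' (hadd2 h) hterm
      refine hI.congr (fun l m a b ha hb => ?_) (fun l m a b ha hb => ?_) <;>
      · rw [hF]; simp only [update_apply]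
        rw [if_neg (by omega), if_neg (by omega), if_neg (by omega), if_neg (by omega)]

theorem zlinks_adj {u w : V} (h : H.adj u w) : (zlinks S H st).soft (.inl u) (.inl w) ∨
    (zlinks S H st).hard (.inl u) (.inl w) ∨ (zlinks S H st).hard (.inl w) (.inl u) := by
  by_cases hS : S u ∨ S w
  · exact .inr (.inl ⟨h, hS⟩)
  · exact .inl ⟨h, by tauto⟩

theorem zlinks_promise {u : V} {l : ℕ} (h : H.lab u l) (h4 : 4 ≤ st l) (h6 : st l ≤ 6) :
    (zlinks S H st).soft (.inl u) (.inr l) ∨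
    (zlinks S H st).hard (.inl u) (.inr l) ∨ (zlinks S H st).hard (.inr l) (.inl u) := by
  by_cases hS : S u
  · refine .inr (.inl ⟨h, ?_⟩); grind
  · by_cases h' : st l = 6
    · exact .inr (.inl ⟨h, .inr h'⟩)
    · exact .inl ⟨h, hS, by omega⟩

theorem Many.exists_ne {C : V → Prop} (h : Many C) (a : V) : ∃ b, C b ∧ a ≠ b := by
  obtain ⟨p, q, hpq, hp, hq⟩ := h; grind

/-- Several vertices with a common neighbour and a promised neighbour are on cycles of length
four, so no hard edge is incident with them. -/
theorem no_hard_of_promise {j : ℕ} {v : V} (hG : (zlinks S H st).Good) (hM : Many (H.lab · j))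
    (hv : ∀ a, H.lab a j → H.adj a v) (hvj : ¬ H.lab v j) (h4 : 4 ≤ st j) (h6 : st j ≤ 6) :
    ¬ S v ∧ st j ≠ 6 ∧ ∀ a, H.lab a j → ¬ S a := by
  have key : ∀ a, H.lab a j → ¬ (zlinks S H st).hard (.inl a) (.inl v) ∧
      ¬ (zlinks S H st).hard (.inl a) (.inr j) := by
    intro a ha; obtain ⟨b, hb, hab⟩ := hM.exists_ne a
    have hav : a ≠ v := by rintro rfl; exact hvj ha
    exact ⟨fun h => hG.not_square (a := .inl a) (b := .inl b) (p := .inl v) (q := .inr j)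
        (by simpa using hab) (by simp) (by simp) (.inl h) (zlinks_promise ha h4 h6)
        (zlinks_adj (hv b hb)) (zlinks_promise hb h4 h6),
      fun h => hG.not_square (a := .inl a) (b := .inl b) (p := .inr j) (q := .inl v)
        (by simpa using hab) (by simp) (by simpa using hav) (.inl h) (zlinks_adj (hv a ha))
        (zlinks_promise hb h4 h6) (zlinks_adj (hv b hb))⟩
  obtain ⟨a, -, -, ha, -⟩ := id hM
  refine ⟨fun h => (key a ha).1 ⟨hv a ha, .inr h⟩, fun h => (key a ha).2 ⟨ha, .inr h⟩,
    fun a ha h => (key a ha).1 ⟨hv a ha, .inl h⟩⟩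

/-- No vertex of `S` is in a complete bipartite graph with several vertices on each side. -/
theorem no_hard_of_many {A C : V → Prop} (hG : (zlinks S H st).Good) (hA : Many A) (hC : Many C)
    (hAC : ∀ a, A a → ¬ C a) (h : ∀ a c, A a → C c → H.adj a c) :
    (∀ a, A a → ¬ S a) ∧ ∀ c, C c → ¬ S c := by
  have key : ∀ a c, A a → C c → ¬ (zlinks S H st).hard (.inl a) (.inl c) := by
    intro a c ha hc hh; obtain ⟨b, hb, hab⟩ := hA.exists_ne a; obtain ⟨d, hd, hcd⟩ := hC.exists_ne c
    have had : a ≠ d := by rintro rfl; exact hAC _ ha hd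
    exact hG.not_square (a := .inl a) (b := .inl b) (p := .inl c) (q := .inl d)
      (by simpa using hab) (by simpa using hcd) (by simpa using had) (.inl hh)
      (zlinks_adj (h a d ha hd)) (zlinks_adj (h b c hb hc)) (zlinks_adj (h b d hb hd))
  obtain ⟨a, -, -, ha, -⟩ := id hA; obtain ⟨c, -, -, hc, -⟩ := id hC
  exact ⟨fun a ha hS => key a c ha hc ⟨h a c ha hc, .inl hS⟩,
    fun c hc hS => key a c ha hc ⟨h a c ha hc, .inr hS⟩⟩

/-- Every choice of promises after a join comes from some choice before it and some guess `g`, which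
tells which of the two labels keep their promises. -/
theorem exists_prejoin {i j : ℕ} (hin : i < n) (hjn : j < n)
    (hij : i ≠ j) (hne : ∀ u w, H.lab u i → H.lab w j → ¬ H.adj u w)
    (hsymm : ∀ u w, H.adj u w → H.adj w u) (hdis : ∀ u, H.lab u i → ¬ H.lab u j)
    (hF : ∀ l, l < n → Fits S (H.lab · l) (st' l)) (hG : (zlinks S (H.join i j) st').Good) :
    ∃ st g, g < 4 ∧ (∀ l, l < n → Fits S (H.lab · l) (st l)) ∧ (zlinks S H st).Good ∧
      (∀ l, l ≠ i → l ≠ j → st l = st' l) ∧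
      ∀ f : ℕ → ℕ, (∀ l, l < n → f l = st l) → (f i = 0 ∨ f j = 0 ∨ Joinable (f i) (f j)) ∧
        ∀ l, l < n → (joinF (n + 1) i j g f).1 l = st' l := by
  by_cases h0 : st' i = 0 ∨ st' j = 0
  · have he : H.join i j = H := join_of_empty (h0.imp
      (fun h => by have := hF i hin; rwa [h] at this)
      (fun h => by have := hF j hjn; rwa [h] at this))
    rw [he] at hG; refine ⟨st', 0, by omega, hF, hG, fun _ _ _ => rfl, fun f hf => ?_⟩
    have h0' : f i = 0 ∨ f j = 0 := by rwa [hf i hin, hf j hjn]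
    refine ⟨by tauto, fun l hl => ?_⟩; rw [joinF, if_pos h0']; exact hf l hl
  · -- it suffices to find the statuses of the two labels and the promises that are kept
    suffices h : ∃ s t b c, b < 2 ∧ c < 2 ∧ Fits S (H.lab · i) s ∧ Fits S (H.lab · j) t ∧ s ≠ 0 ∧
        t ≠ 0 ∧ Joinable s t ∧ joined s b = st' i ∧ joined t c = st' j by
      obtain ⟨s, t, b, c, hb, hc, hs, ht, hs0, ht0, hJ, hi, hj⟩ := h
      set st : ℕ → ℕ := fun l => if l = i then s else if l = j then t else st' l with hst
      have hsx : st i = s := by simp [hst]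
      have hsy : st j = t := by simp [hst, hij.symm]
      have hso : ∀ l, l ≠ i → l ≠ j → st l = st' l := fun l h1 h2 => by simp [hst, h1, h2]
      have hfits : ∀ l, l < n → Fits S (H.lab · l) (st l) := by grind
      have hJ' := hJ; unfold Joinable at hJ'
      refine ⟨st, b + 2 * c, by omega, hfits, ?_, hso, fun f hf => ?_⟩
      · obtain ⟨X, Y, -, -, -, F, φ, φ', hL, -⟩ := join_lifts (S := S) (st := st)
          (st' := st') hin hjn hij hne hsymm (hfits i hin) (hfits j hjn) (by omega) (by omega)
          (by rwa [hsx, hsy]) (fun l e1 e2 => (hso l e1 e2).symm)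
          (by rw [hsx, ← hi]; unfold joined; split_ifs <;> omega)
          (by rw [hsy, ← hj]; unfold joined; split_ifs <;> omega)
        exact (hL.good hG).of_add
      · have hfi := (hf i hin).trans hsx; have hfj := (hf j hjn).trans hsy
        refine ⟨.inr (.inr (by rwa [hfi, hfj])), fun l hl => ?_⟩
        rw [joinF_status (by omega) hij (fun _ => by rwa [hfi, hfj]), if_neg (by omega), hfi, hfj,
          show (b + 2 * c) % 2 = b by omega, show (b + 2 * c) / 2 = c by omega, hi, hj]
        grind
    push Not at h0
    -- one single vertex and several vertices
    have mixed : ∀ i j, (∀ u, H.lab u i → ¬ H.lab u j) → (zlinks S (H.join i j) st').Good →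
        Fits S (H.lab · i) (st' i) → Fits S (H.lab · j) (st' j) → st' i ≠ 0 → st' i ≤ 2 → 3 ≤ st' j →
        ∃ t c, c < 2 ∧ Fits S (H.lab · j) t ∧ joined t c = st' j ∧
          (st' i = 2 ∧ (t = 4 ∨ t = 5) ∨ st' i = 1 ∧ t = 6) := by
      intro i j hdis hG hi hj h0 h2 h3; have hM := hj.many h3; have h6 := hj.le
      obtain ⟨v, hv, hvS⟩ := hi.single h0 h2; rcases Nat.lt_or_ge 3 (st' j) with h4 | h4
      · have := no_hard_of_promise hG (j := j) (v := v) hM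
          (fun a ha => .inr (.inr ⟨ha, (hv v).2 rfl⟩)) (hdis v ((hv v).2 rfl)) h4 h6
        have h5 : st' j ≠ 5 := by
          intro h5; rw [h5] at hj; obtain ⟨-, a, ha, haS⟩ := hj; exact this.2.2 a ha haS
        have h44 : st' j = 4 := by omega
        refine ⟨4, 1, by omega, h44 ▸ hj, by rw [h44]; rfl, .inl ⟨?_, .inl rfl⟩⟩; grind
      · have h33 : st' j = 3 := by omega
        rw [h33]; rcases hvS with h | h
        · exact ⟨6, 0, by omega, hM, rfl, .inr ⟨h.1, rfl⟩⟩
        · by_cases hS : ∀ a, H.lab a j → ¬ S a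
          · exact ⟨4, 0, by omega, ⟨hM, hS⟩, rfl, .inl ⟨h.1, .inl rfl⟩⟩
          · push Not at hS
            exact ⟨5, 0, by omega, ⟨hM, hS⟩, rfl, .inl ⟨h.1, .inr rfl⟩⟩
    have hi := hF i hin; have hj := hF j hjn
    have hjo : ∀ s, s ≤ 2 → joined s 0 = s := fun s hs => by unfold joined; rw [if_pos (by omega)]
    rcases Nat.lt_or_ge 2 (st' i) with hi2 | hi2 <;> rcases Nat.lt_or_ge 2 (st' j) with hj2 | hj2
    · have hMi := hi.many hi2; have hMj := hj.many hj2
      obtain ⟨h1, h2⟩ := no_hard_of_many hG hMi hMj hdis fun a c ha hc => .inr (.inl ⟨ha, hc⟩)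
      have key : ∀ i j, (zlinks S (H.join i j) st').Good → Fits S (H.lab · i) (st' i) →
          Many (H.lab · j) → (∀ u, H.lab u j → ¬ H.lab u i) → 2 < st' i →
          (∀ a, H.lab a i → ¬ S a) → st' i = 3 ∨ st' i = 4 := by
        intro i j hG hi hj hdis h2 hS; by_contra hc; have h6 := hi.le; obtain ⟨p, -, -, hp, -⟩ := hj
        have := no_hard_of_promise hG (j := i) (v := p) (hi.many h2)
          (fun a ha => .inr (.inl ⟨ha, hp⟩)) (hdis p hp) (by omega) h6
        have h5 : st' i = 5 := by omega
        rw [h5] at hi; obtain ⟨-, a, ha, haS⟩ := hi; exact hS a ha haS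
      have ki := key i j hG hi hMj (fun u h1 h2 => hdis u h2 h1) hi2 h1
      have kj := key j i (by rwa [LGraph.join_comm]) hj hMi hdis hj2 h2
      refine ⟨4, 4, if st' i = 4 then 1 else 0, if st' j = 4 then 1 else 0, by split_ifs <;> omega,
        by split_ifs <;> omega, ⟨hMi, h1⟩, ⟨hMj, h2⟩, by omega, by omega, by unfold Joinable; omega, ?_, ?_⟩
      · rcases ki with k | k <;> simp [k, joined]
      · rcases kj with k | k <;> simp [k, joined]
    · obtain ⟨t, c, hc, ht, hjt, h⟩ := mixed j i (fun u h1 h2 => hdis u h2 h1)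
        (by rwa [LGraph.join_comm]) hj hi h0.2 hj2 hi2
      exact ⟨t, st' j, c, 0, hc, by omega, ht, hj, by omega, h0.2, by unfold Joinable; omega, hjt,
        hjo _ hj2⟩
    · obtain ⟨t, c, hc, ht, hjt, h⟩ := mixed i j hdis hG hi hj h0.1 hi2 hj2
      exact ⟨st' i, t, 0, c, by omega, hc, hi, ht, h0.1, by omega, by unfold Joinable; omega,
        hjo _ hi2, hjt⟩
    · exact ⟨st' i, st' j, 0, 0, by omega, by omega, hi, hj, h0.1, h0.2, .inl ⟨hi2, hj2⟩, hjo _ hi2,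
        hjo _ hj2⟩

end

/-! ### Disjoint unions -/

/-- The array of a disjoint union, in which the labels of the second graph are shifted by `k`. -/
def combineF (k K B : ℕ) (f₁ f₂ : ℕ → ℕ) : ℕ → ℕ := fun a =>
  if k ≤ a ∧ a < 2 * k then f₂ (a - k)
  else if K + k ≤ a ∧ a < K + 2 * k ∨ 2 * K + k ≤ a ∧ a < 2 * K + 2 * k then f₂ (a - k) + B
  else f₁ a

/-- `combineF` followed by a renumbering. -/
def unionF (k K B : ℕ) (f₁ f₂ : ℕ → ℕ) : ℕ → ℕ := normIds K B (combineF k K B f₁ f₂)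

theorem combineF_lt {k K B : ℕ} {f₁ f₂ : ℕ → ℕ} (h1 : ∀ a, a < 3 * K → f₁ a < B)
    (h2 : ∀ a, a < 3 * K → f₂ a < B) : ∀ a, a < 3 * K → combineF k K B f₁ f₂ a < 2 * B := by
  intro a ha; have := h1 a ha; have := h2 (a - k) (by omega); unfold combineF; split_ifs <;> omega

namespace Links

variable {Ω Ω' : Type*} {W : Links Ω} {W' : Links Ω'}

/-- The map `g` embeds the part `p` of `W`, from which no edges lead away, into `W'`. -/
structure Part (W : Links Ω) (W' : Links Ω') (p : Ω → Prop) (g : Ω → Ω') : Prop where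
  soft_iff : ∀ a b, W.soft a b → (p a ↔ p b)
  hard_iff : ∀ a b, W.hard a b → (p a ↔ p b)
  soft : ∀ a b, p a → p b → W.soft a b → W'.soft (g a) (g b)
  hard : ∀ a b, p a → p b → W.hard a b → W'.hard (g a) (g b)
  inj : ∀ a b, p a → p b → g a = g b → a = b

variable {p : Ω → Prop} {g : Ω → Ω'}

open Classical in
theorem Part.not_compWithout (h : Part W W' p g) (hG : W'.Good) {x y : Ω} (hx : p x)
    (hxy : W.hard x y) : ¬ W.compWithout x y x y := by
  have hy : p y := (h.hard_iff x y hxy).1 hx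
  refine hG.not_compWithout (fun a => if p a then g a else g x) (x' := g x) (y' := g y)
    (.inl (h.hard x y hx hy hxy)) (by simpa [hx] using .refl _) (by simpa [hy] using .refl _)
    (fun a b hab => ?_) (fun a b hab hne => ?_)
  · have := h.soft_iff a b hab; by_cases ha : p a
    · have hb := this.1 ha; simpa [ha, hb] using Links.blob_rel (h.soft a b ha hb hab)
    · have hb : ¬ p b := fun hb => ha (this.2 hb); simpa [ha, hb] using .refl _
  · have := h.hard_iff a b hab; by_cases ha : p a
    · have hb := this.1 ha; simp only [ha, hb, if_true]
      refine .rel _ _ (.inr ⟨h.hard a b ha hb hab, fun he => hne ?_⟩)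
      rcases Sym2.eq_iff.1 he with ⟨h1, h2⟩ | ⟨h1, h2⟩
      · rw [h.inj _ _ ha hx h1, h.inj _ _ hb hy h2]
      · rw [h.inj _ _ ha hy h1, h.inj _ _ hb hx h2, Sym2.eq_swap]
    · have hb : ¬ p b := fun hb => ha (this.2 hb); simpa [ha, hb] using .refl _

open Classical in
theorem Part.conn (h : Part W W' p g) {a b : Ω} (ha : p a) (hb : p b) :
    (W.blob a b → W'.blob (g a) (g b)) ∧ (W.comp a b → W'.comp (g a) (g b)) := by
  have e : ∀ c, p c → (if p c then g c else g a) = g c := fun c hc => if_pos hc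
  constructor <;> intro hab
  · rw [← e a ha, ← e b hb]
    refine eqvGen_lift (fun c => if p c then g c else g a) (fun c d hcd => ?_) hab
    have := h.soft_iff c d hcd; by_cases hc : p c
    · have hd := this.1 hc; simpa [hc, hd] using EqvGen.rel _ _ (h.soft c d hc hd hcd)
    · have hd : ¬ p d := fun hd => hc (this.2 hd); simpa [hc, hd] using .refl _
  · rw [← e a ha, ← e b hb]
    refine eqvGen_lift (fun c => if p c then g c else g a) (fun c d hcd => ?_) hab
    have : p c ↔ p d := hcd.elim (h.soft_iff c d) (h.hard_iff c d); by_cases hc : p c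
    · have hd := this.1 hc; simp only [hc, hd, if_true]
      exact .rel _ _ (hcd.imp (h.soft c d hc hd) (h.hard c d hc hd))
    · have hd : ¬ p d := fun hd => hc (this.2 hd); simpa [hc, hd] using .refl _

theorem Part.separated (h : Part W W' p g) {a b : Ω} (ha : p a) (hb : ¬ p b) :
    ¬ W.blob a b ∧ ¬ W.comp a b := by
  have : ¬ W.comp a b := fun hab => hb ((eqvGen_invariant p (fun c d hcd =>
    hcd.elim (h.soft_iff c d) (h.hard_iff c d)) hab).1 ha)
  exact ⟨fun h => this (blob_comp h), this⟩

end Links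

section

variable {V : Type*} {S : V → Prop} {H₁ H₂ : LGraph V} {st : ℕ → ℕ} {k : ℕ}

theorem union_lab_iff (h1 : H₁.Proper k) {l : ℕ} (hl : l < k) :
    ((H₁.union k H₂).lab · l) = (H₁.lab · l) ∧ ((H₁.union k H₂).lab · (k + l)) = (H₂.lab · l) := by
  constructor <;> funext u <;> simp only [LGraph.union, eq_iff_iff]
  · grind
  · constructor
    · rintro (h | ⟨l', h, h'⟩)
      · have := h1.lab_lt _ _ h; omega
      · obtain rfl : l' = l := by omega
        exact h
    · exact fun h => .inr ⟨l, h, rfl⟩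

theorem union_proper (h1 : H₁.Proper k) (h2 : H₂.Proper k) : (H₁.union k H₂).Proper (2 * k) where
  symm u v h := h.imp (h1.symm u v) (h2.symm u v)
  lab_lt v l h := by
    rcases h with h | ⟨l', h, rfl⟩
    · have := h1.lab_lt _ _ h; omega
    · have := h2.lab_lt _ _ h; omega
  alive u v h := by
    rcases h with h | h
    · obtain ⟨l, h⟩ := h1.alive u v h; exact ⟨l, .inl h⟩
    · obtain ⟨l, h⟩ := h2.alive u v h; exact ⟨k + l, .inr ⟨l, h, rfl⟩⟩

/-- The points of the second part are renamed. -/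
def unshift (k : ℕ) : V ⊕ ℕ → V ⊕ ℕ := Sum.map id (· - k)

/-- The points that belong to the first operand of a union. -/
def InFirst (k : ℕ) (H : LGraph V) : V ⊕ ℕ → Prop
  | .inl v => ∃ l, H.lab v l
  | .inr m => m < k

/-- The union splits into the two graphs: neither has edges that lead to the other. -/
theorem union_parts (h1 : H₁.Proper k) (h2 : H₂.Proper k)
    (hd : ∀ u l m, H₁.lab u l → ¬ H₂.lab u m) {st₁ st₂ : ℕ → ℕ}
    (e1 : ∀ l, l < k → st₁ l = st l) (e2 : ∀ l, l < k → st₂ l = st (k + l)) :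
    Links.Part (zlinks S (H₁.union k H₂) st) (zlinks S H₁ st₁) (InFirst k H₁) id ∧
    Links.Part (zlinks S (H₁.union k H₂) st) (zlinks S H₂ st₂) (fun a => ¬ InFirst k H₁ a)
      (unshift k) := by
  have hadj : ∀ u w, (H₁.union k H₂).adj u w → (InFirst k H₁ (inl u) ∧ InFirst k H₁ (inl w) ∧
      H₁.adj u w) ∨ (¬ InFirst k H₁ (inl u) ∧ ¬ InFirst k H₁ (inl w) ∧ H₂.adj u w) := by
    rintro u w (h | h)
    · exact .inl ⟨h1.alive u w h, h1.alive w u (h1.symm u w h), h⟩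
    · obtain ⟨l, hl⟩ := h2.alive u w h; obtain ⟨m, hm⟩ := h2.alive w u (h2.symm u w h)
      exact .inr ⟨fun ⟨l', h'⟩ => hd _ _ _ h' hl, fun ⟨l', h'⟩ => hd _ _ _ h' hm, h⟩
  have hlab : ∀ u l, (H₁.union k H₂).lab u l → (InFirst k H₁ (inl u) ∧ InFirst k H₁ (inr l) ∧
      H₁.lab u l ∧ st₁ l = st l) ∨ (¬ InFirst k H₁ (inl u) ∧ ¬ InFirst k H₁ (inr l) ∧
        H₂.lab u (l - k) ∧ st₂ (l - k) = st l) := by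
    rintro u l (h | ⟨l', h, rfl⟩)
    · exact .inl ⟨⟨l, h⟩, h1.lab_lt _ _ h, h, e1 _ (h1.lab_lt _ _ h)⟩
    · refine .inr ⟨fun ⟨l'', h'⟩ => hd _ _ _ h' h, ?_, ?_, ?_⟩
      · simp [InFirst]
      · simpa using h
      · simpa using e2 _ (h2.lab_lt _ _ h)
  have hsoft : ∀ a b, (zlinks S (H₁.union k H₂) st).soft a b →
      (InFirst k H₁ a ∧ InFirst k H₁ b ∧ (zlinks S H₁ st₁).soft a b) ∨
      (¬ InFirst k H₁ a ∧ ¬ InFirst k H₁ b ∧ (zlinks S H₂ st₂).soft (unshift k a) (unshift k b)) := by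
    rintro (u | l) (w | m) h
    · rcases hadj u w h.1 with ⟨g1, g2, g3⟩ | ⟨g1, g2, g3⟩
      · exact .inl ⟨g1, g2, g3, h.2⟩
      · exact .inr ⟨g1, g2, g3, h.2⟩
    · rcases hlab u m h.1 with ⟨g1, g2, g3, g4⟩ | ⟨g1, g2, g3, g4⟩
      · exact .inl ⟨g1, g2, g3, by rw [g4]; exact h.2⟩
      · exact .inr ⟨g1, g2, g3, by rw [g4]; exact h.2⟩
    all_goals exact h.elim
  have hhard : ∀ a b, (zlinks S (H₁.union k H₂) st).hard a b →
      (InFirst k H₁ a ∧ InFirst k H₁ b ∧ (zlinks S H₁ st₁).hard a b) ∨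
      (¬ InFirst k H₁ a ∧ ¬ InFirst k H₁ b ∧ (zlinks S H₂ st₂).hard (unshift k a) (unshift k b)) := by
    rintro (u | l) (w | m) h
    · rcases hadj u w h.1 with ⟨g1, g2, g3⟩ | ⟨g1, g2, g3⟩
      · exact .inl ⟨g1, g2, g3, h.2⟩
      · exact .inr ⟨g1, g2, g3, h.2⟩
    · rcases hlab u m h.1 with ⟨g1, g2, g3, g4⟩ | ⟨g1, g2, g3, g4⟩
      · exact .inl ⟨g1, g2, g3, by rw [g4]; exact h.2⟩
      · exact .inr ⟨g1, g2, g3, by rw [g4]; exact h.2⟩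
    all_goals exact h.elim
  refine ⟨⟨fun a b h => ?_, fun a b h => ?_, fun a b ha hb h => ?_, fun a b ha hb h => ?_,
    fun a b _ _ h => h⟩, ⟨fun a b h => ?_, fun a b h => ?_, fun a b ha hb h => ?_,
    fun a b ha hb h => ?_, ?_⟩⟩
  · have := hsoft a b h; tauto
  · have := hhard a b h; tauto
  · have := hsoft a b h; tauto
  · have := hhard a b h; tauto
  · have := hsoft a b h; tauto
  · have := hhard a b h; tauto
  · have := hsoft a b h; tauto
  · have := hhard a b h; tauto
  · rintro (u | l) (w | m) ha hb h
    · simpa [unshift] using h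
    · simp [unshift] at h
    · simp [unshift] at h
    · simp only [unshift, map_inr, inr.injEq, InFirst] at h ha hb ⊢; omega

/-- Both operands are embedded into a union. -/
theorem union_lifts (h1 : H₁.Proper k) (h2 : H₂.Proper k) {st₁ st₂ : ℕ → ℕ}
    (e1 : ∀ l, l < k → st₁ l = st l) (e2 : ∀ l, l < k → st₂ l = st (k + l)) :
    (∃ φ, Links.Lifts (zlinks S H₁ st₁) (zlinks S (H₁.union k H₂) st) id φ) ∧
    (∃ φ, Links.Lifts (zlinks S H₂ st₂) (zlinks S (H₁.union k H₂) st) (Sum.map id (k + ·)) φ) := by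
  constructor
  · refine ⟨fun a b => (a, b), ⟨?_, ?_, fun _ _ _ _ _ _ h => h⟩⟩
    · rintro (u | l) (w | m) h
      · exact .rel _ _ ⟨.inl h.1, h.2⟩
      · exact .rel _ _ ⟨.inl h.1, by rw [← e1 _ (h1.lab_lt _ _ h.1)]; exact h.2⟩
      all_goals exact h.elim
    · rintro (u | l) (w | m) h
      · exact ⟨.inl ⟨.inl h.1, h.2⟩, .refl _, .refl _⟩
      · exact ⟨.inl ⟨.inl h.1, by rw [← e1 _ (h1.lab_lt _ _ h.1)]; exact h.2⟩, .refl _, .refl _⟩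
      all_goals exact h.elim
  · refine ⟨fun a b => (Sum.map id (k + ·) a, Sum.map id (k + ·) b), ⟨?_, ?_, ?_⟩⟩
    · rintro (u | l) (w | m) h
      · exact .rel _ _ ⟨.inr h.1, h.2⟩
      · exact .rel _ _ ⟨.inr ⟨m, h.1, rfl⟩, by rw [← e2 _ (h2.lab_lt _ _ h.1)]; exact h.2⟩
      all_goals exact h.elim
    · rintro (u | l) (w | m) h
      · exact ⟨.inl ⟨.inr h.1, h.2⟩, .refl _, .refl _⟩
      · exact ⟨.inl ⟨.inr ⟨m, h.1, rfl⟩, by rw [← e2 _ (h2.lab_lt _ _ h.1)]; exact h.2⟩, .refl _,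
          .refl _⟩
      all_goals exact h.elim
    · intro a b c d _ _ h
      have hinj : Injective (Sum.map id (k + ·) : V ⊕ ℕ → V ⊕ ℕ) :=
        Injective.sumMap injective_id (add_right_injective k)
      exact Sym2.map.injective hinj (by simpa using h)

theorem combineF_spec {n B : ℕ} {f₁ f₂ : ℕ → ℕ} (hn : n = 2 * k) (h1 : H₁.Proper k)
    (h2 : H₂.Proper k) (hd : ∀ u l m, H₁.lab u l → ¬ H₂.lab u m) (hR1 : Represents S n H₁ f₁)
    (hR2 : Represents S n H₂ f₂) (hB : ∀ a, a < 3 * (n + 1) → f₁ a < B) :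
    Represents S n (H₁.union k H₂) (combineF k (n + 1) B f₁ f₂) := by
  subst hn; set f := combineF k (2 * k + 1) B f₁ f₂ with hf
  have v1 : ∀ l, l < k → f l = f₁ l ∧ f (2 * k + 1 + l) = f₁ (2 * k + 1 + l) ∧
      f (2 * (2 * k + 1) + l) = f₁ (2 * (2 * k + 1) + l) := by
    intro l hl; refine ⟨?_, ?_, ?_⟩ <;>
    · simp only [hf, combineF]; rw [if_neg (by omega), if_neg (by omega)]
  have v2 : ∀ l, l < k → f (k + l) = f₂ l ∧ f (2 * k + 1 + (k + l)) = f₂ (2 * k + 1 + l) + B ∧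
      f (2 * (2 * k + 1) + (k + l)) = f₂ (2 * (2 * k + 1) + l) + B := by
    intro l hl; refine ⟨?_, ?_, ?_⟩ <;> simp only [hf, combineF]; all_goals grind
  obtain ⟨hP1, hP2⟩ := union_parts (S := S) (st := f) h1 h2 hd (fun l hl => (v1 l hl).1.symm)
    (fun l hl => (v2 l hl).1.symm)
  obtain ⟨⟨φ, hL1⟩, ⟨φ', hL2⟩⟩ := union_lifts (S := S) (st := f) h1 h2
    (fun l hl => (v1 l hl).1.symm) (fun l hl => (v2 l hl).1.symm)
  refine ⟨fun l hl => ?_, fun x y hxy => ?_, ?_⟩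
  · rcases Nat.lt_or_ge l k with h | h
    · rw [(v1 l h).1, (union_lab_iff h1 h).1]; exact hR1.1 l hl
    · obtain ⟨m, rfl⟩ := Nat.exists_eq_add_of_le h
      rw [(v2 m (by omega)).1, (union_lab_iff h1 (by omega)).2]; exact hR2.1 m (by omega)
  · by_cases hx : InFirst k H₁ x
    · exact hP1.not_compWithout hR1.2.1 hx hxy
    · exact hP2.not_compWithout hR2.2.1 hx hxy
  · have t1 : ∀ l a, l < k → term (2 * k) (H₁.union k H₂) f l a →
        term (2 * k) H₁ f₁ l a ∧ InFirst k H₁ a := by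
      rintro l (u | m) hl ⟨g1, g2, g3⟩
      · rw [(v1 l hl).1] at g2; have := (congrFun (union_lab_iff h1 hl).1 u).mp g3
        exact ⟨⟨g1, g2, this⟩, l, this⟩
      · obtain ⟨g3, rfl⟩ := g3; rw [(v1 _ hl).1] at g2 g3; exact ⟨⟨g1, g2, g3, rfl⟩, hl⟩
    have t2 : ∀ l a, l < k → term (2 * k) (H₁.union k H₂) f (k + l) a →
        term (2 * k) H₂ f₂ l (unshift k a) ∧ ¬ InFirst k H₁ a ∧ a = Sum.map id (k + ·) (unshift k a) := by
      rintro l (u | m) hl ⟨g1, g2, g3⟩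
      · rw [(v2 l hl).1] at g2; have := (congrFun (union_lab_iff h1 hl).2 u).mp g3
        exact ⟨⟨by omega, g2, this⟩, fun ⟨l', h⟩ => hd _ _ _ h this, rfl⟩
      · obtain ⟨g3, rfl⟩ := g3; rw [(v2 _ hl).1] at g2 g3
        exact ⟨⟨by omega, g2, g3, Nat.add_sub_cancel_left _ _⟩, by simp [InFirst], by simp [unshift]⟩
    intro l m a b ha hb; have hl := term_lt ha; have hm := term_lt hb
    rcases Nat.lt_or_ge l k with h | h <;> rcases Nat.lt_or_ge m k with h' | h'
    · obtain ⟨a1, a2⟩ := t1 l a h ha; obtain ⟨b1, b2⟩ := t1 m b h' hb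
      rw [(v1 l h).2.1, (v1 l h).2.2, (v1 m h').2.1, (v1 m h').2.2]; have := hR1.2.2 l m a b a1 b1
      exact ⟨this.1.trans ⟨hL1.blob, (hP1.conn a2 b2).1⟩, this.2.trans ⟨hL1.comp, (hP1.conn a2 b2).2⟩⟩
    · obtain ⟨m, rfl⟩ := Nat.exists_eq_add_of_le h'; obtain ⟨a1, a2⟩ := t1 l a h ha
      obtain ⟨b1, b2, -⟩ := t2 m b (by omega) hb
      rw [(v1 l h).2.1, (v1 l h).2.2, (v2 m (by omega)).2.1, (v2 m (by omega)).2.2]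
      have e1 := hB (2 * k + 1 + l) (by omega); have e2 := hB (2 * (2 * k + 1) + l) (by omega)
      have := hP1.separated a2 b2; grind
    · obtain ⟨l, rfl⟩ := Nat.exists_eq_add_of_le h; obtain ⟨a1, a2, -⟩ := t2 l a (by omega) ha
      obtain ⟨b1, b2⟩ := t1 m b h' hb
      rw [(v1 m h').2.1, (v1 m h').2.2, (v2 l (by omega)).2.1, (v2 l (by omega)).2.2]
      have e1 := hB (2 * k + 1 + m) (by omega); have e2 := hB (2 * (2 * k + 1) + m) (by omega)
      have := hP1.separated b2 a2
      exact ⟨iff_of_false (by omega) fun h => this.1 h.symm,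
        iff_of_false (by omega) fun h => this.2 h.symm⟩
    · obtain ⟨l, rfl⟩ := Nat.exists_eq_add_of_le h; obtain ⟨m, rfl⟩ := Nat.exists_eq_add_of_le h'
      obtain ⟨a1, a2, a3⟩ := t2 l a (by omega) ha; obtain ⟨b1, b2, b3⟩ := t2 m b (by omega) hb
      rw [(v2 l (by omega)).2.1, (v2 l (by omega)).2.2, (v2 m (by omega)).2.1,
        (v2 m (by omega)).2.2, Nat.add_right_cancel_iff, Nat.add_right_cancel_iff]
      have := hR2.2.2 l m _ _ a1 b1
      refine ⟨this.1.trans ⟨fun h => ?_, (hP2.conn a2 b2).1⟩,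
        this.2.trans ⟨fun h => ?_, (hP2.conn a2 b2).2⟩⟩
      · rw [a3, b3]; exact hL2.blob h
      · rw [a3, b3]; exact hL2.comp h

theorem unionF_spec {n B : ℕ} {f₁ f₂ : ℕ → ℕ} (hn : n = 2 * k) (h1 : H₁.Proper k)
    (h2 : H₂.Proper k) (hd : ∀ u l m, H₁.lab u l → ¬ H₂.lab u m) (hR1 : Represents S n H₁ f₁)
    (hR2 : Represents S n H₂ f₂) (hB1 : ∀ a, a < 3 * (n + 1) → f₁ a < B)
    (hB2 : ∀ a, a < 3 * (n + 1) → f₂ a < B) (hn' : n + 1 ≤ B) :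
    Represents S n (H₁.union k H₂) (unionF k (n + 1) B f₁ f₂) := by
  refine (combineF_spec hn h1 h2 hd hR1 hR2 hB1).normIds (fun v l h => ?_) hn' fun a ha => ?_
  · rw [hn]; exact (union_proper h1 h2).lab_lt v l h
  · have := combineF_lt (k := k) hB1 hB2 a ha; omega

/-- A partial solution of a union comes from partial solutions of the operands. -/
theorem exists_preunion {n B : ℕ} (hn : n = 2 * k) (h1 : H₁.Proper k) (h2 : H₂.Proper k)
    (hF : ∀ l, l < n → Fits S ((H₁.union k H₂).lab · l) (st l))
    (hG : (zlinks S (H₁.union k H₂) st).Good) : ∃ st₁ st₂,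
      ((∀ l, l < n → Fits S (H₁.lab · l) (st₁ l)) ∧ (zlinks S H₁ st₁).Good) ∧
      ((∀ l, l < n → Fits S (H₂.lab · l) (st₂ l)) ∧ (zlinks S H₂ st₂).Good) ∧
      ∀ f₁ f₂, (∀ l, l < n → f₁ l = st₁ l) → (∀ l, l < n → f₂ l = st₂ l) →
        ∀ l, l < n → combineF k (n + 1) B f₁ f₂ l = st l := by
  subst hn
  refine ⟨fun l => if l < k then st l else 0, fun l => if l < k then st (k + l) else 0, ?_, ?_,
    fun f₁ f₂ g1 g2 l hl => ?_⟩
  · refine ⟨fun l hl => ?_, ?_⟩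
    · dsimp only; split_ifs with h
      · rw [← (union_lab_iff h1 h).1]; exact hF l hl
      · exact fun v hv => h (h1.lab_lt _ _ hv)
    · obtain ⟨⟨φ, hL⟩, -⟩ := union_lifts (S := S) (st := st) h1 h2
        (st₁ := fun l => if l < k then st l else 0) (st₂ := fun l => st (k + l))
        (fun l hl => by simp [hl]) (fun l hl => rfl)
      exact hL.good hG
  · refine ⟨fun l hl => ?_, ?_⟩
    · dsimp only; split_ifs with h
      · rw [← (union_lab_iff h1 h).2]; exact hF _ (by omega)
      · exact fun v hv => h (h2.lab_lt _ _ hv)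
    · obtain ⟨-, ⟨φ, hL⟩⟩ := union_lifts (S := S) (st := st) h1 h2
        (st₂ := fun l => if l < k then st (k + l) else 0) (st₁ := st)
        (fun l hl => rfl) (fun l hl => by simp [hl])
      exact hL.good hG
  · unfold combineF; grind

end

/-! ### Tables indexed by codes of arrays -/

/-- The entry `a` of the array with the code `q`: the digits of `q` in base `B`. -/
def decode (B q : ℕ) : ℕ → ℕ := fun a => q / B ^ a % B

/-- The code of an array with `N` entries below `B`. -/
def encode (B N : ℕ) (f : ℕ → ℕ) : ℕ := ∑ a ∈ Finset.range N, f a * B ^ a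

theorem encode_lt {B N : ℕ} {f : ℕ → ℕ} (hf : ∀ a, a < N → f a < B) : encode B N f < B ^ N := by
  induction N with
  | zero => simp [encode]
  | succ N ih =>
    have h1 := ih fun a ha => hf a (by omega); have h2 := hf N (by omega)
    rw [encode, Finset.sum_range_succ, ← encode, pow_succ]
    nlinarith [Nat.mul_le_mul_right (B ^ N) (Nat.succ_le_of_lt h2)]

theorem decode_lt {B q : ℕ} (hB : 0 < B) (a : ℕ) : decode B q a < B := Nat.mod_lt _ hB

theorem decode_encode {B N : ℕ} {f : ℕ → ℕ} (hf : ∀ a, a < N → f a < B) {a : ℕ} (ha : a < N) :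
    decode B (encode B N f) a = f a := by
  induction N with
  | zero => omega
  | succ N ih =>
    have h0 : encode B (N + 1) f = encode B N f + f N * B ^ N := by
      rw [encode, Finset.sum_range_succ, ← encode]
    have h1 := encode_lt (N := N) fun a ha => hf a (by omega)
    have hB : 0 < B := (Nat.zero_le _).trans_lt (hf N (by omega)); by_cases h : a = N
    · subst h; have hp : 0 < B ^ a := Nat.pow_pos hB
      rw [decode, h0, Nat.add_mul_div_right _ _ hp, Nat.div_eq_of_lt h1, Nat.zero_add,
        Nat.mod_eq_of_lt (hf a (by omega))]
    · have ha' : a < N := by omega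
      rw [← ih (fun a ha => hf a (by omega)) ha', decode, decode, h0]
      obtain ⟨d, rfl⟩ := Nat.exists_eq_add_of_lt ha'
      rw [show f (a + d + 1) * B ^ (a + d + 1) = f (a + d + 1) * B ^ d * B * B ^ a by ring,
        Nat.add_mul_div_right _ _ (Nat.pow_pos hB), Nat.add_mul_mod_self_right]

section

variable {V ι : Type*} {S : V → Prop} {n B : ℕ}

theorem Represents.of_eq {H : LGraph V} {f g : ℕ → ℕ} (hH : ∀ v l, H.lab v l → l < n)
    (h : Represents S n H f) (hfg : ∀ a, a < 3 * (n + 1) → f a = g a) : Represents S n H g :=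
  h.congr hH (fun l hl => hfg l (by omega))
    (fun l m hl hm => by rw [hfg _ (by omega), hfg _ (by omega)])
    (fun l m hl hm => by rw [hfg _ (by omega), hfg _ (by omega)])

/-- `A m q` tells that `q` is the code of an array that is achieved with weight at most `m`.  The
set `A` is correct for the family `H` of graphs if it contains, up to the choice of the identifiers
and of the solution, exactly the descriptions of the partial solutions without cycles through hard
edges.  Only partial solutions whose statuses satisfy `P` are considered. -/
structure Correct (S : V → Prop) (n B : ℕ) (P : (ℕ → ℕ) → Prop) (H : ι → LGraph V)
    (cost : ι → ℕ → Prop) (A : ℕ → ℕ → Prop) : Prop where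
  sound : ∀ m q, A m q → ∃ X, cost X m ∧ Represents S n (H X) (decode B q) ∧ P (decode B q)
  complete : ∀ X m st, cost X m → P st → (∀ l, l < n → Fits S ((H X).lab · l) (st l)) →
    (zlinks S (H X) st).Good → ∃ q, q < B ^ (3 * (n + 1)) ∧ A m q ∧
      Represents S n (H X) (decode B q) ∧ ∀ l, l < n → decode B q l = st l

/-- The codes of the results of an operation with a guess below `4`. -/
def stepSet (n B : ℕ) (F : ℕ → (ℕ → ℕ) → (ℕ → ℕ) × Bool) (A : ℕ → ℕ → Prop) (m q' : ℕ) : Prop :=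
  ∃ q g, q < B ^ (3 * (n + 1)) ∧ g < 4 ∧ A m q ∧ (F g (decode B q)).2 = true ∧
    q' = encode B (3 * (n + 1)) (F g (decode B q)).1

/-- A transition keeps the table correct if it is sound (`hs`) and if each solution is obtained from
some state of the graph before it (`hc`).  Completeness asks for the statuses only, since the rest of
a state is determined by the graph. -/
theorem Correct.step {P : (ℕ → ℕ) → Prop} {H H' : ι → LGraph V} {cost : ι → ℕ → Prop}
    {A : ℕ → ℕ → Prop} {F : ℕ → (ℕ → ℕ) → (ℕ → ℕ) × Bool} (hA : Correct S n B P H cost A)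
    (hB : 0 < B) (hP : ∀ f g, (∀ l, l < n → f l = g l) → P f → P g)
    (hH' : ∀ X m, cost X m → ∀ v l, (H' X).lab v l → l < n)
    (hlt : ∀ g f, (∀ a, a < 3 * (n + 1) → f a < B) → ∀ a, a < 3 * (n + 1) → (F g f).1 a < B)
    (hs : ∀ X m g f, cost X m → (∀ a, a < 3 * (n + 1) → f a < B) → Represents S n (H X) f → P f →
      (F g f).2 = true → Represents S n (H' X) (F g f).1 ∧ P (F g f).1)
    (hc : ∀ X m st', cost X m → P st' → (∀ l, l < n → Fits S ((H' X).lab · l) (st' l)) →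
      (zlinks S (H' X) st').Good → ∃ st g, g < 4 ∧ (∀ l, l < n → Fits S ((H X).lab · l) (st l)) ∧
        (zlinks S (H X) st).Good ∧ P st ∧ ∀ f, (∀ a, a < 3 * (n + 1) → f a < B) →
          Represents S n (H X) f → (∀ l, l < n → f l = st l) →
          (F g f).2 = true ∧ ∀ l, l < n → (F g f).1 l = st' l) :
    Correct S n B P H' cost (stepSet n B F A) where
  sound m q' h := by
    obtain ⟨q, g, hq, hg, hAq, hok, rfl⟩ := h; obtain ⟨X, hX, hR, hPq⟩ := hA.sound m q hAq
    have hd : ∀ a, a < 3 * (n + 1) → decode B q a < B := fun a _ => decode_lt hB a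
    obtain ⟨h1, h2⟩ := hs X m g _ hX hd hR hPq hok
    have e := fun a ha => (decode_encode (hlt g _ hd) (a := a) ha).symm
    exact ⟨X, hX, h1.of_eq (hH' X m hX) e, hP _ _ (fun l hl => e l (by omega)) h2⟩
  complete X m st' hX hP' hF hG := by
    obtain ⟨st, g, hg, hF1, hG1, hP1, hf⟩ := hc X m st' hX hP' hF hG
    obtain ⟨q, hq, hAq, hR, hst⟩ := hA.complete X m st hX hP1 hF1 hG1
    have hd : ∀ a, a < 3 * (n + 1) → decode B q a < B := fun a _ => decode_lt hB a
    obtain ⟨hok, hst'⟩ := hf _ hd hR hst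
    have e := fun a ha => (decode_encode (hlt g _ hd) (a := a) ha).symm
    have h1 := (hs X m g _ hX hd hR (hP _ _ (fun l hl => (hst l hl).symm) hP1) hok).1
    exact ⟨_, encode_lt (hlt g _ hd), ⟨q, g, hq, hg, hAq, hok, rfl⟩, h1.of_eq (hH' X m hX) e,
      fun l hl => (e l (by omega)).symm.trans (hst' l hl)⟩

/-- The labels `k` and `2 * k + 1` are kept for the neighbours of an additional vertex of `S`, which
is the promised neighbour of these labels. -/
def ApexOk (k : ℕ) (st : ℕ → ℕ) : Prop :=
  (st k = 0 ∨ st k = 6) ∧ (st (2 * k + 1) = 0 ∨ st (2 * k + 1) = 6)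

theorem mergeCore_low {K x y g : ℕ} {f : ℕ → ℕ} (hx : x < K) (h7 : 7 ≤ B)
    (hf : ∀ a, a < 3 * K → f a < B) {l : ℕ} (hl : l < K) : (mergeCore K B x y g f).1 l < B := by
  have h1 := hf l (by omega); have h2 := hf x (by omega); unfold mergeCore
  split_ifs with g1 g2 g3 g4
  · exact h1
  · grind
  · grind
  · simp only [mergeLive, update_apply, addE_low hl, addE_freshen_low hl]; split_ifs <;> omega
  · exact h1

theorem Correct.merge {k x y : ℕ} {H : ι → LGraph V} {cost : ι → ℕ → Prop}
    {A : ℕ → ℕ → Prop} (hA : Correct S n B (ApexOk k) H cost A) (hnk : n = 2 * (k + 1)) (h7 : 7 ≤ B)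
    (hnB : n + 1 ≤ B) (hH : ∀ X m, cost X m → ∀ v l, (H X).lab v l → l < n)
    (hxy : x ≠ y) (hxn : x < n) (hyn : y < n)
    (hdis : ∀ X m, cost X m → ∀ u, (H X).lab u x → ¬ (H X).lab u y)
    (hap : (x ≠ k ∧ x ≠ 2 * k + 1 ∧ y ≠ k ∧ y ≠ 2 * k + 1) ∨ (x = 2 * k + 1 ∧ y = k ∧
      ∀ X m, cost X m → ∀ l, l = x ∨ l = y → ∀ v, (H X).lab v l → Many ((H X).lab · l))) :
    Correct S n B (ApexOk k) (fun X => (H X).rename x y) cost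
      (stepSet n B (fun g f => mergeF (n + 1) B x y g f) A) := by
  have hst : ∀ g f, (∀ a, a < 3 * (n + 1) → f a < B) → ∀ l, l < n + 1 →
      (mergeF (n + 1) B x y g f).1 l = (mergeCore (n + 1) B x y g f).1 l := fun g f hf l hl =>
    (normIds_spec hnB fun a ha => (mergeCore_lt (by omega) (by omega) h7 hf a ha).trans_le
      (by omega)).1 l hl
  have hH' : ∀ X m, cost X m → ∀ v l, ((H X).rename x y).lab v l → l < n := by
    intro X m hX v l h; obtain ⟨-, h | ⟨rfl, -⟩⟩ := (rename_lab hxy v l).1 h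
    · exact hH X m hX v l h
    · exact hyn
  refine hA.step (by omega) ?_ hH' ?_ ?_ ?_
  · intro f g h; unfold ApexOk; grind
  · intro g f hf a ha; rcases Nat.lt_or_ge a (n + 1) with h | h
    · rw [hst g f hf a h]; exact mergeCore_low (by omega) h7 hf h
    · exact ((normIds_spec hnB fun a ha => (mergeCore_lt (by omega) (by omega) h7 hf a ha).trans_le
        (by omega)).2.2.2 a h ha).trans_le hnB
  · intro X m g f hX hf hR hP hok; have hm := mergeOk_of_mergeCore hok
    refine ⟨((mergeCore_spec (hH X m hX) hxy hxn hyn (hdis X m hX) hR hf hm).2 hok).normIds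
      (hH' X m hX) hnB fun a ha => (mergeCore_lt (by omega) (by omega) h7 hf a ha).trans_le
      (by omega), ?_⟩
    have hstat := fun l hl => mergeCore_status (f := f) (B := B) (g := g) (l := l)
      (by omega : y < n + 1) hxy hl
    unfold ApexOk at hP ⊢; rw [hst g f hf k (by omega), hst g f hf (2 * k + 1) (by omega)]
    rcases hap with ⟨h1, h2, h3, h4⟩ | ⟨rfl, rfl, -⟩
    · grind
    · obtain ⟨-, c2, c3, c4, c5, c6⟩ := hstat y (by omega); refine ⟨?_, .inl (c3 (.inl hok))⟩
      by_cases e1 : f (2 * y + 1) = 0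
      · rw [c4 e1]; exact hP.1
      · by_cases e2 : f y = 0
        · rw [c2 e1 e2]; exact hP.2
        · rcases hm with h | h | h | h
          · omega
          · omega
          · omega
          · rw [c6 e1 e2 h.1 h.2.1 h.2.2, if_pos]
            · exact .inr rfl
            · have := h.2.1; unfold Allowed at this; omega
  · intro X m st' hX hP hF hG
    obtain ⟨st, g, hg, hF1, hG1, hso, h6, hf⟩ := exists_premerge hxy hxn hyn (hdis X m hX) hF hG
    refine ⟨st, g, hg, hF1, hG1, ?_, fun f hfB hR hfst => ?_⟩
    · unfold ApexOk at hP ⊢; rcases hap with ⟨h1, h2, h3, h4⟩ | ⟨rfl, rfl, hmany⟩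
      · grind
      · have key : ∀ l, l < n → l = 2 * y + 1 ∨ l = y → st l = 0 ∨ st l = 6 := by
          intro l hln hl; by_cases h0 : st l = 0
          · exact .inl h0
          · obtain ⟨v, hv⟩ := (hF1 l hln).nonempty h0
            have h6' : st' y = 6 := by
              refine hP.1.resolve_left fun h => ?_; have := hF y hyn; rw [h] at this
              refine this v ((rename_lab hxy v y).2 ⟨hxy.symm, ?_⟩); grind
            refine (h6 h6' l hl).imp_left fun h2 => ?_
            obtain ⟨w, hw, -⟩ := (hF1 l hln).single h0 h2
            exact ((hmany X m hX l hl v hv).not_subsingleton fun u hu => (hw u).1 hu).elim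
        grind
    · obtain ⟨hok, hfin⟩ := hf f hfst
      have hlow : ∀ l, l < n → (mergeF (n + 1) B x y g f).1 l = st' l := fun l hl =>
        (hst g f hfB l (by omega)).trans (hfin B l hl)
      refine ⟨(mergeCore_spec (hH X m hX) hxy hxn hyn (hdis X m hX) hR hfB hok).1.2 ?_, hlow⟩
      rwa [zlinks_congr (hH' X m hX) (hfin B)]

theorem Correct.join {k i j : ℕ} {H : ι → LGraph V} {cost : ι → ℕ → Prop}
    {A : ℕ → ℕ → Prop} (hA : Correct S n B (ApexOk k) H cost A) (hnk : n = 2 * (k + 1)) (h7 : 7 ≤ B)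
    (hH : ∀ X m, cost X m → (H X).Proper n) (hij : i ≠ j) (hi : i < k) (hj : j < k)
    (hne : ∀ X m, cost X m → ∀ u w, (H X).lab u i → (H X).lab w j → ¬ (H X).adj u w)
    (hdis : ∀ X m, cost X m → ∀ u, (H X).lab u i → ¬ (H X).lab u j) :
    Correct S n B (ApexOk k) (fun X => (H X).join i j) cost
      (stepSet n B (fun g f => joinF (n + 1) i j g f) A) := by
  refine hA.step (by omega) ?_ (fun X m hX => (hH X m hX).lab_lt) ?_ ?_ ?_
  · intro f g h; unfold ApexOk; grind
  · exact fun g f hf => joinF_lt (by omega) (by omega) h7 hf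
  · intro X m g f hX hf hR hP hok; have hJ := joinF_ok hok
    refine ⟨(joinF_spec (hH X m hX).lab_lt (by omega) (by omega) hij (hne X m hX) (hH X m hX).symm hR hJ).2 hok, ?_⟩
    have hst := fun l hl => joinF_status (f := f) (g := g) (K := n + 1) (l := l) hl hij
      fun h => (hJ.resolve_left h.1).resolve_left h.2
    unfold ApexOk at hP ⊢; grind
  · intro X m st' hX hP hF hG
    obtain ⟨st, g, hg, hF1, hG1, hso, hf⟩ := exists_prejoin (H := H X) (by omega) (by omega) hij
      (hne X m hX) (hH X m hX).symm (hdis X m hX) hF hG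
    refine ⟨st, g, hg, hF1, hG1, ?_, fun f hfB hR hfst => ?_⟩
    · unfold ApexOk at hP ⊢; grind
    · obtain ⟨hok, hfin⟩ := hf f hfst
      refine ⟨(joinF_spec (hH X m hX).lab_lt (by omega) (by omega) hij (hne X m hX)
        (hH X m hX).symm hR hok).1.2 ?_, hfin⟩
      rwa [zlinks_congr (H := (H X).join i j) (hH X m hX).lab_lt hfin]

/-- The codes of the unions. -/
def unionSet (k n B : ℕ) (A₁ A₂ : ℕ → ℕ → Prop) (m q : ℕ) : Prop :=
  ∃ m₁ m₂ q₁ q₂, q₁ < B ^ (3 * (n + 1)) ∧ q₂ < B ^ (3 * (n + 1)) ∧ m₁ + m₂ ≤ m ∧ A₁ m₁ q₁ ∧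
    A₂ m₂ q₂ ∧ q = encode B (3 * (n + 1)) (unionF k (n + 1) B (decode B q₁) (decode B q₂))

theorem unionF_lt {k : ℕ} {f₁ f₂ : ℕ → ℕ} (hnk : n = 2 * k) (hnB : n + 1 ≤ B)
    (h1 : ∀ a, a < 3 * (n + 1) → f₁ a < B) (h2 : ∀ a, a < 3 * (n + 1) → f₂ a < B) :
    (∀ a, a < 3 * (n + 1) → unionF k (n + 1) B f₁ f₂ a < B) ∧
    ∀ l, l < n → unionF k (n + 1) B f₁ f₂ l = combineF k (n + 1) B f₁ f₂ l := by
  obtain ⟨g1, -, -, g4⟩ := normIds_spec hnB fun a ha =>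
    (combineF_lt (k := k) h1 h2 a ha).trans_le (by omega : 2 * B ≤ 3 * B)
  refine ⟨fun a ha => ?_, fun l hl => g1 l (by omega)⟩; rcases Nat.lt_or_ge a (n + 1) with h | h
  · rw [unionF, g1 a h]; have e1 := h1 a ha; have e2 := h2 (a - k) (by omega); unfold combineF
    split_ifs <;> omega
  · exact (g4 a h ha).trans_le hnB

theorem Correct.union {k : ℕ} {ι₁ ι₂ : Type*} {H₁ : ι₁ → LGraph V} {H₂ : ι₂ → LGraph V}
    {H : ι → LGraph V}
    {cost₁ : ι₁ → ℕ → Prop} {cost₂ : ι₂ → ℕ → Prop} {cost : ι → ℕ → Prop} {A₁ A₂ : ℕ → ℕ → Prop}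
    (hA1 : Correct S n B (ApexOk k) H₁ cost₁ A₁) (hA2 : Correct S n B (ApexOk k) H₂ cost₂ A₂)
    (hnk : n = 2 * (k + 1)) (h7 : 7 ≤ B) (hnB : n + 1 ≤ B)
    (hH1 : ∀ X m, cost₁ X m → (H₁ X).Proper (k + 1)) (hH2 : ∀ X m, cost₂ X m → (H₂ X).Proper (k + 1))
    (hd : ∀ X m X' m', cost₁ X m → cost₂ X' m' → ∀ u l l', (H₁ X).lab u l → ¬ (H₂ X').lab u l')
    (hjoin : ∀ X₁ m₁ X₂ m₂, cost₁ X₁ m₁ → cost₂ X₂ m₂ →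
      ∃ X, cost X (m₁ + m₂) ∧ H X = (H₁ X₁).union (k + 1) (H₂ X₂))
    (hsplit : ∀ X m, cost X m → ∃ X₁ m₁ X₂ m₂, cost₁ X₁ m₁ ∧ cost₂ X₂ m₂ ∧ m₁ + m₂ ≤ m ∧
      H X = (H₁ X₁).union (k + 1) (H₂ X₂))
    (hmono : ∀ X m m', m ≤ m' → cost X m → cost X m') :
    Correct S n B (ApexOk k) H cost (unionSet (k + 1) n B A₁ A₂) where
  sound m q h := by
    obtain ⟨m₁, m₂, q₁, q₂, hq1, hq2, hm, h1, h2, rfl⟩ := h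
    obtain ⟨X₁, c1, r1, p1⟩ := hA1.sound _ _ h1; obtain ⟨X₂, c2, r2, p2⟩ := hA2.sound _ _ h2
    obtain ⟨X, hX, hH⟩ := hjoin X₁ m₁ X₂ m₂ c1 c2
    have hd1 : ∀ a, a < 3 * (n + 1) → decode B q₁ a < B := fun a _ => decode_lt (by omega) a
    have hd2 : ∀ a, a < 3 * (n + 1) → decode B q₂ a < B := fun a _ => decode_lt (by omega) a
    obtain ⟨u1, u2⟩ := unionF_lt hnk hnB hd1 hd2
    have e := fun a ha => (decode_encode u1 (a := a) ha).symm
    have hR := unionF_spec hnk (hH1 _ _ c1) (hH2 _ _ c2) (hd _ _ _ _ c1 c2) r1 r2 hd1 hd2 hnB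
    refine ⟨X, hmono X _ _ hm hX, ?_, ?_⟩
    · rw [hH]; refine hR.of_eq (fun v l h => ?_) e; rw [hnk]
      exact (union_proper (hH1 _ _ c1) (hH2 _ _ c2)).lab_lt v l h
    · unfold ApexOk at p1 p2 ⊢
      rw [← e _ (by omega), ← e _ (by omega), u2 _ (by omega), u2 _ (by omega)]; unfold combineF
      rw [if_neg (by omega), if_neg (by omega), if_pos (by omega),
        show 2 * k + 1 - (k + 1) = k by omega]
      exact ⟨p1.1, p2.1⟩
  complete X m st hX hP hF hG := by
    obtain ⟨X₁, m₁, X₂, m₂, c1, c2, hm, hH⟩ := hsplit X m hX; rw [hH] at hF hG ⊢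
    obtain ⟨st₁, st₂, ⟨f1, g1⟩, ⟨f2, g2⟩, hst⟩ := exists_preunion (B := B) hnk (hH1 _ _ c1)
      (hH2 _ _ c2) hF hG
    have z : ∀ {H : LGraph V} {st : ℕ → ℕ}, H.Proper (k + 1) →
        (∀ l, l < n → Fits S (H.lab · l) (st l)) → st (2 * k + 1) = 0 := fun hH hf =>
      (hf _ (by omega)).eq_zero fun v hv => by have := hH.lab_lt _ _ hv; omega
    have hst' := hst st₁ st₂ (fun _ _ => rfl) (fun _ _ => rfl); have e1 := hst' k (by omega)
    have e2 := hst' (2 * k + 1) (by omega); unfold combineF at e1 e2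
    rw [if_neg (by omega), if_neg (by omega)] at e1
    rw [if_pos (by omega), show 2 * k + 1 - (k + 1) = k by omega] at e2; unfold ApexOk at hP
    obtain ⟨q₁, hq1, a1, r1, s1⟩ := hA1.complete X₁ m₁ st₁ c1
      ⟨by rw [e1]; exact hP.1, .inl (z (hH1 _ _ c1) f1)⟩ f1 g1
    obtain ⟨q₂, hq2, a2, r2, s2⟩ := hA2.complete X₂ m₂ st₂ c2
      ⟨by rw [e2]; exact hP.2, .inl (z (hH2 _ _ c2) f2)⟩ f2 g2
    have hd1 : ∀ a, a < 3 * (n + 1) → decode B q₁ a < B := fun a _ => decode_lt (by omega) a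
    have hd2 : ∀ a, a < 3 * (n + 1) → decode B q₂ a < B := fun a _ => decode_lt (by omega) a
    obtain ⟨u1, u2⟩ := unionF_lt hnk hnB hd1 hd2
    have e := fun a ha => (decode_encode u1 (a := a) ha).symm
    have hR := unionF_spec hnk (hH1 _ _ c1) (hH2 _ _ c2) (hd _ _ _ _ c1 c2) r1 r2 hd1 hd2 hnB
    refine ⟨_, encode_lt u1, ⟨m₁, m₂, q₁, q₂, hq1, hq2, hm, a1, a2, rfl⟩,
      hR.of_eq (fun v l h => ?_) e, fun l hl => ?_⟩
    · rw [hnk]; exact (union_proper (hH1 _ _ c1) (hH2 _ _ c2)).lab_lt v l h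
    · rw [← e l (by omega), u2 l hl, hst _ _ s1 s2 l hl]

end

/-! ### Labels and adjacency in expressions -/

namespace KExpr

variable {V : Type*} {k : ℕ}

theorem HasLabel.mem_verts {e : KExpr V k} {v : V} {l : Fin k} (h : e.HasLabel v l) :
    v ∈ e.verts := by
  induction e generalizing l with
  | vertex i u => exact h.1
  | union e₁ e₂ ih₁ ih₂ => exact h.elim (fun h => .inl (ih₁ h)) (fun h => .inr (ih₂ h))
  | join i j hij e ih => exact ih h
  | rename i j e ih => obtain ⟨l', h, -⟩ := h; exact ih h

theorem exists_hasLabel {e : KExpr V k} {v : V} (h : v ∈ e.verts) : ∃ l, e.HasLabel v l := by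
  induction e with
  | vertex i u => exact ⟨i, h, rfl⟩
  | union e₁ e₂ ih₁ ih₂ =>
    rcases h with h | h
    · obtain ⟨l, hl⟩ := ih₁ h; exact ⟨l, .inl hl⟩
    · obtain ⟨l, hl⟩ := ih₂ h; exact ⟨l, .inr hl⟩
  | join i j hij e ih => exact ih h
  | rename i j e ih => obtain ⟨l, hl⟩ := ih h; exact ⟨_, l, hl, rfl⟩

theorem IsDisjoint.hasLabel_unique {e : KExpr V k} (he : e.IsDisjoint) {v : V} {a b : Fin k}
    (ha : e.HasLabel v a) (hb : e.HasLabel v b) : a = b := by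
  induction e generalizing a b with
  | vertex i u => exact ha.2.trans hb.2.symm
  | union e₁ e₂ ih₁ ih₂ =>
    obtain ⟨h1, h2, hd⟩ := he; rw [Set.disjoint_left] at hd
    rcases ha with ha | ha <;> rcases hb with hb | hb
    · exact ih₁ h1 ha hb
    · exact (hd ha.mem_verts hb.mem_verts).elim
    · exact (hd hb.mem_verts ha.mem_verts).elim
    · exact ih₂ h2 ha hb
  | join i j hij e ih => exact ih he ha hb
  | rename i j e ih => obtain ⟨a', ha, rfl⟩ := ha; obtain ⟨b', hb, rfl⟩ := hb; rw [ih he ha hb]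

/-- The pairs of labels that are joined below a join of `i` and `j`, if those above it are `R`. -/
def joinedBelow (R : ℕ → ℕ → Prop) (i j : ℕ) : ℕ → ℕ → Prop :=
  fun a b => R a b ∨ (a = i ∧ b = j) ∨ (a = j ∧ b = i)

/-- The pairs of labels that are joined later below a renaming. -/
def renamedBelow (R : ℕ → ℕ → Prop) (i j : ℕ) : ℕ → ℕ → Prop :=
  fun a b => R (if a = i then j else a) (if b = i then j else b)

/-- Adjacency in the graph constructed by the expression without the joins of labels that are
joined again later.  Here `R` are the pairs of labels that are joined after the expression. -/
def thinAdj (R : ℕ → ℕ → Prop) : KExpr V k → V → V → Prop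
  | vertex _ _, _, _ => False
  | union e₁ e₂, u, v => e₁.thinAdj R u v ∨ e₂.thinAdj R u v
  | join i j _ e, u, v => e.thinAdj (joinedBelow R i j) u v ∨
      ¬ R i j ∧ ((e.HasLabel u i ∧ e.HasLabel v j) ∨ (e.HasLabel u j ∧ e.HasLabel v i))
  | rename i j e, u, v => e.thinAdj (renamedBelow R i j) u v

theorem thinAdj_mem_verts {e : KExpr V k} {R : ℕ → ℕ → Prop} {u v : V} (h : e.thinAdj R u v) :
    u ∈ e.verts ∧ v ∈ e.verts := by
  induction e generalizing R with
  | vertex i u => exact h.elim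
  | union e₁ e₂ ih₁ ih₂ =>
    exact h.elim (fun h => (ih₁ h).imp .inl .inl) (fun h => (ih₂ h).imp .inr .inr)
  | join i j hij e ih =>
    rcases h with h | ⟨-, h | h⟩
    · exact ih h
    all_goals exact ⟨h.1.mem_verts, h.2.mem_verts⟩
  | rename i j e ih => exact ih h

theorem thinAdj_symm {e : KExpr V k} {R : ℕ → ℕ → Prop} {u v : V} (h : e.thinAdj R u v) :
    e.thinAdj R v u := by
  induction e generalizing R with
  | vertex i u => exact h.elim
  | union e₁ e₂ ih₁ ih₂ => exact h.imp ih₁ ih₂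
  | join i j hij e ih =>
    rcases h with h | ⟨h0, h | h⟩
    · exact .inl (ih h)
    · exact .inr ⟨h0, .inr h.symm⟩
    · exact .inr ⟨h0, .inl h.symm⟩
  | rename i j e ih => exact ih h

theorem val_ite {i j a : Fin k} : ((if a = i then j else a : Fin k) : ℕ) =
    if (a : ℕ) = i then (j : ℕ) else a := by
  simp only [Fin.ext_iff]; split_ifs <;> rfl

/-- Vertices with labels that are joined later are not yet adjacent. -/
theorem not_thinAdj_of_later {e : KExpr V k} (he : e.IsDisjoint) {R : ℕ → ℕ → Prop}
    (hR : ∀ a b, R a b → R b a) {u v : V} {a b : Fin k} (ha : e.HasLabel u a) (hb : e.HasLabel v b)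
    (hab : R a b) : ¬ e.thinAdj R u v := by
  induction e generalizing R a b with
  | vertex i u => exact id
  | union e₁ e₂ ih₁ ih₂ =>
    obtain ⟨h1, h2, hd⟩ := he; rw [Set.disjoint_left] at hd; rintro (h | h)
    · have := thinAdj_mem_verts h
      exact ih₁ h1 hR (ha.resolve_right fun h => hd this.1 h.mem_verts)
        (hb.resolve_right fun h => hd this.2 h.mem_verts) hab h
    · have := thinAdj_mem_verts h
      exact ih₂ h2 hR (ha.resolve_left fun h => hd h.mem_verts this.1)
        (hb.resolve_left fun h => hd h.mem_verts this.2) hab h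
  | join i j hij e ih =>
    rintro (h | ⟨h0, h | h⟩)
    · refine ih he (fun a b h => ?_) ha hb (.inl hab) h; rcases h with h | h | h
      · exact .inl (hR a b h)
      · exact .inr (.inr h.symm)
      · exact .inr (.inl h.symm)
    · rw [← he.hasLabel_unique ha h.1, ← he.hasLabel_unique hb h.2] at h0; exact h0 hab
    · rw [← he.hasLabel_unique ha h.1, ← he.hasLabel_unique hb h.2] at h0; exact h0 (hR _ _ hab)
  | rename i j e ih =>
    obtain ⟨a', ha, rfl⟩ := ha; obtain ⟨b', hb, rfl⟩ := hb; rw [val_ite, val_ite] at hab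
    exact ih he (fun a b h => hR _ _ h) ha hb hab

theorem thinAdj_adj {e : KExpr V k} {R : ℕ → ℕ → Prop} {u v : V} (h : e.thinAdj R u v) :
    e.Adj u v := by
  induction e generalizing R with
  | vertex i u => exact h
  | union e₁ e₂ ih₁ ih₂ => exact h.imp ih₁ ih₂
  | join i j hij e ih => exact h.imp ih And.right
  | rename i j e ih => exact ih h

theorem adj_thinAdj_or {e : KExpr V k} {R : ℕ → ℕ → Prop} {u v : V} (h : e.Adj u v) :
    e.thinAdj R u v ∨ ∃ a b : Fin k, e.HasLabel u a ∧ e.HasLabel v b ∧ (R a b ∨ R b a) := by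
  induction e generalizing R with
  | vertex i u => exact .inl h
  | union e₁ e₂ ih₁ ih₂ =>
    rcases h with h | h
    · rcases ih₁ (R := R) h with h | ⟨a, b, h1, h2, h3⟩
      · exact .inl (.inl h)
      · exact .inr ⟨a, b, .inl h1, .inl h2, h3⟩
    · rcases ih₂ (R := R) h with h | ⟨a, b, h1, h2, h3⟩
      · exact .inl (.inr h)
      · exact .inr ⟨a, b, .inr h1, .inr h2, h3⟩
  | join i j hij e ih =>
    have key : (e.HasLabel u i ∧ e.HasLabel v j) ∨ (e.HasLabel u j ∧ e.HasLabel v i) →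
        (join i j hij e).thinAdj R u v ∨ ∃ a b : Fin k, e.HasLabel u a ∧ e.HasLabel v b ∧
          (R a b ∨ R b a) := by
      intro h; by_cases h0 : R i j
      · grind
      · exact .inl (.inr ⟨h0, h⟩)
    rcases h with h | h
    · rcases ih (R := joinedBelow R i j) h with h | ⟨a, b, h1, h2, h3⟩
      · exact .inl (.inl h)
      · simp only [joinedBelow, Fin.val_inj] at h3
        rcases h3 with (h | ⟨rfl, rfl⟩ | ⟨rfl, rfl⟩) | (h | ⟨rfl, rfl⟩ | ⟨rfl, rfl⟩)
        · exact .inr ⟨a, b, h1, h2, .inl h⟩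
        · exact key (.inl ⟨h1, h2⟩)
        · exact key (.inr ⟨h1, h2⟩)
        · exact .inr ⟨a, b, h1, h2, .inr h⟩
        · exact key (.inr ⟨h1, h2⟩)
        · exact key (.inl ⟨h1, h2⟩)
    · exact key h
  | rename i j e ih =>
    rcases ih (R := renamedBelow R i j) h with h | ⟨a, b, h1, h2, h3⟩
    · exact .inl h
    · refine .inr ⟨_, _, ⟨a, h1, rfl⟩, ⟨b, h2, rfl⟩, ?_⟩; rw [val_ite, val_ite]; exact h3

theorem thinAdj_false_iff {e : KExpr V k} {u v : V} :
    e.thinAdj (fun _ _ => False) u v ↔ e.Adj u v :=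
  ⟨thinAdj_adj, fun h => (adj_thinAdj_or h).resolve_right (by simp)⟩

/-! ### The labeled graph of a partial solution -/

/-- The graph without the vertices of `X`.  The vertices of `T` and copies of them get the
additional label `k`, which stands for the adjacency to an additional vertex.  By the copies, which
have no neighbours in the graph, this label never has exactly one vertex. -/
def graph (e : KExpr V k) (R : ℕ → ℕ → Prop) (T : Set V) (X : Finset V) : LGraph (V ⊕ V) where
  lab
    | .inl v, l => v ∉ X ∧ ((∃ l' : Fin k, e.HasLabel v l' ∧ l = l') ∨ l = k ∧ v ∈ T ∧ v ∈ e.verts)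
    | .inr v, l => l = k ∧ v ∈ T ∧ v ∈ e.verts
  adj
    | .inl u, .inl v => e.thinAdj R u v ∧ u ∉ X ∧ v ∉ X
    | _, _ => False

/-- The solution `X` consists of vertices of the expression outside `T` and has weight at most
`m`. -/
def Cost (e : KExpr V k) (T : Set V) (c : V → ℕ∞) (X : Finset V) (m : ℕ) : Prop :=
  (∀ x ∈ X, x ∈ e.verts) ∧ (∀ x ∈ X, x ∉ T) ∧ ∑ x ∈ X, c x ≤ m

theorem graph_proper (e : KExpr V k) (R : ℕ → ℕ → Prop) (T : Set V) (X : Finset V) :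
    (e.graph R T X).Proper (k + 1) where
  symm := by
    rintro (u | u) (v | v) h
    · exact ⟨thinAdj_symm h.1, h.2.2, h.2.1⟩
    all_goals exact h
  lab_lt := by
    rintro (v | v) l h
    · obtain ⟨-, ⟨l', -, rfl⟩ | ⟨rfl, -⟩⟩ := h
      · have := l'.isLt; omega
      · omega
    · obtain ⟨rfl, -⟩ := h; omega
  alive := by
    rintro (u | u) (v | v) h
    · obtain ⟨l, hl⟩ := exists_hasLabel (thinAdj_mem_verts h.1).1
      exact ⟨l, h.2.1, .inl ⟨l, hl, rfl⟩⟩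
    all_goals exact h.elim

theorem graph_congr {e : KExpr V k} {R : ℕ → ℕ → Prop} {T : Set V} {X X' : Finset V}
    (h : ∀ v ∈ e.verts, v ∈ X ↔ v ∈ X') : e.graph R T X = e.graph R T X' := by
  simp only [graph, LGraph.mk.injEq]; constructor
  · funext v l; rcases v with v | v
    · by_cases hv : v ∈ e.verts
      · simp only [h v hv]
      · have : ∀ l, ¬ e.HasLabel v l := fun l hl => hv hl.mem_verts; simp [this, hv]
    · rfl
  · funext u v; rcases u with u | u <;> rcases v with v | v <;> simp only [eq_iff_iff]
    refine and_congr_right fun hh => ?_; obtain ⟨h1, h2⟩ := thinAdj_mem_verts hh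
    rw [h u h1, h v h2]

theorem graph_lab_inl {e : KExpr V k} {R : ℕ → ℕ → Prop} {T : Set V} {X : Finset V} {v : V}
    {i : Fin k} : (e.graph R T X).lab (.inl v) i ↔ v ∉ X ∧ e.HasLabel v i := by
  simp only [graph, Fin.val_inj]; grind

theorem graph_lab_inr {e : KExpr V k} {R : ℕ → ℕ → Prop} {T : Set V} {X : Finset V} {v : V}
    {i : Fin k} : ¬ (e.graph R T X).lab (.inr v) i := fun h => absurd h.1 i.isLt.ne

theorem graph_disjoint_labels {e : KExpr V k} (he : e.IsDisjoint) {R : ℕ → ℕ → Prop} {T : Set V}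
    {X : Finset V} {i j : Fin k} (hij : i ≠ j) (u : V ⊕ V) (h : (e.graph R T X).lab u i) :
    ¬ (e.graph R T X).lab u j := by
  intro h'; rcases u with u | u
  · rw [graph_lab_inl] at h h'; exact hij (he.hasLabel_unique h.2 h'.2)
  · exact graph_lab_inr h

theorem graph_join {i j : Fin k} {hij : i ≠ j} {e : KExpr V k} {R : ℕ → ℕ → Prop} (hR : ¬ R i j)
    {T : Set V} {X : Finset V} : (join i j hij e).graph R T X =
      (e.graph (joinedBelow R i j) T X).join i j := by
  have ha : ((join i j hij e).graph R T X).adj =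
      ((e.graph (joinedBelow R i j) T X).join i j).adj := by
    funext u v; rcases u with u | u <;> rcases v with v | v <;> simp only [LGraph.join]
    · simp only [graph_lab_inl]; simp only [graph, thinAdj, eq_iff_iff]; tauto
    all_goals simp only [graph_lab_inr, and_false, false_and, or_false]; simp [graph]
  exact congrArg (fun adj => LGraph.mk _ adj) ha

/-- A join that is repeated later may be omitted. -/
theorem graph_join_of_later {i j : Fin k} {hij : i ≠ j} {e : KExpr V k} {R : ℕ → ℕ → Prop}
    (hR : R i j) {T : Set V} {X : Finset V} : (join i j hij e).graph R T X =
      e.graph (joinedBelow R i j) T X := by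
  simp only [graph, LGraph.mk.injEq]; refine ⟨rfl, ?_⟩; funext u v
  rcases u with u | u <;> rcases v with v | v <;> simp [thinAdj, hR]

theorem graph_rename {i j : Fin k} (hij : i ≠ j) {e : KExpr V k} {R : ℕ → ℕ → Prop}
    {T : Set V} {X : Finset V} : (rename i j e).graph R T X =
      (e.graph (renamedBelow R i j) T X).rename i j := by
  simp only [LGraph.rename]; simp only [graph, LGraph.mk.injEq]; refine ⟨?_, rfl⟩; funext u l
  rcases u with u | u <;> simp only [eq_iff_iff]
  · constructor
    · rintro ⟨hu, ⟨l', ⟨l'', h, rfl⟩, rfl⟩ | ⟨rfl, h⟩⟩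
      · exact ⟨l'', ⟨hu, .inl ⟨l'', h, rfl⟩⟩, val_ite⟩
      · exact ⟨l, ⟨hu, .inr ⟨rfl, h⟩⟩, by rw [if_neg i.isLt.ne']⟩
    · rintro ⟨l', ⟨hu, ⟨l'', h, rfl⟩ | ⟨rfl, h⟩⟩, rfl⟩
      · exact ⟨hu, .inl ⟨_, ⟨l'', h, rfl⟩, val_ite.symm⟩⟩
      · exact ⟨hu, .inr ⟨by rw [if_neg i.isLt.ne'], h⟩⟩
  · constructor
    · rintro ⟨rfl, h⟩; exact ⟨l, ⟨rfl, h⟩, by rw [if_neg i.isLt.ne']⟩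
    · rintro ⟨l', ⟨rfl, h⟩, rfl⟩; exact ⟨by rw [if_neg i.isLt.ne'], h⟩

theorem graph_rename_self {i : Fin k} {e : KExpr V k} {R : ℕ → ℕ → Prop}
    {T : Set V} {X : Finset V} : (rename i i e).graph R T X = e.graph (renamedBelow R i i) T X := by
  simp only [graph, LGraph.mk.injEq]; refine ⟨?_, rfl⟩; funext u l
  rcases u with u | u <;> simp only [eq_iff_iff, HasLabel, verts]; grind

end KExpr

/-- A stage of the passage from a union with separated labels to the union: the labels below `t` of
the second operand have already been merged with those of the first. -/
def LGraph.mergedUnion {V : Type*} (k t : ℕ) (H₁ H₂ : LGraph V) : LGraph V where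
  lab v l := H₁.lab v l ∨ ∃ l', H₂.lab v l' ∧ l = if l' < t then l' else k + l'
  adj u v := H₁.adj u v ∨ H₂.adj u v

theorem LGraph.mergedUnion_zero {V : Type*} {k : ℕ} {H₁ H₂ : LGraph V} :
    mergedUnion k 0 H₁ H₂ = union k H₁ H₂ := by
  simp [mergedUnion, union]

theorem LGraph.mergedUnion_succ {V : Type*} {k t : ℕ} {H₁ H₂ : LGraph V}
    (h1 : ∀ v l, H₁.lab v l → l < k) (h2 : ∀ v l, H₂.lab v l → l < k) :
    mergedUnion k (t + 1) H₁ H₂ = (mergedUnion k t H₁ H₂).rename (k + t) t := by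
  simp only [mergedUnion, rename, LGraph.mk.injEq, and_true]; grind

theorem KExpr.graph_union {V : Type*} {k : ℕ} {e₁ e₂ : KExpr V k} {R : ℕ → ℕ → Prop} {T : Set V}
    {X : Finset V} : (union e₁ e₂).graph R T X =
      (e₁.graph R T X).mergedUnion (k + 1) (k + 1) (e₂.graph R T X) := by
  have h2 := (e₂.graph_proper R T X).lab_lt
  have e : ((e₁.graph R T X).mergedUnion (k + 1) (k + 1) (e₂.graph R T X)).lab = fun v l =>
      (e₁.graph R T X).lab v l ∨ (e₂.graph R T X).lab v l := by
    funext v l; simp only [LGraph.mergedUnion, eq_iff_iff]; grind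
  have : ((union e₁ e₂).graph R T X).lab = fun v l =>
      (e₁.graph R T X).lab v l ∨ (e₂.graph R T X).lab v l := by
    funext v l
    rcases v with v | v <;> simp only [graph, HasLabel, verts, Set.mem_union, eq_iff_iff]
    · grind
    · tauto
  have ha : ((union e₁ e₂).graph R T X).adj =
      ((e₁.graph R T X).mergedUnion (k + 1) (k + 1) (e₂.graph R T X)).adj := by
    funext u v
    rcases u with u | u <;> rcases v with v | v <;>
      simp only [graph, LGraph.mergedUnion, thinAdj, eq_iff_iff, or_self]
    tauto
  rw [← e] at this
  calc (union e₁ e₂).graph R T X = ⟨((union e₁ e₂).graph R T X).lab, ((union e₁ e₂).graph R T X).adj⟩ := rfl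
    _ = _ := by rw [this, ha]

/-! ### The codes that an expression achieves -/

section

variable {V : Type*} {k : ℕ}

/-- Membership in `S` for vertices and their copies. -/
def Marked (S : Set V) : V ⊕ V → Prop
  | .inl v => v ∈ S
  | .inr _ => False

/-- The stages of the passage from a union with separated labels to the union. -/
def mergesSet (k n B : ℕ) (A : ℕ → ℕ → Prop) : ℕ → ℕ → ℕ → Prop
  | 0 => A
  | t + 1 => stepSet n B (fun g f => mergeF (n + 1) B (k + t) t g f) (mergesSet k n B A t)

/-- The code of the array of a vertex of `T` with label `i`. -/
def apexCode (k n B i : ℕ) : ℕ := 2 * B ^ i + 6 * B ^ k + B ^ (n + 1 + k)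

open Classical in
/-- `e.Achieves S T c n B R m q`: the code `q` is achieved by the expression with weight at most
`m`, if `R` are the pairs of labels that are joined later. -/
def KExpr.Achieves (S T : Set V) (c : V → ℕ∞) (n B : ℕ) : (ℕ → ℕ → Prop) → KExpr V k → ℕ → ℕ → Prop
  | _, vertex i v => fun m q =>
      if v ∈ T then q = apexCode k n B i
      else q = 0 ∧ c v ≤ m ∨ q = (if v ∈ S then 1 else 2) * B ^ (i : ℕ)
  | R, union e₁ e₂ =>
      mergesSet (k + 1) n B (unionSet (k + 1) n B (e₁.Achieves S T c n B R)
        (e₂.Achieves S T c n B R)) (k + 1)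
  | R, join i j _ e => if R i j then e.Achieves S T c n B (joinedBelow R i j) else
      stepSet n B (fun g f => joinF (n + 1) i j g f) (e.Achieves S T c n B (joinedBelow R i j))
  | R, rename i j e => if i = j then e.Achieves S T c n B (renamedBelow R i j) else
      stepSet n B (fun g f => mergeF (n + 1) B i j g f) (e.Achieves S T c n B (renamedBelow R i j))

variable {S T : Set V} {c : V → ℕ∞} {n B : ℕ} {R : ℕ → ℕ → Prop}

/-- A graph without edges and promised neighbours. -/
theorem represents_discrete {Ω : Type*} {S : Ω → Prop} {H : LGraph Ω} {f : ℕ → ℕ}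
    (hadj : ∀ u v, ¬ H.adj u v) (hf : ∀ l, l < n → Fits S (H.lab · l) (f l))
    (hH : ∀ v l, H.lab v l → l < n)
    (h2 : ∀ l, l < n → f l ≤ 2) (h1 : ∀ l m, l < n → m < n → f l ≠ 0 → f m ≠ 0 → l = m) :
    Represents S n H f := by
  have hs : ∀ a b, ¬ (zlinks S H f).soft a b := by
    rintro (u | l) (v | m) h
    · exact hadj _ _ h.1
    · have := h2 m (hH _ _ h.1); have := h.2.2; omega
    all_goals exact h
  have hh : ∀ a b, ¬ (zlinks S H f).hard a b := by
    rintro (u | l) (v | m) h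
    · exact hadj _ _ h.1
    · have := h2 m (hH _ _ h.1); have := h.2; omega
    all_goals exact h
  refine ⟨hf, fun a b h => (hh a b h).elim, ?_⟩
  have term_inl : ∀ l a, term n H f l a → ∃ v, a = .inl v ∧ H.lab v l ∧ f l ≠ 0 ∧ l < n := by
    rintro l (v | m) h
    · exact ⟨v, rfl, h.2.2, by have := h.2.1; omega, h.1⟩
    · have := h2 l h.1; have := h.2.1; omega
  intro l m a b ha hb; obtain ⟨v, rfl, hv, hl0, hl⟩ := term_inl l a ha
  obtain ⟨w, rfl, hw, hm0, hm⟩ := term_inl m b hb; obtain rfl := h1 l m hl hm hl0 hm0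
  obtain ⟨x, hx, -⟩ := (hf l hl).single hl0 (h2 l hl)
  obtain rfl : v = w := ((hx v).1 hv).trans ((hx w).1 hw).symm
  exact ⟨iff_of_true rfl (.refl _), iff_of_true rfl (.refl _)⟩

theorem decode_mul_pow {s i : ℕ} (hs : s < B) (a : ℕ) :
    decode B (s * B ^ i) a = if a = i then s else 0 := by
  have hB : 0 < B := by omega
  unfold decode; rcases lt_trichotomy a i with h | h | h
  · rw [if_neg h.ne]; obtain ⟨d, rfl⟩ := Nat.exists_eq_add_of_lt h
    rw [show s * B ^ (a + d + 1) = s * B ^ d * B * B ^ a by ring,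
      Nat.mul_div_cancel _ (Nat.pow_pos hB), Nat.mul_mod_left]
  · subst h; rw [if_pos rfl, Nat.mul_div_cancel _ (Nat.pow_pos hB), Nat.mod_eq_of_lt hs]
  · rw [if_neg h.ne', Nat.div_eq_of_lt, Nat.zero_mod]
    calc s * B ^ i < B * B ^ i := Nat.mul_lt_mul_of_pos_right hs (Nat.pow_pos hB)
      _ = B ^ (i + 1) := by ring
      _ ≤ B ^ a := Nat.pow_le_pow_right hB h

/-- The array with the code `apexCode`. -/
def apexArray (k n i : ℕ) : ℕ → ℕ := fun a =>
  if a = i then 2 else if a = k then 6 else if a = n + 1 + k then 1 else 0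

theorem apexCode_eq {i : ℕ} (hi : i < k) (hn : k < n) :
    apexCode k n B i = encode B (3 * (n + 1)) (apexArray k n i) := by
  have h : ∀ a, apexArray k n i a * B ^ a = (if a = i then 2 * B ^ i else 0) +
      (if a = k then 6 * B ^ k else 0) + (if a = n + 1 + k then B ^ (n + 1 + k) else 0) := by
    intro a; unfold apexArray; by_cases h1 : a = i
    all_goals grind
  rw [encode, Finset.sum_congr rfl fun a _ => h a, Finset.sum_add_distrib, Finset.sum_add_distrib,
    Finset.sum_ite_eq', Finset.sum_ite_eq', Finset.sum_ite_eq', if_pos (by simp; omega),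
    if_pos (by simp; omega), if_pos (by simp; omega)]
  rfl

/-- A vertex outside `S` with the label `i` and the promised neighbour of the label `k`. -/
theorem represents_apex {H : LGraph (V ⊕ V)} {i : ℕ} {v : V} (hi : i < k) (hn : k < n) (hv : v ∉ S)
    (hadj : ∀ u w, ¬ H.adj u w) (hap : ∀ u l, H.lab u l ↔
      (l = i ∧ u = .inl v) ∨ (l = k ∧ (u = .inl v ∨ u = .inr v))) :
    Represents (Marked S) n H (apexArray k n i) := by
  obtain ⟨f, hf⟩ : ∃ f, f = apexArray k n i := ⟨_, rfl⟩
  rw [← hf]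
  have hfit2 : ∀ l, l < n → Fits (Marked S) (H.lab · l) (f l) := by
    intro l hl; rw [hf]; unfold apexArray; split_ifs with h1 h2 h3
    · refine ⟨.inl v, hv, fun u => ?_⟩; simp only [hap]; subst h1; simp [hi.ne]
    · rw [h2]
      exact ⟨.inl v, .inr v, by simp, (hap _ _).2 (.inr ⟨rfl, .inl rfl⟩),
        (hap _ _).2 (.inr ⟨rfl, .inr rfl⟩)⟩
    · omega
    · intro u h; rw [hap] at h; tauto
  have fi : f i = 2 := by rw [hf]; exact if_pos rfl
  have fk : f k = 6 := by rw [hf]; exact (if_neg hi.ne').trans (if_pos rfl)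
  have fo : ∀ l, l < n → l ≠ i → l ≠ k → f l = 0 := by
    intro l hl h1 h2; simp only [hf, apexArray]; rw [if_neg h1, if_neg h2, if_neg (by omega)]
  have hsoft : ∀ a b, ¬ (zlinks (Marked S) H f).soft a b := by
    rintro (u | l) (w | m) h
    · exact hadj _ _ h.1
    · rcases (hap _ _).1 h.1 with ⟨rfl, -⟩ | ⟨rfl, -⟩
      all_goals have := h.2.2; omega
    all_goals exact h
  have hhard : ∀ a b, (zlinks (Marked S) H f).hard a b ↔
      b = .inr k ∧ (a = .inl (.inl v) ∨ a = .inl (.inr v)) := by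
    rintro (u | l) (w | m)
    · exact iff_of_false (fun h => hadj _ _ h.1) (by simp)
    · constructor
      · intro h; rcases (hap _ _).1 h.1 with ⟨rfl, -⟩ | ⟨rfl, h1⟩
        · have := h.2; omega
        · exact ⟨rfl, by simpa using h1⟩
      · rintro ⟨h1, h2⟩; simp only [inr.injEq, inl.injEq] at h1 h2; subst h1
        exact ⟨(hap _ _).2 (.inr ⟨rfl, h2⟩), .inr fk⟩
    all_goals exact iff_of_false id (by simp)
  refine ⟨hfit2, ?_, ?_⟩
  · intro a b hab hc; obtain ⟨rfl, ha⟩ := (hhard a b).1 hab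
    have h0 : ∀ d, ¬ (zlinks (Marked S) H f).soft a d ∧
        ¬ (zlinks (Marked S) H f).soft d a := fun d =>
      ⟨hsoft _ _, hsoft _ _⟩
    have := (Links.eqvGen_isolated (z := a) (fun d h => ?_) (fun d h => ?_)).1 hc; all_goals grind
  · have hterm : ∀ l a, term n H f l a → (l = i ∧ a = .inl (.inl v)) ∨ (l = k ∧ a = .inr k) := by
      intro l a h; have hl := term_lt h; rcases a with u | m
      · rcases (hap _ _).1 h.2.2 with ⟨rfl, rfl⟩ | ⟨rfl, -⟩
        · exact .inl ⟨rfl, rfl⟩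
        · have := h.2.1; omega
      · obtain ⟨-, h1, -, rfl⟩ := h; grind
    have hcomp : (zlinks (Marked S) H f).comp (.inl (.inl v))
        (.inr k) := .rel _ _ (.inr ((hhard _ _).2 ⟨rfl, .inl rfl⟩))
    have hblob : ∀ a b, (zlinks (Marked S) H f).blob a b → b = a :=
      fun a b h => (Links.eqvGen_isolated (fun d => hsoft a d) (fun d => hsoft d a)).1 h
    have fb : f (n + 1 + i) = 0 ∧ f (n + 1 + k) = 1 ∧ f (2 * (n + 1) + i) = 0 ∧
        f (2 * (n + 1) + k) = 0 := by
      simp only [hf, apexArray]; grind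
    obtain ⟨fb1, fb2, fb3, fb4⟩ := fb; intro l m a b ha hb
    rcases hterm l a ha with ⟨rfl, rfl⟩ | ⟨rfl, rfl⟩ <;>
      rcases hterm m b hb with ⟨rfl, rfl⟩ | ⟨rfl, rfl⟩
    · exact ⟨iff_of_true rfl (.refl _), iff_of_true rfl (.refl _)⟩
    · grind
    · rw [fb1, fb2, fb3, fb4]
      exact ⟨iff_of_false (by omega) fun h => by simpa using hblob _ _ h,
        iff_of_true rfl hcomp.symm⟩
    · exact ⟨iff_of_true rfl (.refl _), iff_of_true rfl (.refl _)⟩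

open Classical in
theorem Fits.eq_of_single {Ω : Type*} {S C : Ω → Prop} {s : ℕ} {v : Ω} (h : Fits S C s)
    (hC : ∀ u, C u ↔ u = v) : s = if S v then 1 else 2 := by
  have h0 : s ≠ 0 := by rintro rfl; exact h v ((hC v).2 rfl)
  have h2 : s ≤ 2 := by
    by_contra hs; exact (h.many (by omega)).not_subsingleton fun u hu => (hC u).1 hu
  obtain ⟨w, hw, h⟩ := h.single h0 h2; obtain rfl := (hC w).1 ((hw w).2 rfl); grind

set_option maxHeartbeats 1000000 in
open Classical in
theorem correct_vertex (hn : n = 2 * (k + 1)) (h7 : 7 ≤ B) (hST : ∀ v ∈ T, v ∉ S)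
    (i : Fin k) (v : V) : Correct (Marked S) n B (ApexOk k) ((KExpr.vertex i v).graph R T)
      ((KExpr.vertex i v).Cost T c) ((KExpr.vertex i v).Achieves S T c n B R) := by
  have hi := i.isLt
  have hadj : ∀ X u w, ¬ ((KExpr.vertex i v).graph R T X).adj u w := by
    rintro X (u | u) (w | w) h
    · exact h.1
    all_goals exact h
  have hlt : ∀ X u l, ((KExpr.vertex i v).graph R T X).lab u l → l < n := fun X u l h => by
    have := (KExpr.graph_proper _ R T X).lab_lt u l h; omega
  have hX : ∀ X m, (KExpr.vertex i v).Cost T c X m → X = ∅ ∨ X = {v} ∧ v ∉ T ∧ c v ≤ m := by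
    rintro X m ⟨h1, h2, h3⟩; by_cases hv : v ∈ X
    · obtain rfl : X = {v} := by
        ext u; simp only [Finset.mem_singleton]; exact ⟨h1 u, fun h => h ▸ hv⟩
      grind
    · refine .inl (Finset.eq_empty_of_forall_notMem fun u hu => hv ?_)
      obtain rfl : u = v := h1 u hu; exact hu
  -- the deleted vertex
  have hdel : v ∉ T → ∀ u l, ¬ ((KExpr.vertex i v).graph R T {v}).lab u l := by
    rintro hT (u | u) l h
    · obtain ⟨h1, ⟨l', h2, -⟩ | ⟨-, -, h2⟩⟩ := h
      · exact h1 (by simpa using h2.1)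
      · exact h1 (by simpa [KExpr.verts] using h2)
    · obtain ⟨-, h1, rfl⟩ := h; exact hT h1
  have hdelR : v ∉ T → Represents (Marked S) n ((KExpr.vertex i v).graph R T {v}) (decode B 0) := by
    intro hT; have h0 : ∀ l, decode B 0 l = 0 := fun l => by simp [decode]
    exact represents_discrete (hadj _) (fun l _ => by rw [h0]; exact fun u => hdel hT u l) (hlt _)
      (fun l _ => by rw [h0]; omega) (fun l m _ _ h => absurd (h0 l) h)
  -- a vertex outside `T`
  have hone : v ∉ T → ∀ u l, ((KExpr.vertex i v).graph R T ∅).lab u l ↔ l = i ∧ u = .inl v := by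
    intro hT u l; rcases u with u | u
    · simp only [KExpr.graph, KExpr.HasLabel, KExpr.verts, Set.mem_singleton_iff, inl.injEq]
      constructor <;> grind
    · simp only [reduceCtorEq, and_false, iff_false]; rintro ⟨-, h1, rfl⟩; exact hT h1
  have hs12 : ∃ s, s = (if v ∈ S then 1 else 2) ∧ (s = 1 ∨ s = 2) := by grind
  obtain ⟨s, hs, hs12⟩ := hs12
  have hfit1 : v ∉ T → ∀ l, Fits (Marked S) (((KExpr.vertex i v).graph R T ∅).lab · l)
      (if l = i then s else 0) := by
    intro hT l; simp only [hone hT]; by_cases hl : l = i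
    · rw [if_pos hl]; by_cases hv : v ∈ S
      · rw [hs, if_pos hv]; exact ⟨.inl v, hv, fun u => by simp [hl]⟩
      · rw [hs, if_neg hv]; exact ⟨.inl v, hv, fun u => by simp [hl]⟩
    · rw [if_neg hl]; exact fun u h => hl h.1
  have honeR : v ∉ T → Represents (Marked S) n ((KExpr.vertex i v).graph R T ∅)
      (decode B (s * B ^ (i : ℕ))) := by
    intro hT
    have h0 : ∀ l, decode B (s * B ^ (i : ℕ)) l = if l = i then s else 0 :=
      decode_mul_pow (by omega)
    refine represents_discrete (hadj _) (fun l _ => by rw [h0]; exact hfit1 hT l) (hlt _)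
      (fun l _ => by rw [h0]; split_ifs <;> omega) (fun l m _ _ => ?_)
    rw [h0, h0]; split_ifs <;> omega
  -- a vertex of `T`
  have hap : v ∈ T → ∀ u l, ((KExpr.vertex i v).graph R T ∅).lab u l ↔
      (l = i ∧ u = .inl v) ∨ (l = k ∧ (u = .inl v ∨ u = .inr v)) := by
    intro hT u l; rcases u with u | u
    · simp only [KExpr.graph, KExpr.HasLabel, KExpr.verts, Set.mem_singleton_iff, inl.injEq,
        reduceCtorEq, or_false]
      constructor <;> grind
    · simp only [KExpr.graph, KExpr.verts, Set.mem_singleton_iff, reduceCtorEq, and_false, false_or,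
        inr.injEq]
      grind
  have harr : ∀ a, a < 3 * (n + 1) → decode B (apexCode k n B i) a = apexArray k n i a := by
    intro a ha; rw [apexCode_eq hi (by omega)]; refine decode_encode (fun a _ => ?_) ha
    unfold apexArray; split_ifs <;> omega
  have hapR : v ∈ T → Represents (Marked S) n ((KExpr.vertex i v).graph R T ∅)
      (decode B (apexCode k n B i)) := by
    intro hT
    exact (represents_apex hi (by omega) (hST v hT) (hadj _) (hap hT)).of_eq (hlt _)
      fun a ha => (harr a ha).symm
  have hempty : ∀ m, (KExpr.vertex i v).Cost T c ∅ m := fun m => by simp [KExpr.Cost]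
  refine ⟨fun m q h => ?_, fun X m st hc hP hF hG => ?_⟩
  · by_cases hT : v ∈ T
    · simp only [KExpr.Achieves, if_pos hT] at h; subst h; refine ⟨∅, hempty m, hapR hT, ?_⟩
      unfold ApexOk; rw [harr _ (by omega), harr _ (by omega)]; unfold apexArray; grind
    · simp only [KExpr.Achieves, if_neg hT] at h; rcases h with ⟨rfl, hc⟩ | rfl
      · refine ⟨{v}, ⟨by simp [KExpr.verts], by simpa using hT, by simpa using hc⟩, hdelR hT, ?_⟩
        simp [ApexOk, decode]
      · rw [← hs]; refine ⟨∅, hempty m, honeR hT, ?_⟩; unfold ApexOk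
        rw [decode_mul_pow (by omega), decode_mul_pow (by omega), if_neg (by omega),
          if_neg (by omega)]
        simp
  · have hp : ∀ s a, s < B → a < 3 * (n + 1) → s * B ^ a < B ^ (3 * (n + 1)) := fun s a hs ha =>
      calc s * B ^ a < B * B ^ a := Nat.mul_lt_mul_of_pos_right hs (Nat.pow_pos (by omega))
        _ = B ^ (a + 1) := by ring
        _ ≤ _ := Nat.pow_le_pow_right (by omega) (by omega)
    by_cases hT : v ∈ T
    · obtain rfl : X = ∅ := (hX X m hc).resolve_right fun h => h.2.1 hT
      refine ⟨_, ?_, by simp only [KExpr.Achieves, if_pos hT], hapR hT, fun l hl => ?_⟩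
      · rw [apexCode_eq hi (by omega)]; refine encode_lt fun a _ => ?_; unfold apexArray
        split_ifs <;> omega
      · rw [harr l (by omega)]; unfold apexArray; split_ifs with h1 h2 h3
        · subst h1; rw [(hF i hl).eq_of_single (v := .inl v) fun u => ?_]
          · exact (if_neg (show ¬ Marked S (.inl v) from hST v hT)).symm
          grind
        · subst h2; refine (hP.1.resolve_left fun h => ?_).symm; have := hF l hl; rw [h] at this
          exact this (.inl v) ((hap hT _ _).2 (.inr ⟨rfl, .inl rfl⟩))
        · omega
        · refine ((hF l hl).eq_zero fun u hu => ?_).symm; rw [hap hT] at hu; tauto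
    · rcases hX X m hc with rfl | ⟨rfl, -, hcv⟩
      · refine ⟨s * B ^ (i : ℕ), hp s i (by omega) (by omega), ?_, honeR hT, fun l hl => ?_⟩
        · simp only [KExpr.Achieves, if_neg hT]; right; rw [hs]
        · rw [decode_mul_pow (by omega)]; split_ifs with h
          · subst h; rw [hs, (hF i hl).eq_of_single (v := .inl v) fun u => ?_]
            · rfl
            · simpa using hone hT u i
          · refine ((hF l hl).eq_zero fun u hu => ?_).symm; exact h ((hone hT _ _).1 hu).1
      · refine ⟨0, Nat.pow_pos (by omega), ?_, hdelR hT, fun l hl => ?_⟩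
        · simp only [KExpr.Achieves, if_neg hT]; exact .inl (by simpa using hcv)
        · rw [(hF l hl).eq_zero fun u => hdel hT u l]; simp [decode]

end

section

variable {V : Type*} {k : ℕ} {S T : Set V} {c : V → ℕ∞} {n B : ℕ}

theorem Correct.congr_cost {ι Ω : Type*} {S : Ω → Prop} {P : (ℕ → ℕ) → Prop} {H H' : ι → LGraph Ω}
    {cost cost' : ι → ℕ → Prop} {A : ℕ → ℕ → Prop} (h : Correct S n B P H cost A)
    (hc : ∀ X m, cost X m ↔ cost' X m) (hH : ∀ X m, cost X m → H X = H' X) :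
    Correct S n B P H' cost' A where
  sound m q hq := by
    obtain ⟨X, h1, h2, h3⟩ := h.sound m q hq; exact ⟨X, (hc X m).1 h1, hH X m h1 ▸ h2, h3⟩
  complete X m st hX hP hF hG := by
    have e := hH X m ((hc X m).2 hX); rw [← e] at hF hG
    obtain ⟨q, h1, h2, h3, h4⟩ := h.complete X m st ((hc X m).2 hX) hP hF hG
    exact ⟨q, h1, h2, e ▸ h3, h4⟩

theorem KExpr.Cost.mono {e : KExpr V k} {X : Finset V} {m m' : ℕ} (h : m ≤ m')
    (hX : e.Cost T c X m) : e.Cost T c X m' :=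
  ⟨hX.1, hX.2.1, hX.2.2.trans (by exact_mod_cast h)⟩

open Classical in
theorem KExpr.cost_union {e₁ e₂ : KExpr V k} (hd : Disjoint e₁.verts e₂.verts) {X₁ X₂ : Finset V}
    {m₁ m₂ : ℕ} (h1 : e₁.Cost T c X₁ m₁) (h2 : e₂.Cost T c X₂ m₂) :
    (union e₁ e₂).Cost T c (X₁ ∪ X₂) (m₁ + m₂) := by
  obtain ⟨a1, b1, c1⟩ := h1; obtain ⟨a2, b2, c2⟩ := h2
  have hX : Disjoint X₁ X₂ := by
    rw [Set.disjoint_left] at hd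
    exact Finset.disjoint_left.2 fun x hx hx' => hd (a1 x hx) (a2 x hx')
  refine ⟨fun x hx => ?_, fun x hx => ?_, ?_⟩
  · exact (Finset.mem_union.1 hx).imp (a1 x) (a2 x)
  · grind
  · rw [Finset.sum_union hX, Nat.cast_add]; exact add_le_add c1 c2

open Classical in
theorem KExpr.cost_split {e₁ e₂ : KExpr V k} (hd : Disjoint e₁.verts e₂.verts) {X : Finset V}
    {m : ℕ} (h : (union e₁ e₂).Cost T c X m) : ∃ m₁ m₂, m₁ + m₂ ≤ m ∧
      e₁.Cost T c (X.filter (· ∈ e₁.verts)) m₁ ∧ e₂.Cost T c (X.filter (· ∈ e₂.verts)) m₂ := by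
  obtain ⟨h1, h2, h3⟩ := h; rw [Set.disjoint_left] at hd
  have hX : X = X.filter (· ∈ e₁.verts) ∪ X.filter (· ∈ e₂.verts) := by
    ext x; simp only [Finset.mem_union, Finset.mem_filter]
    exact ⟨fun hx => (h1 x hx).imp (fun h => ⟨hx, h⟩) (fun h => ⟨hx, h⟩),
      fun h => h.elim And.left And.left⟩
  have hdis : Disjoint (X.filter (· ∈ e₁.verts)) (X.filter (· ∈ e₂.verts)) :=
    Finset.disjoint_left.2 fun x hx hx' => hd (Finset.mem_filter.1 hx).2 (Finset.mem_filter.1 hx').2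
  rw [hX, Finset.sum_union hdis] at h3
  have f1 : ∑ x ∈ X.filter (· ∈ e₁.verts), c x ≠ ⊤ := fun h => by simp [h] at h3
  have f2 : ∑ x ∈ X.filter (· ∈ e₂.verts), c x ≠ ⊤ := fun h => by simp [h] at h3
  obtain ⟨m₁, hm1⟩ := ENat.ne_top_iff_exists.1 f1; obtain ⟨m₂, hm2⟩ := ENat.ne_top_iff_exists.1 f2
  refine ⟨m₁, m₂, ?_, ⟨fun x hx => (Finset.mem_filter.1 hx).2,
    fun x hx => h2 x (Finset.mem_filter.1 hx).1, hm1.ge⟩, ⟨fun x hx => (Finset.mem_filter.1 hx).2,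
    fun x hx => h2 x (Finset.mem_filter.1 hx).1, hm2.ge⟩⟩
  rw [← hm1, ← hm2] at h3; exact_mod_cast h3

open Classical in
theorem KExpr.graph_filter {e : KExpr V k} {R : ℕ → ℕ → Prop} {X : Finset V} :
    e.graph R T (X.filter (· ∈ e.verts)) = e.graph R T X :=
  graph_congr fun v hv => by simp [hv]

open Classical in
/-- The states achieved with weight at most `m` are those of the partial solutions of weight at most
`m`. -/
theorem KExpr.correct (hn : n = 2 * (k + 1)) (h7 : 7 ≤ B) (hnB : n + 1 ≤ B)
    (hST : ∀ v ∈ T, v ∉ S) (e : KExpr V k) (he : e.IsDisjoint) (R : ℕ → ℕ → Prop)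
    (hR : ∀ a b, R a b → R b a) :
    Correct (Marked S) n B (ApexOk k) (e.graph R T) (e.Cost T c) (e.Achieves S T c n B R) := by
  have hproper : ∀ (e : KExpr V k) R X, (e.graph R T X).Proper n := fun e R X => by
    have h := e.graph_proper R T X
    exact ⟨h.symm, fun v l hl => by have := h.lab_lt v l hl; omega, h.alive⟩
  induction e generalizing R with
  | vertex i v => exact correct_vertex hn h7 hST i v
  | union e₁ e₂ ih₁ ih₂ =>
    obtain ⟨he1, he2, hd⟩ := he; have hd' := Set.disjoint_left.1 hd
    have hlab : ∀ (e : KExpr V k) X u l, (e.graph R T X).lab u l →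
        (∃ v, u = .inl v ∧ v ∈ e.verts) ∨ ∃ v, u = .inr v ∧ v ∈ e.verts := by
      rintro e X (u | u) l h
      · refine .inl ⟨u, rfl, ?_⟩; rcases h.2 with ⟨l', h, -⟩ | h
        · exact h.mem_verts
        · exact h.2.2
      · exact .inr ⟨u, rfl, h.2.2⟩
    have hdis : ∀ X X' u l l', (e₁.graph R T X).lab u l → ¬ (e₂.graph R T X').lab u l' := by grind
    have h0 : Correct (Marked S) n B (ApexOk k)
        (fun X => (e₁.graph R T X).union (k + 1) (e₂.graph R T X)) ((union e₁ e₂).Cost T c)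
        (unionSet (k + 1) n B (e₁.Achieves S T c n B R) (e₂.Achieves S T c n B R)) := by
      refine (ih₁ he1 R hR).union (ih₂ he2 R hR) hn h7 hnB (fun X _ _ => graph_proper _ _ _ _)
        (fun X _ _ => graph_proper _ _ _ _) (fun X _ X' _ _ _ => hdis X X') ?_ ?_
        (fun X m m' h hX => hX.mono h)
      · intro X₁ m₁ X₂ m₂ h1 h2; refine ⟨X₁ ∪ X₂, cost_union hd h1 h2, ?_⟩; congr 1
        · refine graph_congr fun v hv => ?_
          rw [Finset.mem_union, or_iff_left fun h => hd' hv (h2.1 v h)]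
        · refine graph_congr fun v hv => ?_
          rw [Finset.mem_union, or_iff_right fun h => hd' (h1.1 v h) hv]
      · intro X m hX; obtain ⟨m₁, m₂, hm, h1, h2⟩ := cost_split hd hX
        exact ⟨_, m₁, _, m₂, h1, h2, hm, by rw [graph_filter, graph_filter]⟩
    have hstage : ∀ t, t ≤ k + 1 → Correct (Marked S) n B (ApexOk k)
        (fun X => (e₁.graph R T X).mergedUnion (k + 1) t (e₂.graph R T X))
        ((union e₁ e₂).Cost T c) (mergesSet (k + 1) n B (unionSet (k + 1) n B
          (e₁.Achieves S T c n B R) (e₂.Achieves S T c n B R)) t) := by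
      intro t
      induction t with
      | zero => intro _; simp only [LGraph.mergedUnion_zero]; exact h0
      | succ t ih =>
        intro ht; have l1 := fun X => (e₁.graph_proper R T X).lab_lt
        have l2 := fun X => (e₂.graph_proper R T X).lab_lt
        simp only [LGraph.mergedUnion_succ (l1 _) (l2 _)]
        -- the labels of this stage
        have hx : ∀ X u, ((e₁.graph R T X).mergedUnion (k + 1) t (e₂.graph R T X)).lab u
            (k + 1 + t) → (e₂.graph R T X).lab u t := by
          rintro X u (h | ⟨l', h, h'⟩)
          · have := l1 X u _ h; omega
          · grind
        have hy : ∀ X u, ((e₁.graph R T X).mergedUnion (k + 1) t (e₂.graph R T X)).lab u t →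
            (e₁.graph R T X).lab u t := by
          rintro X u (h | ⟨l', h, h'⟩); all_goals grind
        refine (ih (by omega)).merge hn h7 hnB (fun X m _ v l h => ?_) (by omega) (by omega)
          (by omega) (fun X m _ u h h' => hdis X X u _ _ (hy X u h') (hx X u h)) ?_
        · rcases h with h | ⟨l', h, rfl⟩
          all_goals grind
        · by_cases htk : t = k
          · subst htk; refine .inr ⟨by omega, rfl, fun X m hX l hl v hv => ?_⟩
            have many : ∀ (e : KExpr V t) v, (e.graph R T X).lab v t → ∃ w, w ∈ T ∧
                (e.graph R T X).lab (.inl w) t ∧ (e.graph R T X).lab (.inr w) t := by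
              rintro e (v | v) h
              · obtain ⟨h1, ⟨l', -, h2⟩ | ⟨h2, h3, h4⟩⟩ := h
                · exact absurd h2 l'.isLt.ne'
                · exact ⟨v, h3, ⟨h1, .inr ⟨h2, h3, h4⟩⟩, h2, h3, h4⟩
              · obtain ⟨h2, h3, h4⟩ := h
                exact ⟨v, h3, ⟨fun h => hX.2.1 v h h3, .inr ⟨h2, h3, h4⟩⟩, h2, h3, h4⟩
            rcases hl with rfl | rfl
            · obtain ⟨w, -, h1, h2⟩ := many e₂ v (hx X v hv)
              exact ⟨.inl w, .inr w, by simp, .inr ⟨t, h1, by simp⟩, .inr ⟨t, h2, by simp⟩⟩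
            · obtain ⟨w, -, h1, h2⟩ := many e₁ v (hy X v hv)
              exact ⟨.inl w, .inr w, by simp, .inl h1, .inl h2⟩
          omega
    exact (hstage (k + 1) le_rfl).congr_cost (fun _ _ => .rfl) fun X m _ => graph_union.symm
  | join i j hij e ih =>
    have hR' : ∀ a b, joinedBelow R i j a b → joinedBelow R i j b a := by
      rintro a b (h | h | h)
      · exact .inl (hR a b h)
      · exact .inr (.inr h.symm)
      · exact .inr (.inl h.symm)
    have hi := i.isLt; have hj := j.isLt; by_cases hRij : R i j
    · simp only [Achieves, if_pos hRij]
      exact (ih he _ hR').congr_cost (fun _ _ => .rfl) fun X m _ => (graph_join_of_later hRij).symm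
    · simp only [Achieves, if_neg hRij]
      refine ((ih he _ hR').join hn h7 (fun X _ _ => hproper _ _ X)
        (fun h => hij (Fin.ext h)) hi hj ?_
        (fun X _ _ => graph_disjoint_labels (e := e) he hij)).congr_cost (fun _ _ => .rfl)
        fun X m _ => (graph_join hRij).symm
      rintro X m - (u | u) (w | w) hu hw h
      · rw [graph_lab_inl] at hu hw
        exact not_thinAdj_of_later (e := e) he hR' hu.2 hw.2 (.inr (.inl ⟨rfl, rfl⟩)) h.1
      all_goals exact h
  | rename i j e ih =>
    have hR' : ∀ a b, renamedBelow R i j a b → renamedBelow R i j b a := fun a b h => hR _ _ h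
    have hi := i.isLt; have hj := j.isLt; by_cases hij : i = j
    · subst hij; simp only [Achieves, if_pos]
      exact (ih he _ hR').congr_cost (fun _ _ => .rfl) fun X m _ => graph_rename_self.symm
    · simp only [Achieves, if_neg hij]
      exact ((ih he _ hR').merge hn h7 hnB (fun X _ _ => (hproper _ _ X).lab_lt)
        (fun h => hij (Fin.ext h)) (by omega) (by omega)
        (fun X _ _ => graph_disjoint_labels (e := e) he hij)
        (.inl ⟨by omega, by omega, by omega, by omega⟩)).congr_cost (fun _ _ => .rfl)
        fun X m _ => (graph_rename hij).symm

/-! ### The problems in terms of codes -/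

open Classical in
/-- Statuses without promises. -/
theorem exists_quiet_fits {Ω : Type*} (S : Ω → Prop) (H : LGraph Ω) (T₀ : ℕ → Prop)
    (hT₀ : ∀ l, T₀ l → (∃ v, H.lab v l) → Many (H.lab · l)) :
    ∃ st : ℕ → ℕ, (∀ l, Fits S (H.lab · l) (st l)) ∧ (∀ l, ¬ T₀ l → st l ≤ 3) ∧
      ∀ l, T₀ l → st l = 0 ∨ st l = 6 := by
  have : ∀ l, ∃ s, Fits S (H.lab · l) s ∧ (¬ T₀ l → s ≤ 3) ∧ (T₀ l → s = 0 ∨ s = 6) := by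
    intro l; by_cases h : ∃ v, H.lab v l
    · by_cases h0 : T₀ l
      · exact ⟨6, hT₀ l h0 h, fun h => absurd h0 h, fun _ => .inr rfl⟩
      · obtain ⟨s, h1, -, h2, -⟩ := exists_fits S h (g := 0) (by omega); grind
    · push Not at h
      exact ⟨0, h, fun _ => by omega, fun _ => .inl rfl⟩
  choose st h1 h2 h3 using this
  exact ⟨st, h1, h2, h3⟩

variable {G : SimpleGraph V}

theorem graph_adj_iff {e : KExpr V k} (hG : e.Describes G) {X : Finset V} {u v : V} :
    (e.graph (fun _ _ => False) T X).adj (.inl u) (.inl v) ↔ adjOff G X u v := by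
  simp only [KExpr.graph, KExpr.thinAdj_false_iff, ← hG.2.2, adjOff, Finset.mem_coe]

theorem cost_iff {e : KExpr V k} (hG : e.Describes G) {X : Finset V} {m : ℕ} :
    e.Cost T c X m ↔ (∀ x ∈ X, x ∉ T) ∧ ∑ x ∈ X, c x ≤ m := by
  simp [KExpr.Cost, hG.2.1]

open Classical in
theorem subsetFVS_iff_achieves (hn : n = 2 * (k + 1)) (h7 : 7 ≤ B) (hnB : n + 1 ≤ B)
    {e : KExpr V k} (hG : e.Describes G) {p : ℕ} :
    SubsetFVS G S c p ↔ ∃ q, q < B ^ (3 * (n + 1)) ∧ e.Achieves S ∅ c n B (fun _ _ => False) p q := by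
  have hA := e.correct (S := S) (T := ∅) (c := c) hn h7 hnB (by simp) hG.1 (fun _ _ => False) (by simp)
  rw [subsetFVS_iff]; constructor
  · rintro ⟨X, hX, hgood⟩
    have hk : ∀ v l, l = k → ¬ (e.graph (fun _ _ => False) ∅ X).lab v l := by
      rintro (v | v) l rfl h
      · obtain ⟨-, ⟨l', -, h⟩ | ⟨-, h, -⟩⟩ := h
        · exact l'.isLt.ne h.symm
        · exact h
      · exact h.2.1
    obtain ⟨st, h1, h2, -⟩ := exists_quiet_fits (Marked S) (e.graph (fun _ _ => False) ∅ X)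
      (fun _ => False) (by simp)
    have z : ∀ l, k ≤ l → st l = 0 := fun l hl => (h1 l).eq_zero fun v hv => by
      rcases Nat.eq_or_lt_of_le hl with h | h
      · exact hk v l h.symm hv
      · have := (e.graph_proper _ _ _).lab_lt v l hv; omega
    have hst : ∀ l, st l ≤ 3 := fun l => h2 l id
    have hsoft : ∀ a b, (zlinks (Marked S) (e.graph (fun _ _ => False) ∅ X) st).soft a b →
        ∃ u v, a = inl (inl u) ∧ b = inl (inl v) ∧ (offLinks G S X).soft u v := by
      rintro ((u | u) | l) ((v | v) | m) h
      · exact ⟨u, v, rfl, rfl, (graph_adj_iff hG).1 h.1, h.2⟩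
      all_goals first | exact h.1.elim | exact h.elim | skip
      all_goals have := h.2.2; have := hst m; omega
    have hhard : ∀ a b, (zlinks (Marked S) (e.graph (fun _ _ => False) ∅ X) st).hard a b →
        ∃ u v, a = inl (inl u) ∧ b = inl (inl v) ∧ (offLinks G S X).hard u v := by
      rintro ((u | u) | l) ((v | v) | m) h
      · exact ⟨u, v, rfl, rfl, (graph_adj_iff hG).1 h.1, h.2⟩
      all_goals first | exact h.1.elim | exact h.elim | skip
      all_goals have := h.2; have := hst m; omega
    obtain ⟨q, hq, hq', -⟩ := hA.complete X p st ((cost_iff hG).2 ⟨by simp, hX⟩)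
      ⟨.inl (z _ le_rfl), .inl (z _ (by omega))⟩ (fun l _ => h1 l) fun a b hab => by
        obtain ⟨x, y, rfl, rfl, hxy⟩ := hhard a b hab
        refine hgood.not_compWithout (fun a : (V ⊕ V) ⊕ ℕ => match a with | inl (inl v) => v | _ => x)
          (x' := x) (y' := y) (.inl hxy) (.refl x) (.refl y) (fun a b h => ?_) (fun a b h hne => ?_)
        · obtain ⟨u, v, rfl, rfl, h1⟩ := hsoft a b h; exact .rel _ _ h1
        · obtain ⟨u, v, rfl, rfl, h1⟩ := hhard a b h; refine .rel _ _ (.inr ⟨h1, fun he => hne ?_⟩)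
          simpa using he
    exact ⟨q, hq, hq'⟩
  · rintro ⟨q, -, hq⟩; obtain ⟨X, hX, hR, -⟩ := hA.sound p q hq
    refine ⟨X, ((cost_iff hG).1 hX).2, fun x y hxy => ?_⟩
    have hs : ∀ u v, (offLinks G S X).soft u v → (zlinks (Marked S)
        (e.graph (fun _ _ => False) ∅ X) (decode B q)).soft (inl (inl u)) (inl (inl v)) :=
      fun u v h => ⟨(graph_adj_iff hG).2 h.1, h.2⟩
    have hh : ∀ u v, (offLinks G S X).hard u v → (zlinks (Marked S)
        (e.graph (fun _ _ => False) ∅ X) (decode B q)).hard (inl (inl u)) (inl (inl v)) :=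
      fun u v h => ⟨(graph_adj_iff hG).2 h.1, h.2⟩
    refine hR.2.1.not_compWithout (fun v => inl (inl v)) (.inl (hh x y hxy)) (.refl _) (.refl _)
      (fun a b h => .rel _ _ (hs a b h)) fun a b h hne => .rel _ _ (.inr ⟨hh a b h, fun he => hne ?_⟩)
    simpa using he

open Classical in
theorem nodeMultiwayCut_iff_achieves (hn : n = 2 * (k + 1)) (h7 : 7 ≤ B) (hnB : n + 1 ≤ B)
    {e : KExpr V k} (hG : e.Describes G) {p : ℕ} : NodeMultiwayCut G T c p ↔
      ∃ q, q < B ^ (3 * (n + 1)) ∧ e.Achieves ∅ T c n B (fun _ _ => False) p q := by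
  have hA := e.correct (S := ∅) (T := T) (c := c) hn h7 hnB (by simp) hG.1 (fun _ _ => False) (by simp)
  rw [nodeMultiwayCut_iff]
  have hk : ∀ X u, (e.graph (fun _ _ => False) T X).lab u k ↔
      (∃ v, u = inl v ∧ v ∉ X ∧ v ∈ T) ∨ ∃ v, u = inr v ∧ v ∈ T := by
    rintro X (u | u)
    · simp only [KExpr.graph, hG.2.1, Set.mem_univ, and_true, true_and, inl.injEq,
        exists_eq_left', reduceCtorEq, false_and, exists_false, or_false]
      grind
    · simp [KExpr.graph, hG.2.1]
  constructor
  · rintro ⟨X, hX, hXT, hcut⟩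
    obtain ⟨st, h1, h2, h3⟩ := exists_quiet_fits (Marked ∅) (e.graph (fun _ _ => False) T X)
      (· = k) (by
        rintro l rfl ⟨v, hv⟩; have : ∃ w, w ∈ T := by grind
        obtain ⟨w, hw⟩ := this
        exact ⟨inl w, inr w, by simp, (hk X _).2 (.inl ⟨w, rfl, fun h => hXT w h hw, hw⟩),
          (hk X _).2 (.inr ⟨w, rfl, hw⟩)⟩)
    have hsoft : ∀ a b, (zlinks (Marked ∅) (e.graph (fun _ _ => False) T X) st).soft a b →
        ∃ u v, a = inl (inl u) ∧ b = inl (inl v) ∧ adjOff G X u v := by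
      rintro ((u | u) | l) ((v | v) | m) h
      · exact ⟨u, v, rfl, rfl, (graph_adj_iff hG).1 h.1⟩
      all_goals first | exact h.1.elim | exact h.elim | skip
      all_goals
        have := h.2.2; by_cases hm : m = k
        · have := h3 m hm; omega
        · have := h2 m hm; omega
    have hhard : ∀ a b, (zlinks (Marked ∅) (e.graph (fun _ _ => False) T X) st).hard a b →
        b = inr k ∧ ((∃ v, a = inl (inl v) ∧ v ∈ T) ∨ ∃ v, a = inl (inr v) ∧ v ∈ T) := by
      rintro ((u | u) | l) ((v | v) | m) h
      · exact absurd h.2 (by simp [Marked])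
      all_goals first | exact h.1.elim | exact h.elim | skip
      all_goals
        have hm : m = k := by by_contra hm; have := h2 m hm; have := h.2; omega
        subst hm; have := (hk X _).1 h.1
        simp only [inl.injEq, reduceCtorEq, false_and, exists_false, or_false, false_or,
          inr.injEq] at this
        refine ⟨rfl, ?_⟩; obtain ⟨w, rfl, hw⟩ := this
      all_goals grind
    obtain ⟨q, hq, hq', -⟩ := hA.complete X p st ((cost_iff hG).2 ⟨hXT, hX⟩)
      ⟨h3 k rfl, .inl ((h1 _).eq_zero fun v hv => by
        have := (e.graph_proper _ _ _).lab_lt v _ hv; omega)⟩ (fun l _ => h1 l) fun a b hab hc => by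
        obtain ⟨rfl, ⟨v, rfl, hv⟩ | ⟨v, rfl, hv⟩⟩ := hhard a b hab
        · have := (Links.eqvGen_invariant (fun a => ∃ w, a = inl (inl w) ∧
            EqvGen (adjOff G X) v w) (fun a b h => ?_) hc).1 ⟨v, rfl, .refl _⟩
          · obtain ⟨w, h, -⟩ := this; simp at h
          · rcases h with h | ⟨h, hne⟩
            · obtain ⟨u, w, rfl, rfl, h1⟩ := hsoft a b h; simp only [inl.injEq, exists_eq_left']
              exact ⟨fun h' => h'.trans _ _ _ (.rel _ _ h1),
                fun h' => h'.trans _ _ _ (.symm _ _ (.rel _ _ h1))⟩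
            · grind
        · have := (Links.eqvGen_invariant (fun a => a = inl (inr v)) (fun a b h => ?_) hc).1 rfl
          · simp at this
          · grind
    exact ⟨q, hq, hq'⟩
  · rintro ⟨q, -, hq⟩; obtain ⟨X, hX, hR, hP⟩ := hA.sound p q hq
    obtain ⟨hXT, hX⟩ := (cost_iff hG).1 hX; refine ⟨X, hX, hXT, fun a ha b hb hab hc => ?_⟩
    have hlab : ∀ a, a ∈ T → (e.graph (fun _ _ => False) T X).lab (inl a) k := fun a ha =>
      (hk X _).2 (.inl ⟨a, rfl, fun h => hXT a h ha, ha⟩)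
    have h6 : decode B q k = 6 := hP.1.resolve_left fun h => by
      have := hR.1 k (by omega); rw [h] at this; exact this _ (hlab a ha)
    have hhard : ∀ a, a ∈ T → (zlinks (Marked ∅) (e.graph (fun _ _ => False) T X)
        (decode B q)).hard (inl (inl a)) (inr k) := fun a ha => ⟨hlab a ha, .inr h6⟩
    refine hR.2.1 _ _ (hhard a ha) ?_
    refine EqvGen.trans _ (inl (inl b)) _ (Links.eqvGen_lift (fun v => inl (inl v))
      (fun u v h => .rel _ _ (.inl ⟨(graph_adj_iff hG).2 h, by simp [Marked], by simp [Marked]⟩)) hc)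
      (.rel _ _ (.inr ⟨hhard b hb, ?_⟩))
    simpa [eq_comm] using hab

end

/-! ### Verification of programs of the word RAM -/

namespace WordRAM

open Term Store

/-- The store after an assignment to a register. -/
def Store.set (s : Store) (r x : ℕ) : Store := { s with reg := update s.reg r x }

/-- The store after an assignment to a memory cell. -/
def Store.put (s : Store) (a x : ℕ) : Store := { s with mem := update s.mem a x }

@[simp] theorem Store.set_reg (s : Store) (r x q : ℕ) :
    (s.set r x).reg q = if q = r then x else s.reg q := update_apply _ _ _ _

@[simp] theorem Store.set_mem (s : Store) (r x : ℕ) : (s.set r x).mem = s.mem := rfl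

@[simp] theorem Store.put_reg (s : Store) (a x : ℕ) : (s.put a x).reg = s.reg := rfl

theorem Store.put_mem (s : Store) (a x b : ℕ) :
    (s.put a x).mem b = if b = a then x else s.mem b := update_apply _ _ _ _

instance (x : ℕ) : OfNat Term x := ⟨.lit x⟩
instance : Add Term := ⟨.op .add⟩
instance : Sub Term := ⟨.op .sub⟩
instance : Mul Term := ⟨.op .mul⟩
instance : Div Term := ⟨.op .div⟩
instance : Mod Term := ⟨.op .mod⟩

/-- Comparison of two expressions. -/
def Term.less (a b : Term) : Term := .op .lt a b

/-- Equality test for two expressions. -/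
def Term.equal (a b : Term) : Term := .op .eq a b

/-- Conjunction; a value other than `0` counts as true. -/
def Term.and (a b : Term) : Term := less 0 a - equal b 0

/-- Disjunction; a value other than `0` counts as true. -/
def Term.or (a b : Term) : Term := 1 - (equal a 0 - less 0 b)

/-- The value of an expression if there is no overflow. -/
def Term.val (s : Store) : Term → ℕ
  | .lit x => x
  | .reg r => s.reg r
  | .load a => s.mem (a.val s)
  | .op o a b => o.apply (a.val s) (b.val s)

/-- No overflow occurs, if constants below `1024` are words. -/
def Term.Ok (w : ℕ) (s : Store) : Term → Prop
  | .lit x => x < 1024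
  | .reg _ => True
  | .load a => a.Ok w s
  | .op .add a b => a.Ok w s ∧ b.Ok w s ∧ a.val s + b.val s < 2 ^ w
  | .op .mul a b => a.Ok w s ∧ b.Ok w s ∧ a.val s * b.val s < 2 ^ w
  | .op _ a b => a.Ok w s ∧ b.Ok w s

section

variable {w : ℕ} {s : Store} {a b : Term}

@[simp] theorem Term.val_ofNat (x : ℕ) : (no_index (OfNat.ofNat x) : Term).val s = OfNat.ofNat x := (rfl)
@[simp] theorem Term.val_lit (x : ℕ) : (lit x).val s = x := (rfl)
@[simp] theorem Term.val_reg (r : ℕ) : (reg r).val s = s.reg r := (rfl)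
@[simp] theorem Term.val_load : (load a).val s = s.mem (a.val s) := (rfl)
@[simp] theorem Term.val_add : (a + b).val s = a.val s + b.val s := (rfl)
@[simp] theorem Term.val_sub : (a - b).val s = a.val s - b.val s := (rfl)
@[simp] theorem Term.val_mul : (a * b).val s = a.val s * b.val s := (rfl)
@[simp] theorem Term.val_div : (a / b).val s = a.val s / b.val s := (rfl)
@[simp] theorem Term.val_mod : (a % b).val s = a.val s % b.val s := (rfl)
@[simp] theorem Term.val_less : (a.less b).val s = if a.val s < b.val s then 1 else 0 := (rfl)
@[simp] theorem Term.val_equal : (a.equal b).val s = if a.val s = b.val s then 1 else 0 := (rfl)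
@[simp] theorem Term.val_and : (a.and b).val s = if a.val s ≠ 0 ∧ b.val s ≠ 0 then 1 else 0 := by
  by_cases h1 : a.val s = 0 <;> by_cases h2 : b.val s = 0 <;>
    simp [and, h1, h2, Nat.pos_iff_ne_zero]
@[simp] theorem Term.val_or : (a.or b).val s = if a.val s ≠ 0 ∨ b.val s ≠ 0 then 1 else 0 := by
  by_cases h1 : a.val s = 0 <;> by_cases h2 : b.val s = 0 <;> simp [or, h1, h2, Nat.pos_iff_ne_zero]

@[simp] theorem Term.ok_ofNat (x : ℕ) :
    (no_index (OfNat.ofNat x) : Term).Ok w s ↔ OfNat.ofNat x < 1024 := .rfl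
@[simp] theorem Term.ok_lit (x : ℕ) : (lit x).Ok w s ↔ x < 1024 := .rfl
@[simp] theorem Term.ok_reg (r : ℕ) : (reg r).Ok w s := trivial
@[simp] theorem Term.ok_load : (load a).Ok w s ↔ a.Ok w s := .rfl
@[simp] theorem Term.ok_add : (a + b).Ok w s ↔ a.Ok w s ∧ b.Ok w s ∧ a.val s + b.val s < 2 ^ w :=
  .rfl
@[simp] theorem Term.ok_mul : (a * b).Ok w s ↔ a.Ok w s ∧ b.Ok w s ∧ a.val s * b.val s < 2 ^ w :=
  .rfl
@[simp] theorem Term.ok_sub : (a - b).Ok w s ↔ a.Ok w s ∧ b.Ok w s := .rfl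
@[simp] theorem Term.ok_div : (a / b).Ok w s ↔ a.Ok w s ∧ b.Ok w s := .rfl
@[simp] theorem Term.ok_mod : (a % b).Ok w s ↔ a.Ok w s ∧ b.Ok w s := .rfl
@[simp] theorem Term.ok_less : (a.less b).Ok w s ↔ a.Ok w s ∧ b.Ok w s := .rfl
@[simp] theorem Term.ok_equal : (a.equal b).Ok w s ↔ a.Ok w s ∧ b.Ok w s := .rfl
@[simp] theorem Term.ok_and : (a.and b).Ok w s ↔ a.Ok w s ∧ b.Ok w s := by simp [and]
@[simp] theorem Term.ok_or : (a.or b).Ok w s ↔ a.Ok w s ∧ b.Ok w s := by simp [or]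

@[simp] theorem Term.cost_ofNat (x : ℕ) : (no_index (OfNat.ofNat x) : Term).cost = 1 := rfl
@[simp] theorem Term.cost_reg (r : ℕ) : (reg r).cost = 1 := rfl
@[simp] theorem Term.cost_load : (load a).cost = a.cost + 1 := rfl
@[simp] theorem Term.cost_add : (a + b).cost = a.cost + b.cost + 1 := rfl
@[simp] theorem Term.cost_sub : (a - b).cost = a.cost + b.cost + 1 := rfl
@[simp] theorem Term.cost_mul : (a * b).cost = a.cost + b.cost + 1 := rfl
@[simp] theorem Term.cost_div : (a / b).cost = a.cost + b.cost + 1 := rfl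
@[simp] theorem Term.cost_mod : (a % b).cost = a.cost + b.cost + 1 := rfl
@[simp] theorem Term.cost_less : (a.less b).cost = a.cost + b.cost + 1 := rfl
@[simp] theorem Term.cost_equal : (a.equal b).cost = a.cost + b.cost + 1 := rfl
@[simp] theorem Term.cost_and : (a.and b).cost = a.cost + b.cost + 5 := by simp [and]; omega
@[simp] theorem Term.cost_or : (a.or b).cost = a.cost + b.cost + 7 := by simp [or]; omega

/-- All registers and memory cells hold words, and numbers below `1024` are words. -/
structure WF (w : ℕ) (s : Store) : Prop where
  ten_le : 10 ≤ w
  reg : ∀ r, s.reg r < 2 ^ w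
  mem : ∀ a, s.mem a < 2 ^ w

theorem WF.lit_lt (hs : WF w s) {x : ℕ} (hx : x < 1024) : x < 2 ^ w :=
  hx.trans_le ((by norm_num : 1024 = 2 ^ 10) ▸ Nat.pow_le_pow_right (by norm_num) hs.ten_le)

theorem WF.set (hs : WF w s) {r x : ℕ} (hx : x < 2 ^ w) : WF w (s.set r x) :=
  ⟨hs.ten_le, fun q => by rw [set_reg]; split_ifs; exacts [hx, hs.reg q], hs.mem⟩

theorem WF.put (hs : WF w s) {b x : ℕ} (hx : x < 2 ^ w) : WF w (s.put b x) :=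
  ⟨hs.ten_le, hs.reg, fun q => by rw [put_mem]; split_ifs; exacts [hx, hs.mem q]⟩

theorem eval_eq (hs : WF w s) (h : a.Ok w s) : a.eval w s = some (a.val s) ∧ a.val s < 2 ^ w := by
  have hb : ∀ c : Prop, [Decidable c] → (if c then 1 else 0) < 2 ^ w := fun c _ =>
    lt_of_le_of_lt (by split_ifs <;> omega) (hs.lit_lt (x := 1) (by norm_num))
  have hw : ∀ x, x < 2 ^ w → toWord w x = some x := fun x hx => if_pos hx
  induction a with
  | lit x => exact ⟨hw _ (hs.lit_lt h), hs.lit_lt h⟩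
  | reg r => exact ⟨hw _ (hs.reg r), hs.reg r⟩
  | load a ih =>
    refine ⟨?_, hs.mem _⟩; rw [Term.eval, (ih h).1, Option.bind_some, hw _ (hs.mem _)]; rfl
  | op o a b iha ihb =>
    have hab : a.Ok w s ∧ b.Ok w s := by cases o <;> first | exact h | exact ⟨h.1, h.2.1⟩
    have hlt : o.apply (a.val s) (b.val s) < 2 ^ w := by
      have h1 := (iha hab.1).2
      cases o with
      | add => exact h.2.2
      | mul => exact h.2.2
      | sub => exact (Nat.sub_le _ _).trans_lt h1
      | div => exact (Nat.div_le_self _ _).trans_lt h1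
      | mod => exact (Nat.mod_le _ _).trans_lt h1
      | lt => exact hb _
      | eq => exact hb _
    refine ⟨?_, hlt⟩
    rw [Term.eval, (iha hab.1).1, Option.bind_some, (ihb hab.2).1, Option.bind_some, hw _ hlt]; rfl

/-- Started in the store `s`, the program halts within `T` steps in a store with the property
`Q`. -/
def Ends (w : ℕ) (P : Prog) (T : ℕ) (s : Store) (Q : Store → Prop) : Prop :=
  WF w s → ∃ t s', Exec w P s t s' ∧ t ≤ T ∧ WF w s' ∧ Q s'

variable {P P' : Prog} {T T' : ℕ} {Q Q' : Store → Prop} {r : ℕ}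

theorem Ends.mono (h : Ends w P T s Q) (hT : T ≤ T') (hQ : ∀ s', WF w s' → Q s' → Q' s') :
    Ends w P T' s Q' := fun hs => by
  obtain ⟨t, s', h1, h2, h3, h4⟩ := h hs; exact ⟨t, s', h1, h2.trans hT, h3, hQ s' h3 h4⟩

theorem Ends.le (h : Ends w P T s Q) (hT : T ≤ T') : Ends w P T' s Q := h.mono hT fun _ _ h => h

theorem Ends.imp (h : Ends w P T s Q) (hQ : ∀ s', WF w s' → Q s' → Q' s') : Ends w P T s Q' :=
  h.mono le_rfl hQ

theorem Ends.skip (h : Q s) : Ends w .skip 1 s Q := fun hs => ⟨1, s, .skip s, le_rfl, hs, h⟩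

theorem Ends.assign (ha : a.Ok w s) (h : Q (s.set r (a.val s))) :
    Ends w (.assign r a) (a.cost + 1) s Q := fun hs =>
  ⟨_, _, .assign (eval_eq hs ha).1, le_rfl, hs.set (eval_eq hs ha).2, h⟩

theorem Ends.store (hb : b.Ok w s) (ha : a.Ok w s) (h : Q (s.put (b.val s) (a.val s))) :
    Ends w (.store b a) (b.cost + a.cost + 1) s Q := fun hs =>
  ⟨_, _, .store (eval_eq hs hb).1 (eval_eq hs ha).1, le_rfl, hs.put (eval_eq hs ha).2, h⟩

theorem Ends.seq (h : Ends w P T s fun s' => Ends w P' T' s' Q) :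
    Ends w (.seq P P') (T + T') s Q := fun hs => by
  obtain ⟨t, s', h1, h2, h3, h4⟩ := h hs; obtain ⟨t', s'', h1', h2', h3', h4'⟩ := h4 h3
  exact ⟨_, _, .seq h1 h1', by omega, h3', h4'⟩

/-- The body is executed with the values `0, 1, …` of the register `r`, as long as they are below
the bound. -/
def forUp (r : ℕ) (bound : Term) (body : Prog) : Prog :=
  .seq (.assign r 0) (.loop (less (.reg r) bound) (.seq body (.assign r (.reg r + 1))))

/-- The invariant is stated for the counter `i` about to be used; `T` bounds the time of the body. -/
theorem Ends.forUp {bound : Term} {body : Prog} {m : ℕ} (Inv : ℕ → Store → Prop)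
    (hm : m < 2 ^ w) (h0 : Inv 0 (s.set r 0))
    (hb : ∀ i s', i ≤ m → Inv i s' → bound.Ok w s' ∧ bound.val s' = m)
    (hstep : ∀ i s', i < m → WF w s' → s'.reg r = i → Inv i s' →
      Ends w body T s' fun s'' => s''.reg r = i ∧ Inv (i + 1) (s''.set r (i + 1)))
    (hend : ∀ s', s'.reg r = m → Inv m s' → Q s') :
    Ends w (forUp r bound body) (m * (T + bound.cost + 8) + bound.cost + 6) s Q := by
  have key : ∀ d i s', i + d = m → s'.reg r = i → Inv i s' → Ends w
      (.loop (less (.reg r) bound) (.seq body (.assign r (.reg r + 1))))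
      (d * (T + bound.cost + 8) + bound.cost + 4) s' Q := by
    intro d
    induction d with
    | zero =>
      intro i s' hi hr hI hs; obtain rfl : i = m := by omega
      obtain ⟨hok, hv⟩ := hb i s' le_rfl hI
      have he := (eval_eq hs (a := less (.reg r) bound) ⟨trivial, hok⟩).1
      rw [val_less, val_reg, hr, hv, if_neg (lt_irrefl _)] at he
      refine ⟨_, s', .loopFalse he, ?_, hs, hend s' hr hI⟩; simp only [cost_less, cost_reg]; omega
    | succ d ih =>
      intro i s' hi hr hI hs; obtain ⟨hok, hv⟩ := hb i s' (by omega) hI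
      have he := (eval_eq hs (a := less (.reg r) bound) ⟨trivial, hok⟩).1
      rw [val_less, val_reg, hr, hv, if_pos (by omega)] at he
      obtain ⟨t, s1, e1, l1, w1, q1, q1'⟩ := hstep i s' (by omega) hs hr hI hs
      have hok1 : (reg r + 1).Ok w s1 := by
        simp only [ok_add, ok_reg, ok_ofNat, val_reg, val_ofNat, q1]
        exact ⟨trivial, by norm_num, by omega⟩
      have he1 := eval_eq w1 hok1; rw [val_add, val_reg, q1, val_ofNat] at he1
      obtain ⟨t2, s2, e2, l2, w2, q2⟩ := ih (i + 1) (s1.set r (i + 1)) (by omega) (by simp) q1'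
        (w1.set he1.2)
      refine ⟨_, s2, .loopTrue he (by omega) (.seq e1 (.assign he1.1)) e2, ?_, w2, q2⟩
      simp only [cost_less, cost_reg, cost_add, cost_ofNat]
      grind
  refine (Ends.seq (Ends.assign (a := 0) (by simp) (key m 0 _ (by omega) (by simp) h0))).le ?_
  simp only [cost_ofNat]; omega

/-- The body is executed `c` times, and the test succeeds before each execution. -/
def Iterates (w : ℕ) (test : Term) (body : Prog) (T : ℕ) : ℕ → (Store → Prop) → Store → Prop
  | 0, Q => Q
  | c + 1, Q => fun s => test.Ok w s ∧ test.val s ≠ 0 ∧ Ends w body T s (Iterates w test body T c Q)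

theorem Iterates.imp {test : Term} {body : Prog} {c : ℕ} (h : Iterates w test body T c Q s)
    (hQ : ∀ s', Q s' → Q' s') : Iterates w test body T c Q' s := by
  induction c generalizing s with
  | zero => exact hQ s h
  | succ c ih => exact ⟨h.1, h.2.1, h.2.2.imp fun s' _ h' => ih h'⟩

theorem Iterates.add {test : Term} {body : Prog} {c d : ℕ}
    (h : Iterates w test body T c (Iterates w test body T d Q) s) :
    Iterates w test body T (c + d) Q s := by
  induction c generalizing s with
  | zero => rwa [Nat.zero_add]
  | succ c ih =>
    rw [show c + 1 + d = c + d + 1 by ring]; exact ⟨h.1, h.2.1, h.2.2.imp fun s' _ h' => ih h'⟩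

theorem Ends.loop {test : Term} {body : Prog} {c : ℕ}
    (h : Iterates w test body T c (fun s' => test.Ok w s' ∧ test.val s' = 0 ∧ Q s') s) :
    Ends w (.loop test body) (c * (T + test.cost + 1) + test.cost + 1) s Q := by
  induction c generalizing s with
  | zero =>
    intro hs; obtain ⟨h1, h2, h3⟩ := h
    exact ⟨_, s, .loopFalse (h2 ▸ (eval_eq hs h1).1), by omega, hs, h3⟩
  | succ c ih =>
    intro hs; obtain ⟨h1, h2, h3⟩ := h; obtain ⟨t, s', e1, l1, w1, q1⟩ := h3 hs
    obtain ⟨t2, s2, e2, l2, w2, q2⟩ := ih q1 w1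
    refine ⟨_, s2, .loopTrue (eval_eq hs h1).1 h2 e1 e2, ?_, w2, q2⟩
    grind

end

/-! ### Programs for the operations on arrays -/

infixr:50 " ;; " => Prog.seq
infix:60 " ←ᵣ " => Prog.assign

/-- The content of a register. -/
abbrev R (r : ℕ) : Term := .reg r

/-- The content of a memory cell. -/
abbrev M (a : Term) : Term := .load a

/-- The store `s'` agrees with `s` in the registers below `d` and outside of the memory segment
`[lo, hi)`. -/
structure Keeps (d lo hi : ℕ) (s s' : Store) : Prop where
  reg : ∀ r, r < d → s'.reg r = s.reg r
  mem : ∀ a, a < lo ∨ hi ≤ a → s'.mem a = s.mem a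

/-- The cells from `A` on hold the first `N` values of `f`. -/
def Holds (A N : ℕ) (f : ℕ → ℕ) (s : Store) : Prop := ∀ a, a < N → s.mem (A + a) = f a

/-- The registers below `20` hold the parameters: `k + 1` labels, `K` slots, the base `B`, the number
`Q` of codes, the infinite cost `I`, the addresses of two arrays and of a table, which start at `A`,
and the size of a matrix.  These numbers are small compared with the words. -/
structure Env (w k K B Q I A : ℕ) (s : Store) : Prop where
  slots : K = 2 * k + 3
  base : B = 2 * k + 10
  codes : Q = B ^ (3 * K)
  regs : s.reg 1 = k + 1 ∧ s.reg 2 = K ∧ s.reg 3 = B ∧ s.reg 4 = 3 * K ∧ s.reg 5 = Q ∧ s.reg 6 = I ∧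
    s.reg 7 = A ∧ s.reg 8 = A + 3 * K ∧ s.reg 12 = 3 * B ∧ s.reg 17 = A + 6 * K ∧
    s.reg 18 = A + K ∧ s.reg 19 = A + 2 * K ∧ s.reg 13 = k * k ∧ s.reg 14 = k
  word : A + 6 * K + 4 * Q + 3 * B + 2 * I + 1024 < 2 ^ w
  word_sq : Q * Q < 2 ^ w

section

variable {w k K B Q I A d d' lo hi N T : ℕ} {s s' s'' : Store} {f : ℕ → ℕ}

theorem Keeps.refl : Keeps d lo hi s s := ⟨fun _ _ => rfl, fun _ _ => rfl⟩

theorem Keeps.trans (h : Keeps d lo hi s s') (h' : Keeps d' lo hi s' s'')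
    (hd : d ≤ d' := by norm_num) :
    Keeps d lo hi s s'' :=
  ⟨fun r hr => (h'.reg r (hr.trans_le hd)).trans (h.reg r hr),
    fun a ha => (h'.mem a ha).trans (h.mem a ha)⟩

theorem Keeps.set (h : Keeps d lo hi s s') {r x : ℕ} (hr : d ≤ r := by norm_num) :
    Keeps d lo hi s (s'.set r x) :=
  ⟨fun q hq => by rw [set_reg, if_neg (by omega), h.reg q hq], h.mem⟩

theorem Keeps.put (h : Keeps d lo hi s s') {a x : ℕ} (h1 : lo ≤ a) (h2 : a < hi) :
    Keeps d lo hi s (s'.put a x) :=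
  ⟨h.reg, fun b hb => by rw [put_mem, if_neg (by omega), h.mem b hb]⟩

theorem Keeps.widen (h : Keeps d lo hi s s') {lo' hi' : ℕ} (h1 : lo' ≤ lo) (h2 : hi ≤ hi')
    (hd : d' ≤ d := by norm_num) : Keeps d' lo' hi' s s' :=
  ⟨fun r hr => h.reg r (hr.trans_le hd), fun a ha => h.mem a (by omega)⟩

theorem Holds.set (h : Holds A N f s) {r x : ℕ} : Holds A N f (s.set r x) := h

theorem Holds.put (h : Holds A N f s) {b x a : ℕ} (hb : b = A + a) :
    Holds A N (update f a x) (s.put b x) := fun c hc => by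
  rw [put_mem, update_apply, h c hc, hb]; simp

theorem Holds.keep (h : Holds A N f s) (hk : Keeps d lo hi s s') (hA : A + N ≤ lo ∨ hi ≤ A) :
    Holds A N f s' := fun a ha => (hk.mem _ (by omega)).trans (h a ha)

theorem Env.congr (h : Env w k K B Q I A s) (hr : ∀ r, r < 20 → s'.reg r = s.reg r) :
    Env w k K B Q I A s' := by
  refine ⟨h.slots, h.base, h.codes, ?_, h.word, h.word_sq⟩
  simp only [hr, Nat.reduceLT, h.regs, and_self]

theorem Env.keep (h : Env w k K B Q I A s) (hk : Keeps d lo hi s s') (hd : 20 ≤ d := by norm_num) :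
    Env w k K B Q I A s' :=
  h.congr fun r hr => hk.reg r (hr.trans_le hd)

theorem Env.set (h : Env w k K B Q I A s) {r x : ℕ} (hr : 20 ≤ r := by norm_num) :
    Env w k K B Q I A (s.set r x) :=
  h.congr fun q hq => by rw [set_reg, if_neg (by omega)]

/-- The number of codes exceeds all other parameters, so powers of `Q` bound all running times. -/
theorem codes_large (hK : K = 2 * k + 3) (hB : B = 2 * k + 10) (hQ : Q = B ^ (3 * K)) :
    10 ^ 9 ≤ Q ∧ 3 * K ≤ Q ∧ 10 * B ≤ Q ∧ k * k ≤ Q := by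
  have h1 : B ^ 9 ≤ Q := hQ ▸ Nat.pow_le_pow_right (by omega) (by omega)
  have h2 : B ^ 2 ≤ B ^ 9 := Nat.pow_le_pow_right (by omega) (by norm_num)
  have h3 : 10 ^ 9 ≤ B ^ 9 := Nat.pow_le_pow_left (by omega) _
  have h4 : 10 * B ≤ B * B := Nat.mul_le_mul_right _ (by omega)
  have h5 : k * k ≤ B * B := Nat.mul_le_mul (by omega) (by omega); rw [pow_two] at h2; omega

/-- The time bounds below are powers of `Q`, which exceeds all constants. -/
theorem Env.large (h : Env w k K B Q I A s) : 10 ^ 9 ≤ Q ∧ K ≤ Q ∧ 3 * K ≤ Q ∧ 10 * B ≤ Q := by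
  have := codes_large h.slots h.base h.codes; omega

theorem Env.forUp_le (h : Env w k K B Q I A s) {m c i j : ℕ} (hm : m ≤ Q ^ i) (hT : T ≤ Q ^ j)
    (hc : c ≤ 1000) : m * (T + c + 8) + c + 6 ≤ Q ^ (i + j + 1) := by
  have h1 := h.large.1; have h2 : 1 ≤ Q ^ j := Nat.one_le_pow _ _ (by omega)
  have h0 : 1 ≤ Q ^ i := Nat.one_le_pow _ _ (by omega)
  have h3 : m * (T + c + 8) ≤ Q ^ i * (1009 * Q ^ j) := Nat.mul_le_mul hm (by omega)
  have h5 : Q ^ (i + j + 1) = Q ^ i * Q ^ j * Q := by rw [pow_succ, pow_add]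
  have h6 : Q ^ i * Q ^ j * 2020 ≤ Q ^ i * Q ^ j * Q := Nat.mul_le_mul_left _ (by omega)
  grind

theorem pow_gap (hQ : 10 ^ 9 ≤ Q) (i : ℕ) {j : ℕ} (hij : i < j := by norm_num) :
    1 ≤ Q ^ i ∧ 10 ^ 9 * Q ^ i ≤ Q ^ j :=
  ⟨Nat.one_le_pow _ _ (by omega), ((Nat.mul_le_mul_left _ hQ).trans_eq' (mul_comm _ _)).trans
    ((pow_succ Q i).symm.trans_le (Nat.pow_le_pow_right (by omega) hij))⟩

theorem Env.pow_le (h : Env w k K B Q I A s) (i : ℕ) {j : ℕ} (hij : i < j := by norm_num) :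
    1 ≤ Q ^ i ∧ 10 ^ 9 * Q ^ i ≤ Q ^ j := pow_gap h.large.1 i hij

variable {r : ℕ} {a b : Term} {P P' : Prog} {Z Z' : Store → Prop} {T' : ℕ}

theorem Ends.assignWithin (h : Z (s.set r (a.val s))) (ha : a.Ok w s := by simp)
    (hT : a.cost + 1 ≤ T := by (try simp) <;> omega) : Ends w (r ←ᵣ a) T s Z :=
  (Ends.assign ha h).le hT

theorem Ends.storeWithin (h : Z (s.put (b.val s) (a.val s))) (hb : b.Ok w s := by simp)
    (ha : a.Ok w s := by simp) (hT : b.cost + a.cost + 1 ≤ T := by (try simp) <;> omega) :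
    Ends w (.store b a) T s Z :=
  (Ends.store hb ha h).le hT

theorem Ends.skipWithin (h : Z s) (hT : 1 ≤ T := by (try simp) <;> omega) : Ends w .skip T s Z :=
  (Ends.skip h).le hT

theorem Ends.seqWithin (h : Ends w P T' s Z') (h' : ∀ s', Z' s' → Ends w P' (T - T') s' Z)
    (hT : T' ≤ T := by (try simp) <;> omega) : Ends w (P ;; P') T s Z :=
  (Ends.seq (h.imp fun s' _ hs => h' s' hs)).le (by omega)

theorem Ends.assignSeq (h : Ends w P (T - (a.cost + 1)) (s.set r (a.val s)) Z)
    (ha : a.Ok w s := by simp) (hT : a.cost + 1 ≤ T := by (try simp) <;> omega) :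
    Ends w (r ←ᵣ a ;; P) T s Z :=
  (Ends.seq (.assign ha h)).le (by omega)

theorem Ends.storeSeq (h : Ends w P (T - (b.cost + a.cost + 1)) (s.put (b.val s) (a.val s)) Z)
    (hb : b.Ok w s := by simp) (ha : a.Ok w s := by simp)
    (hT : b.cost + a.cost + 1 ≤ T := by (try simp) <;> omega) : Ends w (.store b a ;; P) T s Z :=
  (Ends.seq (.store hb ha h)).le (by omega)

theorem Ends.condWithin (h1 : a.val s ≠ 0 → Ends w P (T - (a.cost + 1)) s Z)
    (h2 : a.val s = 0 → Ends w P' (T - (a.cost + 1)) s Z) (ha : a.Ok w s := by simp)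
    (hT : a.cost + 1 ≤ T := by (try simp) <;> omega) : Ends w (.cond a P P') T s Z := by
  intro hs; by_cases h : a.val s = 0
  · obtain ⟨t, s', g1, g2, g3, g4⟩ := h2 h hs
    exact ⟨_, _, .condFalse (h ▸ (eval_eq hs ha).1) g1, by omega, g3, g4⟩
  · obtain ⟨t, s', g1, g2, g3, g4⟩ := h1 h hs
    exact ⟨_, _, .condTrue (eval_eq hs ha).1 h g1, by omega, g3, g4⟩

end

/-- Replaces the entries `R 61` by `R 62` in the segment of length `K` from `R 60` on. -/
def relabP : Prog :=
  forUp 63 (R 2) (.cond (.equal (M (R 60 + R 63)) (R 61)) (.store (R 60 + R 63) (R 62)) .skip)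

/-- Renumbers the entries of the segment of length `K` from `R 55` on, with numbers from `R 56`
on. -/
def renumP : Prog :=
  forUp 57 (R 2) (60 ←ᵣ R 55 ;; 61 ←ᵣ M (R 55 + R 57) ;; 62 ←ᵣ R 56 + R 57 ;; relabP)

/-- Renumbers the entries of the segment that starts at the address in register `a`, without
increasing numbers below `K`. -/
def renumTwiceP (a : ℕ) : Prog := 55 ←ᵣ R a ;; 56 ←ᵣ R 12 ;; renumP ;; 56 ←ᵣ 0 ;; renumP

/-- Computes `normIds`. -/
def normP : Prog := renumTwiceP 18 ;; renumTwiceP 19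

/-- Replaces, in the segment of length `K` that starts at the address in register `a`, the entry of
the slot `R 51` by the entry of the slot `R 52`. -/
def relabSlotsP (a : ℕ) : Prog :=
  60 ←ᵣ R a ;; 61 ←ᵣ M (R a + R 51) ;; 62 ←ᵣ M (R a + R 52) ;; relabP

/-- Computes `addE` for the slots `R 51` and `R 52`, where `R 50` tells whether the edge is hard. -/
def addP : Prog := .cond (R 50)
    (.cond (.equal (M (R 19 + R 51)) (M (R 19 + R 52))) (53 ←ᵣ 0) (relabSlotsP 19 ;; 53 ←ᵣ 1))
    (.cond (.equal (M (R 18 + R 51)) (M (R 18 + R 52))) (53 ←ᵣ 1)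
      (.cond (.equal (M (R 19 + R 51)) (M (R 19 + R 52))) (53 ←ᵣ 0)
        (relabSlotsP 19 ;; relabSlotsP 18 ;; 53 ←ᵣ 1)))

section

variable {w k K B Q I A d d' lo hi N T : ℕ} {s s' s'' : Store} {f : ℕ → ℕ}

theorem ends_relabP (E : Env w k K B Q I A s) {o : ℕ} (ho : o + K ≤ 3 * K) (h60 : s.reg 60 = A + o)
    (hf : Holds A (3 * K) f s) : Ends w relabP (Q ^ 3) s fun s' =>
      Holds A (3 * K) (relabel o K (s.reg 61) (s.reg 62) f) s' ∧ Keeps 60 A (A + 3 * K) s s' := by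
  have hw := E.word
  refine (Ends.forUp (T := 40) (m := K) (fun i s' => Holds A (3 * K)
    (relabel o i (s.reg 61) (s.reg 62) f) s' ∧ Keeps 63 A (A + 3 * K) s s') (by omega) ?_ ?_ ?_ ?_).le (E.forUp_le (i := 1) (j := 1) (by simpa using E.large.2.1) ?_ (by simp))
  · refine ⟨fun a ha => ?_, Keeps.refl.set⟩; rw [relab_outside (by omega)]; exact hf a ha
  · intro i s' hi h; have := (E.keep h.2).regs; simp [this]
  · intro i s' hi _ h63 ⟨h1, h2⟩
    have hr : s'.reg 60 = A + o ∧ s'.reg 61 = s.reg 61 ∧ s'.reg 62 = s.reg 62 :=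
      ⟨(h2.reg _ (by norm_num)).trans h60, h2.reg _ (by norm_num), h2.reg _ (by norm_num)⟩
    have ha := h1 (o + i) (by omega); rw [relab_outside (by omega)] at ha
    refine .condWithin (fun hc => .storeWithin ?_ (hb := by simp [hr, h63]; omega))
      (fun hc => .skipWithin ?_) (ha := by simp [hr, h63]; omega)
    all_goals simp only [val_equal, val_load, val_add, val_reg, hr, h63, add_assoc, ha] at hc ⊢
    · have hfa : f (o + i) = s.reg 61 := by by_contra h; simp [h] at hc
      refine ⟨h63, fun a ha => ?_, (h2.put (by omega) (by omega)).set⟩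
      simp only [set_mem, put_mem, relabel]; split_ifs with h3 h4 h4
      · rfl
      · grind
      · rw [h1 a ha, relabel, if_pos ⟨h4.1, by omega, h4.2.2⟩]
      · rw [h1 a ha, relabel, if_neg fun h5 => h4 ⟨h5.1, by omega, h5.2.2⟩]
    · have hfa : f (o + i) ≠ s.reg 61 := by intro h; simp [h] at hc
      refine ⟨trivial, fun a ha => ?_, h2.set⟩; rw [set_mem, h1 a ha]
      refine if_congr ⟨fun h => ⟨h.1, by omega, h.2.2⟩, fun h => ⟨h.1, ?_, h.2.2⟩⟩ rfl rfl
      grind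
  · intro s' _ h; exact ⟨h.1, h.2.widen le_rfl le_rfl⟩
  · have := E.large; rw [pow_one]; omega

theorem ends_renumP (E : Env w k K B Q I A s) {o off : ℕ} (ho : o + K ≤ 3 * K)
    (h55 : s.reg 55 = A + o) (h56 : s.reg 56 = off) (hoff : off ≤ 3 * B)
    (hf : Holds A (3 * K) f s) : Ends w renumP (Q ^ 6) s fun s' =>
      Holds A (3 * K) (renum o K off f K) s' ∧ Keeps 57 A (A + 3 * K) s s' := by
  have hw := E.word; have hl := E.large
  refine (Ends.forUp (m := K) (fun i s' => Holds A (3 * K) (renum o K off f i) s' ∧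
    Keeps 57 A (A + 3 * K) s s') (by omega) ⟨hf, Keeps.refl.set⟩ ?_ ?_ fun s' _ h => h).le
      (E.forUp_le (T := Q ^ 3 + 20) (i := 1) (j := 4) (by simpa using hl.2.1) ?_ (by simp))
  · intro i s' hi h; have := (E.keep h.2).regs; simp [this]
  · intro i s' hi _ h57 ⟨h1, h2⟩
    have hr : s'.reg 55 = A + o ∧ s'.reg 56 = off :=
      ⟨(h2.reg _ (by norm_num)).trans h55, (h2.reg _ (by norm_num)).trans h56⟩
    have E' := E.keep h2
    refine .assignSeq (.assignSeq (ha := by simp [hr, h57]; omega) <|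
      .assignSeq (ha := by simp [hr, h57]; omega) <|
      (ends_relabP (E'.set.set.set) ho (by simp [hr]) h1).mono (by simp) fun s'' _ h => ?_)
    have ha := h1 (o + i) (by omega); simp [hr, h57, add_assoc, ha] at h
    refine ⟨by simpa [h57] using h.2.reg 57 (by norm_num), h.1, Keeps.set ?_ le_rfl⟩
    exact h2.set.set.set.trans h.2
  · have := E.pow_le 3 (j := 4); omega

theorem ends_renumTwiceP (E : Env w k K B Q I A s) {o a : ℕ} (ho : o + K ≤ 3 * K)
    (ha : s.reg a = A + o) (hf : Holds A (3 * K) f s) :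
    Ends w (renumTwiceP a) (3 * Q ^ 6) s fun s' =>
      Holds A (3 * K) (renum o K 0 (renum o K (3 * B) f K) K) s' ∧ Keeps 55 A (A + 3 * K) s s' := by
  have hr := E.regs; have hT := E.pow_le 6 (j := 7); have hT0 := E.pow_le 0 (j := 6)
  have H0 : Keeps 55 A (A + 3 * K) s s := .refl
  refine .assignSeq <| .assignSeq <| .seqWithin (ends_renumP (E.set.set
    (by norm_num)) (o := o) (off := 3 * B) ho (by simp [ha]) (by simp [hr]) le_rfl hf)
    fun s1 ⟨f1, k1⟩ => .assignSeq ?_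
  have H1 := H0.set.set.trans k1; have E1 := E.keep H1
  refine Ends.mono (ends_renumP (E1.set) (o := o) (off := 0) ho
    (by simp [k1.reg, ha]) (by simp) (by omega) f1) (by simp; omega) fun s2 _ ⟨f2, k2⟩ =>
    ⟨f2, H1.set.trans k2⟩

theorem ends_normP (E : Env w k K B Q I A s) (hf : Holds A (3 * K) f s) :
    Ends w normP (Q ^ 7) s fun s' =>
      Holds A (3 * K) (normIds K B f) s' ∧ Keeps 55 A (A + 3 * K) s s' := by
  have hr := E.regs; have hT := E.pow_le 6 (j := 7)
  refine .seqWithin (ends_renumTwiceP E (o := K) (by omega) (by simp [hr]) hf) fun s1 ⟨f1, k1⟩ => ?_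
  refine (ends_renumTwiceP (E.keep k1) (o := 2 * K) (by omega)
    (by simp [k1.reg, hr]) f1).mono (by omega) fun s2 _ ⟨f2, k2⟩ => ⟨f2, k1.trans k2⟩

theorem ends_relabSlotsP (E : Env w k K B Q I A s) {o a x y : ℕ} (ho : o + K ≤ 3 * K)
    (ha : s.reg a = A + o) (ha' : a < 50) (hx : s.reg 51 = x) (hy : s.reg 52 = y) (hxK : x < K)
    (hyK : y < K) (hf : Holds A (3 * K) f s) :
    Ends w (relabSlotsP a) (2 * Q ^ 3) s fun s' => Holds A (3 * K) (relabel o K (f (o + x)) (f (o + y)) f) s' ∧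
        Keeps 60 A (A + 3 * K) s s' := by
  have hr := E.regs; have hw := E.word; have hT0 := E.pow_le 0 (j := 3)
  have n60 : a ≠ 60 := by omega
  have n61 : a ≠ 61 := by omega
  refine .assignSeq <| .assignSeq (ha := by simp [n60, ha, hx]; omega) <|
    .assignSeq (ha := by simp [n60, n61, ha, hy]; omega) <|
    (ends_relabP (E.set.set.set) ho (by simp [ha]) hf).mono (by simp; omega) fun s' _ h => ?_
  have h1 := hf (o + x) (by omega); have h2 := hf (o + y) (by omega)
  simp [n60, n61, ha, hx, hy, add_assoc, h1, h2] at h; exact ⟨h.1, Keeps.refl.set.set.set.trans h.2⟩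

theorem ends_addP (E : Env w k K B Q I A s) {h : Bool} {x y : ℕ} (hh : s.reg 50 = h.toNat)
    (hx : s.reg 51 = x) (hy : s.reg 52 = y) (hxK : x < K) (hyK : y < K)
    (hf : Holds A (3 * K) f s) : Ends w addP (5 * Q ^ 3) s fun s' =>
      Holds A (3 * K) (addE K h x y f).1 s' ∧ s'.reg 53 = (addE K h x y f).2.toNat ∧
        Keeps 53 A (A + 3 * K) s s' := by
  have hr := E.regs; have hw := E.word; have hT := E.pow_le 0 (j := 3)
  have e1 : s.mem (A + 2 * K + x) = f (2 * K + x) := by rw [add_assoc]; exact hf _ (by omega)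
  have e2 : s.mem (A + 2 * K + y) = f (2 * K + y) := by rw [add_assoc]; exact hf _ (by omega)
  have e3 : s.mem (A + K + x) = f (K + x) := by rw [add_assoc]; exact hf _ (by omega)
  have e4 : s.mem (A + K + y) = f (K + y) := by rw [add_assoc]; exact hf _ (by omega)
  have H0 : Keeps 53 A (A + 3 * K) s s := .refl
  have hc := ends_relabSlotsP E (o := 2 * K) (a := 19) (by omega) (by simp [hr]) (by norm_num) hx hy
    hxK hyK hf
  unfold addE; refine .condWithin (fun h1 => ?_) fun h1 => ?_ <;> simp only [val_reg, hh] at h1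
  · obtain rfl : h = true := by cases h <;> simp_all
    refine .condWithin (fun h2 => .assignWithin ?_) (fun h2 => .seqWithin hc
      fun s1 ⟨f1, k1⟩ => .assignWithin ?_) (ha := by simp [hr, hx, hy]; omega) <;>
      simp [hr, hx, hy, e1, e2] at h2
    · simpa [h2] using ⟨hf.set, H0.set⟩
    · simpa [h2] using ⟨f1.set, (k1.widen le_rfl le_rfl).set⟩
  · obtain rfl : h = false := by cases h <;> simp_all
    refine .condWithin (fun h2 => .assignWithin ?_) (fun h2 => .condWithin
      (fun h3 => .assignWithin ?_) (fun h3 => .seqWithin hc fun s1 ⟨f1, k1⟩ => .seqWithin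
      (ends_relabSlotsP (E.keep k1) (o := K) (a := 18) (by omega)
        (by simp [k1.reg, hr]) (by norm_num) (by simp [k1.reg, hx]) (by simp [k1.reg, hy]) hxK hyK f1)
      fun s2 ⟨f2, k2⟩ => .assignWithin ?_) (ha := by simp [hr, hx, hy]; omega))
      (ha := by simp [hr, hx, hy]; omega) <;>
      simp [hr, hx, hy, e3, e4] at h2
    · simpa [h2] using ⟨hf.set, H0.set⟩
    · simp [hr, hx, hy, e1, e2] at h3; simpa [h2, h3] using ⟨hf.set, H0.set⟩
    · simp [hr, hx, hy, e1, e2] at h3; rw [relab_outside (by omega), relab_outside (by omega)] at f2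
      simpa [h2, h3] using ⟨f2.set, ((k1.trans k2).widen le_rfl le_rfl (by norm_num : 53 ≤ 60)).set⟩

end

/-! ### Programs for the transitions -/

/-- The test `Allowed`. -/
def allowedT (g s : Term) : Term :=
  (s.less 3).or (((g.equal 1).and ((s.equal 4).or (s.equal 5))).or ((g.equal 2).and (s.equal 6)))

/-- The test `hardOf`. -/
def hardT (g s : Term) : Term := (s.equal 1).or ((s.equal 2).and (g.equal 2))

/-- Computes `freshen` for the slot `R 25`. -/
def freshenP : Prog := 39 ←ᵣ R 2 - 1 ;; .store (R 18 + R 39) (M (R 18 + R 25)) ;;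
    .store (R 19 + R 39) (M (R 19 + R 25)) ;; .store (R 18 + R 25) (R 3) ;;
    .store (R 19 + R 25) (R 3)

/-- Sets the statuses of the slots `R 24` and `R 25` as `mergeLive` does. -/
def mergeStatusP : Prog := .cond ((R 34).equal 2) (.store (R 7 + R 25) 6)
    (.cond ((((R 36).equal 2).or ((R 36).equal 4)).and (((R 37).equal 2).or ((R 37).equal 4)))
      (.store (R 7 + R 25) 4) (.store (R 7 + R 25) 5)) ;;
  .store (R 7 + R 24) 0

/-- Computes `mergeLive` for the slots `R 24` and `R 25` with statuses `R 36` and `R 37`, where `R 34`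
is the promise. -/
def mergeLiveP : Prog := 38 ←ᵣ 1 ;; .cond ((R 37).less 3)
    (freshenP ;; 50 ←ᵣ hardT (R 34) (R 37) ;; 51 ←ᵣ R 39 ;; 52 ←ᵣ R 25 ;; addP ;; 38 ←ᵣ R 53)
    .skip ;;
  50 ←ᵣ hardT (R 34) (R 36) ;; 51 ←ᵣ R 24 ;; 52 ←ᵣ R 25 ;; addP ;; 35 ←ᵣ (R 38).and (R 53) ;; mergeStatusP

/-- Computes `mergeCore` for the slots `R 24` and `R 25`, where `R 34` is the promise. -/
def mergeCoreP : Prog := 36 ←ᵣ M (R 7 + R 24) ;; 37 ←ᵣ M (R 7 + R 25) ;;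
  .cond ((R 36).equal 0) (35 ←ᵣ 1) (.cond ((R 37).equal 0)
    (.store (R 7 + R 25) (R 36) ;; .store (R 18 + R 25) (M (R 18 + R 24)) ;;
      .store (R 19 + R 25) (M (R 19 + R 24)) ;; .store (R 7 + R 24) 0 ;; 35 ←ᵣ 1)
    (.cond ((R 34).equal 0)
      (.store (R 7 + R 25) 3 ;; .store (R 7 + R 24) 0 ;; 35 ←ᵣ ((R 36).less 4).and ((R 37).less 4))
      (.cond (((R 34).less 3).and ((allowedT (R 34) (R 36)).and (allowedT (R 34) (R 37))))
        mergeLiveP (35 ←ᵣ 0))))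

/-- Computes `mergeF`. -/
def mergeP : Prog := mergeCoreP ;; normP

/-- Both Boolean values are computed from the statuses `R 36` and `R 37`. -/
def joinableT (s t : Term) : Term :=
  ((s.less 3).and (t.less 3)).or (((s.equal 2).and ((t.equal 4).or (t.equal 5))).or
    (((t.equal 2).and ((s.equal 4).or (s.equal 5))).or (((s.equal 4).and (t.equal 4)).or
      (((s.equal 1).and (t.equal 6)).or ((s.equal 6).and (t.equal 1))))))

/-- Stores the status `joined` at the address `a`. -/
def joinedP (a s b : Term) : Prog :=
  .cond (s.less 4) .skip (.cond ((s.equal 4).and (b.equal 1)) (.store a 4) (.store a 3))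

/-- Computes `joinF` for the slots `R 24` and `R 25`, where `R 34` encodes the promises. -/
def joinP : Prog := 36 ←ᵣ M (R 7 + R 24) ;; 37 ←ᵣ M (R 7 + R 25) ;;
  .cond (((R 36).equal 0).or ((R 37).equal 0)) (35 ←ᵣ 1) (.cond (joinableT (R 36) (R 37))
    (50 ←ᵣ (((R 36).less 3).and ((R 37).less 3)).and (((R 36).equal 1).or ((R 37).equal 1)) ;;
      51 ←ᵣ R 24 ;; 52 ←ᵣ R 25 ;; addP ;; 35 ←ᵣ R 53 ;; joinedP (R 7 + R 24) (R 36) (R 34 % 2) ;;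
      joinedP (R 7 + R 25) (R 37) (R 34 / 2)) (35 ←ᵣ 0))

section

variable {w : ℕ} {s : Store} {a b : Term}

@[simp] theorem val_allowedT :
    (allowedT a b).val s = if Allowed (a.val s) (b.val s) then 1 else 0 := by
  simp only [allowedT, val_or, val_and, val_equal, val_less, Allowed]; refine if_congr ?_ rfl rfl
  simp; omega

@[simp] theorem val_hardT : (hardT a b).val s = (hardOf (a.val s) (b.val s)).toNat := by
  simp only [hardT, hardOf, val_or, val_and, val_equal, Bool.toNat, Bool.cond_decide]
  refine if_congr ?_ rfl rfl; simp

@[simp] theorem val_joinableT :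
    (joinableT a b).val s = if Joinable (a.val s) (b.val s) then 1 else 0 := by
  simp only [joinableT, val_or, val_and, val_equal, val_less, Joinable]; refine if_congr ?_ rfl rfl
  simp; omega

@[simp] theorem ok_allowedT : (allowedT a b).Ok w s ↔ a.Ok w s ∧ b.Ok w s := by simp [allowedT]

@[simp] theorem ok_hardT : (hardT a b).Ok w s ↔ a.Ok w s ∧ b.Ok w s := by simp [hardT]; tauto

@[simp] theorem ok_joinableT : (joinableT a b).Ok w s ↔ a.Ok w s ∧ b.Ok w s := by
  simp [joinableT]; tauto

@[simp] theorem cost_allowedT : (allowedT a b).cost = 4 * b.cost + 2 * a.cost + 43 := by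
  simp [allowedT]; omega

@[simp] theorem cost_hardT : (hardT a b).cost = 2 * b.cost + a.cost + 18 := by simp [hardT]; omega

@[simp] theorem cost_joinableT : (joinableT a b).cost = 7 * a.cost + 7 * b.cost + 107 := by
  simp [joinableT]; omega

end

section

variable {w k K B Q I A g x y : ℕ} {s : Store} {f : ℕ → ℕ}

/-- The program `P` computes `F g` for the slots in the registers `24` and `25`, where the register
`34` contains `g`. -/
def Computes (w k K B Q I A x y : ℕ) (P : Prog) (F : ℕ → (ℕ → ℕ) → (ℕ → ℕ) × Bool) : Prop :=
  ∀ s g f, Env w k K B Q I A s → s.reg 24 = x → s.reg 25 = y → s.reg 34 = g →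
    Holds A (3 * K) f s → Ends w P (Q ^ 8) s fun s' => Holds A (3 * K) (F g f).1 s' ∧
      s'.reg 35 = (F g f).2.toNat ∧ Keeps 35 A (A + 3 * K) s s'

theorem ends_joinedP {o : ℕ} {a t b : Term} (hf : Holds A (3 * K) f s) (ho : o < K)
    (ha : a.val s = A + o) (ht : t.val s = f o) (haO : a.Ok w s) (htO : t.Ok w s)
    (hbO : b.Ok w s) : Ends w (joinedP a t b) (2 * t.cost + a.cost + b.cost + 20) s fun s' =>
      Holds A (3 * K) (update f o (joined (f o) (b.val s))) s' ∧
        Keeps 100 A (A + 3 * K) s s' ∧ s'.reg = s.reg := by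
  have H0 : Keeps 100 A (A + 3 * K) s s := .refl
  have hk : ∀ x, Keeps 100 A (A + 3 * K) s (s.put (a.val s) x) := fun x =>
    H0.put (by omega) (by omega)
  unfold joined
  refine .condWithin (fun h1 => .skipWithin ?_) (fun h1 => .condWithin
    (fun h2 => .storeWithin ?_ (hb := haO)) (fun h2 => .storeWithin ?_ (hb := haO))
    (ha := by simp [htO, hbO])) (ha := by simp [htO]) <;> simp [ht] at h1
  · rw [if_pos (by omega), update_eq_self]; exact ⟨hf, H0, rfl⟩
  · simp [ht] at h2; rw [if_neg (by omega), if_pos h2]; exact ⟨hf.put ha, hk _, rfl⟩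
  · simp [ht] at h2; rw [if_neg (by omega), if_neg fun h => h2 h.1 h.2]
    exact ⟨hf.put ha, hk _, rfl⟩

theorem ends_joinP (hx : x < K) (hy : y < K) (hxy : x ≠ y) :
    Computes w k K B Q I A x y joinP (fun g f => joinF K x y g f) := by
  intro s g f E h24 h25 h34 hf; have hr := E.regs; have hw := E.word; have hT := E.pow_le 3 (j := 8)
  have H0 : Keeps 35 A (A + 3 * K) s s := .refl; have fx := hf x (by omega)
  have fy := hf y (by omega)
  refine .assignSeq (ha := by simp [hr, h24]; omega) <| .assignSeq (ha := by simp [hr, h25]; omega) ?_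
  simp [hr, h24, h25, fx, fy]
  have H1 := (H0.set (r := 36) (x := f x) (by norm_num)).set (r := 37) (x := f y) (by norm_num)
  have E1 := E.keep H1
  generalize hs1 : (s.set 36 (f x)).set 37 (f y) = s1 at *
  have hr1 : s1.reg 36 = f x ∧ s1.reg 37 = f y := by simp [← hs1]
  have hf1 : Holds A (3 * K) f s1 := by rw [← hs1]; exact hf
  have hr2 : s1.reg 24 = x ∧ s1.reg 25 = y ∧ s1.reg 34 = g := by simp [← hs1, h24, h25, h34]
  unfold joinF
  refine .condWithin (fun h1 => .assignWithin ?_) fun h1 => .condWithin (fun h2 => ?_)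
    (fun h2 => .assignWithin ?_) <;> simp [hr1] at h1
  · rw [if_pos (by omega)]; exact ⟨hf1.set, by simp, H1.set le_rfl⟩
  · simp [hr1] at h2; rw [if_neg (by omega), if_pos h2]
    refine .assignSeq <| .assignSeq <| .assignSeq <| .seqWithin (ends_addP (x := x) (y := y)
      (h := decide (f x ≤ 2 ∧ f y ≤ 2 ∧ (f x = 1 ∨ f y = 1)))
      (E1.set.set.set) ?_ (by simp [hr2])
      (by simp [hr2]) hx hy hf1) fun s2 ⟨f2, b2, k2⟩ => .assignSeq ?_
    · simp [hr1, Bool.toNat]; refine if_congr ?_ rfl rfl; omega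
    have H2 := ((H1.set.set.set).trans k2 (by norm_num)).set (r := 35) (x := (R 53).val s2) le_rfl
    have E2 := E.keep H2
    have q2 : s2.reg 24 = x ∧ s2.reg 25 = y ∧ s2.reg 34 = g ∧ s2.reg 36 = f x ∧ s2.reg 37 = f y := by
      simp [k2.reg, hr1, hr2]
    have l1 := addE_low (K := K) (h := decide (f x ≤ 2 ∧ f y ≤ 2 ∧ (f x = 1 ∨ f y = 1))) (x := x)
      (y := y) (f := f) hx
    have l2 := addE_low (K := K) (h := decide (f x ≤ 2 ∧ f y ≤ 2 ∧ (f x = 1 ∨ f y = 1))) (x := x)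
      (y := y) (f := f) hy
    clear k2
    generalize addE K (decide (f x ≤ 2 ∧ f y ≤ 2 ∧ (f x = 1 ∨ f y = 1))) x y f = r at *
    generalize hs3 : s2.set 35 ((R 53).val s2) = s3 at *
    have q3 : s3.reg 24 = x ∧ s3.reg 25 = y ∧ s3.reg 34 = g ∧ s3.reg 36 = f x ∧ s3.reg 37 = f y ∧
      s3.reg 35 = r.2.toNat := by simp [← hs3, q2, b2]
    have f3 : Holds A (3 * K) r.1 s3 := by rw [← hs3]; exact f2
    have g3 := E2.regs
    refine .seqWithin (ends_joinedP f3 hx (by simp [g3, q3]) (by simp [q3, l1])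
      (by simp [g3, q3]; omega) (by simp) (by simp)) fun s4 ⟨f4, k4, r4⟩ =>
      (ends_joinedP f4 hy (by simp [r4, g3, q3]) ?_
      (by simp [r4, g3, q3]; omega) (by simp) (by simp)).mono (by simp; omega) fun s5 _ ⟨f5, k5, r5⟩ => ?_
    · simp [r4, q3, l2, hxy.symm]
    · refine ⟨?_, by simp [r5, r4, q3], H2.trans (k4.trans k5 le_rfl) (by norm_num)⟩
      simpa [r4, q3, l1, l2, update_apply, hxy.symm] using f5
  · simp [hr1] at h2; rw [if_neg (by omega), if_neg h2]; exact ⟨hf1.set, by simp, H1.set le_rfl⟩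

theorem ends_freshenP (hy : y < K) (E : Env w k K B Q I A s) (h25 : s.reg 25 = y)
    (hf : Holds A (3 * K) f s) : Ends w freshenP 100 s fun s' =>
      Holds A (3 * K) (freshen K B y f) s' ∧ s'.reg 39 = K - 1 ∧ Keeps 39 A (A + 3 * K) s s' := by
  have hw := E.word; have hg := E.regs; have H0 : Keeps 39 A (A + 3 * K) s s := .refl
  have e2 : s.mem (A + 2 * K + y) = f (2 * K + y) := by rw [add_assoc]; exact hf _ (by omega)
  have e3 : s.mem (A + K + y) = f (K + y) := by rw [add_assoc]; exact hf _ (by omega)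
  have e4 : A + 2 * K + y ≠ A + K + (K - 1) := by omega
  refine .assignSeq <| .storeSeq (.storeSeq (.storeSeq (.storeWithin ?_ (hb := ?_)) (hb := ?_))
    (hb := ?_) (ha := ?_)) (hb := ?_) (ha := ?_) <;>
    simp [hg, h25, e2, e3, e4, put_mem] <;> try omega
  refine ⟨?_, ?_⟩
  · unfold freshen; exact ((((hf.set.put (by omega)).put (by omega)).put (by omega)).put (by omega))
  · exact ((((H0.set le_rfl).put (by omega) (by omega)).put (by omega) (by omega)).put (by omega)
      (by omega)).put (by omega) (by omega)

theorem ends_mergeStatusP {a b : ℕ} (hx : x < K) (hy : y < K) (E : Env w k K B Q I A s)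
    (hr : s.reg 24 = x ∧ s.reg 25 = y ∧ s.reg 34 = g ∧ s.reg 36 = a ∧ s.reg 37 = b)
    (hf : Holds A (3 * K) f s) : Ends w mergeStatusP 100 s fun s' =>
      Holds A (3 * K) (update (update f y (if g = 2 then 6 else
        if (a = 2 ∨ a = 4) ∧ (b = 2 ∨ b = 4) then 4 else 5)) x 0) s' ∧ s'.reg = s.reg ∧
        Keeps 100 A (A + 3 * K) s s' := by
  have hw := E.word; have hg := E.regs; have h7 : s.reg 7 = A := by simp [hg]
  clear hg E
  have p1 : A ≤ (R 7 + R 25).val s ∧ (R 7 + R 25).val s < A + 3 * K := by simp [h7, hr]; omega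
  have ok1 : (R 7 + R 25).Ok w s := by simp [h7, hr]; omega
  refine .seqWithin (T' := 80) (Z' := fun s' => Holds A (3 * K) (update f y
    (if g = 2 then 6 else if (a = 2 ∨ a = 4) ∧ (b = 2 ∨ b = 4) then 4 else 5)) s' ∧
    s'.reg = s.reg ∧ Keeps 100 A (A + 3 * K) s s') (.condWithin
      (fun h1 => .storeWithin ?_ (hb := ok1)) fun h1 => .condWithin
      (fun h2 => .storeWithin ?_ (hb := ok1)) fun h2 => .storeWithin ?_ (hb := ok1))
    fun s1 ⟨f1, r1, k1⟩ => .storeWithin ?_ (hb := ?_)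
  · simp [hr] at h1; rw [if_pos h1]
    exact ⟨hf.put (by simp [h7, hr]), rfl, Keeps.refl.put p1.1 p1.2⟩
  · simp [hr] at h1; simp [hr, -not_and, -not_or] at h2; rw [if_neg h1, if_pos h2]
    exact ⟨hf.put (by simp [h7, hr]), rfl, Keeps.refl.put p1.1 p1.2⟩
  · simp [hr] at h1; simp [hr, -not_and, -not_or] at h2; rw [if_neg h1, if_neg h2]
    exact ⟨hf.put (by simp [h7, hr]), rfl, Keeps.refl.put p1.1 p1.2⟩
  · have p2 : A ≤ (R 7 + R 24).val s1 ∧ (R 7 + R 24).val s1 < A + 3 * K := by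
      simp [r1, h7, hr]; omega
    exact ⟨f1.put (by simp [r1, h7, hr]), r1, k1.put p2.1 p2.2⟩
  · simp [r1, h7, hr]; omega

theorem ends_mergeLiveP (hx : x < K) (hy : y < K) (E : Env w k K B Q I A s)
    (hr : s.reg 24 = x ∧ s.reg 25 = y ∧ s.reg 34 = g ∧ s.reg 36 = f x ∧ s.reg 37 = f y)
    (hf : Holds A (3 * K) f s) : Ends w mergeLiveP (12 * Q ^ 3) s fun s' =>
      Holds A (3 * K) (mergeLive K B x y g f).1 s' ∧ s'.reg 35 = (mergeLive K B x y g f).2.toNat ∧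
        Keeps 35 A (A + 3 * K) s s' := by
  have hw := E.word; have hg := E.regs; have hT := E.pow_le 0 (j := 3)
  have hT' := E.pow_le 3 (j := 4); have H0 : Keeps 38 A (A + 3 * K) s s := .refl
  obtain ⟨r₁, hr₁⟩ : ∃ r₁, r₁ = (if f y ≤ 2 then addE K (hardOf g (f y)) (K - 1) y (freshen K B y f)
    else (f, true)) := ⟨_, rfl⟩
  unfold mergeLive; simp only [← hr₁]
  refine .assignSeq <| .seqWithin (T' := 6 * Q ^ 3) (Z' := fun s' => Holds A (3 * K) r₁.1 s' ∧
    s'.reg 38 = r₁.2.toNat ∧ Keeps 38 A (A + 3 * K) s s') (.condWithin (fun h1 => ?_)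
    fun h1 => .skipWithin ?_) fun s1 ⟨f1, b1, k1⟩ => ?_
  · simp [hr] at h1; rw [if_pos (by omega)] at hr₁
    have H1 := H0.set (r := 38) (x := (1 : Term).val s) le_rfl
    refine .seqWithin (ends_freshenP hy (E.set) (by simp [hr]) hf.set) fun s1 ⟨f1, b1, k1⟩ => ?_
    have H2 := H1.trans k1; have E2 := E.keep H2
    have q1 : s1.reg 25 = y ∧ s1.reg 34 = g ∧ s1.reg 37 = f y := by simp [k1.reg, hr]
    refine .assignSeq <| .assignSeq <| .assignSeq <| .seqWithin (ends_addP (x := K - 1) (y := y)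
      (h := hardOf g (f y)) (E2.set.set.set)
      (by simp [q1]) (by simp [b1]) (by simp [q1]) (by omega) hy f1) fun s2 ⟨f2, b2, k2⟩ =>
      .assignWithin ?_
    rw [hr₁]
    exact ⟨f2.set, by simp [b2], ((H2.set.set.set (by norm_num)).trans k2).set le_rfl⟩
  · simp [hr] at h1; rw [if_neg (by omega)] at hr₁; rw [hr₁]; exact ⟨hf.set, by simp, H0.set le_rfl⟩
  · have E1 := E.keep k1
    have q1 : s1.reg 24 = x ∧ s1.reg 25 = y ∧ s1.reg 34 = g ∧ s1.reg 36 = f x ∧ s1.reg 37 = f y := by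
      simp [k1.reg, hr]
    refine .assignSeq <| .assignSeq <| .assignSeq <| .seqWithin (ends_addP (x := x) (y := y)
      (h := hardOf g (f x)) (E1.set.set.set)
      (by simp [q1]) (by simp [q1]) (by simp [q1]) hx hy f1) fun s2 ⟨f2, b2, k2⟩ =>
      .assignSeq ?_
    have H2 := (((k1.set.set.set).trans k2
      (by norm_num)).widen le_rfl le_rfl (by norm_num : 35 ≤ 38)).set (r := 35)
      (x := ((R 38).and (R 53)).val s2) le_rfl
    have E2 := E.keep H2
    have q2 : s2.reg 24 = x ∧ s2.reg 25 = y ∧ s2.reg 34 = g ∧ s2.reg 36 = f x ∧ s2.reg 37 = f y ∧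
        s2.reg 38 = r₁.2.toNat := by
      simp [k2.reg, q1, b1]
    clear k2
    generalize addE K (hardOf g (f x)) x y r₁.1 = r at *
    generalize hs3 : s2.set 35 (((R 38).and (R 53)).val s2) = s3 at *
    have q3 : s3.reg 24 = x ∧ s3.reg 25 = y ∧ s3.reg 34 = g ∧ s3.reg 36 = f x ∧ s3.reg 37 = f y ∧
        s3.reg 35 = (r₁.2 && r.2).toNat := by
      simp [← hs3, q2, b2]; cases r₁.2 <;> cases r.2 <;> simp
    have f3 : Holds A (3 * K) r.1 s3 := by rw [← hs3]; exact f2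
    exact (ends_mergeStatusP hx hy E2 ⟨q3.1, q3.2.1, q3.2.2.1, q3.2.2.2.1, q3.2.2.2.2.1⟩ f3).mono
      (by simp; omega) fun s4 _ ⟨f4, r4, k4⟩ => ⟨f4, by simp [r4, q3], H2.trans k4⟩

theorem ends_mergeP (hx : x < K) (hy : y < K) :
    Computes w k K B Q I A x y mergeP (fun g f => mergeF K B x y g f) := by
  intro s g f E h24 h25 h34 hf; have hr := E.regs; have hw := E.word; have hT := E.pow_le 3 (j := 7)
  have hT' := E.pow_le 7 (j := 8); have hT0 := E.pow_le 0 (j := 3)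
  have H0 : Keeps 35 A (A + 3 * K) s s := .refl; have fx := hf x (by omega)
  have fy := hf y (by omega)
  suffices h : Ends w mergeCoreP (20 * Q ^ 3) s fun s' =>
      Holds A (3 * K) (mergeCore K B x y g f).1 s' ∧ s'.reg 35 = (mergeCore K B x y g f).2.toNat ∧
        Keeps 35 A (A + 3 * K) s s' from
    .seqWithin h fun s1 ⟨f1, b1, k1⟩ => (ends_normP (E.keep k1) f1).mono (by omega)
      fun s2 _ ⟨f2, k2⟩ => ⟨f2, (k2.reg 35 (by norm_num)).trans b1, k1.trans k2⟩
  refine .assignSeq (ha := by simp [hr, h24]; omega) <| .assignSeq (ha := by simp [hr, h25]; omega) ?_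
  simp [hr, h24, h25, fx, fy]
  have H1 := (H0.set (r := 36) (x := f x) (by norm_num)).set (r := 37) (x := f y) (by norm_num)
  have E1 := E.keep H1
  generalize hs1 : (s.set 36 (f x)).set 37 (f y) = s1 at *
  have hr1 : s1.reg 24 = x ∧ s1.reg 25 = y ∧ s1.reg 34 = g ∧ s1.reg 36 = f x ∧ s1.reg 37 = f y := by
    simp [← hs1, h24, h25, h34]
  have hf1 : Holds A (3 * K) f s1 := by rw [← hs1]; exact hf
  have hg := E1.regs; clear hs1 hr; have q0 := hf1 x (by omega); have q1 := hf1 (K + x) (by omega)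
  have q2 := hf1 (2 * K + x) (by omega); rw [← add_assoc] at q1 q2
  have p0 : A ≤ (R 7 + R 24).val s1 ∧ (R 7 + R 24).val s1 < A + 3 * K := by simp [hg, hr1]; omega
  have p1 : A ≤ (R 7 + R 25).val s1 ∧ (R 7 + R 25).val s1 < A + 3 * K := by simp [hg, hr1]; omega
  have p2 : A ≤ (R 18 + R 25).val s1 ∧ (R 18 + R 25).val s1 < A + 3 * K := by simp [hg, hr1]; omega
  have p3 : A ≤ (R 19 + R 25).val s1 ∧ (R 19 + R 25).val s1 < A + 3 * K := by simp [hg, hr1]; omega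
  unfold mergeCore
  refine .condWithin (fun h1 => .assignWithin ?_) fun h1 => .condWithin (fun h2 => ?_) fun h2 =>
    .condWithin (fun h3 => ?_) fun h3 => .condWithin (fun h4 => ?_) fun h4 => .assignWithin ?_
  · simp [hr1] at h1; rw [if_pos h1]; exact ⟨hf1, by simp, H1.set le_rfl⟩
  · simp [hr1] at h1 h2; rw [if_neg h1, if_pos h2]
    refine .storeSeq (.storeSeq (.storeSeq (.storeSeq (.assignWithin ?_) (hb := ?_))
      (hb := ?_) (ha := ?_)) (hb := ?_) (ha := ?_)) (hb := ?_)
    · refine ⟨?_, by simp, ((((H1.put p1.1 p1.2).put p2.1 p2.2).put p3.1 p3.2).put p0.1 p0.2).set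
        le_rfl⟩
      have n1 : A + K + x ≠ A + y := by omega
      have n2 : A + 2 * K + x ≠ A + y := by omega
      have n3 : A + 2 * K + x ≠ A + K + y := by omega
      simp [hg, hr1, put_mem, q1, q2, n1, n2, n3]
      exact (((hf1.put rfl).put (by omega)).put (by omega)).put rfl
    all_goals simp [hg, hr1, put_mem]; try omega
  · simp [hr1] at h1 h2 h3; rw [if_neg h1, if_neg h2, if_pos h3]
    refine .storeSeq (.storeSeq (.assignWithin ?_) (hb := ?_)) (hb := ?_)
    · refine ⟨(hf1.put ?_).put ?_, ?_, ((H1.put p1.1 p1.2).put p0.1 p0.2).set le_rfl⟩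
      · simp [hg, hr1]
      · simp [hg, hr1]
      · simp [hr1, Bool.toNat, Nat.lt_succ_iff]
    all_goals simp [hg, hr1]; try omega
  · simp [hr1] at h1 h2 h3 h4; rw [if_neg h1, if_neg h2, if_neg h3, if_pos ⟨by omega, h4.2⟩]
    exact (ends_mergeLiveP hx hy E1 hr1 hf1).mono (by simp; omega) fun s2 _ ⟨f2, b2, k2⟩ =>
      ⟨f2, b2, H1.trans k2 le_rfl⟩
  · simp [hr1, -not_and] at h1 h2 h3 h4
    rw [if_neg h1, if_neg h2, if_neg h3, if_neg fun h => h4 ⟨by omega, h.2⟩]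
    exact ⟨hf1, by simp, H1.set le_rfl⟩

end

/-! ### Programs for the tables -/

/-- Writes the digits of `R 70` to the cells from `R 71` on. -/
def decodeP : Prog := forUp 72 (R 4) (.store (R 71 + R 72) (R 70 % R 3) ;; 70 ←ᵣ R 70 / R 3)

/-- Computes the number with the digits in the first array in the register `71`. -/
def encodeP : Prog :=
  70 ←ᵣ 1 ;; 71 ←ᵣ 0 ;; forUp 72 (R 4) (71 ←ᵣ R 71 + M (R 7 + R 72) * R 70 ;; 70 ←ᵣ R 70 * R 3)

/-- Computes the power of the base with exponent `R 71` in the register `70`. -/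
def powP : Prog := 70 ←ᵣ 1 ;; forUp 72 (R 71) (70 ←ᵣ R 70 * R 3)

/-- Computes `unionF` from both arrays. -/
def unionOpP : Prog := forUp 36 (R 1) (.store (R 7 + (R 1 + R 36)) (M (R 8 + R 36)) ;;
    .store (R 7 + (R 2 + R 1 + R 36)) (M (R 8 + (R 2 + R 36)) + R 3) ;;
    .store (R 7 + (R 2 + R 2 + R 1 + R 36)) (M (R 8 + (R 2 + R 2 + R 36)) + R 3)) ;;
  normP

section

variable {w k K B Q I A q : ℕ} {s : Store} {f f' : ℕ → ℕ}

theorem ends_decodeP (E : Env w k K B Q I A s) {o : ℕ} (h70 : s.reg 70 = q) (h71 : s.reg 71 = o)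
    (ho : o + 3 * K < 2 ^ w) : Ends w decodeP (Q ^ 3) s fun s' =>
      Holds o (3 * K) (decode B q) s' ∧ Keeps 70 o (o + 3 * K) s s' := by
  have hK := E.large.2.2.1
  refine (Ends.forUp (T := 20) (m := 3 * K) (fun i s' => Holds o i (decode B q) s' ∧
    s'.reg 70 = q / B ^ i ∧ s'.reg 71 = o ∧ Keeps 70 o (o + 3 * K) s s') (by omega) ?_ ?_ ?_ ?_).le
      (E.forUp_le (i := 1) (j := 1) (by simpa using hK) ?_ (by simp))
  · exact ⟨fun a ha => by omega, by simp [h70], by simp [h71], Keeps.refl.set⟩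
  · intro i s' _ h; simp [(E.keep h.2.2.2).regs]
  · intro i s' hi _ h72 ⟨h1, h2, h3, h4⟩; have hB : s'.reg 3 = B := by simp [(E.keep h4).regs]
    refine .storeSeq (.assignWithin ?_) (hb := by simp [h3, h72]; omega)
    refine ⟨by simp [h72], fun a ha => ?_, ?_, by simp [h3], ?_⟩
    · simp only [set_mem, put_mem]; rcases Nat.lt_succ_iff_lt_or_eq.1 ha with h | rfl
      · rw [if_neg (by simp [h3, h72]; omega), h1 a h]
      · simp [h3, h72, h2, hB, decode]
    · simp [h2, hB, Nat.div_div_eq_div_mul, pow_succ]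
    · exact ((h4.put (by simp [h3]) (by simp [h3, h72]; omega)).set).set
  · intro s' _ h; exact ⟨h.1, h.2.2.2⟩
  · have := E.large; rw [pow_one]; omega

theorem ends_encodeP (E : Env w k K B Q I A s) (hf : Holds A (3 * K) f s)
    (hB : ∀ a, a < 3 * K → f a < B) : Ends w encodeP (Q ^ 4) s fun s' =>
      s'.reg 71 = encode B (3 * K) f ∧ Keeps 70 A A s s' := by
  have hw := E.word; have hl := E.large; have hT := E.pow_le 3 (j := 4); have hK := hl.2.2.1
  refine .assignSeq <| .assignSeq <| ((Ends.forUp (T := 20) (m := 3 * K) (fun i s' =>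
    s'.reg 70 = B ^ i ∧ s'.reg 71 = encode B i f ∧ Keeps 70 A A s s') (by omega) ?_ ?_ ?_ ?_).le
      (E.forUp_le (i := 1) (j := 1) (by simpa using hK) ?_ (by simp))).le ?_
  · exact ⟨by simp, by simp [encode], Keeps.refl.set.set.set⟩
  · intro i s' _ h; simp [(E.keep h.2.2).regs]
  · intro i s' hi _ h72 ⟨h1, h2, h3⟩
    have hr : s'.reg 3 = B ∧ s'.reg 7 = A := by simp [(E.keep h3).regs]
    have hm : s'.mem (A + i) = f i := (h3.mem _ (by omega)).trans (hf i hi)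
    have e1 : encode B (i + 1) f = encode B i f + f i * B ^ i := Finset.sum_range_succ _ _
    have e2 : encode B (i + 1) f < B ^ (i + 1) := encode_lt fun a ha => hB a (by omega)
    have e3 : B ^ (i + 1) ≤ Q := E.codes ▸ Nat.pow_le_pow_right (by have := E.base; omega) hi
    rw [e1, pow_succ] at e2; rw [pow_succ] at e3
    refine .assignSeq (ha := by simp [h1, h2, hr, h72, hm]; omega) <|
      .assignWithin (ha := by simp [h1, hr]; omega) ?_
    refine ⟨by simp [h72], by simp [h1, hr, pow_succ], by simp [h1, h2, hr, h72, hm, e1], ?_⟩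
    exact h3.set.set.set
  · intro s' _ h; exact ⟨h.2.1, h.2.2⟩
  · rw [pow_one]; omega
  · simp; omega

theorem ends_powP {i : ℕ} (h3 : s.reg 3 = B) (h71 : s.reg 71 = i) (hB : 0 < B)
    (hi : B ^ i < 2 ^ w) (hiw : i < 2 ^ w) : Ends w powP (i * 30 + 20) s fun s' =>
      s'.reg 70 = B ^ i ∧ Keeps 70 0 0 s s' := by
  refine .assignSeq <| ((Ends.forUp (T := 20) (m := i) (fun i s' =>
    s'.reg 70 = B ^ i ∧ s'.reg 71 = s.reg 71 ∧ Keeps 70 0 0 s s') (by omega) ?_ ?_ ?_ ?_).le ?_)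
  · exact ⟨by simp, by simp, Keeps.refl.set.set⟩
  · intro i s' _ h; simp [h.2.1, h71]
  · intro i' s' hi' _ h72 ⟨h1, h2, h4⟩; have hr : s'.reg 3 = B := by simp [h4.reg, h3]
    have e3 : B ^ (i' + 1) ≤ B ^ i := Nat.pow_le_pow_right (by omega) (by omega)
    rw [pow_succ] at e3; refine .assignWithin (ha := by simp [h1, hr]; omega) ?_
    exact ⟨by simp [h72], by simp [h1, hr, pow_succ], by simp [h2], h4.set.set⟩
  · intro s' _ h; exact ⟨h.1, h.2.2⟩
  · simp; omega

theorem ends_unionOpP (E : Env w k K B Q I A s) (hf : Holds A (3 * K) f s)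
    (hf' : Holds (A + 3 * K) (3 * K) f' s) (hB : ∀ a, f' a < B) :
    Ends w unionOpP (Q ^ 8) s fun s' =>
      Holds A (3 * K) (unionF (k + 1) K B f f') s' ∧ Keeps 36 A (A + 3 * K) s s' := by
  have hw := E.word; have hl := E.large; have hT := E.pow_le 7 (j := 8)
  have hT' := E.pow_le 3 (j := 7); have hs := E.slots
  refine .seqWithin (T' := Q ^ 3) (Z' := fun s' => Holds A (3 * K) (combineF (k + 1) K B f f') s' ∧
    Keeps 36 A (A + 3 * K) s s') ((Ends.forUp (T := 100) (m := k + 1) (fun i s' => Holds A (3 * K)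
      (fun a => if k + 1 ≤ a ∧ a < k + 1 + i then f' (a - (k + 1)) else
        if K + (k + 1) ≤ a ∧ a < K + (k + 1) + i ∨ 2 * K + (k + 1) ≤ a ∧ a < 2 * K + (k + 1) + i then
          f' (a - (k + 1)) + B else f a) s' ∧ Keeps 36 A (A + 3 * K) s s')
      (by omega) ?_ ?_ ?_ ?_).le (E.forUp_le (i := 1) (j := 1) (by simp; omega) ?_ (by simp)))
    fun s1 ⟨f1, k1⟩ => (ends_normP (E.keep k1) f1).mono (by omega) fun s2 _ ⟨f2, k2⟩ =>
      ⟨f2, k1.trans k2⟩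
  · refine ⟨fun a ha => ?_, Keeps.refl.set⟩
    beta_reduce
    rw [if_neg (by omega), if_neg (by omega)]; exact hf a ha
  · intro i s' _ h; simp [(E.keep h.2).regs]
  · intro i s' hi _ h36 ⟨h1, h2⟩
    have hr : s'.reg 1 = k + 1 ∧ s'.reg 2 = K ∧ s'.reg 3 = B ∧ s'.reg 7 = A ∧ s'.reg 8 = A + 3 * K := by
      simp [(E.keep h2).regs]
    have m1 : ∀ a, a < 3 * K → s'.mem (A + 3 * K + a) = f' a := fun a ha =>
      (h2.mem _ (by omega)).trans (hf' a ha)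
    have n1 : A + 3 * K + (K + i) ≠ A + (k + 1 + i) := by omega
    have n2 : A + 3 * K + (K + K + i) ≠ A + (k + 1 + i) := by omega
    have n3 : A + 3 * K + (K + K + i) ≠ A + (K + (k + 1) + i) := by omega
    have e1 := m1 i (by omega); have e2 := m1 (K + i) (by omega)
    have e3 := m1 (K + K + i) (by omega); have b1 := hB (K + i); have b2 := hB (K + K + i)
    refine .storeSeq (.storeSeq (.storeWithin ?_ (hb := ?_) (ha := ?_)) (hb := ?_) (ha := ?_))
      (hb := ?_) (ha := ?_)
    · have h3 := ((h1.put (s := s') (a := k + 1 + i) (x := f' i) rfl).put (a := K + (k + 1) + i)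
        (x := f' (K + i) + B) rfl).put (a := K + K + (k + 1) + i) (x := f' (K + K + i) + B) rfl
      simp [hr, h36, put_mem, n1, n2, n3, e1, e2, e3]; refine ⟨fun a ha => (h3 a ha).trans ?_, ?_⟩
      · grind
      · refine Keeps.set (Keeps.put (Keeps.put (h2.put ?_ ?_) ?_ ?_) ?_ ?_) le_rfl <;> omega
    all_goals simp [hr, h36, put_mem, n1, n2, n3, e2, e3]; try omega
  · intro s' _ h; refine ⟨fun a ha => ?_, h.2⟩; rw [h.1 a ha, combineF]
    grind
  · rw [pow_one]; omega

end

/-! ### Minima over all states -/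

/-- Fills the auxiliary table with the infinite cost. -/
def fillP : Prog := forUp 30 (R 5) (.store (R 17 + R 30) (R 6))

/-- For the numbers in the register `30` below the bound, the body computes whether there is a
transition (`R 31`), its cost `R 32` and the resulting state `R 33`.  The auxiliary table receives
the minimal costs. -/
def minP (bound : Term) (body : Prog) : Prog :=
  forUp 30 bound (body ;; .cond ((R 31).and ((R 32).less (M (R 17 + R 33))))
    (.store (R 17 + R 33) (R 32)) .skip)

/-- Copies the auxiliary table to the table `R 21`. -/
def copyP : Prog := forUp 30 (R 5) (.store (R 21 + R 30) (M (R 17 + R 30)))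

/-- Replaces the table `R 21` by the table of the minimal costs. -/
def tableP (bound : Term) (body : Prog) : Prog := fillP ;; minP bound body ;; copyP

/-- Replaces the table `R 21` by the table after the transition that is computed by `P`. -/
def stepP (P : Prog) : Prog := tableP (R 5 * 4)
  (70 ←ᵣ R 30 / 4 ;; 71 ←ᵣ R 7 ;; decodeP ;; 34 ←ᵣ R 30 % 4 ;; P ;; encodeP ;; 31 ←ᵣ R 35 ;;
    32 ←ᵣ M (R 21 + R 30 / 4) ;; 33 ←ᵣ R 71)

/-- Replaces the table `R 21` by the table of `unionSet` for the tables `R 21` and `R 22`. -/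
def pairsP : Prog := tableP (R 5 * R 5)
  (70 ←ᵣ R 30 / R 5 ;; 71 ←ᵣ R 7 ;; decodeP ;; 70 ←ᵣ R 30 % R 5 ;; 71 ←ᵣ R 8 ;; decodeP ;;
    unionOpP ;; encodeP ;; 31 ←ᵣ 1 ;;
    32 ←ᵣ M (R 21 + R 30 / R 5) + M (R 22 + R 30 % R 5) ;; 33 ←ᵣ R 71)

/-- The table at the address `t` contains for each code the least cost with which it is achieved. -/
def IsTable (Q I t : ℕ) (𝒜 : ℕ → ℕ → Prop) (s : Store) : Prop :=
  ∀ q, q < Q → s.mem (t + q) ≤ I ∧ ∀ c, c < I → (s.mem (t + q) ≤ c ↔ 𝒜 c q)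

/-- The store `s'` agrees with `s` in the registers below `d`, in the memory below `A`, and in the
memory cells from `W` to `t`. -/
structure Below (d A W t : ℕ) (s s' : Store) : Prop where
  reg : ∀ r, r < d → s'.reg r = s.reg r
  mem : ∀ a, a < A ∨ W ≤ a ∧ a < t → s'.mem a = s.mem a

section

variable {w k K B Q I A t d d' W : ℕ} {s s' s'' : Store} {f f' : ℕ → ℕ} {bound : Term} {body : Prog}

theorem Below.trans (h : Below d A W t s s') (h' : Below d' A W t s' s'')
    (hd : d ≤ d' := by norm_num) :
    Below d A W t s s'' :=
  ⟨fun r hr => (h'.reg r (hr.trans_le hd)).trans (h.reg r hr),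
    fun a ha => (h'.mem a ha).trans (h.mem a ha)⟩

theorem Below.set (h : Below d A W t s s') {r x : ℕ} (hr : d ≤ r := by norm_num) :
    Below d A W t s (s'.set r x) :=
  ⟨fun q hq => by rw [set_reg, if_neg (by omega), h.reg q hq], h.mem⟩

theorem Env.below (h : Env w k K B Q I A s) (hk : Below d A W t s s') (hd : 20 ≤ d := by norm_num) :
    Env w k K B Q I A s' :=
  h.congr fun r hr => hk.reg r (hr.trans_le hd)

theorem ends_fillP (E : Env w k K B Q I A s) : Ends w fillP (Q ^ 3) s fun s' =>
    (∀ q, q < Q → s'.mem (A + 6 * K + q) = I) ∧ Keeps 30 (A + 6 * K) (A + 6 * K + Q) s s' := by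
  have hw := E.word; have hl := E.large
  refine (Ends.forUp (T := 20) (m := Q) (fun i s' => (∀ q, q < i → s'.mem (A + 6 * K + q) = I) ∧
    Keeps 30 (A + 6 * K) (A + 6 * K + Q) s s') (by omega) ?_ ?_ ?_ fun s' _ h => h).le
      (E.forUp_le (i := 1) (j := 1) (by simp) (by simp; omega) (by simp))
  · exact ⟨by simp, Keeps.refl.set le_rfl⟩
  · intro i s' _ h; simp [(E.keep h.2).regs]
  · intro i s' hi _ h30 ⟨h1, h2⟩
    have hr : s'.reg 6 = I ∧ s'.reg 17 = A + 6 * K := by simp [(E.keep h2).regs]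
    refine .storeWithin ⟨by simp [h30], fun q hq => ?_, ?_⟩ (hb := by simp [hr, h30]; omega)
    · simp only [set_mem, put_mem, val_add, val_reg, hr, h30]; split_ifs with h
      · rfl
      · exact h1 q (by omega)
    · exact (h2.put (by simp [hr]) (by simp [hr, h30]; omega)).set le_rfl

theorem ends_copyP (E : Env w k K B Q I A s) (ht : s.reg 21 = t) (h1 : A + 6 * K + Q ≤ t)
    (h2 : t + Q < 2 ^ w) : Ends w copyP (Q ^ 3) s fun s' =>
      (∀ q, q < Q → s'.mem (t + q) = s.mem (A + 6 * K + q)) ∧ Keeps 30 t (t + Q) s s' := by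
  have hl := E.large
  refine (Ends.forUp (T := 20) (m := Q) (fun i s' => (∀ q, q < i → s'.mem (t + q) =
    s.mem (A + 6 * K + q)) ∧ Keeps 30 t (t + Q) s s') (by omega) ?_ ?_ ?_ fun s' _ h => h).le
      (E.forUp_le (i := 1) (j := 1) (by simp) (by simp; omega) (by simp))
  · exact ⟨by simp, Keeps.refl.set le_rfl⟩
  · intro i s' _ h; simp [(E.keep h.2).regs]
  · intro i s' hi _ h30 ⟨h3, h4⟩
    have hr : s'.reg 21 = t ∧ s'.reg 17 = A + 6 * K := by simp [(E.keep h4).regs, h4.reg, ht]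
    have hm := h4.mem (A + 6 * K + i) (by omega)
    refine .storeWithin ⟨by simp [h30], fun q hq => ?_, ?_⟩ (hb := by simp [hr, h30]; omega)
      (ha := by simp [hr, h30]; omega)
    · simp only [set_mem, put_mem, val_add, val_reg, val_load, hr, h30]; split_ifs with h
      all_goals grind
    · exact (h4.put (by simp [hr]) (by simp [hr, h30]; omega)).set le_rfl

variable {m : ℕ} {good : ℕ → Prop} {val tgt : ℕ → ℕ}

theorem ends_tableP (E : Env w k K B Q I A s) (ht : s.reg 21 = t) (h1 : A + 6 * K + Q ≤ t)
    (h2 : t + Q < 2 ^ w) (hm : m ≤ Q ^ 2) (hmw : m < 2 ^ w) (hc : bound.cost ≤ 1000)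
    (hb : ∀ s', Env w k K B Q I A s' → bound.Ok w s' ∧ bound.val s' = m)
    (htgt : ∀ x, x < m → tgt x < Q)
    (hbody : ∀ x s', x < m → Keeps 30 (A) (A + 6 * K + Q) s s' → s'.reg 30 = x →
      Ends w body (Q ^ 9) s' fun s'' => (s''.reg 31 ≠ 0 ↔ good x) ∧ s''.reg 32 = val x ∧
        s''.reg 33 = tgt x ∧ Keeps 31 A (A + 6 * K) s' s'') :
    Ends w (tableP bound body) (Q ^ 14) s fun s' =>
      IsTable Q I t (fun c q => ∃ x, x < m ∧ good x ∧ tgt x = q ∧ val x ≤ c) s' ∧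
        Below 30 A (A + 6 * K + Q) t s s' := by
  have hw := E.word; have hl := E.large; have hT := E.pow_le 9 (j := 10)
  have hT' := E.pow_le 13 (j := 14); have hT0 := E.pow_le 3 (j := 13)
  refine .seqWithin (ends_fillP E) fun s1 ⟨f1, k1⟩ => ?_; have E1 := E.keep k1
  have K1 := k1.widen (lo' := A) (by omega) le_rfl le_rfl
  refine .seqWithin (T' := Q ^ 13) (Z' := fun s' => IsTable Q I (A + 6 * K) (fun c q =>
    ∃ x, x < m ∧ good x ∧ tgt x = q ∧ val x ≤ c) s' ∧ Keeps 30 A (A + 6 * K + Q) s1 s')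
    ((Ends.forUp (T := Q ^ 9 + 30) (m := m) (fun i s' => IsTable Q I (A + 6 * K) (fun c q =>
      ∃ x, x < i ∧ good x ∧ tgt x = q ∧ val x ≤ c) s' ∧ Keeps 30 A (A + 6 * K + Q) s1 s')
      hmw ?_ ?_ ?_ fun s' _ h => h).le
      (E.forUp_le (i := 2) (j := 10) hm (by omega) hc)) ?_
  · refine ⟨fun q hq => ?_, Keeps.refl.set le_rfl⟩; rw [set_mem, f1 q hq]
    grind
  · intro i s' _ h; exact hb s' (E1.keep h.2)
  · intro i s' hi _ h30 ⟨h3, h4⟩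
    refine .seqWithin (hbody i s' hi (K1.trans h4 le_rfl) h30) fun s2 ⟨b1, b2, b3, k2⟩ => ?_
    have K2 := h4.trans (k2.widen le_rfl (by omega : A + 6 * K ≤ A + 6 * K + Q) le_rfl) (by norm_num)
    have hg : s2.reg 17 = A + 6 * K := by simp [(E1.keep K2).regs]
    have h30' : s2.reg 30 = i := (k2.reg 30 (by norm_num)).trans h30
    have e : ∀ q, q < Q → s2.mem (A + 6 * K + q) = s'.mem (A + 6 * K + q) := fun q hq =>
      k2.mem _ (by omega)
    have ht := htgt i hi
    refine .condWithin (fun h => .storeWithin ?_ (hb := by simp [hg, b3]; omega))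
      (fun h => .skipWithin ?_) (ha := by simp [hg, b3]; omega)
    · simp only [val_and, val_less, val_reg, val_load, val_add, hg, b3, b2] at h
      have h' : good i ∧ val i < s'.mem (A + 6 * K + tgt i) := by rw [← e _ ht]; simpa [b1] using h
      refine ⟨h30', fun q hq => ?_, (K2.put (by simp [hg]; omega) (by simp [hg, b3]; omega)).set le_rfl⟩
      simp only [set_mem, put_mem, val_add, val_reg, hg, b2, b3]; obtain ⟨g1, g2⟩ := h3 q hq
      grind
    · simp only [val_and, val_less, val_reg, val_load, val_add, hg, b3, b2] at h
      have h' : good i → s'.mem (A + 6 * K + tgt i) ≤ val i := by rw [← e _ ht]; simpa [b1] using h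
      refine ⟨h30', fun q hq => ?_, K2.set le_rfl⟩; rw [set_mem, e q hq]; obtain ⟨g1, g2⟩ := h3 q hq
      grind
  · rintro s2 ⟨f2, k2⟩; have K2 := K1.trans k2 le_rfl
    refine (ends_copyP (E.keep K2) ((K2.reg 21 (by norm_num)).trans ht) h1 h2).mono
      (by omega) fun s3 _ ⟨f3, k3⟩ => ⟨fun q hq => ?_, fun r hr => ?_, fun a ha => ?_⟩
    · rw [f3 q hq]; exact f2 q hq
    · rw [k3.reg r hr, K2.reg r hr]
    · rw [k3.mem a (by omega), K2.mem a (by omega)]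

theorem IsTable.congr {𝒜 𝒜' : ℕ → ℕ → Prop} (h : IsTable Q I t 𝒜 s)
    (hA : ∀ c q, c < I → q < Q → (𝒜 c q ↔ 𝒜' c q)) : IsTable Q I t 𝒜' s := fun q hq =>
  ⟨(h q hq).1, fun c hc => ((h q hq).2 c hc).trans (hA c q hc hq)⟩

theorem ends_stepP {x y : ℕ} {P : Prog} {F : ℕ → (ℕ → ℕ) → (ℕ → ℕ) × Bool} {𝒜 : ℕ → ℕ → Prop}
    (hP : Computes w k K B Q I A x y P F)
    (hF : ∀ g f, (∀ a, a < 3 * K → f a < B) → ∀ a, a < 3 * K → (F g f).1 a < B)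
    (E : Env w k K B Q I A s) (ht : s.reg 21 = t) (h1 : A + 6 * K + Q ≤ t) (h2 : t + Q < 2 ^ w)
    (h24 : s.reg 24 = x) (h25 : s.reg 25 = y) (hA : IsTable Q I t 𝒜 s) :
    Ends w (stepP P) (Q ^ 14) s fun s' => IsTable Q I t (fun c q' => ∃ q g, q < Q ∧ g < 4 ∧ 𝒜 c q ∧
      (F g (decode B q)).2 = true ∧ q' = encode B (3 * K) (F g (decode B q)).1) s' ∧
        Below 30 A (A + 6 * K + Q) t s s' := by
  have hw := E.word; have hl := E.large; have hB : 0 < B := by have := E.base; omega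
  have hd : ∀ q a, a < 3 * K → decode B q a < B := fun q a _ => decode_lt hB a
  refine (ends_tableP (m := Q * 4) (good := fun x => (F (x % 4) (decode B (x / 4))).2 = true)
    (val := fun x => s.mem (t + x / 4)) (tgt := fun x => encode B (3 * K)
      (F (x % 4) (decode B (x / 4))).1) E ht h1 h2 (by rw [pow_two]; exact Nat.mul_le_mul_left _ (by omega))
    (by omega) (by simp) (fun s' E' => ?_)
    (fun x _ => E.codes ▸ encode_lt (hF _ _ (hd _))) fun i s1 hi k1 h30 => ?_).imp
      fun s' _ ⟨h3, h4⟩ => ⟨h3.congr fun c q hc hq => ⟨?_, ?_⟩, h4⟩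
  · simp [E'.regs]; omega
  · have hT0 := E.pow_le 3 (j := 4); have hT1 := E.pow_le 4 (j := 8)
    have hT2 := E.pow_le 8 (j := 9); have E1 := E.keep k1
    have g1 : s1.reg 7 = A := by simp [E1.regs]
    have r1 : s1.reg 21 = t ∧ s1.reg 24 = x ∧ s1.reg 25 = y := by simp [k1.reg, ht, h24, h25]
    refine .assignSeq <| .assignSeq <| .seqWithin (ends_decodeP (q := i / 4) (o := A)
      (E1.set.set) (by simp [h30]) (by simp [g1]) (by omega))
      fun s2 ⟨f2, k2⟩ => .assignSeq ?_
    have K2 := ((((Keeps.refl.set (s := s1) (d := 31) (by norm_num)).set).trans k2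
      (by norm_num)).set (r := 34) (x := (R 30 % 4).val s2) (by norm_num))
    have h34 : (s2.set 34 ((R 30 % 4).val s2)).reg 34 = i % 4 := by simp [k2.reg, h30]
    have f3 : Holds A (3 * K) (decode B (i / 4)) (s2.set 34 ((R 30 % 4).val s2)) := f2
    generalize s2.set 34 ((R 30 % 4).val s2) = s3 at K2 h34 f3
    clear f2 k2
    refine .seqWithin (hP s3 (i % 4) _ (E1.keep K2) (by simp [K2.reg, r1])
      (by simp [K2.reg, r1]) h34 f3) fun s4 ⟨f4, b4, k4⟩ => ?_
    have K4 := (K2.widen le_rfl (by omega : A + 3 * K ≤ A + 6 * K) le_rfl).trans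
      (k4.widen le_rfl (by omega : A + 3 * K ≤ A + 6 * K) le_rfl) (by norm_num)
    refine .seqWithin (ends_encodeP (E1.keep K4) f4 (hF _ _ (hd _))) fun s5 ⟨b5, k5⟩ => ?_
    have K5 := K4.trans (k5.widen (le_refl A) (by omega : A ≤ A + 6 * K) le_rfl) (by norm_num)
    have m5 : s5.mem (t + i / 4) = s.mem (t + i / 4) := by
      rw [K5.mem _ (by omega), k1.mem _ (by omega)]
    have r5 : s5.reg 35 = (F (i % 4) (decode B (i / 4))).2.toNat ∧ s5.reg 21 = t ∧ s5.reg 30 = i := by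
      refine ⟨by rw [k5.reg 35 (by norm_num), b4], ?_⟩; simp [K5.reg, r1, h30]
    refine .assignSeq <| .assignSeq (ha := by simp [r5]; omega) <| .assignWithin ⟨?_, ?_, ?_, ?_⟩
    · simp [r5]
    · simp [r5, m5]
    · simp [b5]
    · exact ((K5.set le_rfl).set).set
  · rintro ⟨x, hx, hx1, rfl, hx3⟩
    exact ⟨x / 4, x % 4, by omega, by omega, ((hA _ (by omega)).2 c hc).1 hx3, hx1, rfl⟩
  · rintro ⟨q, g, hq, hg, h5, h6, rfl⟩; have e1 : (q * 4 + g) / 4 = q := by omega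
    have e2 : (q * 4 + g) % 4 = g := by omega
    refine ⟨q * 4 + g, by omega, ?_, ?_, ?_⟩ <;> simp only [e1, e2]
    · exact h6
    · exact ((hA _ (by omega)).2 c hc).2 h5

theorem ends_pairsP {t' : ℕ} {𝒜 𝒜' : ℕ → ℕ → Prop} (E : Env w k K B Q I A s)
    (ht : s.reg 21 = t) (ht' : s.reg 22 = t') (h1 : A + 6 * K + Q ≤ t)
    (h2 : t + Q < 2 ^ w) (h1' : A + 6 * K + Q ≤ t') (h2' : t' + Q < 2 ^ w)
    (hA : IsTable Q I t 𝒜 s) (hA' : IsTable Q I t' 𝒜' s) :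
    Ends w pairsP (Q ^ 14) s fun s' => IsTable Q I t (fun c q => ∃ c₁ c₂ q₁ q₂, q₁ < Q ∧ q₂ < Q ∧
      c₁ + c₂ ≤ c ∧ 𝒜 c₁ q₁ ∧ 𝒜' c₂ q₂ ∧
        q = encode B (3 * K) (unionF (k + 1) K B (decode B q₁) (decode B q₂))) s' ∧
        Below 30 A (A + 6 * K + Q) t s s' := by
  have hw := E.word; have hw2 := E.word_sq; have hl := E.large
  have hB : 0 < B := by have := E.base; omega
  have hd : ∀ q a, a < 3 * K → decode B q a < B := fun q a _ => decode_lt hB a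
  have hF : ∀ q q' a, a < 3 * K → unionF (k + 1) K B (decode B q) (decode B q') a < B := by
    have e := E.slots; have b := E.base; obtain rfl : K = 2 * (k + 1) + 1 := by omega
    exact fun q q' => (unionF_lt rfl (by omega) (hd q) (hd q')).1
  refine (ends_tableP (m := Q * Q) (good := fun _ => True)
    (val := fun x => s.mem (t + x / Q) + s.mem (t' + x % Q)) (tgt := fun x => encode B (3 * K)
      (unionF (k + 1) K B (decode B (x / Q)) (decode B (x % Q)))) E ht h1 h2 (by rw [pow_two])
    (by omega) (by simp) (fun s' E' => ?_)
    (fun x _ => E.codes ▸ encode_lt (hF _ _)) fun i s1 hi k1 h30 => ?_).imp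
      fun s' _ ⟨h3, h4⟩ => ⟨h3.congr fun c q hc hq => ⟨?_, ?_⟩, h4⟩
  · simp [E'.regs]; omega
  · have hq1 : i / Q < Q := Nat.div_lt_of_lt_mul hi; have hq2 : i % Q < Q := Nat.mod_lt _ (by omega)
    have hT0 := E.pow_le 3 (j := 4); have hT1 := E.pow_le 4 (j := 8)
    have hT2 := E.pow_le 8 (j := 9); have E1 := E.keep k1
    have g1 : s1.reg 7 = A ∧ s1.reg 8 = A + 3 * K ∧ s1.reg 5 = Q := by simp [E1.regs]
    have r1 : s1.reg 21 = t ∧ s1.reg 22 = t' := by simp [k1.reg, ht, ht']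
    refine .assignSeq <| .assignSeq <| .seqWithin (ends_decodeP (q := i / Q) (o := A)
      (E1.set.set) (by simp [h30, g1]) (by simp [g1]) (by omega))
      fun s2 ⟨f2, k2⟩ => ?_
    have K2 : Keeps 31 A (A + 6 * K) s1 s2 := ((Keeps.refl.set).set).trans
      (k2.widen le_rfl (by omega) le_rfl) (by norm_num)
    have r2 : s2.reg 30 = i ∧ s2.reg 8 = A + 3 * K ∧ s2.reg 5 = Q := by simp [K2.reg, h30, g1]
    clear k2
    refine .assignSeq <| .assignSeq <| .seqWithin (ends_decodeP (q := i % Q) (o := A + 3 * K)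
      (((E1.keep K2).set).set) (by simp [r2])
      (by simp [r2]) (by omega)) fun s3 ⟨f3, k3⟩ => ?_
    have K3 : Keeps 31 A (A + 6 * K) s1 s3 := (K2.set.set).trans
      (k3.widen (by omega) (by omega) le_rfl) (by norm_num)
    have f3' := Holds.keep (f := decode B (i / Q)) (A := A) (N := 3 * K) (s := (s2.set 70 _).set 71 _)
      f2 k3 (by omega)
    clear k3
    refine .seqWithin (ends_unionOpP (E1.keep K3) f3' f3 fun a => decode_lt hB a)
      fun s4 ⟨f4, k4⟩ => ?_
    have K4 := K3.trans (k4.widen le_rfl (by omega : A + 3 * K ≤ A + 6 * K) le_rfl) (by norm_num)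
    refine .seqWithin (ends_encodeP (E1.keep K4) f4 (hF _ _)) fun s5 ⟨b5, k5⟩ => ?_
    have K5 := K4.trans (k5.widen (le_refl A) (by omega : A ≤ A + 6 * K) le_rfl) (by norm_num)
    have l3 := Nat.le_add_right t (i / Q); have l4 := Nat.le_add_right t' (i % Q)
    have m5 : s5.mem (t + i / Q) = s.mem (t + i / Q) ∧ s5.mem (t' + i % Q) = s.mem (t' + i % Q) := by
      rw [K5.mem _ (by omega), k1.mem _ (by omega), K5.mem _ (by omega), k1.mem _ (by omega)]
      exact ⟨rfl, rfl⟩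
    have r5 : s5.reg 21 = t ∧ s5.reg 22 = t' ∧ s5.reg 30 = i ∧ s5.reg 5 = Q := by
      simp [K5.reg, r1, h30, g1]
    have l1 := (hA (i / Q) hq1).1; have l2 := (hA' (i % Q) hq2).1
    refine .assignSeq <| .assignSeq (ha := by simp [r5, m5]; omega) <| .assignWithin ⟨?_, ?_, ?_, ?_⟩
    · simp
    · simp [r5, m5]
    · simp [b5]
    · exact ((K5.set le_rfl).set).set
  · rintro ⟨x, hx, -, rfl, hx3⟩; have hq1 : x / Q < Q := Nat.div_lt_of_lt_mul hx
    have hq2 : x % Q < Q := Nat.mod_lt _ (by omega)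
    exact ⟨_, _, x / Q, x % Q, hq1, hq2, hx3, ((hA _ hq1).2 _ (by omega)).1 le_rfl,
      ((hA' _ hq2).2 _ (by omega)).1 le_rfl, rfl⟩
  · rintro ⟨c₁, c₂, q₁, q₂, hq1, hq2, hcc, a1, a2, rfl⟩
    have e1 : (q₁ * Q + q₂) / Q = q₁ := by
      rw [mul_comm, Nat.mul_add_div (by omega), Nat.div_eq_of_lt hq2, add_zero]
    have e2 : (q₁ * Q + q₂) % Q = q₂ := by rw [mul_comm, Nat.mul_add_mod, Nat.mod_eq_of_lt hq2]
    have e3 : q₁ * Q + q₂ < Q * Q := by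
      have := Nat.mul_le_mul_right Q (Nat.succ_le_of_lt hq1); rw [Nat.succ_mul] at this; omega
    refine ⟨q₁ * Q + q₂, e3, trivial, ?_, ?_⟩ <;> simp only [e1, e2]
    have := ((hA _ hq1).2 _ (by omega)).2 a1; have := ((hA' _ hq2).2 _ (by omega)).2 a2; omega

end

/-! ### Programs for the operations of an expression -/

/-- Merges the labels of the second operand of a union with those of the first. -/
def mergesP : Prog := forUp 26 (R 1) (24 ←ᵣ R 1 + R 26 ;; 25 ←ᵣ R 26 ;; stepP mergeP)

/-- The auxiliary table receives the state of a vertex in `T` with label `R 27`. -/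
def apexP : Prog :=
  71 ←ᵣ R 27 ;; powP ;; 69 ←ᵣ R 70 * 2 ;; 71 ←ᵣ R 14 ;; powP ;; 69 ←ᵣ R 69 + R 70 * 6 ;;
  71 ←ᵣ R 2 + R 14 ;; powP ;; .store (R 17 + (R 69 + R 70)) 0

/-- The auxiliary table receives the states of a vertex outside of `T` with label `R 27` and weight
`R 29`; the status of the vertex is `a`. -/
def singleP (a : Term) : Prog :=
  71 ←ᵣ R 27 ;; powP ;; .cond (R 29) (.cond ((R 29 - 1).less (R 6)) (.store (R 17) (R 29 - 1)) .skip)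
    .skip ;; .store (R 17 + a * R 70) 0

/-- Writes the table of the creation of a vertex with label `R 27` and weight `R 29`, where the bit
`R 28` tells whether it is in `T` (if `b` is true) or in `S` (if `b` is false). -/
def vertexP (b : Bool) : Prog :=
  fillP ;; (if b then .cond (R 28) apexP (singleP 2) else singleP (2 - R 28)) ;; copyP

section

variable {w k K B Q I A t n : ℕ} {s s' s'' : Store}

theorem stepSet_eq {F : ℕ → (ℕ → ℕ) → (ℕ → ℕ) × Bool} {𝒜 : ℕ → ℕ → Prop}
    (hQ : Q = B ^ (3 * K)) (hK : K = n + 1) : (fun c q' => ∃ q g, q < Q ∧ g < 4 ∧ 𝒜 c q ∧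
      (F g (decode B q)).2 = true ∧ q' = encode B (3 * K) (F g (decode B q)).1) =
        stepSet n B F 𝒜 := by
  subst hQ hK; rfl

theorem Env.slots_eq (E : Env w k K B Q I A s) : K = 2 * (k + 1) + 1 := E.slots

theorem ends_mergeStep {x y : ℕ} {𝒜 : ℕ → ℕ → Prop} (hx : x < K) (hy : y < K)
    (E : Env w k K B Q I A s) (ht : s.reg 21 = t) (h1 : A + 6 * K + Q ≤ t) (h2 : t + Q < 2 ^ w)
    (h24 : s.reg 24 = x) (h25 : s.reg 25 = y) (hA : IsTable Q I t 𝒜 s) :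
    Ends w (stepP mergeP) (Q ^ 14) s fun s' =>
      IsTable Q I t (stepSet (2 * (k + 1)) B (fun g f => mergeF K B x y g f) 𝒜) s' ∧
        Below 30 A (A + 6 * K + Q) t s s' := by
  rw [← stepSet_eq E.codes E.slots_eq]
  refine ends_stepP (ends_mergeP hx hy) (fun g f hf a ha => ?_) E ht h1 h2 h24 h25 hA
  have e := E.slots; have b := E.base; have hm := mergeCore_lt (g := g) hx hy (by omega : 7 ≤ B) hf
  obtain ⟨n1, -, -, n4⟩ := normIds_spec (B := B) (by omega : K ≤ B)
    fun a ha => (hm a ha).trans_le (by omega)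
  by_cases h : a < K
  · exact (n1 a h).trans_lt (mergeCore_low hx (by omega) hf h)
  · exact (n4 a (by omega) ha).trans_le (by omega)

theorem ends_joinStep {x y : ℕ} {𝒜 : ℕ → ℕ → Prop} (hx : x < K) (hy : y < K) (hxy : x ≠ y)
    (E : Env w k K B Q I A s) (ht : s.reg 21 = t) (h1 : A + 6 * K + Q ≤ t) (h2 : t + Q < 2 ^ w)
    (h24 : s.reg 24 = x) (h25 : s.reg 25 = y) (hA : IsTable Q I t 𝒜 s) :
    Ends w (stepP joinP) (Q ^ 14) s fun s' =>
      IsTable Q I t (stepSet (2 * (k + 1)) B (fun g f => joinF K x y g f) 𝒜) s' ∧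
        Below 30 A (A + 6 * K + Q) t s s' := by
  rw [← stepSet_eq E.codes E.slots_eq]
  exact ends_stepP (ends_joinP hx hy hxy) (fun g f hf => joinF_lt hx hy
    (by have := E.base; omega) hf) E ht h1 h2 h24 h25 hA

theorem ends_mergesP {𝒜 : ℕ → ℕ → Prop} (E : Env w k K B Q I A s) (ht : s.reg 21 = t)
    (h1 : A + 6 * K + Q ≤ t) (h2 : t + Q < 2 ^ w) (hA : IsTable Q I t 𝒜 s) :
    Ends w mergesP (Q ^ 17) s fun s' =>
      IsTable Q I t (mergesSet (k + 1) (2 * (k + 1)) B 𝒜 (k + 1)) s' ∧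
        Below 24 A (A + 6 * K + Q) t s s' := by
  have hw := E.word; have hl := E.large; have hs := E.slots_eq; have hT0 := E.pow_le 0 (j := 14)
  have hT := E.pow_le 14 (j := 15)
  refine (Ends.forUp (m := k + 1) (T := Q ^ 14 + 20) (fun i s' => IsTable Q I t
    (mergesSet (k + 1) (2 * (k + 1)) B 𝒜 i) s' ∧ Below 24 A (A + 6 * K + Q) t s s') (by omega) ?_ ?_ ?_
    fun s' _ h => h).le (E.forUp_le (i := 1) (j := 15) (by simp; omega) (by omega) (by simp))
  · exact ⟨hA, fun r hr => by simp; omega, fun _ _ => rfl⟩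
  · intro i s' _ h; simp [(E.below h.2).regs]
  · intro i s' hi _ h26 ⟨h3, h4⟩; have E' := E.below h4
    have hr : s'.reg 1 = k + 1 ∧ s'.reg 21 = t := by simp [E'.regs, h4.reg, ht]
    refine .assignSeq (.assignSeq <| (ends_mergeStep (x := k + 1 + i) (y := i) (by omega) (by omega)
      ((E'.set).set) (by simp [hr]) h1 h2 (by simp [h26, hr])
      (by simp [h26]) h3).mono (by simp) fun s2 _ ⟨h5, h6⟩ => ⟨?_, ?_, ?_⟩)
      (ha := by simp [hr, h26]; omega)
    · simp [h6.reg, h26]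
    · rw [hs] at h5; exact h5
    · exact ((h4.set.set).trans h6).set

theorem ends_unionP {t' : ℕ} {𝒜 𝒜' : ℕ → ℕ → Prop} (E : Env w k K B Q I A s)
    (ht : s.reg 21 = t) (ht' : s.reg 22 = t') (h1 : A + 6 * K + Q ≤ t)
    (h2 : t + Q < 2 ^ w) (h1' : A + 6 * K + Q ≤ t') (h2' : t' + Q < 2 ^ w)
    (hA : IsTable Q I t 𝒜 s) (hA' : IsTable Q I t' 𝒜' s) :
    Ends w (pairsP ;; mergesP) (Q ^ 18) s fun s' => IsTable Q I t (mergesSet (k + 1) (2 * (k + 1)) B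
      (unionSet (k + 1) (2 * (k + 1)) B 𝒜 𝒜') (k + 1)) s' ∧ Below 24 A (A + 6 * K + Q) t s s' := by
  have hT := E.pow_le 14 (j := 17); have hT' := E.pow_le 17 (j := 18)
  refine .seqWithin (ends_pairsP E ht ht' h1 h2 h1' h2' hA hA') fun s1 ⟨h3, h4⟩ => ?_
  refine (ends_mergesP (E.below h4) ((h4.reg 21 (by norm_num)).trans ht) h1 h2
    h3).mono (by omega) fun s2 _ ⟨h5, h6⟩ => ⟨?_, fun r hr => ?_, fun a ha => ?_⟩
  · rw [E.codes, E.slots_eq] at h5; rw [E.codes, E.slots_eq]; exact h5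
  · rw [h6.reg r hr, h4.reg r (by omega)]
  · rw [h6.mem a ha, h4.mem a ha]

theorem ends_singleP {i wc b : ℕ} {a : Term} (E : Env w k K B Q I A s)
    (hf : ∀ q, q < Q → s.mem (A + 6 * K + q) = I) (hi : i < K) (h27 : s.reg 27 = i)
    (h29 : s.reg 29 = wc) (ha : ∀ s', Keeps 30 (A + 6 * K) (A + 6 * K + Q) s s' → a.Ok w s' ∧ a.val s' = b)
    (hac : a.cost ≤ 100) (hb : 0 < b) (hb2 : b ≤ 2) : Ends w (singleP a) (Q ^ 2) s fun s' =>
      IsTable Q I (A + 6 * K) (fun c q => q = 0 ∧ wc ≠ 0 ∧ wc - 1 ≤ c ∨ q = b * B ^ i) s' ∧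
        Keeps 30 (A + 6 * K) (A + 6 * K + Q) s s' := by
  have hw := E.word; have hl := E.large; have hB := E.base; have hT := E.pow_le 1 (j := 2)
  have hk := E.slots
  have hQ : B * B ^ i ≤ Q := by
    rw [E.codes, mul_comm, ← pow_succ]; exact Nat.pow_le_pow_right (by omega) (by omega)
  have h0 : 1 ≤ B ^ i := Nat.one_le_pow _ _ (by omega)
  have hbi : b * B ^ i ≤ 2 * B ^ i := Nat.mul_le_mul_right _ hb2
  have hbi' : 1 * B ^ i ≤ b * B ^ i := Nat.mul_le_mul_right _ hb
  have hbB : 3 * B ^ i ≤ B * B ^ i := Nat.mul_le_mul_right _ (by omega); rw [pow_one] at hT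
  refine .assignSeq <| .seqWithin (ends_powP (i := i) (B := B) (by simp [E.regs]) (by simp [h27])
    (by omega) (by omega) (by omega)) fun s1 ⟨r1, k1⟩ => ?_
  have K1 : Keeps 30 (A + 6 * K) (A + 6 * K + Q) s s1 :=
    ⟨fun r hr => by rw [k1.reg r (by omega), set_reg, if_neg (by omega)],
      fun a _ => by rw [k1.mem a (by omega)]; rfl⟩
  have E1 := E.keep K1
  have g1 : s1.reg 6 = I ∧ s1.reg 17 = A + 6 * K ∧ s1.reg 29 = wc := by simp [E1.regs, K1.reg, h29]
  have f1 : ∀ q, q < Q → s1.mem (A + 6 * K + q) = I := fun q hq => by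
    rw [k1.mem _ (by omega)]; exact hf q hq
  refine .seqWithin (T' := 60) (Z' := fun s' => IsTable Q I (A + 6 * K) (fun c q => q = 0 ∧ wc ≠ 0 ∧
      wc - 1 ≤ c) s' ∧ s'.reg = s1.reg ∧ Keeps 30 (A + 6 * K) (A + 6 * K + Q) s s')
    (.condWithin (fun h1 => .condWithin (fun h2 => .storeWithin ?_ (hb := by simp))
      fun h2 => .skipWithin ?_) fun h1 => .skipWithin ?_) fun s2 ⟨f2, r2, k2⟩ => .storeWithin ?_
      (hb := ?_) (hT := ?_)
  · simp [g1] at h1 h2; refine ⟨fun q hq => ?_, rfl, K1.put (by simp [g1]) (by simp [g1]; omega)⟩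
    simp only [put_mem, val_reg, val_sub, val_ofNat, g1]; split_ifs with h
    all_goals grind
  · simp [g1] at h1 h2; refine ⟨fun q hq => ?_, rfl, K1⟩; rw [f1 q hq]
    exact ⟨le_rfl, fun c hc => by omega⟩
  · simp [g1] at h1; refine ⟨fun q hq => ?_, rfl, K1⟩; rw [f1 q hq]
    exact ⟨le_rfl, fun c hc => by omega⟩
  · obtain ⟨-, a2⟩ := ha s2 k2
    refine ⟨fun q hq => ?_, k2.put (by simp [r2, g1]) (by simp [r2, g1, a2, r1]; omega)⟩
    simp only [put_mem, val_reg, val_add, val_mul, val_ofNat, r2, g1, a2, r1]; split_ifs with h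
    · grind
    · refine ⟨(f2 q hq).1, fun c hc => ((f2 q hq).2 c hc).trans ?_⟩; omega
  · obtain ⟨a1, a2⟩ := ha s2 k2; simp [r2, g1, a2, r1, a1]; omega
  · simp; omega

theorem ends_apexP {i : ℕ} (E : Env w k K B Q I A s)
    (hf : ∀ q, q < Q → s.mem (A + 6 * K + q) = I) (hi : i < k) (h27 : s.reg 27 = i) :
    Ends w apexP (Q ^ 2) s fun s' =>
      IsTable Q I (A + 6 * K) (fun _ q => q = apexCode k (2 * (k + 1)) B i) s' ∧
        Keeps 30 (A + 6 * K) (A + 6 * K + Q) s s' := by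
  have hw := E.word; have hl := E.large; have hB := E.base; have hT := E.pow_le 1 (j := 2)
  have hk := E.slots_eq
  have hQ : apexCode k (2 * (k + 1)) B i < Q := by
    rw [apexCode_eq hi (by omega), E.codes, hk]; refine encode_lt fun a _ => ?_; unfold apexArray
    split_ifs <;> omega
  have hQ' := hQ; rw [apexCode, ← hk] at hQ; rw [pow_one] at hT
  have gs : s.reg 3 = B ∧ s.reg 14 = k ∧ s.reg 2 = K ∧ s.reg 17 = A + 6 * K := by simp [E.regs]
  refine .assignSeq <| .seqWithin (ends_powP (i := i) (B := B) (by simp [gs]) (by simp [h27])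
    (by omega) (by omega) (by omega)) fun s1 ⟨r1, k1⟩ => .assignSeq (.assignSeq ?_)
    (ha := by simp [r1]; omega)
  have g1 : s1.reg 3 = B ∧ s1.reg 14 = k ∧ s1.reg 2 = K ∧ s1.reg 17 = A + 6 * K := by
    simp [k1.reg, gs]
  refine .seqWithin (ends_powP (i := k) (B := B) (by simp [g1]) (by simp [g1]) (by omega) (by omega)
    (by omega)) fun s2 ⟨r2, k2⟩ => ?_
  have e2 : s2.reg 69 = B ^ i * 2 := by simp [k2.reg, r1]
  have g2 : s2.reg 3 = B ∧ s2.reg 14 = k ∧ s2.reg 2 = K ∧ s2.reg 17 = A + 6 * K := by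
    simp [k2.reg, g1]
  have q2 : ∀ r, r < 69 → s2.reg r = s.reg r := fun r hr => by
    rw [k2.reg r (by omega), set_reg, set_reg, if_neg (by omega), if_neg (by omega), k1.reg r (by omega),
      set_reg, if_neg (by omega)]
  have m2 : s2.mem = s.mem := by
    funext a; rw [k2.mem a (by omega), set_mem, set_mem, k1.mem a (by omega), set_mem]
  clear k1 k2 g1 r1
  refine .assignSeq (.assignSeq (.seqWithin (ends_powP (i := K + k) (B := B) (by simp [g2])
    (by simp [g2]) (by omega) (by omega) (by omega)) fun s3 ⟨r3, k3⟩ => ?_)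
    (ha := by simp [g2]; omega)) (ha := by simp [e2, r2]; omega)
  have e3 : s3.reg 69 = B ^ i * 2 + B ^ k * 6 := by simp [k3.reg, e2, r2]
  have g3 : s3.reg 17 = A + 6 * K := by simp [k3.reg, g2]
  have m3 : s3.mem = s.mem := by funext a; rw [k3.mem a (by omega), set_mem, set_mem, m2]
  have q3 : ∀ r, r < 69 → s3.reg r = s.reg r := fun r hr => by
    rw [k3.reg r (by omega), set_reg, set_reg, if_neg (by omega), if_neg (by omega), q2 r hr]
  clear k3 g2 q2 m2 e2 r2
  have ev : B ^ i * 2 + B ^ k * 6 + B ^ (K + k) = apexCode k (2 * (k + 1)) B i := by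
    rw [apexCode, ← hk]; omega
  refine .storeWithin ⟨fun q hq => ?_, fun r hr => q3 r (by omega), fun a ha => ?_⟩
    (hb := by simp [g3, e3, r3]; omega)
  · simp only [put_mem, val_add, val_reg, val_ofNat, g3, e3, r3, ev, m3]; split_ifs with h
    all_goals grind
  · simp only [put_mem, val_add, val_reg, g3, e3, r3, ev, m3]; rw [if_neg (by omega)]

theorem ends_vertexP {b : Bool} {i bt wc : ℕ} (E : Env w k K B Q I A s) (ht : s.reg 21 = t)
    (h1 : A + 6 * K + Q ≤ t) (h2 : t + Q < 2 ^ w) (hi : i < k) (h27 : s.reg 27 = i)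
    (h28 : s.reg 28 = bt) (h29 : s.reg 29 = wc) (hbt : bt ≤ 1) :
    Ends w (vertexP b) (Q ^ 4) s fun s' => IsTable Q I t (fun c q =>
      if b = true ∧ bt ≠ 0 then q = apexCode k (2 * (k + 1)) B i
      else q = 0 ∧ wc ≠ 0 ∧ wc - 1 ≤ c ∨ q = (if b = true then 2 else 2 - bt) * B ^ i) s' ∧
        Below 30 A (A + 6 * K + Q) t s s' := by
  have hw := E.word; have hl := E.large; have hT := E.pow_le 3 (j := 4)
  have hT' := E.pow_le 2 (j := 3); have hk := E.slots
  refine .seqWithin (ends_fillP E) fun s1 ⟨f1, k1⟩ => ?_; have E1 := E.keep k1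
  have q1 : s1.reg 27 = i ∧ s1.reg 28 = bt ∧ s1.reg 29 = wc := by simp [k1.reg, h27, h28, h29]
  refine .seqWithin (T' := Q ^ 2 + 10) (Z' := fun s' => IsTable Q I (A + 6 * K) (fun c q =>
      if b = true ∧ bt ≠ 0 then q = apexCode k (2 * (k + 1)) B i
      else q = 0 ∧ wc ≠ 0 ∧ wc - 1 ≤ c ∨ q = (if b = true then 2 else 2 - bt) * B ^ i) s' ∧
        Keeps 30 (A + 6 * K) (A + 6 * K + Q) s1 s') ?_ fun s2 ⟨f2, k2⟩ => ?_
  · rcases b with _ | _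
    · simp only [Bool.false_eq_true, if_false, false_and]
      exact (ends_singleP E1 f1 (by omega) q1.1 q1.2.2 (b := 2 - bt) (fun s' k' => by
        simp [k'.reg, q1]) (by simp) (by omega) (by omega)).le (by omega)
    · simp only [if_true, true_and]; refine .condWithin (fun h => ?_) fun h => ?_ <;> simp [q1] at h
      · simp only [ne_eq, h, not_false_eq_true, if_true]
        exact (ends_apexP E1 f1 hi q1.1).le (by simp)
      · simp only [ne_eq, h, not_true_eq_false, if_false]
        exact (ends_singleP E1 f1 (by omega) q1.1 q1.2.2 (b := 2) (fun s' k' => by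
          simp) (by simp) (by omega) (by omega)).le (by simp)
  · have K2 := k1.trans k2 le_rfl
    refine (ends_copyP (E.keep K2) ((K2.reg 21 (by norm_num)).trans ht) h1 h2).mono
      (by omega) fun s3 _ ⟨f3, k3⟩ => ⟨fun q hq => ?_, fun r hr => ?_, fun a ha => ?_⟩
    · rw [f3 q hq]; exact f2 q hq
    · rw [k3.reg r hr, K2.reg r hr]
    · rw [k3.mem a (by omega), K2.mem a (by omega)]

end

end WordRAM

/-! ### Marking the joins that are repeated later -/

section

variable {V : Type*} {k : ℕ}

open Classical in
/-- The memory `m` holds the operations of the expression from the cell `p` on.  If `marked` is true,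
then the fourth cell of each join tells whether its labels are joined again later, where `R` are
the pairs of labels that are joined after the expression. -/
def KExpr.Stored (marked : Prop) (S : Set V) (c : V → ℕ∞) (m : ℕ → ℕ) :
    (ℕ → ℕ → Prop) → KExpr V k → ℕ → Prop
  | _, vertex i v, p => m p = 0 ∧ m (p + 1) = i ∧ m (p + 2) = (if v ∈ S then 1 else 0) ∧
      m (p + 3) = weightCode (c v)
  | R, union e₁ e₂, p => e₁.Stored marked S c m R p ∧ e₂.Stored marked S c m R (p + 4 * e₁.size) ∧
      m (p + 4 * e₁.size + 4 * e₂.size) = 1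
  | R, join i j _ e, p => e.Stored marked S c m (joinedBelow R i j) p ∧ m (p + 4 * e.size) = 2 ∧
      m (p + 4 * e.size + 1) = i ∧ m (p + 4 * e.size + 2) = j ∧
        (marked → (m (p + 4 * e.size + 3) ≠ 0 ↔ R i j))
  | R, rename i j e, p => e.Stored marked S c m (renamedBelow R i j) p ∧ m (p + 4 * e.size) = 3 ∧
      m (p + 4 * e.size + 1) = i ∧ m (p + 4 * e.size + 2) = j

variable {marked : Prop} {S : Set V} {c : V → ℕ∞} {m m' : ℕ → ℕ}

theorem KExpr.size_pos (e : KExpr V k) : 1 ≤ e.size := by cases e <;> simp [size]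

theorem KExpr.Stored.congr {e : KExpr V k} {R : ℕ → ℕ → Prop} {p : ℕ}
    (h : e.Stored marked S c m R p) (hm : ∀ a, p ≤ a → a < p + 4 * e.size → m' a = m a) :
    e.Stored marked S c m' R p := by
  induction e generalizing R p with
  | vertex i v =>
    simp only [size] at hm
    simpa only [Stored, hm p (by omega) (by omega), hm (p + 1) (by omega) (by omega),
      hm (p + 2) (by omega) (by omega), hm (p + 3) (by omega) (by omega)] using h
  | union e₁ e₂ ih₁ ih₂ =>
    simp only [size] at hm
    refine ⟨ih₁ h.1 fun a _ _ => hm a (by omega) (by omega),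
      ih₂ h.2.1 fun a _ _ => hm a (by omega) (by omega), ?_⟩
    rw [hm _ (by omega) (by omega)]; exact h.2.2
  | join i j _ e ih =>
    simp only [size] at hm; refine ⟨ih h.1 fun a _ _ => hm a (by omega) (by omega), ?_⟩
    simpa only [hm _ (by omega : p ≤ p + 4 * e.size) (by omega),
      hm _ (by omega : p ≤ p + 4 * e.size + 1) (by omega),
      hm _ (by omega : p ≤ p + 4 * e.size + 2) (by omega),
      hm _ (by omega : p ≤ p + 4 * e.size + 3) (by omega)] using h.2
  | rename i j e ih =>
    simp only [size] at hm; refine ⟨ih h.1 fun a _ _ => hm a (by omega) (by omega), ?_⟩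
    simpa only [hm _ (by omega : p ≤ p + 4 * e.size) (by omega),
      hm _ (by omega : p ≤ p + 4 * e.size + 1) (by omega),
      hm _ (by omega : p ≤ p + 4 * e.size + 2) (by omega)] using h.2

theorem KExpr.length_code (e : KExpr V k) : (e.code S c).length = 4 * e.size := by
  induction e <;> simp [code, size, *] <;> omega

theorem KExpr.stored_of_code (e : KExpr V k) {R : ℕ → ℕ → Prop} {p : ℕ}
    (h : ∀ x, x < 4 * e.size → m (p + x) = (e.code S c).getD x 0) : e.Stored False S c m R p := by
  induction e generalizing R p with
  | vertex i v =>
    simp only [size] at h; exact ⟨h 0 (by omega), h 1 (by omega), h 2 (by omega), h 3 (by omega)⟩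
  | union e₁ e₂ ih₁ ih₂ =>
    simp only [size, code] at h; have l₁ := e₁.length_code (S := S) (c := c)
    have l₂ := e₂.length_code (S := S) (c := c); refine ⟨ih₁ fun x hx => ?_, ih₂ fun x hx => ?_, ?_⟩
    · grind
    · rw [add_assoc, h _ (by omega), List.append_assoc, List.getD_append_right _ _ _ _ (by omega),
        List.getD_append _ _ _ _ (by omega), l₁, Nat.add_sub_cancel_left]
    · rw [add_assoc, h _ (by omega), List.getD_append_right _ _ _ _ (by simp; omega)]; simp [l₁, l₂]
  | join i j _ e ih =>
    simp only [size, code] at h; have l := e.length_code (S := S) (c := c)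
    refine ⟨ih fun x hx => ?_, ?_, ?_, ?_, False.elim⟩
    · grind
    all_goals
      (try rw [add_assoc p])
      rw [h _ (by omega), List.getD_append_right _ _ _ _ (by omega)]; simp [l]
  | rename i j e ih =>
    simp only [size, code] at h; have l := e.length_code (S := S) (c := c)
    refine ⟨ih fun x hx => ?_, ?_, ?_, ?_⟩
    · grind
    all_goals
      (try rw [add_assoc p])
      rw [h _ (by omega), List.getD_append_right _ _ _ _ (by omega)]; simp [l]

end

namespace WordRAM

open Term Store

/-- The address of an entry of the current matrix, which starts at the address in register `23`. -/
def entryP (a b : Term) : Term := R 23 + (a * R 14 + b)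

/-- Pushes a copy of the current matrix. -/
def pushP : Prog :=
  forUp 30 (R 13) (.store (R 23 + R 13 + R 30) (M (R 23 + R 30))) ;; 23 ←ᵣ R 23 + R 13

/-- Replaces the row and the column of the label `R 24` by those of the label `R 25`. -/
def renameMatrixP : Prog :=
  forUp 30 (R 14) (.store (entryP (R 24) (R 30)) (M (entryP (R 25) (R 30)))) ;;
  forUp 30 (R 14) (.store (entryP (R 30) (R 24)) (M (entryP (R 30) (R 25))))

/-- Marks a join if the current matrix has the entry `1` at its labels, and sets this entry to `1`. -/
def markP : Prog :=
  .store (R 20 + 3) (M (entryP (R 24) (R 25))) ;; .store (entryP (R 24) (R 25)) 1 ;;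
  .store (entryP (R 25) (R 24)) 1

/-- One step of the pass through the operations in reverse order.  A stack of matrices holds the
pairs of labels that are joined after the operands that are still to be processed. -/
def pruneP : Prog := 20 ←ᵣ R 20 - 4 ;; 24 ←ᵣ M (R 20 + 1) ;; 25 ←ᵣ M (R 20 + 2) ;;
  .cond (M (R 20)) (.cond (.equal (M (R 20)) 1) pushP (.cond (.equal (M (R 20)) 2) markP renameMatrixP))
    (23 ←ᵣ R 23 - R 13)

/-- The cells from `r` on hold the matrix of the relation `P` on the labels. -/
def HasMatrix (k : ℕ) (P : ℕ → ℕ → Prop) (r : ℕ) (s : Store) : Prop :=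
  ∀ a b, a < k → b < k → (s.mem (r + (a * k + b)) ≠ 0 ↔ P a b)

section

variable {w k K B Q I A p r t x y : ℕ} {s s' : Store} {P : ℕ → ℕ → Prop}

theorem entry_lt {a b : ℕ} (ha : a < k) (hb : b < k) : a * k + b < k * k := by
  have := Nat.mul_le_mul_right k (Nat.succ_le_of_lt ha); rw [Nat.succ_mul] at this; omega

theorem entry_inj {a b a' b' : ℕ} (hb : b < k) (hb' : b' < k) (h : a * k + b = a' * k + b') :
    a = a' ∧ b = b' := by
  have e1 := congrArg (· / k) h; have e2 := congrArg (· % k) h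
  simp only [Nat.mul_add_mod_of_lt hb, Nat.mul_add_mod_of_lt hb'] at e2; have hk : 0 < k := by omega
  simp only [Nat.mul_comm _ k, Nat.mul_add_div hk, Nat.div_eq_of_lt hb, Nat.div_eq_of_lt hb'] at e1
  exact ⟨by simpa using e1, e2⟩

theorem HasMatrix.congr (h : HasMatrix k P r s)
    (hm : ∀ a, r ≤ a → a < r + k * k → s'.mem a = s.mem a) : HasMatrix k P r s' := fun a b ha hb => by
  have := entry_lt ha hb; rw [hm _ (by omega) (by omega)]; exact h a b ha hb

theorem ends_pushP (E : Env w k K B Q I A s) (h23 : s.reg 23 = r) (hr : r + 2 * (k * k) < 2 ^ w)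
    (hP : HasMatrix k P r s) : Ends w pushP (Q ^ 5) s fun s' =>
      HasMatrix k P (r + k * k) s' ∧ s'.reg 23 = r + k * k ∧
        Keeps 23 (r + k * k) (r + 2 * (k * k)) s s' := by
  have hl := E.large; have hk := E.slots; have hT := E.pow_le 4 (j := 5)
  have hkk : k * k ≤ Q ^ 2 := by rw [pow_two]; exact Nat.mul_le_mul (by omega) (by omega)
  refine .seqWithin (Z' := fun s' => (∀ x, x < k * k → s'.mem (r + k * k + x) = s.mem (r + x)) ∧
    Keeps 30 (r + k * k) (r + 2 * (k * k)) s s') ((Ends.forUp (T := 20) (m := k * k) (fun i s' =>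
      (∀ x, x < i → s'.mem (r + k * k + x) = s.mem (r + x)) ∧
        Keeps 30 (r + k * k) (r + 2 * (k * k)) s s') (by omega) ?_ ?_ ?_ fun s' _ h => h).le
          (E.forUp_le (i := 2) (j := 1) hkk (by simp; omega) (by simp))) fun s1 ⟨f1, k1⟩ => ?_
  · exact ⟨fun _ h => by omega, Keeps.refl.set le_rfl⟩
  · intro i s' _ h; simp [(E.keep h.2).regs]
  · intro i s' hi _ h30 ⟨f, k'⟩
    have g : s'.reg 23 = r ∧ s'.reg 13 = k * k := by simp [k'.reg, h23, E.regs]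
    refine .storeWithin ⟨h30, fun x hx => ?_, (k'.put (by simp [g, h30]) (by simp [g, h30]; omega)).set
      le_rfl⟩ (hb := by simp [g, h30]; omega) (ha := by simp [g, h30]; omega)
    simp only [set_mem, put_mem, val_add, val_reg, val_load, g, h30]; split_ifs with h
    · obtain rfl : x = i := by omega
      exact k'.mem _ (by omega)
    · exact f x (by omega)
  · have g : s1.reg 23 = r ∧ s1.reg 13 = k * k := by simp [k1.reg, h23, E.regs]
    refine .assignWithin ⟨fun a b ha hb => ?_, by simp [g], (k1.widen le_rfl le_rfl (by norm_num)).set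
      le_rfl⟩ (ha := by simp [g]; omega)
    rw [set_mem, f1 _ (entry_lt ha hb)]; exact hP a b ha hb

theorem ends_renameMatrixP (E : Env w k K B Q I A s) (h23 : s.reg 23 = r) (h24 : s.reg 24 = x)
    (h25 : s.reg 25 = y) (hx : x < k) (hy : y < k) (hr : r + k * k < 2 ^ w) (hP : HasMatrix k P r s) :
    Ends w renameMatrixP (Q ^ 4) s fun s' =>
      HasMatrix k (KExpr.renamedBelow P x y) r s' ∧ Keeps 30 r (r + k * k) s s' := by
  have hl := E.large; have hk := E.slots; have hT := E.pow_le 3 (j := 4); have hw := E.word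
  have row : Ends w (forUp 30 (R 14) (.store (entryP (R 24) (R 30)) (M (entryP (R 25) (R 30)))))
      (Q ^ 3) s fun s' => HasMatrix k (fun a b => P (if a = x then y else a) b) r s' ∧
        Keeps 30 r (r + k * k) s s' := by
    refine (Ends.forUp (T := 30) (m := k) (fun i s' =>
      HasMatrix k (fun a b => P (if a = x ∧ b < i then y else a) b) r s' ∧ Keeps 30 r (r + k * k) s s')
        (by omega) ?_ ?_ ?_ fun s' _ h => ⟨fun a b ha hb => ?_, h.2⟩).le
          (E.forUp_le (i := 1) (j := 1) (by simp; omega) (by simp; omega) (by simp))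
    · exact ⟨fun a b ha hb => by simpa using hP a b ha hb, Keeps.refl.set le_rfl⟩
    · intro i s' _ h; simp [(E.keep h.2).regs]
    · intro i s' hi _ h30 ⟨f, k'⟩
      have g : s'.reg 23 = r ∧ s'.reg 14 = k ∧ s'.reg 24 = x ∧ s'.reg 25 = y := by
        simp [k'.reg, h23, h24, h25, E.regs]
      have l1 := entry_lt hx hi; have l2 := entry_lt hy hi
      refine .storeWithin ⟨h30, fun a b ha hb => ?_, (k'.put (by simp [entryP, g, h30])
        (by simp [entryP, g, h30]; omega)).set le_rfl⟩ (hb := by simp [entryP, g, h30]; omega)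
        (ha := by simp [entryP, g, h30]; omega) (hT := by simp [entryP])
      simp only [entryP, set_mem, put_mem, val_add, val_mul, val_reg, val_load, g, h30]
      split_ifs with h h' h'
      · obtain ⟨rfl, rfl⟩ := entry_inj hb hi (Nat.add_left_cancel h); rw [f _ _ hy hi]; simp
      · obtain ⟨rfl, rfl⟩ := entry_inj hb hi (Nat.add_left_cancel h)
        exact absurd ⟨rfl, by omega⟩ h'
      all_goals rw [f a b ha hb]; grind
    · have := h.1 a b ha hb; simpa [hb] using this
  refine .seqWithin row fun s1 ⟨f1, k1⟩ => ?_; have E1 := E.keep k1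
  refine (Ends.forUp (T := 30) (m := k) (fun i s' => HasMatrix k (fun a b => P (if a = x then y else a)
    (if b = x ∧ a < i then y else b)) r s' ∧ Keeps 30 r (r + k * k) s s')
      (by omega) ?_ ?_ ?_ fun s' _ h => ⟨fun a b ha hb => ?_, h.2⟩).le
        ((E.forUp_le (i := 1) (j := 1) (by simp; omega) (by simp; omega) (by simp)).trans (by simp only [Nat.reduceAdd]; omega))
  · exact ⟨fun a b ha hb => by simpa using f1 a b ha hb, k1.set le_rfl⟩
  · intro i s' _ h; simp [(E.keep h.2).regs]
  · intro i s' hi _ h30 ⟨f, k'⟩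
    have g : s'.reg 23 = r ∧ s'.reg 14 = k ∧ s'.reg 24 = x ∧ s'.reg 25 = y := by
      simp [k'.reg, h23, h24, h25, E.regs]
    have l1 := entry_lt hi hx; have l2 := entry_lt hi hy
    refine .storeWithin ⟨h30, fun a b ha hb => ?_, (k'.put (by simp [entryP, g, h30])
      (by simp [entryP, g, h30]; omega)).set le_rfl⟩ (hb := by simp [entryP, g, h30]; omega)
      (ha := by simp [entryP, g, h30]; omega) (hT := by simp [entryP])
    simp only [entryP, set_mem, put_mem, val_add, val_mul, val_reg, val_load, g, h30]
    by_cases h : a = i ∧ b = x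
    · obtain ⟨rfl, rfl⟩ := h; rw [if_pos rfl, f _ _ hi hy]; by_cases hyb : y = b <;> simp [hyb]
    · rw [if_neg fun h2 => h (entry_inj hb hx (Nat.add_left_cancel h2)), f a b ha hb]; grind
  · have := h.1 a b ha hb; simpa [ha, KExpr.renamedBelow] using this

theorem ends_markP (E : Env w k K B Q I A s) (h20 : s.reg 20 = p) (h23 : s.reg 23 = r)
    (h24 : s.reg 24 = x) (h25 : s.reg 25 = y) (hx : x < k) (hy : y < k) (hp : p + 4 ≤ r)
    (hr : r + k * k < 2 ^ w) (hP : HasMatrix k P r s) : Ends w markP 100 s fun s' =>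
      HasMatrix k (KExpr.joinedBelow P x y) r s' ∧ (s'.mem (p + 3) ≠ 0 ↔ P x y) ∧ s'.reg = s.reg ∧
        ∀ a, a < r → a ≠ p + 3 → s'.mem a = s.mem a := by
  have l1 := entry_lt hx hy; have l2 := entry_lt hy hx; have g : s.reg 14 = k := by simp [E.regs]
  refine .storeSeq (.storeSeq (.storeWithin ⟨fun a b ha hb => ?_, ?_, rfl, fun a h1 h2 => ?_⟩
    (hb := ?_) (hT := by simp [entryP])) (hb := ?_) (hT := by simp [entryP])) (hb := ?_) (ha := ?_)
    (hT := by simp [entryP])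
  rotate_right 4
  all_goals simp [entryP, g, h20, h23, h24, h25, put_mem]; all_goals try omega
  · have l := entry_lt ha hb
    have h1 : a * k + b = y * k + x ↔ a = y ∧ b = x := ⟨entry_inj hb hx, fun h => by rw [h.1, h.2]⟩
    have h2 : a * k + b = x * k + y ↔ a = x ∧ b = y := ⟨entry_inj hb hy, fun h => by rw [h.1, h.2]⟩
    rw [if_neg (by omega : ¬ r + (a * k + b) = p + 3)]; simp only [h1, h2, KExpr.joinedBelow]
    have := hP a b ha hb; split_ifs <;> simp [*]
  · rw [if_neg (by omega), if_neg (by omega)]; exact hP x y hx hy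
  grind

end

/-! ### The operations on the stacks -/

section

variable {V : Type*} {w k K B Q I A p r t : ℕ} {s s' : Store} {S : Set V} {c : V → ℕ∞}
  {Z : Store → Prop}

theorem ends_pruneP (E : Env w k K B Q I A s) (h20 : s.reg 20 = p + 4) (hp : p + 4 < 2 ^ w)
    (h : ∀ s', s'.mem = s.mem → s'.reg 20 = p → s'.reg 24 = s.mem (p + 1) →
      s'.reg 25 = s.mem (p + 2) → (∀ q, q < 24 → q ≠ 20 → s'.reg q = s.reg q) →
        Ends w (if s.mem p = 0 then 23 ←ᵣ R 23 - R 13 else if s.mem p = 1 then pushP else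
          if s.mem p = 2 then markP else renameMatrixP) (Q ^ 5) s' Z) : Ends w pruneP (Q ^ 6) s Z := by
  have hT := E.pow_le 5 (j := 6)
  refine .assignSeq (.assignSeq (.assignSeq ?_ (ha := by simp [h20]; omega))
    (ha := by simp [h20]; omega))
  have h' := h (((s.set 20 p).set 24 (s.mem (p + 1))).set 25 (s.mem (p + 2))) rfl (by simp) (by simp)
    (by simp) (fun q hq hq' => by simp [hq', show q ≠ 24 by omega, show q ≠ 25 by omega])
  simp only [h20, val_sub, val_reg, val_ofNat, val_load, val_add, set_reg,
    set_mem, if_true, Nat.add_sub_cancel, if_neg (by norm_num : (20 : ℕ) ≠ 24)]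
  refine .condWithin (fun h1 => .condWithin (fun h2 => ?_) (fun h2 => .condWithin (fun h3 => ?_)
    (fun h3 => ?_))) (fun h1 => ?_) <;> simp at h1
  · simp at h2; simp only [h2, if_true] at h'; exact h'.le (by simp; omega)
  · simp at h2 h3; simp only [h3, if_true] at h'; exact h'.le (by simp; omega)
  · simp at h2 h3; simp only [h1, h2, h3, if_false] at h'; exact h'.le (by simp; omega)
  · simp only [h1, if_true] at h'; exact h'.le (by simp; omega)

/-- The effect of processing all operations of the expression `e` in reverse order. -/
structure Pruned (e : KExpr V k) (S : Set V) (c : V → ℕ∞) (P : ℕ → ℕ → Prop) (p r : ℕ)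
    (s s' : Store) : Prop where
  pos : s'.reg 20 = p
  top : s'.reg 23 + k * k = r
  stored : e.Stored True S c s'.mem P p
  reg : ∀ q, q < 20 → s'.reg q = s.reg q
  mem : ∀ a, a < r → a < p ∨ p + 4 * e.size ≤ a → s'.mem a = s.mem a

/-- The cells are read from the last to the first, so the joins above an operation precede it, and the
matrix on top of the stack tells which labels are joined later.  Every step consumes one operation. -/
theorem iterates_pruneP (e : KExpr V k) {P : ℕ → ℕ → Prop} (E : Env w k K B Q I A s)
    (h20 : s.reg 20 = p + 4 * e.size) (h23 : s.reg 23 = r) (hp : 3 ≤ p)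
    (hpr : p + 4 * e.size + k * k ≤ r) (hr : r + e.size * (k * k) + k * k < 2 ^ w)
    (hS : e.Stored False S c s.mem P p) (hP : HasMatrix k P r s) :
    Iterates w (less 3 (R 20)) pruneP (Q ^ 6) e.size (Pruned e S c P p r s) s := by
  have hT := E.pow_le 0 (j := 5); have hT' := E.pow_le 4 (j := 5)
  induction e generalizing P p r s with
  | vertex i v =>
    simp only [KExpr.size] at h20 hpr hr ⊢; obtain ⟨m0, m1, m2, m3⟩ := hS
    refine ⟨by simp, by simp [h20], ends_pruneP E h20 (by omega) fun s1 g1 g2 g3 g4 g5 => ?_⟩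
    have g : s1.reg 23 = r ∧ s1.reg 13 = k * k := by simp [g5, h23, E.regs]
    rw [if_pos m0]
    refine .assignWithin ⟨by simp [g2], by simp [g]; omega, ?_, fun q hq => ?_, fun a _ _ => ?_⟩
    · simp only [KExpr.Stored, set_mem, g1]; exact ⟨m0, m1, m2, m3⟩
    · rw [set_reg, if_neg (by omega), g5 q (by omega) (by omega)]
    · rw [set_mem, g1]
  | union e₁ e₂ ih₁ ih₂ =>
    simp only [KExpr.size] at h20 hpr hr ⊢; obtain ⟨S1, S2, m0⟩ := hS
    have hmul : (e₁.size + e₂.size + 1) * (k * k) = e₁.size * (k * k) + e₂.size * (k * k) + k * k := by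
      ring
    refine ⟨by simp, by simp [h20]; omega, ends_pruneP E
      (p := p + 4 * e₁.size + 4 * e₂.size) (by omega) (by omega) fun s1 g1 g2 g3 g4 g5 => ?_⟩
    rw [m0, if_neg (by norm_num), if_pos rfl]
    have E1 := E.congr (s' := s1) fun q hq => g5 q (by omega) (by omega)
    have M1 : HasMatrix k P r s1 := hP.congr fun a _ _ => by rw [g1]
    refine (ends_pushP E1 ((g5 23 (by norm_num) (by norm_num)).trans h23) (by omega) M1).imp
      fun s2 _ ⟨M2, g23, k2⟩ => ?_
    rw [add_comm e₁.size]
    refine .add ((ih₂ (p := p + 4 * e₁.size) (E1.keep k2)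
      ((k2.reg 20 (by norm_num)).trans (by omega)) g23 (by omega) (by omega) (by omega)
      (S2.congr fun a _ _ => by rw [k2.mem a (by omega), g1]) M2).imp fun s3 h3 => ?_)
    refine (ih₁ (p := p) (r := r) ((E1.keep k2).congr h3.reg) h3.pos
      (by have := h3.top; omega) hp (by omega) (by omega)
      (S1.congr fun a _ _ => by rw [h3.mem a (by omega) (by omega), k2.mem a (by omega), g1])
      (hP.congr fun a _ _ => by rw [h3.mem a (by omega) (by omega), k2.mem a (by omega), g1])).imp
      fun s4 h4 => ⟨h4.pos, h4.top, ⟨h4.stored, ?_, ?_⟩, fun q hq => ?_, fun a h1 h2 => ?_⟩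
    · exact h3.stored.congr fun a _ _ => h4.mem a (by omega) (by omega)
    · rw [h4.mem _ (by omega) (by omega), h3.mem _ (by omega) (by omega), k2.mem _ (by omega), g1, m0]
    · rw [h4.reg q hq, h3.reg q hq, k2.reg q (by omega), g5 q (by omega) (by omega)]
    · simp only [KExpr.size] at h2
      rw [h4.mem _ (by omega) (by omega), h3.mem _ (by omega) (by omega), k2.mem _ (by omega), g1]
  | join i j hij e ih =>
    simp only [KExpr.size] at h20 hpr hr ⊢; obtain ⟨S1, m0, m1, m2, -⟩ := hS
    have hmul : (e.size + 1) * (k * k) = e.size * (k * k) + k * k := by ring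
    refine ⟨by simp, by simp [h20]; omega, ends_pruneP E
      (p := p + 4 * e.size) (by omega) (by omega) fun s1 g1 g2 g3 g4 g5 => ?_⟩
    rw [m0, if_neg (by norm_num), if_neg (by norm_num), if_pos rfl]
    have E1 := E.congr (s' := s1) fun q hq => g5 q (by omega) (by omega)
    have M1 : HasMatrix k P r s1 := hP.congr fun a _ _ => by rw [g1]
    refine (ends_markP E1 g2 ((g5 23 (by norm_num) (by norm_num)).trans h23) (g3.trans m1)
      (g4.trans m2) i.isLt j.isLt (by omega) (by omega) M1).mono (by omega)
      fun s2 _ ⟨M2, h2, r2, k2⟩ => ?_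
    refine (ih (p := p) (r := r) (E1.congr fun q _ => by rw [r2]) (by rw [r2, g2])
      (by rw [r2, g5 23 (by norm_num) (by norm_num), h23]) hp (by omega) (by omega)
      (S1.congr fun a _ _ => by rw [k2 a (by omega) (by omega), g1]) M2).imp
      fun s3 h3 => ⟨h3.pos, h3.top, ⟨h3.stored, ?_, ?_, ?_, fun _ => ?_⟩, fun q hq => ?_, fun a l1 l2 => ?_⟩
    · rw [h3.mem _ (by omega) (by omega), k2 _ (by omega) (by omega), g1, m0]
    · rw [h3.mem _ (by omega) (by omega), k2 _ (by omega) (by omega), g1, m1]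
    · rw [h3.mem _ (by omega) (by omega), k2 _ (by omega) (by omega), g1, m2]
    · rw [h3.mem _ (by omega) (by omega), h2]
    · rw [h3.reg q hq, r2, g5 q (by omega) (by omega)]
    · simp only [KExpr.size] at l2
      rw [h3.mem _ (by omega) (by omega), k2 _ (by omega) (by omega), g1]
  | rename i j e ih =>
    simp only [KExpr.size] at h20 hpr hr ⊢; obtain ⟨S1, m0, m1, m2⟩ := hS
    have hmul : (e.size + 1) * (k * k) = e.size * (k * k) + k * k := by ring
    refine ⟨by simp, by simp [h20]; omega, ends_pruneP E
      (p := p + 4 * e.size) (by omega) (by omega) fun s1 g1 g2 g3 g4 g5 => ?_⟩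
    rw [m0, if_neg (by norm_num), if_neg (by norm_num), if_neg (by norm_num)]
    have E1 := E.congr (s' := s1) fun q hq => g5 q (by omega) (by omega)
    have M1 : HasMatrix k P r s1 := hP.congr fun a _ _ => by rw [g1]
    refine (ends_renameMatrixP E1 ((g5 23 (by norm_num) (by norm_num)).trans h23) (g3.trans m1)
      (g4.trans m2) i.isLt j.isLt (by omega) M1).mono (by omega) fun s2 _ ⟨M2, k2⟩ => ?_
    refine (ih (p := p) (r := r) (E1.keep k2) (by rw [k2.reg 20 (by norm_num), g2])
      (by rw [k2.reg 23 (by norm_num), g5 23 (by norm_num) (by norm_num), h23]) hp (by omega) (by omega)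
      (S1.congr fun a _ _ => by rw [k2.mem a (by omega), g1]) M2).imp
      fun s3 h3 => ⟨h3.pos, h3.top, ⟨h3.stored, ?_, ?_, ?_⟩, fun q hq => ?_, fun a l1 l2 => ?_⟩
    · rw [h3.mem _ (by omega) (by omega), k2.mem _ (by omega), g1, m0]
    · rw [h3.mem _ (by omega) (by omega), k2.mem _ (by omega), g1, m1]
    · rw [h3.mem _ (by omega) (by omega), k2.mem _ (by omega), g1, m2]
    · rw [h3.reg q hq, k2.reg q (by omega), g5 q (by omega) (by omega)]
    · simp only [KExpr.size] at l2; rw [h3.mem _ (by omega) (by omega), k2.mem _ (by omega), g1]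

end

/-- Pushes the table of the creation of a vertex. -/
def pushVertexP (b : Bool) : Prog :=
  21 ←ᵣ R 23 ;; 27 ←ᵣ R 24 ;; 29 ←ᵣ R 28 ;; 28 ←ᵣ R 25 ;; vertexP b ;; 23 ←ᵣ R 23 + R 5

/-- Replaces the two topmost tables by the table of the disjoint union. -/
def popUnionP : Prog :=
  21 ←ᵣ R 23 - R 5 * 2 ;; 22 ←ᵣ R 23 - R 5 ;; (pairsP ;; mergesP) ;; 23 ←ᵣ R 23 - R 5

/-- Updates the topmost table for a join, unless it is marked. -/
def joinTopP : Prog := 21 ←ᵣ R 23 - R 5 ;; .cond (R 28) .skip (stepP joinP)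

/-- Updates the topmost table for a renaming. -/
def renameTopP : Prog := 21 ←ᵣ R 23 - R 5 ;; .cond (.equal (R 24) (R 25)) .skip (stepP mergeP)

/-- One step of the pass through the operations in their order.  A stack of tables holds the
achievable codes of the operands; register `23` contains the first free address. -/
def evalP (b : Bool) : Prog := 24 ←ᵣ M (R 20 + 1) ;; 25 ←ᵣ M (R 20 + 2) ;; 28 ←ᵣ M (R 20 + 3) ;;
  .cond (M (R 20)) (.cond (.equal (M (R 20)) 1) popUnionP (.cond (.equal (M (R 20)) 2) joinTopP renameTopP))
    (pushVertexP b) ;;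
  20 ←ᵣ R 20 + 4

section

variable {V : Type*} {w k K B Q I A p r t i bt wc x y : ℕ} {s s' : Store} {S T : Set V} {c : V → ℕ∞}
  {Z : Store → Prop} {b : Bool} {𝒜 𝒜' : ℕ → ℕ → Prop}

/-- The topmost table is at `t` and contains the codes `𝒜`; everything below it is as in `s`. -/
structure Top (Q I A W t : ℕ) (𝒜 : ℕ → ℕ → Prop) (s s' : Store) : Prop where
  table : IsTable Q I t 𝒜 s'
  top : s'.reg 23 = t + Q
  below : Below 21 A W t s s'

theorem ends_pushVertexP (E : Env w k K B Q I A s) (h23 : s.reg 23 = t) (h1 : A + 6 * K + Q ≤ t)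
    (h2 : t + Q < 2 ^ w) (hi : i < k) (h24 : s.reg 24 = i) (h25 : s.reg 25 = bt)
    (h28 : s.reg 28 = wc) (hbt : bt ≤ 1) : Ends w (pushVertexP b) (Q ^ 5) s
      (Top Q I A (A + 6 * K + Q) t (fun c q => if b = true ∧ bt ≠ 0 then q = apexCode k (2 * (k + 1)) B i
        else q = 0 ∧ wc ≠ 0 ∧ wc - 1 ≤ c ∨ q = (if b = true then 2 else 2 - bt) * B ^ i) s) := by
  have hw := E.word; have hl := E.large; have hT := E.pow_le 4 (j := 5)
  refine .assignSeq <| .assignSeq <| .assignSeq <| .assignSeq ?_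
  simp only [val_reg, set_reg, h23, h24, h25, h28, Nat.reduceEqDiff, if_false]
  set s1 := (((s.set 21 t).set 27 i).set 29 wc).set 28 bt with hs1
  have g : s1.reg 5 = Q ∧ s1.reg 23 = t := by simp [hs1, E.regs, h23]
  refine .seqWithin (ends_vertexP (i := i) (bt := bt) (wc := wc) (t := t) (E.congr fun q hq => ?_)
    (by simp [hs1]) h1 h2 hi (by simp [hs1]) (by simp [hs1]) (by simp [hs1]) hbt)
    fun s2 ⟨f2, k2⟩ => ?_
  · simp [hs1, show q ≠ 21 by omega, show q ≠ 27 by omega, show q ≠ 28 by omega, show q ≠ 29 by omega]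
  · refine .assignWithin ⟨f2, by simp [k2.reg, g], fun q hq => ?_, fun a ha => k2.mem a ha⟩
      (ha := by simp [k2.reg, g]; omega)
    simp [k2.reg q (by omega), hs1, show q ≠ 23 by omega, show q ≠ 21 by omega, show q ≠ 27 by omega,
      show q ≠ 28 by omega, show q ≠ 29 by omega]

theorem ends_popUnionP (E : Env w k K B Q I A s) (h23 : s.reg 23 = t + Q + Q)
    (h1 : A + 6 * K + Q ≤ t) (h2 : t + Q + Q < 2 ^ w) (hA : IsTable Q I t 𝒜 s)
    (hA' : IsTable Q I (t + Q) 𝒜' s) : Ends w popUnionP (Q ^ 19) s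
      (Top Q I A (A + 6 * K + Q) t (mergesSet (k + 1) (2 * (k + 1)) B
        (unionSet (k + 1) (2 * (k + 1)) B 𝒜 𝒜') (k + 1)) s) := by
  have hl := E.large; have hw := E.word; have hT := E.pow_le 18 (j := 19)
  have g : s.reg 5 = Q := by simp [E.regs]
  refine .assignSeq (.assignSeq ?_) (ha := by simp [g]; omega)
  simp only [val_reg, val_sub, val_mul, val_ofNat, set_reg, h23, g,
    Nat.reduceEqDiff, if_false, show t + Q + Q - Q * 2 = t by omega, Nat.add_sub_cancel]
  refine .seqWithin (ends_unionP (E.set.set) (by simp) (by simp) h1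
    (by omega) (by omega) (by omega) hA hA') fun s2 ⟨f2, k2⟩ => ?_
  refine .assignWithin ⟨f2, by simp [k2.reg, g, h23], fun q hq => ?_, fun a ha => k2.mem a ha⟩
  simp [k2.reg q (by omega), show q ≠ 23 by omega, show q ≠ 21 by omega, show q ≠ 22 by omega]

open Classical in
theorem ends_joinTopP (E : Env w k K B Q I A s) (h23 : s.reg 23 = t + Q)
    (h1 : A + 6 * K + Q ≤ t) (h2 : t + Q < 2 ^ w) (h24 : s.reg 24 = x) (h25 : s.reg 25 = y)
    (hx : x < k) (hy : y < k) (hxy : x ≠ y) {P : Prop} (hP : s.reg 28 ≠ 0 ↔ P)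
    (hA : IsTable Q I t 𝒜 s) : Ends w joinTopP (Q ^ 15) s
      (Top Q I A (A + 6 * K + Q) t (if P then 𝒜 else
        stepSet (2 * (k + 1)) B (fun g f => joinF (2 * (k + 1) + 1) x y g f) 𝒜) s) := by
  have hT := E.pow_le 14 (j := 15); have g : s.reg 5 = Q := by simp [E.regs]
  refine .assignSeq ?_; simp only [val_reg, val_sub, h23, g, Nat.add_sub_cancel]
  refine .condWithin (fun h => .skipWithin ?_) fun h => ?_ <;> simp at h
  · rw [if_pos (hP.1 h)]
    exact ⟨hA, by simp [h23], fun q hq => by simp [show q ≠ 21 by omega], fun a ha => rfl⟩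
  · rw [if_neg fun h' => hP.2 h' h, ← E.slots_eq]; have := E.slots
    exact (ends_joinStep (by omega) (by omega) hxy (E.set) (by simp) h1 h2 (by simp [h24])
      (by simp [h25]) hA).mono (by simp; omega) fun s2 _ ⟨f2, k2⟩ => ⟨f2, by simp [k2.reg, h23],
        fun q hq => by simp [k2.reg q (by omega), show q ≠ 21 by omega], fun a ha => k2.mem a ha⟩

theorem ends_renameTopP (E : Env w k K B Q I A s) (h23 : s.reg 23 = t + Q)
    (h1 : A + 6 * K + Q ≤ t) (h2 : t + Q < 2 ^ w) (h24 : s.reg 24 = x) (h25 : s.reg 25 = y)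
    (hx : x < k) (hy : y < k) (hA : IsTable Q I t 𝒜 s) : Ends w renameTopP (Q ^ 15) s
      (Top Q I A (A + 6 * K + Q) t (if x = y then 𝒜 else
        stepSet (2 * (k + 1)) B (fun g f => mergeF (2 * (k + 1) + 1) B x y g f) 𝒜) s) := by
  have hT := E.pow_le 14 (j := 15); have g : s.reg 5 = Q := by simp [E.regs]
  refine .assignSeq ?_; simp only [val_reg, val_sub, h23, g, Nat.add_sub_cancel]
  refine .condWithin (fun h => .skipWithin ?_) fun h => ?_ <;> simp [h24, h25] at h
  · rw [if_pos h]
    exact ⟨hA, by simp [h23], fun q hq => by simp [show q ≠ 21 by omega], fun a ha => rfl⟩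
  · rw [if_neg h, ← E.slots_eq]; have := E.slots
    exact (ends_mergeStep (by omega) (by omega) (E.set) (by simp) h1 h2 (by simp [h24])
      (by simp [h25]) hA).mono (by simp; omega) fun s2 _ ⟨f2, k2⟩ => ⟨f2, by simp [k2.reg, h23],
        fun q hq => by simp [k2.reg q (by omega), show q ≠ 21 by omega], fun a ha => k2.mem a ha⟩

theorem ends_evalP (E : Env w k K B Q I A s) (h20 : s.reg 20 = p) (hp : p + 4 < 2 ^ w)
    {𝒜 : ℕ → ℕ → Prop} {W : ℕ}
    (h : ∀ s', s'.mem = s.mem → s'.reg 24 = s.mem (p + 1) → s'.reg 25 = s.mem (p + 2) →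
      s'.reg 28 = s.mem (p + 3) → (∀ q, q < 24 → s'.reg q = s.reg q) →
        Ends w (if s.mem p = 0 then pushVertexP b else if s.mem p = 1 then popUnionP else
          if s.mem p = 2 then joinTopP else renameTopP) (Q ^ 19) s' (Top Q I A W t 𝒜 s')) :
    Ends w (evalP b) (Q ^ 20) s fun s' => s'.reg 20 = p + 4 ∧ IsTable Q I t 𝒜 s' ∧
      s'.reg 23 = t + Q ∧ Below 20 A W t s s' := by
  have hT := E.pow_le 19 (j := 20)
  have g : ∀ q, q ≠ 24 → q ≠ 25 → q ≠ 28 → ((((s.set 24 (s.mem (p + 1))).set 25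
      (s.mem (p + 2))).set 28 (s.mem (p + 3)))).reg q = s.reg q := fun q h1 h2 h3 => by simp [h1, h2, h3]
  have h' := h (((s.set 24 (s.mem (p + 1))).set 25 (s.mem (p + 2))).set 28 (s.mem (p + 3))) rfl
    (by simp) (by simp) (by simp) fun q hq => g q (by omega) (by omega) (by omega)
  refine .assignSeq (.assignSeq (.assignSeq (.seqWithin (T' := Q ^ 19 + 20) (Z' := Top Q I A W t 𝒜
    (((s.set 24 (s.mem (p + 1))).set 25 (s.mem (p + 2))).set 28 (s.mem (p + 3)))) ?_
    fun s2 h2 => ?_) (ha := by simp [h20]; omega)) (ha := by simp [h20]; omega))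
    (ha := by simp [h20]; omega)
  · simp only [h20, val_reg, val_ofNat, val_load, val_add, set_reg,
      set_mem, Nat.reduceEqDiff, if_false]
    refine .condWithin (fun h1 => .condWithin (fun h2 => ?_) (fun h2 => .condWithin (fun h3 => ?_)
      (fun h3 => ?_))) (fun h1 => ?_) <;> simp [h20] at h1
    · simp [h20] at h2; simp only [h2] at h'; exact h'.le (by simp)
    · simp [h20] at h2 h3; simp only [h3] at h'; exact h'.le (by simp)
    · simp [h20] at h2 h3; simp only [h1, h2, h3, if_false] at h'; exact h'.le (by simp)
    · simp only [h1, if_true] at h'; exact h'.le (by simp)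
  · have e : s2.reg 20 = p := by
      rw [h2.below.reg 20 (by norm_num), g 20 (by norm_num) (by norm_num) (by norm_num), h20]
    refine .assignWithin ⟨by simp [e], h2.table, by simp [h2.top], fun q hq => ?_, fun a ha => ?_⟩
      (ha := by simp [e]; omega)
    · rw [set_reg, if_neg (by omega), h2.below.reg q (by omega),
        g q (by omega) (by omega) (by omega)]
    · exact h2.below.mem a ha

end

end WordRAM

theorem le_iff_weightCode {x : ℕ∞} {m : ℕ} : x ≤ m ↔ weightCode x ≠ 0 ∧ weightCode x - 1 ≤ m := by
  cases x with
  | top => simp [weightCode]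
  | coe x => simp [weightCode]

namespace WordRAM

open Term Store

section

variable {V : Type*} {w k K B Q I A p r t : ℕ} {s s' : Store} {S : Set V} {c : V → ℕ∞} {b : Bool}

/-- The codes achieved by an expression, where the given vertex set plays the role of the terminals of
`NodeMultiwayCut` (if `b` is true) or of the set `S` of `SubsetFVS` (if `b` is false). -/
def achieves (b : Bool) (S : Set V) (c : V → ℕ∞) (B : ℕ) (P : ℕ → ℕ → Prop) (e : KExpr V k) :
    ℕ → ℕ → Prop :=
  e.Achieves (if b = true then ∅ else S) (if b = true then S else ∅) c (2 * (k + 1)) B P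

/-- The operations are in postfix order: after those of `e`, its table is on top of the stack. -/
theorem iterates_evalP (e : KExpr V k) {P : ℕ → ℕ → Prop} (E : Env w k K B Q I A s)
    (h20 : s.reg 20 = p) (h23 : s.reg 23 = t) (h1 : A + 6 * K + Q ≤ t) (h2 : t + e.size * Q < 2 ^ w)
    (hp : p + 4 * e.size ≤ A) (hS : e.Stored True S c s.mem P p) :
    Iterates w (less (R 20) (R 7)) (evalP b) (Q ^ 20) e.size (fun s' =>
      s'.reg 20 = p + 4 * e.size ∧ IsTable Q I t (achieves b S c B P e) s' ∧ s'.reg 23 = t + Q ∧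
        Below 20 A (A + 6 * K + Q) t s s') s := by
  have hw := E.word
  induction e generalizing P p t s with
  | vertex i v =>
    simp only [KExpr.size] at h2 hp ⊢; obtain ⟨m0, m1, m2, m3⟩ := hS
    refine ⟨by simp, by simp [h20, E.regs]; omega, ends_evalP E h20 (by omega)
      fun s1 g1 g2 g3 g4 g5 => ?_⟩
    have hT := E.pow_le 5 (j := 19); rw [if_pos m0]
    refine (ends_pushVertexP (E.congr fun q hq => g5 q (by omega)) ((g5 23 (by norm_num)).trans h23)
      h1 (by omega) i.isLt (g2.trans m1) (g3.trans m2) (g4.trans m3) (by split_ifs <;> omega)).mono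
      (by omega) fun s2 _ h => ⟨h.table.congr fun m q hm hq => ?_, h.top, h.below⟩
    simp only [achieves, KExpr.Achieves, le_iff_weightCode]
    grind
  | union e₁ e₂ ih₁ ih₂ =>
    simp only [KExpr.size] at h2 hp ⊢; obtain ⟨S1, S2, m0⟩ := hS
    have hmul : (e₁.size + e₂.size + 1) * Q = e₁.size * Q + e₂.size * Q + Q := by ring
    have hmul' : 1 * Q ≤ e₁.size * Q := Nat.mul_le_mul_right _ e₁.size_pos
    have hmul2 : 1 * Q ≤ e₂.size * Q := Nat.mul_le_mul_right _ e₂.size_pos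
    refine .add (.add ((ih₁ E h20 h23 h1 (by omega) (by omega) S1).imp fun s1 ⟨f1, t1, r1, k1⟩ => ?_))
    have E1 := E.below k1 le_rfl
    refine (ih₂ E1 f1 r1 (by omega) (by omega) (by omega) (S2.congr fun a _ _ => k1.mem a (by omega))).imp
      fun s2 ⟨f2, t2, r2, k2⟩ => ?_
    have E2 := E1.below k2 le_rfl
    have m2 : s2.mem (p + 4 * e₁.size + 4 * e₂.size) = 1 := by
      rw [k2.mem _ (by omega), k1.mem _ (by omega), m0]
    refine ⟨by simp, by simp [f2, E2.regs]; omega, (ends_evalP E2 f2 (by omega) (t := t)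
      (W := A + 6 * K + Q) (𝒜 := achieves b S c B P (.union e₁ e₂)) fun s3 g1 g2 g3 g4 g5 => ?_).imp
      fun s4 _ ⟨f4, t4, r4, k4⟩ => ⟨by omega, t4, r4, fun q hq => ?_, fun a ha => ?_⟩⟩
    · rw [m2, if_neg (by norm_num), if_pos rfl]
      refine ends_popUnionP (E2.congr fun q hq => g5 q (by omega)) ((g5 23 (by norm_num)).trans r2) h1
        (by omega) (fun q hq => ?_) (fun q hq => ?_)
      · rw [g1, k2.mem _ (by omega)]; exact t1 q hq
      · rw [g1]; exact t2 q hq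
    · rw [k4.reg q hq, k2.reg q hq, k1.reg q hq]
    · rw [k4.mem a ha, k2.mem a (by omega), k1.mem a ha]
  | join i j hij e ih =>
    simp only [KExpr.size] at h2 hp ⊢; obtain ⟨S1, m0, m1, m2, m3⟩ := hS
    have hmul : (e.size + 1) * Q = e.size * Q + Q := by ring
    have hmul' : 1 * Q ≤ e.size * Q := Nat.mul_le_mul_right _ e.size_pos
    refine .add ((ih E h20 h23 h1 (by omega) (by omega) S1).imp fun s1 ⟨f1, t1, r1, k1⟩ => ?_)
    have E1 := E.below k1 le_rfl; have hT := E.pow_le 15 (j := 19)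
    refine ⟨by simp, by simp [f1, E1.regs]; omega, (ends_evalP E1 f1 (by omega) (t := t)
      (W := A + 6 * K + Q) (𝒜 := achieves b S c B P (.join i j hij e)) fun s3 g1 g2 g3 g4 g5 => ?_).imp
      fun s4 _ ⟨f4, t4, r4, k4⟩ => ⟨by omega, t4, r4, k1.trans k4⟩⟩
    rw [k1.mem _ (by omega), m0, if_neg (by norm_num), if_neg (by norm_num), if_pos rfl]
    rw [k1.mem _ (by omega)] at g2 g3 g4
    refine (ends_joinTopP (E1.congr fun q hq => g5 q (by omega)) ((g5 23 (by norm_num)).trans r1) h1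
      (by omega) (g2.trans m1) (g3.trans m2) i.isLt j.isLt (by omega) (g4 ▸ m3 trivial) (fun q hq => ?_)).le
      (by omega)
    rw [g1]; exact t1 q hq
  | rename i j e ih =>
    simp only [KExpr.size] at h2 hp ⊢; obtain ⟨S1, m0, m1, m2⟩ := hS
    have hmul : (e.size + 1) * Q = e.size * Q + Q := by ring
    have hmul' : 1 * Q ≤ e.size * Q := Nat.mul_le_mul_right _ e.size_pos
    refine .add ((ih E h20 h23 h1 (by omega) (by omega) S1).imp fun s1 ⟨f1, t1, r1, k1⟩ => ?_)
    have E1 := E.below k1 le_rfl; have hT := E.pow_le 15 (j := 19)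
    refine ⟨by simp, by simp [f1, E1.regs]; omega, (ends_evalP E1 f1 (by omega) (t := t)
      (W := A + 6 * K + Q) (𝒜 := achieves b S c B P (.rename i j e)) fun s3 g1 g2 g3 g4 g5 => ?_).imp
      fun s4 _ ⟨f4, t4, r4, k4⟩ => ⟨by omega, t4, r4, k1.trans k4⟩⟩
    rw [k1.mem _ (by omega), m0, if_neg (by norm_num), if_neg (by norm_num), if_neg (by norm_num)]
    rw [k1.mem _ (by omega)] at g2 g3
    have h := ends_renameTopP (𝒜 := achieves b S c B (KExpr.renamedBelow P i j) e)
      (E1.congr fun q hq => g5 q (by omega)) ((g5 23 (by norm_num)).trans r1) h1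
      (by omega) (g2.trans m1) (g3.trans m2) i.isLt j.isLt (fun q hq => by rw [g1]; exact t1 q hq)
    simp only [Fin.val_inj] at h; exact h.le (by omega)

end

/-! ### The program that decides both problems -/

/-- Computes the parameters. -/
def setupP : Prog :=
  14 ←ᵣ M 0 ;; 9 ←ᵣ M 1 ;; 6 ←ᵣ M 2 + 1 ;; 1 ←ᵣ R 14 + 1 ;; 2 ←ᵣ R 14 * 2 + 3 ;; 3 ←ᵣ R 14 * 2 + 10 ;;
  4 ←ᵣ R 2 * 3 ;; 12 ←ᵣ R 3 * 3 ;; 7 ←ᵣ R 9 * 4 + 3 ;; 8 ←ᵣ R 7 + R 4 ;; 17 ←ᵣ R 8 + R 4 ;;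
  18 ←ᵣ R 7 + R 2 ;; 19 ←ᵣ R 18 + R 2 ;; 13 ←ᵣ R 14 * R 14 ;; 71 ←ᵣ R 4 ;; powP ;; 5 ←ᵣ R 70

/-- Sets the register `0` to `1` if the table at the address in register `21` has an entry less than
`R 6`, i.e. at most the budget. -/
def answerP : Prog := forUp 30 (R 5) (.cond (.less (M (R 21 + R 30)) (R 6)) (0 ←ᵣ 1) .skip)

/-- The pass through the operations in reverse order. -/
def markJoinsP : Prog := 20 ←ᵣ R 7 ;; 23 ←ᵣ R 17 + R 5 + R 13 ;; .loop (less 3 (R 20)) pruneP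

/-- The pass through the operations in their order. -/
def tabulateP (b : Bool) : Prog :=
  20 ←ᵣ 3 ;; 23 ←ᵣ R 17 + R 5 ;; .loop (less (R 20) (R 7)) (evalP b)

/-- Decides `NodeMultiwayCut` (if `b` is true) or `SubsetFVS` (if `b` is false). -/
def solveP (b : Bool) : Prog := setupP ;; markJoinsP ;; tabulateP b ;; 21 ←ᵣ R 17 + R 5 ;; answerP

section

variable {V : Type*} {w k K B Q A n p t N : ℕ} {s s' : Store} {S : Set V} {c : V → ℕ∞} {b : Bool}

theorem ends_setupP (h0 : s.mem 0 = k) (h1 : s.mem 1 = n) (h2 : s.mem 2 = p) (hK : K = 2 * k + 3)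
    (hB : B = 2 * k + 10) (hQ : Q = B ^ (3 * K)) (hw : 100 * Q + 10 * (4 * n + 3) + 2 * p < 2 ^ w)
    (hw' : Q * Q < 2 ^ w) : Ends w setupP (K * 90 + 200) s fun s' =>
      Env w k K B Q (p + 1) (4 * n + 3) s' ∧ s'.mem = s.mem ∧ s'.reg 0 = s.reg 0 := by
  obtain ⟨l1, l2, l3, l4⟩ := codes_large hK hB hQ
  iterate 15 refine .assignSeq ?_ (ha := by simp [h0, h1, h2] <;> omega)
  have h : ∀ s0 : Store, s0.mem = s.mem → (s0.reg 1 = k + 1 ∧ s0.reg 2 = K ∧ s0.reg 3 = B ∧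
      s0.reg 4 = 3 * K ∧ s0.reg 6 = p + 1 ∧ s0.reg 7 = 4 * n + 3 ∧ s0.reg 8 = 4 * n + 3 + 3 * K ∧
      s0.reg 12 = 3 * B ∧ s0.reg 17 = 4 * n + 3 + 6 * K ∧ s0.reg 18 = 4 * n + 3 + K ∧
      s0.reg 19 = 4 * n + 3 + 2 * K ∧ s0.reg 13 = k * k ∧ s0.reg 14 = k ∧ s0.reg 0 = s.reg 0 ∧
      s0.reg 71 = 3 * K) → Ends w (powP ;; 5 ←ᵣ R 70) (K * 90 + 30) s0 fun s' =>
        Env w k K B Q (p + 1) (4 * n + 3) s' ∧ s'.mem = s.mem ∧ s'.reg 0 = s.reg 0 := fun s0 hm g => by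
    refine .seqWithin (ends_powP (B := B) (i := 3 * K) (by simp [g]) (by simp [g]) (by omega) (by omega)
      (by omega)) (fun s1 ⟨r1, k1⟩ => .assignWithin
        ⟨⟨hK, hB, hQ, by simp [k1.reg, g, r1, hQ], by omega, hw'⟩, ?_, by simp [k1.reg, g]⟩ (hT := ?_)) ?_
    · funext a; rw [set_mem, k1.mem a (by omega), hm]
    · simp; omega
    · omega
  refine Ends.le (h _ ?_ ⟨?_, ?_, ?_, ?_, ?_, ?_, ?_, ?_, ?_, ?_, ?_, ?_, ?_, ?_, ?_⟩) ?_
  · rfl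
  all_goals simp [h0, h1, h2]; try omega

theorem ends_answerP {I : ℕ} {𝒜 : ℕ → ℕ → Prop} (E : Env w k K B Q I A s) (ht : s.reg 21 = t)
    (ht' : t + Q < 2 ^ w) (hA : IsTable Q I t 𝒜 s) (h0 : s.reg 0 = 0) (hp : p < I)
    (hI : I = p + 1) :
    Ends w answerP (Q ^ 3) s fun s' => s'.reg 0 = 1 ↔ ∃ q, q < Q ∧ 𝒜 p q := by
  have hl := E.large; have hw := E.word
  refine (Ends.forUp (T := 20) (m := Q) (fun i s' => (s'.reg 0 = 1 ↔ ∃ q, q < i ∧ s.mem (t + q) ≤ p) ∧ s'.mem = s.mem ∧ ∀ q, 0 < q → q < 30 → s'.reg q = s.reg q) (by omega) ?_ ?_ ?_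
      fun s' _ h => ?_).le (E.forUp_le (i := 1) (j := 1) (by simp) (by simp; omega) (by simp))
  · exact ⟨by simp [h0], rfl, fun q hq _ => by simp [show q ≠ 30 by omega]⟩
  · intro i s' _ h; simp [h.2.2, E.regs]
  · intro i s' hi _ h30 ⟨h1, h2, h3⟩
    have g : s'.reg 21 = t ∧ s'.reg 6 = I := by simp [h3, ht, E.regs]
    refine .condWithin (fun h => .assignWithin ⟨by simp [h30], ?_, h2, fun q hq hq' => ?_⟩)
      (fun h => .skipWithin ⟨h30, ?_, h2, fun q hq hq' => ?_⟩) (ha := by simp [g, h30]; omega)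
    all_goals simp [g, h30, h2, hI] at h
    · simpa using ⟨i, le_rfl, h⟩
    · simp [show q ≠ 30 by omega, show q ≠ 0 by omega, h3 q hq hq']
    · have : (∃ q, q < i + 1 ∧ s.mem (t + q) ≤ p) ↔ ∃ q, q < i ∧ s.mem (t + q) ≤ p :=
        exists_congr fun q => ⟨fun h' => ⟨by_contra fun h2 => by
          obtain rfl : q = i := by omega
          omega, h'.2⟩, fun h' => ⟨by omega, h'.2⟩⟩
      rw [this]; simpa using h1
    · simp [show q ≠ 30 by omega, h3 q hq hq']
  · exact h.1.trans (exists_congr fun q => and_congr_right fun hq => (hA q hq).2 p hp)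

end

variable {V : Type*} {w k K B Q I N p : ℕ} {s : Store} {S : Set V} {c : V → ℕ∞} {b : Bool}

theorem ends_markJoinsP (e : KExpr V k) (E : Env w k K B Q I (4 * e.size + 3) s)
    (hw : 4 * e.size + 3 + 6 * K + Q + k * k + e.size * (k * k) + k * k < 2 ^ w)
    (hz : ∀ a, 4 * e.size + 3 ≤ a → s.mem a = 0)
    (hS : e.Stored False S c s.mem (fun _ _ => False) 3) :
    Ends w markJoinsP (e.size * (Q ^ 6 + 4) + 20) s fun s' =>
      e.Stored True S c s'.mem (fun _ _ => False) 3 ∧ ∀ q, q < 20 → s'.reg q = s.reg q := by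
  have g : s.reg 7 = 4 * e.size + 3 ∧ s.reg 17 = 4 * e.size + 3 + 6 * K ∧ s.reg 5 = Q ∧
    s.reg 13 = k * k := by simp [E.regs]
  refine .assignSeq (.assignSeq ?_ (ha := by simp [g]; omega))
  refine (Ends.loop ((iterates_pruneP (P := fun _ _ => False) (S := S) (c := c) (p := 3)
    (r := 4 * e.size + 3 + 6 * K + Q + k * k) e (E.set.set) ?_ ?_ le_rfl ?_
      (by omega) ?_ ?_).imp (Q' := fun s2 => (less 3 (R 20)).Ok w s2 ∧
        (less 3 (R 20)).val s2 = 0 ∧ e.Stored True S c s2.mem (fun _ _ => False) 3 ∧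
          ∀ q, q < 20 → s2.reg q = s.reg q) fun s2 h => ⟨by simp, ?_, h.stored, fun q hq => ?_⟩)).le ?_
  · simp [g, add_comm]
  · simp [g]
  · omega
  · exact hS
  · intro a b _ _
    simp [hz _ (by omega : 4 * e.size + 3 ≤ 4 * e.size + 3 + 6 * K + Q + k * k + (a * k + b))]
  · simp [h.pos]
  · rw [h.reg q hq]; simp [show q ≠ 20 by omega, show q ≠ 23 by omega]
  · simp

theorem ends_tabulateP (e : KExpr V k) (E : Env w k K B Q I (4 * e.size + 3) s)
    (hw : 4 * e.size + 3 + 6 * K + Q + e.size * Q < 2 ^ w)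
    (hS : e.Stored True S c s.mem (fun _ _ => False) 3) :
    Ends w (tabulateP b) (e.size * (Q ^ 20 + 4) + 20) s fun s' =>
      IsTable Q I (4 * e.size + 3 + 6 * K + Q) (achieves b S c B (fun _ _ => False) e) s' ∧
        ∀ q, q < 20 → s'.reg q = s.reg q := by
  have g : s.reg 7 = 4 * e.size + 3 ∧ s.reg 17 = 4 * e.size + 3 + 6 * K ∧ s.reg 5 = Q := by
    simp [E.regs]
  refine .assignSeq (.assignSeq ?_ (ha := by simp [g]; omega))
  refine (Ends.loop ((iterates_evalP (b := b) (P := fun _ _ => False) (S := S) (c := c) (p := 3)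
    (t := 4 * e.size + 3 + 6 * K + Q) e (E.set.set) ?_ ?_ le_rfl hw
      (by omega) ?_).imp (Q' := fun s2 => (less (R 20) (R 7)).Ok w s2 ∧
        (less (R 20) (R 7)).val s2 = 0 ∧ IsTable Q I (4 * e.size + 3 + 6 * K + Q)
          (achieves b S c B (fun _ _ => False) e) s2 ∧
            ∀ q, q < 20 → s2.reg q = s.reg q) fun s2 h => ⟨by simp, ?_, h.2.1, fun q hq => ?_⟩)).le ?_
  · simp
  · simp [g]
  · exact hS
  · simp [h.1, h.2.2.2.reg, g, add_comm]
  · rw [h.2.2.2.reg q hq]; simp [show q ≠ 20 by omega, show q ≠ 23 by omega]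
  · simp

/-- Both passes take a number of steps bounded by `Q ^ 20` per operation; `21` leaves room for the
set-up and the final test. -/
theorem ends_solveP (e : KExpr V k) (hN : (inputCode e S c p).length ≤ N) (hp : p ≤ N)
    (hK : K = 2 * k + 3) (hB : B = 2 * k + 10) (hQ : Q = B ^ (3 * K)) (hw : 1000 * (Q * N) < 2 ^ w)
    (hw' : Q * Q < 2 ^ w) : Ends w (solveP b) (Q ^ 21 * e.size) (.init (inputCode e S c p)) fun s' =>
      s'.reg 0 = 1 ↔ ∃ q, q < Q ∧ achieves b S c B (fun _ _ => False) e p q := by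
  obtain ⟨l1, l2, l3, l4⟩ := codes_large hK hB hQ; have hn := e.size_pos
  have hc := e.length_code (S := S) (c := c); simp only [inputCode, List.length_cons, hc] at hN
  have hQN : 1 * N ≤ Q * N := Nat.mul_le_mul_right _ (by omega)
  have hQN' : Q * 1 ≤ Q * N := Nat.mul_le_mul_left _ (by omega)
  have hQn : Q * e.size ≤ Q * N := Nat.mul_le_mul_left _ (by omega)
  have hkn : e.size * (k * k) ≤ Q * N := by rw [mul_comm]; exact Nat.mul_le_mul l4 (by omega)
  set s := init (inputCode e S c p) with hs
  have hm : ∀ x, x < 4 * e.size → s.mem (3 + x) = (e.code S c).getD x 0 := fun x _ => by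
    simp [hs, init, inputCode, add_comm 3 x]
  have hz : ∀ a, 4 * e.size + 3 ≤ a → s.mem a = 0 := fun a ha => by
    simp only [hs, init]; exact List.getD_eq_default _ _ (by simp [inputCode, hc]; omega)
  have hS := e.stored_of_code (R := fun _ _ => False) hm; have t1 := pow_gap l1 6 (j := 20)
  have t2 := pow_gap l1 20 (j := 21); have t3 := pow_gap l1 1 (j := 3)
  have t4 := pow_gap l1 3 (j := 20); rw [pow_one] at t3
  have t5 : 1 * 1 ≤ Q ^ 20 * e.size := Nat.mul_le_mul t2.1 hn
  have t6 : Q ^ 20 * 1 ≤ Q ^ 20 * e.size := Nat.mul_le_mul_left _ hn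
  have t7 : 10 ^ 9 * (Q ^ 20 * e.size) ≤ Q ^ 21 * e.size := by
    rw [← mul_assoc]; exact Nat.mul_le_mul_right _ t2.2
  have t8 : e.size * (Q ^ 6 + 4) ≤ Q ^ 20 * e.size := by
    rw [mul_comm]; exact Nat.mul_le_mul_right _ (by omega)
  have t9 : e.size * (Q ^ 20 + 4) ≤ 2 * (Q ^ 20 * e.size) := by grind
  refine .seqWithin (ends_setupP (k := k) (n := e.size) (p := p) rfl rfl rfl hK hB hQ (by omega) hw')
    (fun s1 ⟨E1, m1, r1⟩ => .seqWithin (ends_markJoinsP (S := S) (c := c) e E1 (by omega)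
      (by rwa [m1]) (by rwa [m1])) (fun s2 ⟨f2, r2⟩ => .seqWithin (ends_tabulateP (b := b) e (E1.congr r2)
        (by rw [mul_comm] at hQn; omega) f2) (fun s3 ⟨f3, r3⟩ => ?_) (hT := ?_)) (hT := ?_)) (hT := ?_)
  · have E3 := (E1.congr r2).congr r3
    have g : s3.reg 17 = 4 * e.size + 3 + 6 * K ∧ s3.reg 5 = Q := by simp [E3.regs]
    refine .assignSeq ((ends_answerP (E3.set) (by simp [g]) (by omega) f3
      (by simp [r3, r2, r1, hs, init]) (Nat.lt_succ_self p) rfl).le ?_) (ha := by simp [g]; omega)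
      (hT := ?_)
    all_goals simp; omega
  all_goals omega

end WordRAM

theorem decidesOnExpressions {Prob : ∀ {V : Type u}, SimpleGraph V → Set V → (V → ℕ∞) → ℕ → Prop} (b : Bool)
    (h : ∀ {V : Type u} {k : ℕ} (e : KExpr V k) (G : SimpleGraph V) (S : Set V) (c : V → ℕ∞) (p : ℕ),
      e.Describes G → (Prob G S c p ↔ ∃ q, q < (2 * k + 10) ^ (3 * (2 * k + 3)) ∧
        WordRAM.achieves b S c (2 * k + 10) (fun _ _ => False) e p q)) :
    DecidesOnExpressions.{u} (WordRAM.solveP b) Prob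
      (fun k n => 2 ^ (21 * Real.logb 2 ((2 * k + 10) ^ (3 * (2 * k + 3)) : ℕ)) * n)
      (fun k N => 21 * Real.logb 2 ((2 * k + 10) ^ (3 * (2 * k + 3)) : ℕ) + (2 : ℕ) * Real.logb 2 N) := by
  intro V k e G S c p hG N w hN hle hw; set Q := (2 * k + 10) ^ (3 * (2 * k + 3)) with hQ
  obtain ⟨l1, l2, l3, l4⟩ := WordRAM.codes_large (k := k) rfl rfl hQ; have hn := e.size_pos
  have hN3 : 7 ≤ N := by
    have hc := e.length_code (S := S) (c := c); simp only [inputCode, List.length_cons, hc] at hN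
    omega
  have hQ0 : (0 : ℝ) < Q := by exact_mod_cast (by omega : 0 < Q)
  have e1 : (2 : ℝ) ^ (21 * Real.logb 2 Q) = (Q : ℝ) ^ 21 := by
    rw [mul_comm, Real.rpow_mul (by norm_num), Real.rpow_logb (by norm_num) (by norm_num) hQ0]
    simp_all
  have e2 : (2 : ℝ) ^ ((2 : ℕ) * Real.logb 2 N) = (N : ℝ) ^ 2 := by
    rw [mul_comm, Real.rpow_mul (by norm_num), Real.rpow_logb (by norm_num) (by norm_num)
      (by exact_mod_cast (by omega : 0 < N)), Real.rpow_natCast]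
  have hw2 : Q ^ 21 * N ^ 2 ≤ 2 ^ w := by
    have := Real.rpow_le_rpow_of_exponent_le (by norm_num : (1 : ℝ) ≤ 2) hw
    rw [Real.rpow_add (by norm_num), e1, e2, Real.rpow_natCast] at this; exact_mod_cast this
  have h1 : Q ^ 3 * N ≤ Q ^ 21 * N ^ 2 :=
    Nat.mul_le_mul (Nat.pow_le_pow_right (by omega) (by norm_num)) (Nat.le_self_pow (by norm_num) _)
  have h2 : 10 ^ 9 * (Q * (Q * N)) ≤ Q * (Q * (Q * N)) := Nat.mul_le_mul_right _ l1
  have h3 : Q ^ 3 * N = Q * (Q * (Q * N)) := by ring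
  have h4 : 1 * (Q * N) ≤ Q * (Q * N) := Nat.mul_le_mul_right _ (by omega)
  have h5 : Q * (Q * 1) ≤ Q * (Q * N) := Nat.mul_le_mul_left _ (Nat.mul_le_mul_left _ (by omega))
  have h6 : 1 * N ≤ Q * N := Nat.mul_le_mul_right _ (by omega)
  have h7 : Q * 1 ≤ Q * Q := Nat.mul_le_mul_left _ (by omega); rw [mul_one] at h5 h7
  have hwf : WordRAM.WF w (.init (inputCode e S c p)) := by
    refine ⟨?_, fun r => ?_, fun a => ?_⟩
    · by_contra hlt; have := Nat.pow_lt_pow_right (by norm_num : 1 < 2) (by omega : w < 10); omega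
    · exact Nat.two_pow_pos w
    · simp only [WordRAM.Store.init]; by_cases ha : a < (inputCode e S c p).length
      · rw [List.getD_eq_getElem _ _ ha]; have := hle _ (List.getElem_mem ha); omega
      · rw [List.getD_eq_default _ _ (by omega)]; exact Nat.two_pow_pos w
  obtain ⟨t, s, hE, ht, -, hs⟩ := WordRAM.ends_solveP (b := b) (w := w) (S := S) (c := c) (p := p) e hN
    (hle p (by simp [inputCode])) rfl rfl hQ (by omega) (by omega) hwf
  refine ⟨t, s, hE, ?_, hs.trans (h e G S c p hG).symm⟩
  beta_reduce
  rw [← hQ, e1]; exact_mod_cast ht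

/-- The steps per operation are bounded by `Q ^ 21`, where `Q = (2 k + 10) ^ (3 (2 k + 3))`. -/
theorem isBigO_logb_codes : (fun k : ℕ => 21 * Real.logb 2 ((2 * k + 10) ^ (3 * (2 * k + 3)) : ℕ)) =O[atTop]
    fun k : ℕ => (k : ℝ) * Real.log k := by
  refine .of_bound (21 * (15 * 5) / Real.log 2) (eventually_atTop.2 ⟨2, fun k hk => ?_⟩)
  have hk' : (2 : ℝ) ≤ k := by exact_mod_cast hk
  have hl : 0 < Real.log 2 := Real.log_pos (by norm_num)
  have hlk : Real.log 2 ≤ Real.log k := Real.log_le_log (by norm_num) hk'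
  have h1 : Real.log (2 * k + 10) ≤ 5 * Real.log k := by
    rw [show (5 : ℝ) = (5 : ℕ) by norm_num, ← Real.log_pow]
    refine Real.log_le_log (by positivity) ?_
    have : (16 : ℝ) * k ≤ k ^ 5 := by
      have := pow_le_pow_left₀ (by norm_num) hk' 4; rw [pow_succ]; nlinarith
    linarith
  have h0 : 0 ≤ Real.log (2 * k + 10) := Real.log_nonneg (by linarith)
  rw [Real.logb, Nat.cast_pow, Real.log_pow]
  push_cast
  rw [Real.norm_of_nonneg (by positivity), Real.norm_of_nonneg (by positivity)]
  have h2 : (3 * (2 * (k : ℝ) + 3)) * Real.log (2 * k + 10) ≤ (15 * k) * (5 * Real.log k) :=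
    mul_le_mul (by linarith) h1 h0 (by positivity)
  calc _ = 21 / Real.log 2 * ((3 * (2 * (k : ℝ) + 3)) * Real.log (2 * k + 10)) := by ring
    _ ≤ 21 / Real.log 2 * ((15 * k) * (5 * Real.log k)) := by gcongr
    _ = _ := by ring

theorem theorem2 :
    ∃ f : ℕ → ℝ, f =O[atTop] (fun k : ℕ => (k : ℝ) * Real.log k) ∧
      (∃ (P : WordRAM.Prog) (C : ℕ),
        DecidesOnExpressions.{u} P SubsetFVS
          (fun k n => 2 ^ f k * n) (fun k N => f k + C * Real.logb 2 N)) ∧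
      (∃ (P : WordRAM.Prog) (C : ℕ),
        DecidesOnExpressions.{u} P NodeMultiwayCut
          (fun k n => 2 ^ f k * n) (fun k N => f k + C * Real.logb 2 N)) ∧
      ∀ (V : Type u) (G : SimpleGraph V) (T : Set V) (c : V → ℕ∞) (p : ℕ),
        NodeMultiwayCut G T c p ↔ SubsetFVS (addApex G T) {none} (apexWeight T c) p := by
  refine ⟨_, isBigO_logb_codes, ⟨WordRAM.solveP false, 2, decidesOnExpressions false
    fun e G S c p hG => ?_⟩, ⟨WordRAM.solveP true, 2, decidesOnExpressions true
      fun e G T c p hG => ?_⟩, fun V G T c p => nodeMultiwayCut_iff_subsetFVS G T c p⟩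
  · exact subsetFVS_iff_achieves rfl (by omega) (by omega) hG
  · exact nodeMultiwayCut_iff_achieves rfl (by omega) (by omega) hG
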